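/- **Setting.** Let $l>0$ and let $\Gamma\subset\{(x_2,x_3): x_3<0\}$ be a bounded domain (open connected set) in the plane with Lipschitz boundary such that $\partial\Gamma\cap\{x_3=0\}=\{|x_2|\le l,\ x_3=0\}$. Let $\Pi=\mathbb R\times\Gamma$ be the canal with points $x=(x_1,x_2,x_3)$, and $\Lambda=\mathbb R\times\{|x_2|<l\}\times\{0\}$ the water surface. Let $\Theta(\varepsilon)\subset\Pi$ be a bounded set (the submerged body) with $\overline{\Theta(\varepsilon)}\cap\Lambda=\varnothing$ such that $\Pi(\varepsilon)=\Pi\setminus\overline{\Theta(\varepsilon)}$ is connected, has a Lipschitz boundary and is symmetric under $x_2\mapsto-x_2$; the parameter $\varepsilon>0$ is fixed. Let $\mathcal H$ be the Sobolev space $H^1(\Pi(\varepsilon))$ of complex functions with the inner product $$\langle\Phi,\Psi\rangle=(\nabla\Phi,\nabla\Psi)_{L^2(\Pi(\varepsilon))}+(\Phi,\Psi)_{L^2(\Lambda)},$$ and $\mathcal H^0\subset\mathcal H$ the subspace of functions that are odd in $x_2$ (equivalently, functions on the half-canal $\{x\in\Pi(\varepsilon):x_2>0\}$ that vanish on $\{x\in\Pi(\varepsilon):x_2=0\}$).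 Let $\mathcal T_\varepsilon$ be the operator in $\mathcal H$ given by $\langle\mathcal T_\varepsilon\Phi,\Psi\rangle=(\Phi,\Psi)_{L^2(\Lambda)}$ for all $\Phi,\Psi\in\mathcal H$, and let $\mathcal T^0_\varepsilon$ be its restriction to $\mathcal H^0$. Let $\Gamma^+=\{x'\in\Gamma:x_2>0\}$ and $\gamma_0^+=\{0<x_2<l,\ x_3=0\}$. A number $\lambda$ is a Steklov eigenvalue of the half cross-section if there is $\varphi\in H^1(\Gamma^+)$, $\varphi\neq0$, with $\varphi=0$ on $\{x'\in\Gamma:x_2=0\}$ and $$(\nabla\varphi,\nabla\psi)_{L^2(\Gamma^+)}=\lambda(\varphi,\psi)_{L^2(\gamma_0^+)}$$ for all $\psi\in H^1(\Gamma^+)$ with $\psi=0$ on $\{x'\in\Gamma:x_2=0\}$. The continuous spectrum of a bounded self-adjoint operator $T$ is the set of $\mu$ such that the range of $T-\mu$ is not closed (it may contain eigenvalues); the discrete spectrum is the set of isolated points of the spectrum that are eigenvalues of finite multiplicity. **Lemma 3.2.** The space $\mathcal H^0$ is a Hilbert space, the operator $\mathcal T^0_\varepsilon:\mathcal H^0\to\mathcal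 H^0$ is well defined and bounded, and there is a smallest Steklov eigenvalue $\lambda^0_\Gamma$ of the half cross-section; it satisfies $\lambda^0_\Gamma>0$. Put $\mu^0_\Gamma=(1+\lambda^0_\Gamma)^{-1}$. Then 1. every $\mu\in(0,\mu^0_\Gamma]$ belongs to the continuous spectrum of $\mathcal T^0_\varepsilon$; 2. every point of the spectrum of $\mathcal T^0_\varepsilon$ in $(\mu^0_\Gamma,1]$ belongs to the discrete spectrum; 3. $\mu=0$ is an eigenvalue of $\mathcal T^0_\varepsilon$ with the infinite-dimensional eigenspace $\{\Phi\in\mathcal H^0:\Phi=0\text{ on }\Lambda\}$. -/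

import Mathlib

open MeasureTheory Set Filter Topology
open scoped ContDiff

noncomputable section

/-- Euclidean space `ℝⁿ`. -/
abbrev E (n : ℕ) : Type := EuclideanSpace ℝ (Fin n)

/-- The first `d` coordinates of a point of `ℝ^{d+1}`. -/
def horiz {d : ℕ} (x : E (d + 1)) : E d := WithLp.toLp 2 fun i => x i.castSucc

/-- The inclusion `y ↦ (y, 0)` of `ℝ^d` as the plane `{x_{d+1} = 0}` of `ℝ^{d+1}`. -/
def toSurface {d : ℕ} (y : E d) : E (d + 1) := WithLp.toLp 2 (Fin.snoc (fun i => y i) 0)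

/-- `Ω` has a Lipschitz boundary: near each boundary point and in suitable Cartesian coordinates,
`Ω` is the set of the points below the graph of a Lipschitz function. -/
def HasLipschitzBoundary {d : ℕ} (Ω : Set (E (d + 1))) : Prop :=
  ∀ p ∈ frontier Ω, ∃ (R : E (d + 1) ≃ₗᵢ[ℝ] E (d + 1)) (f : E d → ℝ) (K : NNReal) (r : ℝ),
    0 < r ∧ LipschitzWith K f ∧
      ∀ x ∈ Metric.ball p r, (x ∈ Ω ↔ (R x) (Fin.last d) < f (horiz (R x)))

/-! ### Sobolev functions with a trace on the horizontal part of the boundary -/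

/-- Real test functions on `ℝⁿ`: smooth, with compact support. -/
def IsTest {n : ℕ} (φ : E n → ℝ) : Prop := ContDiff ℝ ∞ φ ∧ HasCompactSupport φ

/-- The partial derivative `∂φ/∂xᵢ`. -/
def partialDeriv {n : ℕ} (φ : E n → ℝ) (i : Fin n) (x : E n) : ℝ :=
  fderiv ℝ φ x (EuclideanSpace.single i 1)

/-- `L²(Ω)`, complex valued. -/
abbrev L2 {n : ℕ} (Ω : Set (E n)) : Type := Lp ℂ 2 ((volume : Measure (E n)).restrict Ω)

/-- `L²(Ω)ᵏ`, complex valued vector fields. -/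
abbrev L2Vec {n : ℕ} (k : ℕ) (Ω : Set (E n)) : Type :=
  Lp (EuclideanSpace ℂ (Fin k)) 2 ((volume : Measure (E n)).restrict Ω)

/-- `∫_Ω (u ∂ᵢφ + Gᵢ φ) dx`. If `G` is the gradient of `u`, then this is `∫_Ω ∂ᵢ(u φ) dx`, that is,
the integral of `u φ nᵢ` over the boundary of `Ω`, where `n` is the outward normal. -/
def green {n : ℕ} {Ω : Set (E n)} (u : L2 Ω) (G : L2Vec n Ω) (φ : E n → ℝ) (i : Fin n) : ℂ :=
  ∫ x in Ω, (u x * (partialDeriv φ i x : ℂ) + G x i * (φ x : ℂ))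

/-- `G` is the weak gradient of `u` in `Ω`. -/
def IsWeakGradient {n : ℕ} {Ω : Set (E n)} (u : L2 Ω) (G : L2Vec n Ω) : Prop :=
  ∀ φ : E n → ℝ, IsTest φ → tsupport φ ⊆ Ω → ∀ i, green u G φ i = 0

/-- `g` is the trace of `u` (with weak gradient `G`) on the part `S × {0}` of the boundary of `Ω`,
where the outward normal is the last basis vector: Green's formula holds for all test functions
whose support meets the boundary of `Ω` only in `S × {0}`. -/
def IsSurfaceTrace {d : ℕ} {Ω : Set (E (d + 1))} {S : Set (E d)}
    (u : L2 Ω) (G : L2Vec (d + 1) Ω) (g : L2 S) : Prop :=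
  ∀ φ : E (d + 1) → ℝ, IsTest φ → tsupport φ ∩ closure Ω ⊆ Ω ∪ toSurface '' S →
    green u G φ (Fin.last d) = ∫ y in S, g y * (φ (toSurface y) : ℂ)

/-- `u` (with weak gradient `G`) vanishes on the part `P` of the boundary of `Ω`: Green's formula
has no boundary term for test functions whose support meets the boundary only in `P`. -/
def VanishesOn {n : ℕ} {Ω : Set (E n)} (u : L2 Ω) (G : L2Vec n Ω) (P : Set (E n)) : Prop :=
  ∀ φ : E n → ℝ, IsTest φ → tsupport φ ∩ closure Ω ⊆ Ω ∪ P → ∀ i, green u G φ i = 0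

theorem IsTest.continuous_partialDeriv {n : ℕ} {φ : E n → ℝ} (h : IsTest φ) (i : Fin n) :
    Continuous (partialDeriv φ i) := by
  have := h.1.continuous_fderiv (by simp)
  unfold partialDeriv
  fun_prop

theorem IsTest.hasCompactSupport_partialDeriv {n : ℕ} {φ : E n → ℝ} (h : IsTest φ) (i : Fin n) :
    HasCompactSupport (partialDeriv φ i) :=
  (h.2.fderiv ℝ).comp_left (g := fun L : E n →L[ℝ] ℝ => L (EuclideanSpace.single i 1)) (by simp)

theorem integrable_mul_test {n : ℕ} {μ : Measure (E n)} [IsFiniteMeasureOnCompacts μ]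
    {f : E n → ℂ} (hf : MemLp f 2 μ) {φ : E n → ℝ} (hc : Continuous φ)
    (hs : HasCompactSupport φ) : Integrable (fun x => f x * (φ x : ℂ)) μ := by
  have h1 : MemLp (fun x => (φ x : ℂ)) 2 μ :=
    (Complex.continuous_ofReal.comp hc).memLp_of_hasCompactSupport
      (hs.comp_left (g := fun t : ℝ => (t : ℂ)) (by simp))
  exact hf.integrable_mul h1

theorem memLp_coord {n k : ℕ} {Ω : Set (E n)} (G : L2Vec k Ω) (i : Fin k) :
    MemLp (fun x => G x i) 2 ((volume : Measure (E n)).restrict Ω) :=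
  (EuclideanSpace.proj (𝕜 := ℂ) i).comp_memLp' (Lp.memLp G)

theorem green_integrable {n : ℕ} {Ω : Set (E n)} (u : L2 Ω) (G : L2Vec n Ω) {φ : E n → ℝ}
    (h : IsTest φ) (i : Fin n) :
    Integrable (fun x => u x * (partialDeriv φ i x : ℂ) + G x i * (φ x : ℂ))
      ((volume : Measure (E n)).restrict Ω) :=
  (integrable_mul_test (Lp.memLp u) (h.continuous_partialDeriv i)
    (h.hasCompactSupport_partialDeriv i)).add
    (integrable_mul_test (memLp_coord G i) h.1.continuous h.2)

theorem green_add {n : ℕ} {Ω : Set (E n)} (u v : L2 Ω) (F G : L2Vec n Ω) {φ : E n → ℝ}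
    (h : IsTest φ) (i : Fin n) :
    green (u + v) (F + G) φ i = green u F φ i + green v G φ i := by
  unfold green
  rw [← integral_add (green_integrable u F h i) (green_integrable v G h i)]
  refine integral_congr_ae ?_
  filter_upwards [Lp.coeFn_add u v, Lp.coeFn_add F G] with x hx hy
  simp only [hx, hy, Pi.add_apply, PiLp.add_apply]
  ring

theorem green_smul {n : ℕ} {Ω : Set (E n)} (c : ℂ) (u : L2 Ω) (G : L2Vec n Ω) (φ : E n → ℝ)
    (i : Fin n) : green (c • u) (c • G) φ i = c * green u G φ i := by
  unfold green
  rw [← integral_const_mul]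
  refine integral_congr_ae ?_
  filter_upwards [Lp.coeFn_smul c u, Lp.coeFn_smul c G] with x hx hy
  simp only [hx, hy, Pi.smul_apply, PiLp.smul_apply, smul_eq_mul]
  ring

theorem IsTest.integrable_surface {d : ℕ} {S : Set (E d)} (g : L2 S) {φ : E (d + 1) → ℝ}
    (h : IsTest φ) :
    Integrable (fun y => g y * (φ (toSurface y) : ℂ)) ((volume : Measure (E d)).restrict S) := by
  have hc : Continuous (toSurface : E d → E (d + 1)) := by
    refine (PiLp.continuous_toLp 2 _).comp ?_
    refine continuous_pi fun j => ?_
    refine Fin.lastCases ?_ (fun i => ?_) j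
    · simpa using continuous_const
    · simp only [Fin.snoc_castSucc]
      fun_prop
  have hl : Function.LeftInverse (horiz : E (d + 1) → E d) toSurface := by
    intro y
    ext i
    simp [horiz, toSurface]
  have hh : Continuous (horiz : E (d + 1) → E d) := by
    unfold horiz
    fun_prop
  exact integrable_mul_test (φ := fun y => φ (toSurface y)) (Lp.memLp g)
    (h.1.continuous.comp hc) (h.2.comp_isClosedEmbedding (hl.isClosedEmbedding hh hc))

/-- The graph of the gradient and of the trace: all triples `(u, ∇u, u|_{S × {0}})` where `u` runs
through the functions of the Sobolev space `H¹(Ω)` with trace in `L²(S)`. -/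
def sobolevTriples {d : ℕ} (Ω : Set (E (d + 1))) (S : Set (E d)) :
    Submodule ℂ (L2 Ω × L2Vec (d + 1) Ω × L2 S) where
  carrier := {w | IsWeakGradient w.1 w.2.1 ∧ IsSurfaceTrace w.1 w.2.1 w.2.2}
  zero_mem' := by
    have h0 : ∀ φ i, green (0 : L2 Ω) (0 : L2Vec (d + 1) Ω) φ i = 0 := fun φ i => by
      simpa using green_smul 0 (0 : L2 Ω) 0 φ i
    refine ⟨fun φ _ _ i => h0 φ i, fun φ _ _ => ?_⟩
    rw [show (0 : L2 Ω × L2Vec (d + 1) Ω × L2 S).1 = 0 from rfl,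
      show (0 : L2 Ω × L2Vec (d + 1) Ω × L2 S).2.1 = 0 from rfl, h0]
    symm
    refine integral_eq_zero_of_ae ?_
    filter_upwards [Lp.coeFn_zero ℂ 2 ((volume : Measure (E d)).restrict S)] with y hy
    have h : ((0 : L2 S) : E d → ℂ) y = 0 := hy
    change ((0 : L2 S) : E d → ℂ) y * _ = 0
    rw [h, zero_mul]
  add_mem' := by
    rintro ⟨u, F, f⟩ ⟨v, G, g⟩ ⟨h1, h2⟩ ⟨h3, h4⟩
    refine ⟨fun φ hφ hs i => ?_, fun φ hφ hs => ?_⟩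
    · have := green_add u v F G hφ i
      rw [h1 φ hφ hs i, h3 φ hφ hs i, add_zero] at this
      exact this
    · have := green_add u v F G hφ (Fin.last d)
      rw [h2 φ hφ hs, h4 φ hφ hs] at this
      refine this.trans ?_
      rw [← integral_add (hφ.integrable_surface f) (hφ.integrable_surface g)]
      refine integral_congr_ae ?_
      filter_upwards [Lp.coeFn_add f g] with y hy
      change _ = ((f + g : L2 S) : E d → ℂ) y * _
      simp only [hy, Pi.add_apply]
      ring
  smul_mem' := by
    rintro c ⟨u, F, f⟩ ⟨h1, h2⟩
    refine ⟨fun φ hφ hs i => ?_, fun φ hφ hs => ?_⟩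
    · have := green_smul c u F φ i
      rw [h1 φ hφ hs i, mul_zero] at this
      exact this
    · have := green_smul c u F φ (Fin.last d)
      rw [h2 φ hφ hs] at this
      refine this.trans ?_
      rw [← integral_const_mul]
      refine integral_congr_ae ?_
      filter_upwards [Lp.coeFn_smul c f] with y hy
      change _ = ((c • f : L2 S) : E d → ℂ) y * _
      simp only [hy, Pi.smul_apply, smul_eq_mul]
      ring

/-- The Sobolev space `H¹(Ω)` (functions with trace on `S × {0}`). It gets below the specific inner
product `(∇u, ∇v)_Ω + (u, v)_S`. -/
def Sob {d : ℕ} (Ω : Set (E (d + 1))) (S : Set (E d)) : Type := ↥(sobolevTriples Ω S)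

namespace Sob

variable {d : ℕ} {Ω : Set (E (d + 1))} {S : Set (E d)}

instance : AddCommGroup (Sob Ω S) := inferInstanceAs (AddCommGroup ↥(sobolevTriples Ω S))

instance : Module ℂ (Sob Ω S) := inferInstanceAs (Module ℂ ↥(sobolevTriples Ω S))

/-- The function `u` itself. -/
def fn : Sob Ω S →ₗ[ℂ] L2 Ω :=
  (LinearMap.fst ℂ _ _).comp (sobolevTriples Ω S).subtype

/-- The gradient `∇u`. -/
def grad : Sob Ω S →ₗ[ℂ] L2Vec (d + 1) Ω :=
  ((LinearMap.fst ℂ _ _).comp (LinearMap.snd ℂ _ _)).comp (sobolevTriples Ω S).subtype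

/-- The trace of `u` on `S × {0}`. -/
def trace : Sob Ω S →ₗ[ℂ] L2 S :=
  ((LinearMap.snd ℂ _ _).comp (LinearMap.snd ℂ _ _)).comp (sobolevTriples Ω S).subtype

/-- `u ↦ (∇u, u|_S)`, into the Hilbert sum `L²(Ω)^{d+1} ⊕ L²(S)`. -/
def energyMap : Sob Ω S →ₗ[ℂ] WithLp 2 (L2Vec (d + 1) Ω × L2 S) :=
  (WithLp.linearEquiv 2 ℂ (L2Vec (d + 1) Ω × L2 S)).symm.toLinearMap.comp (grad.prod trace)

/-- The (semi)norm `(‖∇u; L²(Ω)‖² + ‖u; L²(S)‖²)^{1/2}`. -/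
instance : SeminormedAddCommGroup (Sob Ω S) := SeminormedAddCommGroup.induced _ _ energyMap

instance : InnerProductSpace ℂ (Sob Ω S) := InnerProductSpace.induced energyMap

theorem inner_eq (u v : Sob Ω S) :
    inner ℂ u v = inner ℂ u.grad v.grad + inner ℂ u.trace v.trace := rfl

theorem norm_sq_eq (u : Sob Ω S) : ‖u‖ ^ 2 = ‖u.grad‖ ^ 2 + ‖u.trace‖ ^ 2 :=
  WithLp.prod_norm_sq_eq_of_L2 (energyMap u)

end Sob

/-! ### The canal, the body and the function space -/

/-- The canal `Π = ℝ × Γ`; the coordinates are `(x₁, x₂, x₃) = (x 0, x 1, x 2)`. -/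
def canal (Γ : Set (E 2)) : Set (E 3) := {x | !₂[x 1, x 2] ∈ Γ}

/-- The part of the canal that is outside the body `Θ`. -/
def waterDomain (Γ : Set (E 2)) (Θ : Set (E 3)) : Set (E 3) := canal Γ \ closure Θ

/-- The water surface `Λ = ℝ × (-l, l)`, in the coordinates `(x₁, x₂)`. -/
def waterSurface (l : ℝ) : Set (E 2) := {y | |y 1| < l}

/-- The reflection `(x₁, x₂, x₃) ↦ (x₁, -x₂, x₃)`. -/
def reflect (x : E 3) : E 3 := !₂[x 0, -x 1, x 2]

/-- The subspace of the functions that are odd in `x₂` (have an odd representative). -/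
def oddSubspace (Ω : Set (E 3)) (S : Set (E 2)) : Submodule ℂ (Sob Ω S) where
  carrier := {u | ∃ f : E 3 → ℂ, (∀ x, f (reflect x) = -f x) ∧
    u.fn =ᵐ[(volume : Measure (E 3)).restrict Ω] f}
  zero_mem' := ⟨0, by simp, by
    rw [map_zero]
    exact Lp.coeFn_zero ℂ 2 ((volume : Measure (E 3)).restrict Ω)⟩
  add_mem' := by
    rintro u v ⟨f, hf, hu⟩ ⟨g, hg, hv⟩
    refine ⟨f + g, fun x => by simp [hf x, hg x, add_comm], ?_⟩
    rw [map_add]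
    exact (Lp.coeFn_add _ _).trans (hu.add hv)
  smul_mem' := by
    rintro c u ⟨f, hf, hu⟩
    refine ⟨c • f, fun x => by simp [hf x], ?_⟩
    rw [map_smul]
    exact (Lp.coeFn_smul _ _).trans (hu.const_smul c)

/-- The space `𝓗⁰`: the functions of `H¹(Π(ε))` that are odd in `x₂`, with the inner product
`(∇Φ, ∇Ψ)_{Π(ε)} + (Φ, Ψ)_Λ`. -/
abbrev OddSpace (l : ℝ) (Γ : Set (E 2)) (Θ : Set (E 3)) : Type :=
  ↥(oddSubspace (waterDomain Γ Θ) (waterSurface l))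

/-- `T` is the restriction to `𝓗⁰` of the operator `𝓣` on the whole space `𝓗` that is defined by
`⟨𝓣Φ, Ψ⟩ = (Φ, Ψ)_Λ` for all `Φ, Ψ ∈ 𝓗` (the inner product of Mathlib is linear in the second
variable). -/
def IsOddOperator {l : ℝ} {Γ : Set (E 2)} {Θ : Set (E 3)}
    (T : OddSpace l Γ Θ →L[ℂ] OddSpace l Γ Θ) : Prop :=
  ∀ (Φ : OddSpace l Γ Θ) (Ψ : Sob (waterDomain Γ Θ) (waterSurface l)),
    inner ℂ Ψ (T Φ : Sob (waterDomain Γ Θ) (waterSurface l)) = inner ℂ Ψ.trace Φ.1.trace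

/-! ### The Steklov problem on the half cross-section -/

/-- The half cross-section `Γ⁺`; the coordinates are `(x₂, x₃) = (x 0, x 1)`. -/
def halfSection (Γ : Set (E 2)) : Set (E 2) := {x | x ∈ Γ ∧ 0 < x 0}

/-- The half `(0, l)` of the upper side of the cross-section. -/
def halfTop (l : ℝ) : Set (E 1) := {y | 0 < y 0 ∧ y 0 < l}

/-- The artificial boundary `{x ∈ Γ : x₂ = 0}`. -/
def midLine (Γ : Set (E 2)) : Set (E 2) := {x | x ∈ Γ ∧ x 0 = 0}

/-- `lam` is an eigenvalue, in the weak sense, of the problem `Δφ = 0` in `Γ⁺`, `φ = 0` on the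
artificial boundary, `∂φ/∂x₃ = lam φ` on the upper side and `∂φ/∂n = 0` on the rest of the
boundary. -/
def IsSteklovEigenvalue (l : ℝ) (Γ : Set (E 2)) (lam : ℝ) : Prop :=
  ∃ φ : Sob (halfSection Γ) (halfTop l), φ.fn ≠ 0 ∧ VanishesOn φ.fn φ.grad (midLine Γ) ∧
    ∀ ψ : Sob (halfSection Γ) (halfTop l), VanishesOn ψ.fn ψ.grad (midLine Γ) →
      inner ℂ ψ.grad φ.grad = (lam : ℂ) * inner ℂ ψ.trace φ.trace

/-! ### Parts of the spectrum -/

/-- The continuous spectrum of a (self-adjoint) operator: the points `μ` such that the range of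
`T - μ` is not closed. It may contain eigenvalues. -/
def continuousSpectrum {X : Type*} [SeminormedAddCommGroup X] [InnerProductSpace ℂ X]
    (T : X →L[ℂ] X) : Set ℂ :=
  {μ | ¬ IsClosed (Set.range fun x => T x - μ • x)}

/-- The discrete spectrum: the isolated points of the spectrum that are eigenvalues of finite
multiplicity. -/
def discreteSpectrum {X : Type*} [SeminormedAddCommGroup X] [InnerProductSpace ℂ X]
    (T : X →L[ℂ] X) : Set ℂ :=
  {μ | μ ∈ spectrum ℂ T ∧ ¬ AccPt μ (𝓟 (spectrum ℂ T)) ∧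
    Module.End.HasEigenvalue (T : Module.End ℂ X) μ ∧
    FiniteDimensional ℂ (Module.End.eigenspace (T : Module.End ℂ X) μ)}

end

noncomputable section

open scoped ENNReal

/-! ### Compact maps and variational problems in Hilbert spaces -/

/-! Since `⟨TΦ,Φ⟩` is the square of the trace norm and the energy norm is gradient plus trace, the
spectral parameter `μ` of `T` corresponds to the water wave parameter `λ = 1/μ - 1`. The cut-off
value `λ⁰` is the least `λ` for which the cross-section carries an odd wave. Everything is done with
odd functions on the whole cross-section and the whole canal. The half cross-section enters only
through restriction and odd extension (`Sob.exists_restrict`, `Sob.exists_extend`), which identify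
odd functions with those vanishing on the middle line and double all inner products
(`isLeast_steklov`).

Analytic tools. A Lipschitz boundary gives a cone of directions leading into the domain
(`HasLipschitzBoundary.localCone`). Translations along this cone yield Rellich's lemma
(`exists_finite_rank_approx`) and a trace inequality with an arbitrarily small factor at the
gradient (`exists_trace_bound`). An odd function with vanishing gradient on a connected domain is
zero, so a Peetre-Tartar argument gives Poincaré's inequality, and minimisation of the Rayleigh
quotient gives the positive first Steklov eigenvalue (`Sob.exists_steklov`).

From the cross-section to the canal. Beyond the body the water domain is a cylinder. The function
there is expanded in an orthonormal basis of `L²` in the longitudinal variable. Each coefficient is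
an odd Sobolev function on the cross-section, and Parseval's identity adds up the estimates for the
coefficients (`Sob.exists_sliceFamily`). This yields Poincaré's inequality in the canal, hence
separation and completeness of the odd space, and the Steklov estimate on the cylindrical ends.

Discrete spectrum. The Steklov estimate on the ends bounds `⟨Tx,x⟩` by `μ⁰‖x‖²` plus the squared
norm of the trace on a bounded piece of the surface, which is a compact term. For `μ > μ⁰` a bounded
sequence with `(T - μ)xₙ → 0` therefore has a convergent subsequence. So the kernel of `T - μ` is
finite-dimensional, `T - μ` is bounded below on its complement, and `μ` is isolated in the spectrum
(`mem_discreteSpectrum_of_le_add_compact`).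

Continuous spectrum. For `0 < ν < μ⁰` the number `λ' = 1/ν - 1` exceeds `λ⁰`, so the form `‖∇χ‖² -
λ'‖χ‖²` (the second norm being that of the trace) takes negative values on the cross-section. Its
minimum relative to the `L²` norm is some `-κ² < 0`, attained at a mode `χ` (`Sob.exists_mode`). A
slowly modulated wave of frequency `κ` along the canal, multiplied by `χ`, is an approximate
eigenvector of `T` at `ν` (`exists_wave`, `Sob.inner_prod_mode`). If `T - μ` had closed range for
some `0 < μ ≤ μ⁰`, then `T - ν` would be bounded below by `|ν - μ|` for `ν` slightly below `μ`, a
contradiction. Approaching from below covers the threshold `μ = μ⁰` without special treatment.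

The point zero. The kernel consists of the functions with vanishing trace. Products of one such
function on the cross-section with amplitudes of disjoint supports are pairwise orthogonal in `L²`,
so the kernel is infinite-dimensional. -/

/-- Bounded sequences have subsequences along which `j` converges. -/
def CompactMap {X Y : Type*} [SeminormedAddCommGroup X] [SeminormedAddCommGroup Y] (j : X → Y) :
    Prop :=
  ∀ (x : ℕ → X) (C : ℝ), (∀ n, ‖x n‖ ≤ C) →
    ∃ (y : Y) (φ : ℕ → ℕ), StrictMono φ ∧ Tendsto (fun n => j (x (φ n))) atTop (𝓝 y)

/-- On a bounded set the images under `P` are totally bounded, and two points whose `P`-images lie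
in one small ball have close `j`-images. This is the form in which Rellich's lemma delivers
compactness. -/
theorem CompactMap.of_finite_rank_approx {X Y : Type*} [SeminormedAddCommGroup X]
    [NormedSpace ℂ X] [NormedAddCommGroup Y] [NormedSpace ℂ Y] [CompleteSpace Y] (j : X →ₗ[ℂ] Y)
    (h : ∀ ε > 0, ∃ (N : ℕ) (P : X →L[ℂ] (Fin N → ℂ)), ∀ x, ‖j x‖ ≤ ε * ‖x‖ + ‖P x‖) :
    CompactMap j := by
  intro x C hx
  have hC : 0 ≤ C := (norm_nonneg _).trans (hx 0)
  have htb : TotallyBounded (range fun n => j (x n)) := by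
    refine Metric.totallyBounded_of_finite_discretization fun δ hδ => ?_
    -- Differences have norm at most `2 * C`, so this factor contributes at most `δ / 2`; the balls
    -- of radius `δ / 8` contribute `δ / 4`.
    obtain ⟨N, P, hP⟩ := h (δ / (4 * (C + 1))) (by positivity)
    have hb : Bornology.IsBounded (range fun n => P (x n)) := by
      rw [isBounded_iff_forall_norm_le]
      refine ⟨‖P‖ * C, ?_⟩
      rintro _ ⟨n, rfl⟩
      exact (P.le_opNorm _).trans (mul_le_mul_of_nonneg_left (hx n) (norm_nonneg _))
    obtain ⟨t, ht, hcov⟩ := Metric.totallyBounded_iff.1 (hb.isCompact_closure.totallyBounded.subset subset_closure) (δ / 8) (by positivity)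
    have hex : ∀ s : range (fun n => j (x n)), ∃ n, j (x n) = s := fun s => s.2
    choose idx hidx using hex
    have hex2 : ∀ n, ∃ y : {y : Fin N → ℂ // y ∈ t}, P (x n) ∈ Metric.ball y.1 (δ / 8) := by
      intro n
      have := hcov ⟨n, rfl⟩
      simp only [mem_iUnion] at this
      obtain ⟨y, hy, hn⟩ := this
      exact ⟨⟨y, hy⟩, hn⟩
    choose c hc using hex2
    have : Fintype {y : Fin N → ℂ // y ∈ t} := ht.fintype
    refine ⟨ULift {y : Fin N → ℂ // y ∈ t}, inferInstance, fun s => ULift.up (c (idx s)),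
      fun s s' hss => ?_⟩
    replace hss : c (idx s) = c (idx s') := congrArg ULift.down hss
    rw [← hidx s, ← hidx s', dist_eq_norm, ← map_sub]
    have h1 := hP (x (idx s) - x (idx s'))
    have h2 : ‖x (idx s) - x (idx s')‖ ≤ 2 * C :=
      (norm_sub_le _ _).trans (by linarith [hx (idx s), hx (idx s')])
    have h3 : ‖P (x (idx s) - x (idx s'))‖ ≤ δ / 4 := by
      rw [map_sub, ← dist_eq_norm]
      have a1 := Metric.mem_ball.1 (hc (idx s))
      have a2 := Metric.mem_ball.1 (hc (idx s'))
      rw [← hss, dist_comm] at a2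
      linarith [dist_triangle (P (x (idx s))) (c (idx s)).1 (P (x (idx s')))]
    have h4 : δ / (4 * (C + 1)) * ‖x (idx s) - x (idx s')‖ ≤ δ / 2 := by
      calc δ / (4 * (C + 1)) * ‖x (idx s) - x (idx s')‖ ≤ δ / (4 * (C + 1)) * (2 * (C + 1)) := by
            gcongr; linarith
        _ = δ / 2 := by field_simp; ring
    linarith
  obtain ⟨y, -, φ, hφ, hy⟩ := (htb.closure.isCompact_of_isClosed isClosed_closure).tendsto_subseq
    (x := fun n => j (x n)) (fun n => subset_closure ⟨n, rfl⟩)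
  exact ⟨y, φ, hφ, hy⟩

/-- An Ehrling inequality: along a subsequence where `j` converges, the differences of `k` are small
up to `ε` times a bounded quantity. It passes compactness from the embedding to the trace. -/
theorem CompactMap.of_le {X Y Z : Type*} [SeminormedAddCommGroup X]
    [NormedSpace ℂ X] [NormedAddCommGroup Y] [NormedSpace ℂ Y] [NormedAddCommGroup Z]
    [NormedSpace ℂ Z] [CompleteSpace Z] {j : X →ₗ[ℂ] Y} (hj : CompactMap j) (k : X →ₗ[ℂ] Z)
    (h : ∀ ε > 0, ∃ C : ℝ, ∀ x, ‖k x‖ ≤ ε * ‖x‖ + C * ‖j x‖) : CompactMap k := by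
  intro x C hx
  have hC : 0 ≤ C := (norm_nonneg _).trans (hx 0)
  obtain ⟨y, φ, hφ, hy⟩ := hj x C hx
  have hcau : CauchySeq fun n => k (x (φ n)) := by
    rw [Metric.cauchySeq_iff]
    intro δ hδ
    obtain ⟨D, hD⟩ := h (δ / (4 * (C + 1))) (by positivity)
    obtain ⟨N, hN⟩ := Metric.cauchySeq_iff.1 hy.cauchySeq (δ / (2 * (|D| + 1))) (by positivity)
    refine ⟨N, fun m hm n hn => ?_⟩
    have h1 := hD (x (φ m) - x (φ n))
    have h2 : ‖x (φ m) - x (φ n)‖ ≤ 2 * C :=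
      (norm_sub_le _ _).trans (by linarith [hx (φ m), hx (φ n)])
    have h3 := hN m hm n hn
    rw [dist_eq_norm, ← map_sub] at h3 ⊢
    have h4 : δ / (4 * (C + 1)) * ‖x (φ m) - x (φ n)‖ ≤ δ / 2 := by
      calc δ / (4 * (C + 1)) * ‖x (φ m) - x (φ n)‖ ≤ δ / (4 * (C + 1)) * (2 * (C + 1)) := by
            gcongr; linarith
        _ = δ / 2 := by field_simp; ring
    have h5 : D * ‖j (x (φ m) - x (φ n))‖ < δ / 2 := by
      calc D * ‖j (x (φ m) - x (φ n))‖ ≤ (|D| + 1) * ‖j (x (φ m) - x (φ n))‖ := by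
            gcongr; linarith [le_abs_self D]
        _ < (|D| + 1) * (δ / (2 * (|D| + 1))) := by gcongr
        _ = δ / 2 := by field_simp
    linarith
  obtain ⟨z, hz⟩ := cauchySeq_tendsto_of_complete hcau
  exact ⟨z, φ, hφ, hz⟩

theorem CompactMap.clm_comp {X Y Z : Type*} [SeminormedAddCommGroup X]
    [SeminormedAddCommGroup Y] [SeminormedAddCommGroup Z] {j : X → Y} (hj : CompactMap j)
    {f : Y → Z} (hf : Continuous f) : CompactMap fun x => f (j x) := by
  intro x C hx
  obtain ⟨y, φ, hφ, hy⟩ := hj x C hx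
  exact ⟨f y, φ, hφ, (hf.tendsto y).comp hy⟩

/-- The Peetre–Tartar lemma. -/
theorem exists_bound_of_injective_of_compact {X Y Z : Type*} [NormedAddCommGroup X]
    [NormedSpace ℂ X] [NormedAddCommGroup Y] [NormedSpace ℂ Y] [CompleteSpace Y]
    [NormedAddCommGroup Z] [NormedSpace ℂ Z] (A : Y →L[ℂ] Z) (j : Y →L[ℂ] X)
    (hA : ∀ y, A y = 0 → y = 0) (hj : CompactMap j) (C : ℝ)
    (h : ∀ y, ‖y‖ ≤ C * (‖A y‖ + ‖j y‖)) : ∃ C' : ℝ, ∀ y, ‖y‖ ≤ C' * ‖A y‖ := by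
  by_contra hcon
  push Not at hcon
  have hex : ∀ n : ℕ, ∃ y : Y, ‖y‖ = 1 ∧ ‖A y‖ ≤ 1 / ((n : ℝ) + 1) := by
    intro n
    obtain ⟨y, hy⟩ := hcon (n + 1)
    have hy0 : 0 < ‖y‖ := lt_of_le_of_lt (by positivity) hy
    refine ⟨((‖y‖⁻¹ : ℝ) : ℂ) • y, ?_, ?_⟩
    · rw [norm_smul, Complex.norm_real, norm_inv, norm_norm, inv_mul_cancel₀ hy0.ne']
    · rw [map_smul, norm_smul, Complex.norm_real, norm_inv, norm_norm, le_div_iff₀ (by positivity),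
        inv_mul_eq_div, div_mul_eq_mul_div, div_le_one hy0]
      linarith
  choose y hy1 hyA using hex
  obtain ⟨x, φ, hφ, hx⟩ := hj y 1 (fun n => (hy1 n).le)
  have hA0 : Tendsto (fun n => A (y (φ n))) atTop (𝓝 0) := by
    rw [tendsto_zero_iff_norm_tendsto_zero]
    refine squeeze_zero (fun n => norm_nonneg _) (fun n => hyA (φ n)) ?_
    exact tendsto_one_div_add_atTop_nhds_zero_nat.comp hφ.tendsto_atTop
  -- Both `A` and `j` converge along the subsequence, and the assumed bound turns this into
  -- convergence in `Y`. The limit is a unit vector killed by `A`.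
  have hcau : CauchySeq fun n => y (φ n) := by
    rw [Metric.cauchySeq_iff]
    intro δ hδ
    obtain ⟨N1, hN1⟩ := Metric.cauchySeq_iff.1 hx.cauchySeq (δ / (2 * (|C| + 1))) (by positivity)
    obtain ⟨N2, hN2⟩ := Metric.cauchySeq_iff.1 hA0.cauchySeq (δ / (2 * (|C| + 1))) (by positivity)
    refine ⟨max N1 N2, fun m hm n hn => ?_⟩
    have h1 := hN1 m (le_of_max_le_left hm) n (le_of_max_le_left hn)
    have h2 := hN2 m (le_of_max_le_right hm) n (le_of_max_le_right hn)
    rw [dist_eq_norm, ← map_sub] at h1 h2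
    rw [dist_eq_norm]
    calc ‖y (φ m) - y (φ n)‖ ≤ C * (‖A (y (φ m) - y (φ n))‖ + ‖j (y (φ m) - y (φ n))‖) := h _
      _ ≤ (|C| + 1) * (‖A (y (φ m) - y (φ n))‖ + ‖j (y (φ m) - y (φ n))‖) := by
          gcongr; linarith [le_abs_self C]
      _ < (|C| + 1) * (δ / (2 * (|C| + 1)) + δ / (2 * (|C| + 1))) := by gcongr
      _ = δ := by field_simp; ring
  obtain ⟨z, hz⟩ := cauchySeq_tendsto_of_complete hcau
  have hz1 : ‖z‖ = 1 := tendsto_nhds_unique hz.norm (by simp [hy1])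
  have hzA : A z = 0 := tendsto_nhds_unique ((A.continuous.tendsto z).comp hz) hA0
  rw [hA z hzA, norm_zero] at hz1
  exact zero_ne_one hz1

/-- For small `t` of the sign opposite to `b` the linear term wins; `t = -b / (|c| + 1)` is small
enough. -/
theorem eq_zero_of_forall_quadratic_nonneg {b c : ℝ} (h : ∀ t : ℝ, 0 ≤ 2 * t * b + t ^ 2 * c) :
    b = 0 := by
  by_contra hb
  have hc : 0 < |c| + 1 := by positivity
  have := h (-b / (|c| + 1))
  have h2 : 2 * (-b / (|c| + 1)) * b + (-b / (|c| + 1)) ^ 2 * c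
      = b ^ 2 / (|c| + 1) ^ 2 * (c - 2 * (|c| + 1)) := by
    field_simp
    ring
  rw [h2] at this
  have h3 : c - 2 * (|c| + 1) < 0 := by linarith [le_abs_self c, abs_nonneg c]
  have h4 : 0 < b ^ 2 / (|c| + 1) ^ 2 := by positivity
  nlinarith

theorem norm_add_real_smul_sq {F : Type*} [SeminormedAddCommGroup F] [InnerProductSpace ℂ F]
    (a b : F) (t : ℝ) :
    ‖a + (t : ℂ) • b‖ ^ 2 = ‖a‖ ^ 2 + 2 * t * (inner ℂ b a).re + t ^ 2 * ‖b‖ ^ 2 := by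
  rw [@norm_add_sq ℂ, inner_smul_right, norm_smul, Complex.norm_real, mul_pow,
    Real.norm_eq_abs, sq_abs]
  have : RCLike.re ((t : ℂ) * inner ℂ a b) = t * (inner ℂ b a).re := by
    rw [← inner_conj_symm a b, RCLike.re_eq_complex_re, Complex.re_ofReal_mul, Complex.conj_re]
  rw [this]
  ring

section Variational

variable {H Y Z : Type*} [SeminormedAddCommGroup H] [InnerProductSpace ℂ H]
  [NormedAddCommGroup Y] [InnerProductSpace ℂ Y] [NormedAddCommGroup Z] [InnerProductSpace ℂ Z]

/-- The quadratic form of the pencil. -/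
def pencilForm (K : H →L[ℂ] Y) (J : H →L[ℂ] Z) (m : ℝ) (x : H) : ℝ :=
  ‖x‖ ^ 2 - ‖K x‖ ^ 2 - m * ‖J x‖ ^ 2

/-- Each summand is the square of a Hilbert seminorm. The law makes minimising sequences Cauchy,
although the form contains negative terms. -/
theorem pencilForm_parallelogram (K : H →L[ℂ] Y) (J : H →L[ℂ] Z) (m : ℝ) (x y : H) :
    pencilForm K J m (x + y) + pencilForm K J m (x - y)
      = 2 * pencilForm K J m x + 2 * pencilForm K J m y := by
  have h1 := parallelogram_law_with_norm ℂ x y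
  have h2 := parallelogram_law_with_norm ℂ (K x) (K y)
  have h3 := parallelogram_law_with_norm ℂ (J x) (J y)
  simp only [pencilForm, map_add, map_sub]
  linear_combination h1 - h2 - m * h3

theorem pencilForm_add_smul (K : H →L[ℂ] Y) (J : H →L[ℂ] Z) (m : ℝ) (x y : H) (t : ℝ) :
    pencilForm K J m (x + (t : ℂ) • y) = pencilForm K J m x
      + 2 * t * (inner ℂ y x - inner ℂ (K y) (K x) - (m : ℂ) * inner ℂ (J y) (J x)).re
      + t ^ 2 * pencilForm K J m y := by
  simp only [pencilForm, map_add, map_smul]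
  rw [norm_add_real_smul_sq x y, norm_add_real_smul_sq (K x), norm_add_real_smul_sq (J x)]
  simp only [Complex.sub_re, Complex.re_ofReal_mul]
  ring

/-- The lowest eigenvalue of the pencil `(1 - K*K) - m J*J` with compact `K` and `J`. -/
theorem exists_lowest_eigenvalue_pencil [CompleteSpace H] (K : H →L[ℂ] Y) (J : H →L[ℂ] Z)
    (hK : CompactMap K) (hJ : CompactMap J) (hJ0 : ∃ x, J x ≠ 0) (C : ℝ)
    (hC : ∀ x, ‖K x‖ ^ 2 ≤ ‖x‖ ^ 2 / 2 + C * ‖J x‖ ^ 2) :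
    ∃ (m : ℝ) (x : H), ‖J x‖ = 1 ∧ (∀ y, 0 ≤ pencilForm K J m y) ∧
      ∀ y, inner ℂ y x - inner ℂ (K y) (K x) = (m : ℂ) * inner ℂ (J y) (J x) := by
  -- The values of the Rayleigh quotient; `m` is their infimum, finite by the weak coercivity `hC`.
  set S : Set ℝ := {s | ∃ x, ‖J x‖ = 1 ∧ s = ‖x‖ ^ 2 - ‖K x‖ ^ 2} with hS
  have normalize : ∀ y, J y ≠ 0 → ‖J (((‖J y‖⁻¹ : ℝ) : ℂ) • y)‖ = 1 := by
    intro y hy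
    rw [map_smul, norm_smul, Complex.norm_real, norm_inv, norm_norm,
      inv_mul_cancel₀ (norm_ne_zero_iff.2 hy)]
  have hne : S.Nonempty := by
    obtain ⟨y, hy⟩ := hJ0
    exact ⟨_, _, normalize y hy, rfl⟩
  have hbdd : BddBelow S := by
    refine ⟨-C, ?_⟩
    rintro _ ⟨x, hx, rfl⟩
    have := hC x
    rw [hx] at this
    nlinarith [sq_nonneg ‖x‖]
  set m := sInf S with hm
  have hpos : ∀ y, 0 ≤ pencilForm K J m y := by
    intro y
    by_cases hy : J y = 0
    · have := hC y
      simp only [pencilForm, hy, norm_zero] at this ⊢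
      nlinarith [sq_nonneg ‖y‖]
    · have h1 : m ≤ _ := csInf_le hbdd ⟨_, normalize y hy, rfl⟩
      rw [map_smul, norm_smul, norm_smul, Complex.norm_real, norm_inv, norm_norm] at h1
      have h0 : 0 < ‖J y‖ := norm_pos_iff.2 hy
      have h2 : (‖J y‖⁻¹ * ‖y‖) ^ 2 - (‖J y‖⁻¹ * ‖K y‖) ^ 2
          = (‖y‖ ^ 2 - ‖K y‖ ^ 2) / ‖J y‖ ^ 2 := by
        field_simp
      rw [h2, le_div_iff₀ (by positivity)] at h1
      simp only [pencilForm]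
      linarith
  have hex : ∀ n : ℕ, ∃ x, ‖J x‖ = 1 ∧ ‖x‖ ^ 2 - ‖K x‖ ^ 2 < m + 1 / ((n : ℝ) + 1) := by
    intro n
    obtain ⟨_, ⟨x, hx, rfl⟩, hlt⟩ := exists_lt_of_csInf_lt hne
      (show sInf S < m + 1 / ((n : ℝ) + 1) by rw [← hm]; linarith [Nat.one_div_pos_of_nat (α := ℝ) (n := n)])
    exact ⟨x, hx, hlt⟩
  choose x hx1 hxm using hex
  -- With `‖J x‖ = 1` the coercivity bounds `‖x‖ ^ 2` by twice the Rayleigh value plus a constant.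
  have hxb : ∀ n, ‖x n‖ ≤ 2 * (|m| + 1 + |C|) + 1 := by
    intro n
    have h1 := hC (x n)
    have h2 := hxm n
    rw [hx1 n] at h1
    have h3 : 1 / ((n : ℝ) + 1) ≤ 1 := by
      rw [div_le_one (by positivity)]
      linarith [(Nat.cast_nonneg n : (0 : ℝ) ≤ n)]
    have h4 : ‖x n‖ ^ 2 ≤ 2 * (|m| + 1 + |C|) := by
      linarith [le_abs_self m, le_abs_self C]
    nlinarith [sq_nonneg (‖x n‖ - 1), abs_nonneg m, abs_nonneg C]
  obtain ⟨k, φ, hφ, hk⟩ := hK x _ hxb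
  obtain ⟨z, ψ, hψ, hz⟩ := hJ (fun n => x (φ n)) _ (fun n => hxb _)
  set u : ℕ → H := fun n => x (φ (ψ n)) with hu
  have hku : Tendsto (fun n => K (u n)) atTop (𝓝 k) := hk.comp hψ.tendsto_atTop
  have hp0 : Tendsto (fun n => pencilForm K J m (u n)) atTop (𝓝 0) := by
    refine squeeze_zero (fun n => hpos _) (g := fun n => 1 / (((φ (ψ n) : ℕ) : ℝ) + 1))
      (fun n => ?_) ?_
    · simp only [pencilForm, hu, hx1]
      linarith [hxm (φ (ψ n))]
    · exact tendsto_one_div_add_atTop_nhds_zero_nat.comp (hφ.comp hψ).tendsto_atTop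
  -- By the parallelogram law the form of `u a - u b` is at most twice the sum of the forms of `u a`
  -- and `u b`, which tend to zero. The terms with `K` and `J` are small by compactness, so the norm
  -- of the difference is small.
  have hcau : CauchySeq u := by
    rw [Metric.cauchySeq_iff]
    intro δ hδ
    have hm1 : 0 < |m| + 1 := by positivity
    set η : ℝ := min 1 (δ ^ 2 / (8 * (|m| + 1))) with hη
    have hη0 : 0 < η := lt_min one_pos (by positivity)
    obtain ⟨N1, hN1⟩ := Metric.cauchySeq_iff.1 hku.cauchySeq η hη0
    obtain ⟨N2, hN2⟩ := Metric.cauchySeq_iff.1 hz.cauchySeq η hη0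
    obtain ⟨N3, hN3⟩ := Metric.tendsto_atTop.1 hp0 (δ ^ 2 / 16) (by positivity)
    refine ⟨max N1 (max N2 N3), fun a ha b hb => ?_⟩
    simp only [ge_iff_le, max_le_iff] at ha hb
    have k1 := hN1 a ha.1 b hb.1
    have k2 := hN2 a ha.2.1 b hb.2.1
    have k3 := hN3 a ha.2.2
    have k4 := hN3 b hb.2.2
    rw [dist_eq_norm, ← map_sub] at k1 k2
    rw [Real.dist_eq, sub_zero] at k3 k4
    have k5 := pencilForm_parallelogram K J m (u a) (u b)
    have k6 := hpos (u a + u b)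
    have k7 : ‖u a - u b‖ ^ 2 = pencilForm K J m (u a - u b) + ‖K (u a - u b)‖ ^ 2
        + m * ‖J (u a - u b)‖ ^ 2 := by simp only [pencilForm]; ring
    have hη2 : η ^ 2 ≤ δ ^ 2 / (8 * (|m| + 1)) := by
      calc η ^ 2 = η * η := sq η
        _ ≤ 1 * (δ ^ 2 / (8 * (|m| + 1))) :=
          mul_le_mul (min_le_left _ _) (min_le_right _ _) hη0.le zero_le_one
        _ = _ := one_mul _
    have k8 : ‖K (u a - u b)‖ ^ 2 ≤ η ^ 2 := by gcongr
    have k9 : m * ‖J (u a - u b)‖ ^ 2 ≤ |m| * η ^ 2 := by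
      have : ‖J (u a - u b)‖ ^ 2 ≤ η ^ 2 := by gcongr
      exact mul_le_mul (le_abs_self m) this (sq_nonneg _) (abs_nonneg m)
    have k10 : (|m| + 1) * η ^ 2 ≤ δ ^ 2 / 8 := by
      calc (|m| + 1) * η ^ 2 ≤ (|m| + 1) * (δ ^ 2 / (8 * (|m| + 1))) := by gcongr
        _ = δ ^ 2 / 8 := by field_simp
    rw [dist_eq_norm]
    refine lt_of_pow_lt_pow_left₀ 2 hδ.le ?_
    have := le_abs_self (pencilForm K J m (u a))
    have := le_abs_self (pencilForm K J m (u b))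
    nlinarith [sq_nonneg δ, sq_pos_of_pos hδ]
  obtain ⟨v, hv⟩ := cauchySeq_tendsto_of_complete hcau
  have hJv : ‖J v‖ = 1 := by
    refine tendsto_nhds_unique (((J.continuous.tendsto v).comp hv).norm) ?_
    simp [hu, hx1]
  have hpv : pencilForm K J m v = 0 := by
    refine tendsto_nhds_unique ?_ hp0
    have hcont : Continuous (pencilForm K J m) := by
      unfold pencilForm
      fun_prop
    exact (hcont.tendsto v).comp hv
  -- The nonnegative form vanishes at `v`, so its derivative there vanishes in every direction.
  have hre : ∀ y, (inner ℂ y v - inner ℂ (K y) (K v) - (m : ℂ) * inner ℂ (J y) (J v)).re = 0 := by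
    intro y
    refine eq_zero_of_forall_quadratic_nonneg (c := pencilForm K J m y) fun t => ?_
    have := hpos (v + (t : ℂ) • y)
    rw [pencilForm_add_smul, hpv] at this
    linarith
  refine ⟨m, v, hJv, hpos, fun y => ?_⟩
  rw [← sub_eq_zero]
  refine Complex.ext (hre y) ?_
  -- Only real multiples were varied; the direction `I • y` recovers the imaginary part.
  have h2 := hre (Complex.I • y)
  simp only [map_smul, inner_smul_left, Complex.conj_I] at h2
  have h3 : -Complex.I * inner ℂ y v - -Complex.I * inner ℂ (K y) (K v)
      - (m : ℂ) * (-Complex.I * inner ℂ (J y) (J v))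
      = -Complex.I * (inner ℂ y v - inner ℂ (K y) (K v) - (m : ℂ) * inner ℂ (J y) (J v)) := by ring
  rw [h3] at h2
  simpa using h2

end Variational

/-! ### Symmetric operators near a real spectral value -/

section Spectral

variable {X : Type*} [NormedAddCommGroup X] [InnerProductSpace ℂ X]

theorem inner_apply_sub_smul_comm {T : X →L[ℂ] X} (hT : ∀ x y, inner ℂ (T x) y = inner ℂ x (T y))
    (ν : ℂ) (x y : X) :
    inner ℂ (T x - ν • x) y = inner ℂ x (T y - (starRingEnd ℂ ν) • y) := by
  rw [inner_sub_left, inner_sub_right, hT, inner_smul_left, inner_smul_right]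

/-- If `T - μ` is bounded below by `c` on the orthogonal complement of its kernel, then `T - ν` is
bounded below by `|ν - μ|` if `ν` is close to `μ`. -/
theorem norm_apply_sub_smul_ge_of_close {T : X →L[ℂ] X}
    (hT : ∀ x y, inner ℂ (T x) y = inner ℂ x (T y)) {μ : ℝ} {c : ℝ}
    (N : Submodule ℂ X) [N.HasOrthogonalProjection] (hN : ∀ x ∈ N, T x = (μ : ℂ) • x)
    (hc : ∀ y ∈ Nᗮ, c * ‖y‖ ≤ ‖T y - (μ : ℂ) • y‖) {ν : ℂ} (hν : 2 * ‖ν - μ‖ ≤ c) (x : X) :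
    ‖ν - μ‖ * ‖x‖ ≤ ‖T x - ν • x‖ := by
  set k := N.starProjection x with hk
  set y := x - k with hy
  have hkN : k ∈ N := N.starProjection_apply_mem x
  have hyN : y ∈ Nᗮ := N.sub_starProjection_mem_orthogonal x
  have hx : x = k + y := by rw [hy]; abel
  -- The complement of the eigenspace is invariant, so the two components of `T x - ν • x` are
  -- orthogonal and can be estimated separately.
  have hw : T y - ν • y ∈ Nᗮ := by
    rw [Submodule.mem_orthogonal]
    intro n hn
    rw [inner_sub_right, ← hT, hN n hn, inner_smul_right, inner_smul_left,
      (Submodule.mem_orthogonal N y).1 hyN n hn]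
    simp
  have h1 : T x - ν • x = -((ν - μ) • k) + (T y - ν • y) := by
    rw [hx, map_add, hN k hkN]
    module
  have h2 : ‖T x - ν • x‖ ^ 2 = (‖ν - μ‖ * ‖k‖) ^ 2 + ‖T y - ν • y‖ ^ 2 := by
    rw [h1, sq, norm_add_sq_eq_norm_sq_add_norm_sq_of_inner_eq_zero (𝕜 := ℂ), norm_neg, norm_smul]
    · ring
    · rw [inner_neg_left, inner_smul_left, (Submodule.mem_orthogonal N _).1 hw k hkN]
      simp
  have h3 : ‖ν - μ‖ * ‖y‖ ≤ ‖T y - ν • y‖ := by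
    have e : T y - (μ : ℂ) • y = (T y - ν • y) + (ν - μ) • y := by module
    have := hc y hyN
    rw [e] at this
    have t := norm_add_le (T y - ν • y) ((ν - μ) • y)
    rw [norm_smul] at t
    nlinarith [norm_nonneg y]
  have h4 : ‖x‖ ^ 2 = ‖k‖ ^ 2 + ‖y‖ ^ 2 := by
    conv_lhs => rw [hx]
    rw [sq, norm_add_sq_eq_norm_sq_add_norm_sq_of_inner_eq_zero (𝕜 := ℂ)]
    · ring
    · exact (Submodule.mem_orthogonal N _).1 hyN k hkN
  refine le_of_sq_le_sq ?_ (norm_nonneg _)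
  rw [h2, mul_pow, h4, mul_add, mul_pow]
  have h5 : (‖ν - μ‖ * ‖y‖) ^ 2 ≤ ‖T y - ν • y‖ ^ 2 := by gcongr
  rw [mul_pow] at h5
  linarith
where le_of_sq_le_sq {a b : ℝ} (h : a ^ 2 ≤ b ^ 2) (hb : 0 ≤ b) : a ≤ b :=
  abs_le_of_sq_le_sq' h hb |>.2

end Spectral

section SpectralHilbert

variable {X : Type*} [NormedAddCommGroup X] [InnerProductSpace ℂ X] [CompleteSpace X]

/-- A closed range makes `T - μ` bounded below on the complement of its kernel, by the open mapping
theorem. Then `norm_apply_sub_smul_ge_of_close` excludes approximate eigenvectors at `ν` close to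
`μ`. Only `ν < μ` is used, so nothing has to be known at `μ` itself. -/
theorem not_isClosed_range_of_approximate_eigenvectors' {T : X →L[ℂ] X}
    (hT : ∀ x y, inner ℂ (T x) y = inner ℂ x (T y)) {μ : ℝ} (hμ : 0 < μ)
    (happ : ∀ ν : ℝ, 0 < ν → ν < μ → ∀ ε > 0, ∃ x, 0 < ‖x‖ ∧ ‖T x - (ν : ℂ) • x‖ ≤ ε * ‖x‖) :
    ¬ IsClosed (Set.range fun x => T x - (μ : ℂ) • x) := by
  intro hcl
  set A : X →L[ℂ] X := T - (μ : ℂ) • ContinuousLinearMap.id ℂ X with hA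
  have hAx : ∀ x, A x = T x - (μ : ℂ) • x := fun x => by simp [hA]
  set N : Submodule ℂ X := A.ker with hN
  have hNc : IsClosed (N : Set X) := A.isClosed_ker
  have : CompleteSpace N := hNc.completeSpace_coe
  set B : Nᗮ →L[ℂ] X := A.comp Nᗮ.subtypeL with hB
  have hBinj : Function.Injective B := by
    rw [injective_iff_map_eq_zero]
    intro y hy
    have h1 : (y : X) ∈ N := hy
    have h2 : inner ℂ (y : X) (y : X) = 0 := (Submodule.mem_orthogonal N _).1 y.2 _ h1
    exact Subtype.ext (inner_self_eq_zero.1 h2)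
  have hBr : Set.range B = Set.range fun x => T x - (μ : ℂ) • x := by
    ext z
    constructor
    · rintro ⟨y, rfl⟩
      exact ⟨y, (hAx y).symm⟩
    · rintro ⟨x, rfl⟩
      refine ⟨⟨x - N.starProjection x, N.sub_starProjection_mem_orthogonal x⟩, ?_⟩
      have h1 : A (N.starProjection x) = 0 := N.starProjection_apply_mem x
      change A (x - N.starProjection x) = _
      rw [map_sub, h1, sub_zero, hAx]
  have hBc : IsClosed (Set.range B) := hBr ▸ hcl
  obtain ⟨K, hK⟩ := B.antilipschitz_of_injective_of_isClosed_range hBinj hBc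
  -- The antilipschitz constant `K` may be zero, hence `K + 1`.
  set c : ℝ := ((K : ℝ) + 1)⁻¹ with hcdef
  have hc0 : 0 < c := by positivity
  have hc : ∀ y ∈ Nᗮ, c * ‖y‖ ≤ ‖T y - (μ : ℂ) • y‖ := by
    intro y hy
    have h2 : ‖y‖ ≤ K * ‖T y - (μ : ℂ) • y‖ := by
      have h1 := hK.le_mul_dist ⟨y, hy⟩ 0
      rw [map_zero, dist_zero_right, dist_zero_right] at h1
      rw [← hAx]
      exact h1
    rw [hcdef, inv_mul_le_iff₀ (by positivity)]
    linarith [norm_nonneg (T y - (μ : ℂ) • y)]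
  have hNT : ∀ x ∈ N, T x = (μ : ℂ) • x := by
    intro x hx
    have : A x = 0 := hx
    rw [hAx] at this
    exact sub_eq_zero.1 this
  -- The first entry keeps `μ - δ` in the range of the lower bound, the second keeps it positive.
  set δ : ℝ := min (c / 2) (μ / 2) with hδ
  have hδ0 : 0 < δ := lt_min (by positivity) (by positivity)
  have hδμ : δ ≤ μ / 2 := min_le_right _ _
  obtain ⟨x, hx0, hx⟩ := happ (μ - δ) (by linarith) (by linarith) (δ / 2) (by positivity)
  have hn : ‖((μ - δ : ℝ) : ℂ) - μ‖ = δ := by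
    rw [← Complex.ofReal_sub, Complex.norm_real, sub_sub_cancel_left, norm_neg, Real.norm_eq_abs,
      abs_of_pos hδ0]
  have := norm_apply_sub_smul_ge_of_close hT N hNT hc (ν := ((μ - δ : ℝ) : ℂ))
    (by rw [hn]; linarith [min_le_left (c / 2) (μ / 2)]) x
  rw [hn] at this
  nlinarith

/-- The lower bound gives injectivity and closed range. A vector orthogonal to the range is killed
by the formal adjoint `B`, so the range is dense. -/
theorem isUnit_of_bounded_below {A B : X →L[ℂ] X} (hAB : ∀ x y, inner ℂ (A x) y = inner ℂ x (B y))
    {c : ℝ} (hc : 0 < c) (hA : ∀ x, c * ‖x‖ ≤ ‖A x‖) (hB : ∀ x, B x = 0 → x = 0) : IsUnit A := by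
  rw [ContinuousLinearMap.isUnit_iff_bijective,
    ContinuousLinearMap.bijective_iff_dense_range_and_antilipschitz]
  constructor
  · rw [Submodule.topologicalClosure_eq_top_iff, Submodule.eq_bot_iff]
    intro z hz
    refine hB z ?_
    rw [← inner_self_eq_zero (𝕜 := ℂ), ← hAB]
    exact (Submodule.mem_orthogonal _ z).1 hz _ ⟨B z, rfl⟩
  · refine ⟨(c⁻¹).toNNReal, AddMonoidHomClass.antilipschitz_of_bound A fun x => ?_⟩
    rw [Real.coe_toNNReal _ (by positivity), inv_mul_eq_div, le_div_iff₀ hc, mul_comm]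
    exact hA x

/-- Above `μ₀` the form of `μ - T` is positive definite up to a compact term, so there are no
singular Weyl sequences at `μ`. Finite multiplicity, isolation and the existence of eigenvectors all
follow from this. -/
theorem mem_discreteSpectrum_of_le_add_compact' {Y : Type*} [NormedAddCommGroup Y]
    [NormedSpace ℂ Y] {T : X →L[ℂ] X}
    (hT : ∀ x y, inner ℂ (T x) y = inner ℂ x (T y)) {μ μ₀ : ℝ} (hμ : μ₀ < μ) (K : X →ₗ[ℂ] Y)
    (hK : CompactMap K) (hle : ∀ x, (inner ℂ x (T x)).re ≤ μ₀ * ‖x‖ ^ 2 + ‖K x‖ ^ 2)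
    (hspec : (μ : ℂ) ∈ spectrum ℂ T) : (μ : ℂ) ∈ discreteSpectrum T := by
  -- For a difference `w` of two members, `(μ - μ₀)‖w‖²` is at most `‖K w‖²` plus `‖w‖ ‖(T - μ)w‖`;
  -- along a subsequence on which `K` converges both terms become small.
  have key : ∀ (x : ℕ → X) (C : ℝ), (∀ n, ‖x n‖ ≤ C) →
      Tendsto (fun n => T (x n) - (μ : ℂ) • x n) atTop (𝓝 0) →
      ∃ (y : X) (φ : ℕ → ℕ), StrictMono φ ∧ Tendsto (fun n => x (φ n)) atTop (𝓝 y) := by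
    intro x C hx h0
    have hC : 0 ≤ C := (norm_nonneg _).trans (hx 0)
    obtain ⟨y, φ, hφ, hy⟩ := hK x C hx
    have h0' := h0.comp hφ.tendsto_atTop
    have hcau : CauchySeq fun n => x (φ n) := by
      rw [Metric.cauchySeq_iff]
      intro δ hδ
      set d := μ - μ₀ with hd
      have hd0 : 0 < d := by linarith
      have hη : 0 < d * δ ^ 2 / (8 * (C + 1)) := by positivity
      have hη' : 0 < Real.sqrt (d * δ ^ 2 / 4) := Real.sqrt_pos.2 (by positivity)
      obtain ⟨N1, hN1⟩ := Metric.cauchySeq_iff.1 hy.cauchySeq _ hη'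
      obtain ⟨N2, hN2⟩ := Metric.cauchySeq_iff.1 h0'.cauchySeq _ hη
      refine ⟨max N1 N2, fun m hm n hn => ?_⟩
      have h1 := hN1 m (le_of_max_le_left hm) n (le_of_max_le_left hn)
      have h2 := hN2 m (le_of_max_le_right hm) n (le_of_max_le_right hn)
      rw [dist_eq_norm, ← map_sub] at h1
      set w := x (φ m) - x (φ n) with hw
      have e : dist ((fun n => T (x n) - (μ : ℂ) • x n) (φ m))
          ((fun n => T (x n) - (μ : ℂ) • x n) (φ n)) = ‖T w - (μ : ℂ) • w‖ := by
        rw [dist_eq_norm, hw, map_sub]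
        congr 1
        module
      change dist ((fun n => T (x n) - (μ : ℂ) • x n) (φ m))
          ((fun n => T (x n) - (μ : ℂ) • x n) (φ n)) < _ at h2
      rw [e] at h2
      have hwC : ‖w‖ ≤ 2 * C := (norm_sub_le _ _).trans (by linarith [hx (φ m), hx (φ n)])
      have h3 := hle w
      have h4 : (inner ℂ w (T w)).re = μ * ‖w‖ ^ 2 + (inner ℂ w (T w - (μ : ℂ) • w)).re := by
        have hself : (inner ℂ w w).re = ‖w‖ ^ 2 := inner_self_eq_norm_sq (𝕜 := ℂ) w
        rw [inner_sub_right, inner_smul_right, Complex.sub_re, Complex.re_ofReal_mul, hself]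
        ring
      have h5 : -(‖w‖ * ‖T w - (μ : ℂ) • w‖) ≤ (inner ℂ w (T w - (μ : ℂ) • w)).re :=
        neg_le_of_abs_le ((Complex.abs_re_le_norm _).trans (norm_inner_le_norm _ _))
      have h6 : ‖w‖ * ‖T w - (μ : ℂ) • w‖ ≤ 2 * (C + 1) * (d * δ ^ 2 / (8 * (C + 1))) :=
        mul_le_mul (by linarith) h2.le (norm_nonneg _) (by positivity)
      have h7 : 2 * (C + 1) * (d * δ ^ 2 / (8 * (C + 1))) = d * δ ^ 2 / 4 := by
        field_simp; ring
      have h8 : ‖K w‖ ^ 2 ≤ d * δ ^ 2 / 4 := by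
        rw [← Real.sq_sqrt (show 0 ≤ d * δ ^ 2 / 4 by positivity)]
        gcongr
      have h9 : d * ‖w‖ ^ 2 ≤ d * (δ ^ 2 / 2) := by
        rw [hd] at *
        nlinarith
      have h10 := le_of_mul_le_mul_left h9 hd0
      rw [dist_eq_norm]
      refine lt_of_pow_lt_pow_left₀ 2 hδ.le ?_
      nlinarith [sq_pos_of_pos hδ]
    obtain ⟨z, hz⟩ := cauchySeq_tendsto_of_complete hcau
    exact ⟨z, φ, hφ, hz⟩
  set A : X →L[ℂ] X := T - (μ : ℂ) • ContinuousLinearMap.id ℂ X with hA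
  have hAx : ∀ x, A x = T x - (μ : ℂ) • x := fun x => by simp [hA]
  set N : Submodule ℂ X := A.ker with hN
  have hNc : IsClosed (N : Set X) := A.isClosed_ker
  have : CompleteSpace N := hNc.completeSpace_coe
  have hNT : ∀ x ∈ N, T x = (μ : ℂ) • x := by
    intro x hx
    have : A x = 0 := hx
    rw [hAx] at this
    exact sub_eq_zero.1 this
  have hfin : FiniteDimensional ℂ N := by
    refine FiniteDimensional.of_isCompact_closedBall₀ ℂ (r := 1) one_pos ?_
    refine IsSeqCompact.isCompact fun x hx => ?_
    obtain ⟨y, φ, hφ, hy⟩ := key (fun n => (x n : X)) 1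
      (fun n => by simpa using hx n) (by
        have : (fun n => T (x n : X) - (μ : ℂ) • (x n : X)) = fun _ => 0 := by
          ext n
          rw [hNT _ (x n).2, sub_self]
        rw [this]
        exact tendsto_const_nhds)
    have hyN : y ∈ N := hNc.mem_of_tendsto hy (Eventually.of_forall fun n => (x (φ n)).2)
    refine ⟨⟨y, hyN⟩, ?_, φ, hφ, ?_⟩
    · rw [mem_closedBall_zero_iff]
      exact le_of_tendsto hy.norm (Eventually.of_forall fun n => by simpa using hx (φ n))
    · exact tendsto_subtype_rng.2 hy
  -- Otherwise `key` produces a unit vector that lies both in the kernel and in its complement.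
  obtain ⟨c, hc0, hc⟩ : ∃ c : ℝ, 0 < c ∧ ∀ y ∈ Nᗮ, c * ‖y‖ ≤ ‖T y - (μ : ℂ) • y‖ := by
    by_contra hcon
    push Not at hcon
    have hex : ∀ n : ℕ, ∃ y : X, y ∈ Nᗮ ∧ ‖y‖ = 1 ∧ ‖A y‖ ≤ 1 / ((n : ℝ) + 1) := by
      intro n
      obtain ⟨y, hyN, hy⟩ := hcon (1 / ((n : ℝ) + 1)) (by positivity)
      have hy0 : 0 < ‖y‖ := by
        refine norm_pos_iff.2 fun h => ?_
        rw [h] at hy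
        simp at hy
      refine ⟨((‖y‖⁻¹ : ℝ) : ℂ) • y, Submodule.smul_mem _ _ hyN, ?_, ?_⟩
      · rw [norm_smul, Complex.norm_real, norm_inv, norm_norm, inv_mul_cancel₀ hy0.ne']
      · rw [map_smul, norm_smul, Complex.norm_real, norm_inv, norm_norm, inv_mul_le_iff₀ hy0,
          hAx, mul_comm]
        exact hy.le
    choose y hyN hy1 hyA using hex
    have hA0 : Tendsto (fun n => T (y n) - (μ : ℂ) • y n) atTop (𝓝 0) := by
      rw [tendsto_zero_iff_norm_tendsto_zero]
      refine squeeze_zero (fun n => norm_nonneg _) (fun n => ?_)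
        tendsto_one_div_add_atTop_nhds_zero_nat
      rw [← hAx]
      exact hyA n
    obtain ⟨z, φ, hφ, hz⟩ := key y 1 (fun n => (hy1 n).le) hA0
    have hz1 : ‖z‖ = 1 := tendsto_nhds_unique hz.norm (by simp [hy1])
    have hzN : z ∈ Nᗮ := (Submodule.isClosed_orthogonal N).mem_of_tendsto hz
      (Eventually.of_forall fun n => hyN _)
    have hzA : A z = 0 := by
      refine tendsto_nhds_unique ((A.continuous.tendsto z).comp hz) ?_
      have := hA0.comp hφ.tendsto_atTop
      simp_rw [← hAx] at this
      exact this
    have h2 : inner ℂ z z = 0 := (Submodule.mem_orthogonal N _).1 hzN z hzA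
    rw [inner_self_eq_zero.1 h2, norm_zero] at hz1
    exact zero_ne_one hz1
  -- The adjoint of `T - ν` is `T` minus the conjugate of `ν`, so invertibility is read off from
  -- lower bounds at both points. Since `μ` is real they are equally far from `μ`.
  have hunit : ∀ ν : ℂ, (∀ ν' : ℂ, ν' = ν ∨ ν' = starRingEnd ℂ ν →
      ∃ c' > 0, ∀ x, c' * ‖x‖ ≤ ‖T x - ν' • x‖) → ν ∉ spectrum ℂ T := by
    intro ν h
    obtain ⟨c', hc', h1⟩ := h ν (Or.inl rfl)
    obtain ⟨c'', hc'', h2⟩ := h _ (Or.inr rfl)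
    rw [spectrum.notMem_iff, ← IsUnit.neg_iff]
    have e : ∀ ν x, (-(algebraMap ℂ (X →L[ℂ] X) ν - T)) x = T x - ν • x := by
      intro ν x
      simp [Algebra.algebraMap_eq_smul_one]
    refine isUnit_of_bounded_below (B := -(algebraMap ℂ (X →L[ℂ] X) (starRingEnd ℂ ν) - T))
      (fun x y => ?_) hc' (fun x => ?_) (fun x hx => ?_)
    · rw [e, e, inner_apply_sub_smul_comm hT]
    · rw [e]
      exact h1 x
    · rw [e] at hx
      have := h2 x
      rw [hx, norm_zero] at this
      exact norm_le_zero_iff.1 (nonpos_of_mul_nonpos_right this hc'')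
  have heig : Module.End.eigenspace (T : Module.End ℂ X) (μ : ℂ) = N := by
    ext x
    rw [Module.End.mem_eigenspace_iff]
    constructor
    · intro h
      change A x = 0
      rw [hAx, sub_eq_zero]
      exact h
    · exact hNT x
  refine ⟨hspec, ?_, ?_, ?_⟩
  · rw [accPt_iff_nhds]
    intro hacc
    obtain ⟨ν, ⟨hν1, hν2⟩, hν3⟩ := hacc (Metric.ball (μ : ℂ) (c / 2))
      (Metric.ball_mem_nhds _ (by positivity))
    refine hunit ν (fun ν' hν' => ?_) hν2
    have hd : ‖ν' - μ‖ = ‖ν - μ‖ := by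
      rcases hν' with rfl | rfl
      · rfl
      · rw [← Complex.norm_conj (ν - μ), map_sub, Complex.conj_ofReal]
    rw [Metric.mem_ball, dist_eq_norm] at hν1
    refine ⟨‖ν' - μ‖, ?_, fun x => norm_apply_sub_smul_ge_of_close hT N hNT hc (by
      rw [hd]; linarith) x⟩
    rw [hd]
    exact norm_pos_iff.2 (sub_ne_zero.2 hν3)
  · rw [Module.End.hasEigenvalue_iff, heig]
    intro hbot
    -- With a trivial kernel the lower bound on the complement holds everywhere, so `μ` would not be
    -- in the spectrum.
    refine hunit μ (fun ν' hν' => ⟨c, hc0, fun x => ?_⟩) hspec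
    have : ν' = μ := by rcases hν' with rfl | rfl <;> simp
    rw [this]
    refine hc x ?_
    rw [hbot, Submodule.bot_orthogonal_eq_top]
    trivial
  · rw [heig]
    exact hfin

end SpectralHilbert

section SpectralSeminormed

variable {X : Type*} [SeminormedAddCommGroup X] [InnerProductSpace ℂ X] [CompleteSpace X]

/-- The energy of Sobolev functions is a priori only a seminorm. The next statements take its
definiteness as the hypothesis `hsep` and switch to the induced normed structure. -/
theorem not_isClosed_range_of_approximate_eigenvectors (hsep : ∀ x : X, ‖x‖ = 0 → x = 0)
    {T : X →L[ℂ] X} (hT : ∀ x y, inner ℂ (T x) y = inner ℂ x (T y)) {μ : ℝ} (hμ : 0 < μ)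
    (happ : ∀ ν : ℝ, 0 < ν → ν < μ → ∀ ε > 0, ∃ x, 0 < ‖x‖ ∧ ‖T x - (ν : ℂ) • x‖ ≤ ε * ‖x‖) :
    (μ : ℂ) ∈ continuousSpectrum T := by
  let : NormedAddCommGroup X := NormedAddCommGroup.ofSeparation hsep
  exact not_isClosed_range_of_approximate_eigenvectors' hT hμ happ

theorem mem_discreteSpectrum_of_le_add_compact (hsep : ∀ x : X, ‖x‖ = 0 → x = 0)
    {Y : Type*} [NormedAddCommGroup Y] [NormedSpace ℂ Y] {T : X →L[ℂ] X}
    (hT : ∀ x y, inner ℂ (T x) y = inner ℂ x (T y)) {μ μ₀ : ℝ} (hμ : μ₀ < μ) (K : X →ₗ[ℂ] Y)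
    (hK : CompactMap K) (hle : ∀ x, (inner ℂ x (T x)).re ≤ μ₀ * ‖x‖ ^ 2 + ‖K x‖ ^ 2)
    (hspec : (μ : ℂ) ∈ spectrum ℂ T) : (μ : ℂ) ∈ discreteSpectrum T := by
  let : NormedAddCommGroup X := NormedAddCommGroup.ofSeparation hsep
  exact mem_discreteSpectrum_of_le_add_compact' hT hμ K hK hle hspec

/-- The Riesz representation of a bounded sesquilinear form. -/
theorem exists_clm_of_sesqForm (hsep : ∀ x : X, ‖x‖ = 0 → x = 0) {Y : Type*} [NormedAddCommGroup Y]
    [InnerProductSpace ℂ Y] [CompleteSpace Y] (t : X →L[ℂ] Y) :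
    ∃ T : X →L[ℂ] X, ∀ x y, inner ℂ y (T x) = inner ℂ (t y) (t x) := by
  let : NormedAddCommGroup X := NormedAddCommGroup.ofSeparation hsep
  refine ⟨(ContinuousLinearMap.adjoint t).comp t, fun x y => ?_⟩
  rw [ContinuousLinearMap.comp_apply]
  exact ContinuousLinearMap.adjoint_inner_right t y (t x)

end SpectralSeminormed

/-! ### Square integrable functions -/

section SquareIntegrable

variable {α : Type*} [MeasurableSpace α] {μ : Measure α} {F : Type*} [NormedAddCommGroup F]

theorem sq_eLpNorm_two (f : α → F) : eLpNorm f 2 μ ^ 2 = ∫⁻ x, ‖f x‖ₑ ^ 2 ∂μ := by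
  rw [eLpNorm_eq_lintegral_rpow_enorm_toReal (by simp) (by simp)]
  simp only [ENNReal.toReal_ofNat]
  rw [← ENNReal.rpow_natCast, ← ENNReal.rpow_mul]
  norm_num

theorem enorm_sq_Lp_two (f : Lp F 2 μ) : ‖f‖ₑ ^ 2 = ∫⁻ x, ‖f x‖ₑ ^ 2 ∂μ := by
  rw [Lp.enorm_def, sq_eLpNorm_two]

theorem norm_sq_Lp_two (f : Lp F 2 μ) : ENNReal.ofReal (‖f‖ ^ 2) = ∫⁻ x, ‖f x‖ₑ ^ 2 ∂μ := by
  rw [← enorm_sq_Lp_two, ENNReal.ofReal_pow (norm_nonneg f), ofReal_norm]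

theorem norm_sq_toLp_two {f : α → F} (hf : MemLp f 2 μ) :
    ENNReal.ofReal (‖hf.toLp f‖ ^ 2) = ∫⁻ x, ‖f x‖ₑ ^ 2 ∂μ := by
  rw [norm_sq_Lp_two]
  refine lintegral_congr_ae ?_
  filter_upwards [hf.coeFn_toLp] with x hx
  rw [hx]

theorem memLp_two_iff_lintegral {f : α → F} (hf : AEStronglyMeasurable f μ) :
    MemLp f 2 μ ↔ ∫⁻ x, ‖f x‖ₑ ^ 2 ∂μ < ⊤ := by
  rw [← sq_eLpNorm_two, MemLp, and_iff_right hf]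
  constructor
  · exact fun h => ENNReal.pow_lt_top h
  · intro h
    by_contra hcon
    rw [not_lt_top_iff.1 hcon] at h
    simp at h

/-- The Cauchy-Schwarz inequality against the constant one. -/
theorem sq_lintegral_le (f : α → ℝ≥0∞) (hf : AEMeasurable f μ) :
    (∫⁻ x, f x ∂μ) ^ 2 ≤ μ univ * ∫⁻ x, f x ^ 2 ∂μ := by
  have h := ENNReal.lintegral_mul_le_Lp_mul_Lq μ (Real.HolderConjugate.two_two)
    (aemeasurable_const (b := (1 : ℝ≥0∞))) hf
  simp only [Pi.mul_apply, one_mul, ENNReal.one_rpow, lintegral_const] at h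
  calc (∫⁻ x, f x ∂μ) ^ 2 ≤ (μ univ ^ (1 / 2 : ℝ) * (∫⁻ x, f x ^ (2 : ℝ) ∂μ) ^ (1 / 2 : ℝ)) ^ 2 := by
        gcongr
    _ = _ := by
        rw [mul_pow, ← ENNReal.rpow_natCast, ← ENNReal.rpow_natCast, ← ENNReal.rpow_mul,
          ← ENNReal.rpow_mul]
        norm_num

theorem le_of_ofReal_sq_le {a b : ℝ} (hb : 0 ≤ b)
    (h : ENNReal.ofReal (a ^ 2) ≤ ENNReal.ofReal (b ^ 2)) : a ≤ b := by
  rw [ENNReal.ofReal_le_ofReal_iff (sq_nonneg b)] at h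
  exact (abs_le_of_sq_le_sq' h hb).2

variable [NormedSpace ℂ F]

/-- Multiplication by the indicator function of `K`. -/
def cut (K : Set α) (hK : MeasurableSet K) : Lp F 2 μ →L[ℂ] Lp F 2 μ :=
  LinearMap.mkContinuous
    { toFun := fun f => ((Lp.memLp f).indicator hK).toLp (K.indicator f)
      map_add' := fun f g => by
        rw [← MemLp.toLp_add, MemLp.toLp_eq_toLp_iff]
        filter_upwards [Lp.coeFn_add f g] with x hx
        rw [← indicator_add', indicator, indicator, hx]
      map_smul' := fun c f => by
        rw [RingHom.id_apply, ← MemLp.toLp_const_smul, MemLp.toLp_eq_toLp_iff]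
        filter_upwards [Lp.coeFn_smul c f] with x hx
        by_cases h : x ∈ K
        · simp only [Pi.smul_apply, indicator_of_mem h, hx]
        · simp [h] } 1 (fun f => by
      rw [one_mul]
      refine le_of_ofReal_sq_le (norm_nonneg _) ?_
      simp only [LinearMap.coe_mk, AddHom.coe_mk]
      rw [norm_sq_toLp_two, norm_sq_Lp_two]
      refine lintegral_mono fun x => ?_
      gcongr
      by_cases h : x ∈ K <;> simp [h])

theorem cut_coeFn (K : Set α) (hK : MeasurableSet K) (f : Lp F 2 μ) :
    cut K hK f =ᵐ[μ] K.indicator f :=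
  ((Lp.memLp f).indicator hK).coeFn_toLp

theorem norm_sq_cut (K : Set α) (hK : MeasurableSet K) (f : Lp F 2 μ) :
    ENNReal.ofReal (‖cut K hK f‖ ^ 2) = ∫⁻ x in K, ‖f x‖ₑ ^ 2 ∂μ := by
  rw [norm_sq_Lp_two, ← lintegral_indicator hK]
  refine lintegral_congr_ae ?_
  filter_upwards [cut_coeFn K hK f] with x hx
  rw [hx]
  by_cases h : x ∈ K <;> simp [h]

theorem norm_cut_le (K : Set α) (hK : MeasurableSet K) (f : Lp F 2 μ) : ‖cut K hK f‖ ≤ ‖f‖ := by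
  refine le_of_ofReal_sq_le (norm_nonneg _) ?_
  rw [norm_sq_cut, norm_sq_Lp_two]
  exact setLIntegral_le_lintegral _ _

theorem norm_cut_mono {K L : Set α} (hK : MeasurableSet K) (hL : MeasurableSet L) (h : K ⊆ L)
    (f : Lp F 2 μ) : ‖cut K hK f‖ ≤ ‖cut L hL f‖ := by
  refine le_of_ofReal_sq_le (norm_nonneg _) ?_
  rw [norm_sq_cut, norm_sq_cut]
  exact lintegral_mono_set h

theorem norm_sq_cut_add_compl (K : Set α) (hK : MeasurableSet K) (f : Lp F 2 μ) :
    ‖f‖ ^ 2 = ‖cut K hK f‖ ^ 2 + ‖cut Kᶜ hK.compl f‖ ^ 2 := by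
  have h : ENNReal.ofReal (‖f‖ ^ 2)
      = ENNReal.ofReal (‖cut K hK f‖ ^ 2 + ‖cut Kᶜ hK.compl f‖ ^ 2) := by
    rw [ENNReal.ofReal_add (sq_nonneg _) (sq_nonneg _), norm_sq_cut, norm_sq_cut, norm_sq_Lp_two,
      lintegral_add_compl _ hK]
  rwa [ENNReal.ofReal_eq_ofReal_iff (sq_nonneg _) (by positivity)] at h

end SquareIntegrable

/-! ### Test functions -/

section Tests

variable {n : ℕ}

theorem IsTest.memLp {φ : E n → ℝ} (h : IsTest φ) (μ : Measure (E n))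
    [IsFiniteMeasureOnCompacts μ] : MemLp φ 2 μ :=
  h.1.continuous.memLp_of_hasCompactSupport h.2

theorem IsTest.sub {φ ψ : E n → ℝ} (h : IsTest φ) (h' : IsTest ψ) : IsTest (φ - ψ) :=
  ⟨h.1.sub h'.1, h.2.sub h'.2⟩

theorem IsTest.add {φ ψ : E n → ℝ} (h : IsTest φ) (h' : IsTest ψ) : IsTest (φ + ψ) :=
  ⟨h.1.add h'.1, h.2.add h'.2⟩

theorem IsTest.mul_left {φ ψ : E n → ℝ} (h : IsTest φ) (h' : ContDiff ℝ ∞ ψ) :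
    IsTest fun x => ψ x * φ x :=
  ⟨h'.mul h.1, h.2.mul_left⟩

theorem tsupport_add_subset_union {φ ψ : E n → ℝ} :
    tsupport (φ + ψ) ⊆ tsupport φ ∪ tsupport ψ := by
  unfold tsupport
  rw [← closure_union]
  exact closure_mono (Function.support_add _ _)

/-- The fundamental lemma of the calculus of variations. -/
theorem ae_eq_zero_of_integral_test {F : Type*} [NormedAddCommGroup F] [NormedSpace ℝ F]
    [CompleteSpace F] {U : Set (E n)} (hU : IsOpen U) {f : E n → F}
    (hf : MemLp f 2 ((volume : Measure (E n)).restrict U))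
    (h : ∀ φ : E n → ℝ, IsTest φ → tsupport φ ⊆ U → ∫ x in U, φ x • f x = 0) :
    f =ᵐ[(volume : Measure (E n)).restrict U] 0 := by
  have hloc : LocallyIntegrableOn f U volume :=
    locallyIntegrableOn_of_locallyIntegrable_restrict (hf.locallyIntegrable (by norm_num))
  have h0 := hU.ae_eq_zero_of_integral_contDiff_smul_eq_zero hloc fun φ h1 h2 h3 => by
    rw [← h φ ⟨h1, h2⟩ h3, setIntegral_eq_integral_of_forall_compl_eq_zero]
    intro x hx
    rw [image_eq_zero_of_notMem_tsupport fun h => hx (h3 h), zero_smul]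
  exact (ae_restrict_iff' hU.measurableSet).2 h0

/-- Real test functions with support in an open set `U` are dense in `L²(U)`. -/
theorem exists_test_near {U : Set (E n)} (hU : IsOpen U)
    (f : Lp ℝ 2 ((volume : Measure (E n)).restrict U)) {ε : ℝ} (hε : 0 < ε) :
    ∃ (φ : E n → ℝ) (hφ : IsTest φ), tsupport φ ⊆ U ∧ ‖f - (hφ.memLp _).toLp φ‖ < ε := by
  let D : Submodule ℝ (Lp ℝ 2 ((volume : Measure (E n)).restrict U)) :=
    { carrier := {g | ∃ (φ : E n → ℝ) (hφ : IsTest φ), tsupport φ ⊆ U ∧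
        g = (hφ.memLp _).toLp φ}
      zero_mem' := ⟨0, ⟨contDiff_const, HasCompactSupport.zero⟩, by simp,
        (MemLp.toLp_zero _).symm⟩
      add_mem' := by
        rintro _ _ ⟨φ, hφ, hs, rfl⟩ ⟨ψ, hψ, hs', rfl⟩
        exact ⟨φ + ψ, hφ.add hψ, tsupport_add_subset_union.trans (union_subset hs hs'),
          (MemLp.toLp_add _ _).symm⟩
      smul_mem' := by
        rintro c _ ⟨φ, hφ, hs, rfl⟩
        refine ⟨c • φ, ⟨hφ.1.const_smul c, hφ.2.smul_left (f := fun _ => c)⟩, ?_, ?_⟩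
        · exact (closure_mono (Function.support_const_smul_subset c φ)).trans hs
        · exact (MemLp.toLp_const_smul c _).symm }
  -- A function orthogonal to all tests vanishes by the fundamental lemma.
  have hD : D.topologicalClosure = ⊤ := by
    rw [Submodule.topologicalClosure_eq_top_iff, Submodule.eq_bot_iff]
    intro g hg
    refine Lp.eq_zero_iff_ae_eq_zero.2 (ae_eq_zero_of_integral_test hU (Lp.memLp g) ?_)
    intro φ hφ hs
    have h1 := (Submodule.mem_orthogonal D g).1 hg _ ⟨φ, hφ, hs, rfl⟩
    rw [L2.inner_def] at h1
    rw [← h1]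
    refine integral_congr_ae ?_
    filter_upwards [(hφ.memLp ((volume : Measure (E n)).restrict U)).coeFn_toLp] with x hx
    rw [hx, smul_eq_mul, RCLike.inner_apply, conj_trivial, mul_comm]
  have hf : f ∈ closure (D : Set (Lp ℝ 2 ((volume : Measure (E n)).restrict U))) := by
    have : f ∈ D.topologicalClosure := hD ▸ Submodule.mem_top
    exact this
  obtain ⟨_, ⟨φ, hφ, hs, rfl⟩, hd⟩ := Metric.mem_closure_iff.1 hf ε hε
  exact ⟨φ, hφ, hs, by rwa [← dist_eq_norm]⟩

theorem norm_toLp_test_eq {U : Set (E n)} {φ : E n → ℝ} (hφ : IsTest φ) (hs : tsupport φ ⊆ U) :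
    ‖(hφ.memLp ((volume : Measure (E n)).restrict U)).toLp φ‖ = Real.sqrt (∫ x, φ x ^ 2) := by
  symm
  rw [Real.sqrt_eq_iff_mul_self_eq (integral_nonneg fun x => sq_nonneg _) (norm_nonneg _),
    ← real_inner_self_eq_norm_mul_norm, L2.inner_def]
  rw [← setIntegral_eq_integral_of_forall_compl_eq_zero (s := U) (fun x hx => by
    rw [image_eq_zero_of_notMem_tsupport fun h => hx (hs h), zero_pow two_ne_zero])]
  refine integral_congr_ae ?_
  filter_upwards [(hφ.memLp ((volume : Measure (E n)).restrict U)).coeFn_toLp] with x hx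
  rw [hx, RCLike.inner_apply, conj_trivial, sq]

/-- The `L²(U)` norm by duality. -/
theorem lintegral_sq_le_of_test {U : Set (E n)} (hU : IsOpen U) {f : E n → ℂ}
    (hf : MemLp f 2 ((volume : Measure (E n)).restrict U)) {C : ℝ} (hC : 0 ≤ C)
    (h : ∀ φ : E n → ℝ, IsTest φ → tsupport φ ⊆ U →
      ‖∫ x in U, f x * (φ x : ℂ)‖ ≤ C * Real.sqrt (∫ x, φ x ^ 2)) :
    ∫⁻ x in U, ‖f x‖ₑ ^ 2 ≤ ENNReal.ofReal (2 * C ^ 2) := by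
  -- Test functions are real, so real and imaginary part are estimated separately; this causes the
  -- factor two.
  have key : ∀ g : E n → ℝ, MemLp g 2 ((volume : Measure (E n)).restrict U) →
      (∀ φ : E n → ℝ, IsTest φ → tsupport φ ⊆ U →
        |∫ x in U, g x * φ x| ≤ C * Real.sqrt (∫ x, φ x ^ 2)) →
      ∫⁻ x in U, ‖g x‖ₑ ^ 2 ≤ ENNReal.ofReal (C ^ 2) := by
    intro g hg hb
    rw [← norm_sq_toLp_two hg]
    refine ENNReal.ofReal_le_ofReal (pow_le_pow_left₀ (norm_nonneg _) ?_ 2)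
    set G := hg.toLp g with hG
    by_contra hcon
    push Not at hcon
    set d := ‖G‖ ^ 2 - C * ‖G‖ with hd
    -- If `‖G‖ > C`, then a test function close to `G` violates the bound; `d` measures the room
    -- that is left.
    have hd0 : 0 < d := by nlinarith
    obtain ⟨φ, hφ, hs, hlt⟩ := exists_test_near hU G (ε := d / (2 * (C + ‖G‖)))
      (div_pos hd0 (by linarith))
    set Φ := (hφ.memLp ((volume : Measure (E n)).restrict U)).toLp φ with hΦ
    have h1 : |inner ℝ G Φ| ≤ C * ‖Φ‖ := by
      rw [norm_toLp_test_eq hφ hs, L2.inner_def]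
      refine le_trans (le_of_eq ?_) (hb φ hφ hs)
      congr 1
      refine integral_congr_ae ?_
      filter_upwards [(hφ.memLp ((volume : Measure (E n)).restrict U)).coeFn_toLp,
        hg.coeFn_toLp] with x hx hx'
      rw [hx, hx', RCLike.inner_apply, conj_trivial, mul_comm]
    have h2 : ‖G‖ ^ 2 = inner ℝ G Φ + inner ℝ G (G - Φ) := by
      rw [← inner_add_right, add_sub_cancel, real_inner_self_eq_norm_sq]
    have h3 : inner ℝ G (G - Φ) ≤ ‖G‖ * ‖G - Φ‖ := real_inner_le_norm _ _
    have h4 : ‖Φ‖ ≤ ‖G‖ + ‖G - Φ‖ := by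
      have := norm_sub_le G (G - Φ)
      rwa [sub_sub_cancel] at this
    have h5 : (C + ‖G‖) * ‖G - Φ‖ < d / 2 := by
      rw [lt_div_iff₀ (by linarith)] at hlt
      linarith
    nlinarith [le_abs_self (inner ℝ G Φ)]
  have e : ∀ φ : E n → ℝ, IsTest φ →
      (∫ x in U, f x * (φ x : ℂ)).re = ∫ x in U, (f x).re * φ x ∧
      (∫ x in U, f x * (φ x : ℂ)).im = ∫ x in U, (f x).im * φ x := by
    intro φ hφ
    have hi := integrable_mul_test hf hφ.1.continuous hφ.2
    constructor
    · refine (integral_re hi).symm.trans (integral_congr_ae (Eventually.of_forall fun x => ?_))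
      simp
    · refine (integral_im hi).symm.trans (integral_congr_ae (Eventually.of_forall fun x => ?_))
      simp
  have hre := key (fun x => (f x).re) hf.re fun φ hφ hs => by
    rw [← (e φ hφ).1]
    exact (Complex.abs_re_le_norm _).trans (h φ hφ hs)
  have him := key (fun x => (f x).im) hf.im fun φ hφ hs => by
    rw [← (e φ hφ).2]
    exact (Complex.abs_im_le_norm _).trans (h φ hφ hs)
  have hsum : ∀ x, ‖f x‖ₑ ^ 2 = ‖(f x).re‖ₑ ^ 2 + ‖(f x).im‖ₑ ^ 2 := by
    intro x
    rw [← ofReal_norm, ← ofReal_norm, ← ofReal_norm, ← ENNReal.ofReal_pow (norm_nonneg _),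
      ← ENNReal.ofReal_pow (norm_nonneg _), ← ENNReal.ofReal_pow (norm_nonneg _),
      ← ENNReal.ofReal_add (by positivity) (by positivity), Complex.sq_norm, Complex.normSq_apply]
    simp only [Real.norm_eq_abs, sq_abs]
    congr 1
    ring
  have hm : AEMeasurable (fun x => ‖(f x).re‖ₑ ^ 2) ((volume : Measure (E n)).restrict U) :=
    hf.re.1.enorm.pow_const 2
  simp_rw [hsum]
  rw [lintegral_add_left' hm, two_mul,
    ENNReal.ofReal_add (by positivity) (by positivity)]
  exact add_le_add hre him

end Tests

theorem integral_norm_mul_norm_le {α : Type*} [MeasurableSpace α] {μ : Measure α} {F : Type*}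
    [NormedAddCommGroup F] (f : Lp F 2 μ) {g : α → ℝ} (hg : MemLp g 2 μ) :
    ∫ x, ‖f x‖ * ‖g x‖ ∂μ ≤ ‖f‖ * ‖hg.toLp g‖ := by
  have hf := (Lp.memLp f).norm
  have h1 : ‖hf.toLp _‖ = ‖f‖ := by
    rw [Lp.norm_toLp, eLpNorm_norm, Lp.norm_def]
  have h2 : ‖hg.norm.toLp _‖ = ‖hg.toLp g‖ := by
    rw [Lp.norm_toLp, eLpNorm_norm, Lp.norm_toLp]
  rw [← h1, ← h2]
  refine le_trans (le_of_eq ?_) (real_inner_le_norm (hf.toLp _) (hg.norm.toLp _))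
  rw [L2.inner_def]
  refine integral_congr_ae ?_
  filter_upwards [hf.coeFn_toLp, hg.norm.coeFn_toLp] with x h3 h4
  rw [h3, h4, RCLike.inner_apply, conj_trivial, mul_comm]

/-! ### Translates of Sobolev functions -/

section Translation

variable {n : ℕ}

theorem IsTest.translate {φ : E n → ℝ} (h : IsTest φ) (v : E n) : IsTest fun x => φ (x - v) :=
  ⟨h.1.comp (contDiff_id.sub contDiff_const), h.2.comp_homeomorph (Homeomorph.subRight v)⟩

theorem tsupport_translate (φ : E n → ℝ) (v : E n) :
    tsupport (fun x => φ (x - v)) = (fun x => x - v) ⁻¹' tsupport φ :=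
  tsupport_comp_eq_preimage φ (Homeomorph.subRight v)

theorem fderiv_translate (φ : E n → ℝ) (v x : E n) :
    fderiv ℝ (fun x => φ (x - v)) x = fderiv ℝ φ (x - v) :=
  fderiv_comp_sub v

theorem IsTest.fderiv_apply_eq_sum {φ : E n → ℝ} (x z : E n) :
    fderiv ℝ φ x z = ∑ i, z i * partialDeriv φ i x := by
  conv_lhs => rw [← (EuclideanSpace.basisFun (Fin n) ℝ).sum_repr z, map_sum]
  refine Finset.sum_congr rfl fun i _ => ?_
  rw [map_smul, smul_eq_mul]
  simp [partialDeriv]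

theorem sum_green {Ω : Set (E n)} (u : L2 Ω) (G : L2Vec n Ω) {φ : E n → ℝ} (hφ : IsTest φ)
    (z : E n) :
    ∫ x in Ω, (u x * ((fderiv ℝ φ x z : ℝ) : ℂ) + (∑ i, (z i : ℂ) * G x i) * (φ x : ℂ))
      = ∑ i, (z i : ℂ) * green u G φ i := by
  unfold green
  simp_rw [← integral_const_mul]
  rw [← integral_finsetSum _ fun i _ => (green_integrable u G hφ i).const_mul _]
  refine integral_congr_ae (Eventually.of_forall fun x => ?_)
  simp only
  rw [IsTest.fderiv_apply_eq_sum, Complex.ofReal_sum, Finset.mul_sum, Finset.sum_mul,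
    ← Finset.sum_add_distrib]
  refine Finset.sum_congr rfl fun i _ => ?_
  push_cast
  ring

theorem norm_sum_mul_le (z : E n) (g : EuclideanSpace ℂ (Fin n)) :
    ‖∑ i, (z i : ℂ) * g i‖ ≤ ‖z‖ * ‖g‖ := by
  have h : ∑ i, (z i : ℂ) * g i
      = inner ℂ (WithLp.toLp 2 fun i => (z i : ℂ) : EuclideanSpace ℂ (Fin n)) g := by
    rw [PiLp.inner_apply]
    refine Finset.sum_congr rfl fun i _ => ?_
    rw [RCLike.inner_apply]
    simp [mul_comm]
  rw [h]
  refine (norm_inner_le_norm _ _).trans (le_of_eq ?_)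
  congr 1
  rw [EuclideanSpace.norm_eq, EuclideanSpace.norm_eq]
  simp

theorem integrable_fderiv_apply {Ω : Set (E n)} (u : L2 Ω) {φ : E n → ℝ} (hφ : IsTest φ) (z : E n) :
    Integrable (fun x => u x * ((fderiv ℝ φ x z : ℝ) : ℂ)) (volume.restrict Ω) := by
  refine integrable_mul_test (Lp.memLp u) (φ := fun x => fderiv ℝ φ x z) ?_ ?_
  · have := hφ.1.continuous_fderiv (by simp)
    fun_prop
  · exact (hφ.2.fderiv ℝ).comp_left (g := fun L : E n →L[ℝ] ℝ => L z) (by simp)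

theorem integrable_sum_mul {Ω : Set (E n)} (G : L2Vec n Ω) {φ : E n → ℝ} (hφ : IsTest φ)
    (z : E n) :
    Integrable (fun x => (∑ i, (z i : ℂ) * G x i) * (φ x : ℂ)) (volume.restrict Ω) := by
  have : (fun x => (∑ i, (z i : ℂ) * G x i) * (φ x : ℂ))
      = fun x => ∑ i, (z i : ℂ) * (G x i * (φ x : ℂ)) := by
    ext x
    rw [Finset.sum_mul]
    refine Finset.sum_congr rfl fun i _ => ?_
    ring
  rw [this]
  exact integrable_finsetSum _ fun i _ =>
    (integrable_mul_test (memLp_coord G i) hφ.1.continuous hφ.2).const_mul _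

/-- The `L²` bound of the gradient term of Green's formula. -/
theorem norm_integral_sum_mul_le {Ω : Set (E n)} (G : L2Vec n Ω) {φ : E n → ℝ} (hφ : IsTest φ)
    (z : E n) :
    ‖∫ x in Ω, (∑ i, (z i : ℂ) * G x i) * (φ x : ℂ)‖ ≤ ‖z‖ * ‖G‖ * Real.sqrt (∫ x, φ x ^ 2) := by
  have hm := hφ.memLp ((volume : Measure (E n)).restrict Ω)
  have h1 : ∫ x in Ω, ‖G x‖ * ‖φ x‖ ≤ ‖G‖ * ‖hm.toLp φ‖ := integral_norm_mul_norm_le G hm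
  have h2 : ‖hm.toLp φ‖ ≤ Real.sqrt (∫ x, φ x ^ 2) := by
    have h3 := norm_toLp_test_eq hφ (subset_univ (tsupport φ))
    rw [← h3]
    refine le_of_ofReal_sq_le (norm_nonneg _) ?_
    rw [norm_sq_toLp_two, norm_sq_toLp_two, Measure.restrict_univ]
    exact setLIntegral_le_lintegral _ _
  calc ‖∫ x in Ω, (∑ i, (z i : ℂ) * G x i) * (φ x : ℂ)‖
      ≤ ∫ x in Ω, ‖(∑ i, (z i : ℂ) * G x i) * (φ x : ℂ)‖ := norm_integral_le_integral_norm _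
    _ ≤ ∫ x in Ω, ‖z‖ * (‖G x‖ * ‖φ x‖) := by
        refine integral_mono (integrable_sum_mul G hφ z).norm ?_ fun x => ?_
        · exact ((Lp.memLp G).norm.integrable_mul hm.norm).const_mul _
        · simp only
          rw [norm_mul, Complex.norm_real, ← mul_assoc]
          gcongr
          exact norm_sum_mul_le z (G x)
    _ ≤ ‖z‖ * ‖G‖ * Real.sqrt (∫ x, φ x ^ 2) := by
        rw [integral_const_mul, mul_assoc]
        gcongr
        exact h1.trans (by gcongr)

/-- The translation sits on the smooth factor, so the integral is differentiable although `u` is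
merely square integrable. -/
theorem hasDerivAt_integral_translate {Ω : Set (E n)} (u : L2 Ω) {φ : E n → ℝ} (hφ : IsTest φ)
    (z : E n) (s : ℝ) :
    HasDerivAt (fun s : ℝ => ∫ x in Ω, u x * (φ (x - s • z) : ℂ))
      (-∫ x in Ω, u x * ((fderiv ℝ φ (x - s • z) z : ℝ) : ℂ)) s := by
  obtain ⟨R, hR⟩ := hφ.2.isBounded.subset_closedBall 0
  -- This ball contains the supports of all translates with parameter within distance one of `s`,
  -- which gives an integrable majorant.
  set K : Set (E n) := Metric.closedBall 0 (R + (|s| + 1) * ‖z‖) with hK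
  have hKc : IsCompact K := isCompact_closedBall _ _
  have hcd : Continuous (fun x => fderiv ℝ φ x z) := by
    have := hφ.1.continuous_fderiv (by simp)
    fun_prop
  have hcs : HasCompactSupport (fun x => fderiv ℝ φ x z) :=
    (hφ.2.fderiv ℝ).comp_left (g := fun L : E n →L[ℝ] ℝ => L z) (by simp)
  obtain ⟨M, hM⟩ := hcs.exists_bound_of_continuous hcd
  have hM0 : 0 ≤ M := (norm_nonneg _).trans (hM 0)
  have hsupp : ∀ r ∈ Metric.ball s 1, ∀ x, x ∉ K → fderiv ℝ φ (x - r • z) z = 0 := by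
    intro r hr x hx
    have h1 : x - r • z ∉ tsupport φ := by
      intro h
      apply hx
      have h2 := hR h
      rw [hK, mem_closedBall_zero_iff] at *
      have h3 : |r| ≤ |s| + 1 := by
        rw [Metric.mem_ball, Real.dist_eq] at hr
        linarith [abs_sub_abs_le_abs_sub r s]
      calc ‖x‖ = ‖(x - r • z) + r • z‖ := by rw [sub_add_cancel]
        _ ≤ ‖x - r • z‖ + ‖r • z‖ := norm_add_le _ _
        _ ≤ R + (|s| + 1) * ‖z‖ := by
            rw [norm_smul, Real.norm_eq_abs]
            gcongr
    have h2 : fderiv ℝ φ (x - r • z) = 0 :=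
      image_eq_zero_of_notMem_tsupport fun h => h1 (tsupport_fderiv_subset ℝ h)
    rw [h2]
    rfl
  have hu : AEStronglyMeasurable u ((volume : Measure (E n)).restrict Ω) := (Lp.memLp u).1
  have key := hasDerivAt_integral_of_dominated_loc_of_deriv_le
    (μ := (volume : Measure (E n)).restrict Ω)
    (F := fun (s : ℝ) x => u x * (φ (x - s • z) : ℂ))
    (F' := fun (s : ℝ) x => u x * (-(fderiv ℝ φ (x - s • z) z : ℝ) : ℂ)) (x₀ := s)
    (s := Metric.ball s 1)
    (bound := K.indicator fun x => ‖u x‖ * M) (Metric.ball_mem_nhds s one_pos) ?_ ?_ ?_ ?_ ?_ ?_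
  · have e : -∫ x in Ω, u x * ((fderiv ℝ φ (x - s • z) z : ℝ) : ℂ)
        = ∫ x in Ω, u x * (-(fderiv ℝ φ (x - s • z) z : ℝ) : ℂ) := by
      rw [← integral_neg]
      refine integral_congr_ae (Eventually.of_forall fun x => ?_)
      simp
    rw [e]
    exact key.2
  · refine Eventually.of_forall fun r => hu.mul ?_
    exact (Complex.continuous_ofReal.comp (hφ.translate (r • z)).1.continuous).aestronglyMeasurable
  · exact integrable_mul_test (Lp.memLp u) (hφ.translate (s • z)).1.continuous (hφ.translate _).2
  · refine hu.mul ?_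
    exact ((Complex.continuous_ofReal.comp
      (hcd.comp (continuous_id.sub continuous_const))).neg).aestronglyMeasurable
  · refine Eventually.of_forall fun x r hr => ?_
    by_cases hx : x ∈ K
    · rw [indicator_of_mem hx, norm_mul, norm_neg, Complex.norm_real]
      gcongr
      exact hM _
    · rw [hsupp r hr x hx, indicator_of_notMem hx]
      simp
  · rw [integrable_indicator_iff hKc.measurableSet]
    refine Integrable.mul_const ?_ _
    have : IsFiniteMeasure (((volume : Measure (E n)).restrict Ω).restrict K) :=
      ⟨by
        rw [Measure.restrict_apply_univ]
        exact hKc.measure_lt_top⟩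
    exact (((Lp.memLp u).restrict K).integrable (by norm_num)).norm
  · refine Eventually.of_forall fun x r hr => ?_
    refine HasDerivAt.const_mul _ ?_
    have h1 : HasDerivAt (fun r : ℝ => x - r • z) (-z) r := by
      simpa using ((hasDerivAt_id r).smul_const z).const_sub x
    have h2 := (hφ.1.differentiable (by simp)).differentiableAt.hasFDerivAt.comp_hasDerivAt
      (f := fun r : ℝ => x - r • z) r h1
    rw [map_neg] at h2
    simpa using h2.ofReal_comp

/-- The translation estimate for functions with a weak gradient. -/
theorem lintegral_translate_sub_le {Ω : Set (E n)} {u : L2 Ω} {G : L2Vec n Ω}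
    (hG : IsWeakGradient u G) (hΩ : IsOpen Ω) {A : Set (E n)} (hA : IsOpen A) {z : E n}
    (hz : ∀ x ∈ A, ∀ s ∈ Icc (0 : ℝ) 1, x + s • z ∈ Ω) :
    ∫⁻ x in A, ‖u (x + z) - u x‖ₑ ^ 2 ≤ ENNReal.ofReal (2 * (‖z‖ * ‖G‖) ^ 2) := by
  have hAΩ : A ⊆ Ω := fun x hx => by simpa using hz x hx 0 (by simp)
  have hAz : ∀ x ∈ A, x + z ∈ Ω := fun x hx => by simpa using hz x hx 1 (by simp)
  have hu1 : MemLp u 2 ((volume : Measure (E n)).restrict A) :=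
    (Lp.memLp u).mono_measure (Measure.restrict_mono hAΩ le_rfl)
  have hu2 : MemLp (fun x => u (x + z)) 2 ((volume : Measure (E n)).restrict A) := by
    have h1 : MeasurePreserving (fun x : E n => x + z) (volume.restrict ((fun x => x + z) ⁻¹' Ω))
        (volume.restrict Ω) :=
      (measurePreserving_add_right volume z).restrict_preimage hΩ.measurableSet
    exact ((Lp.memLp u).comp_measurePreserving h1).mono_measure (Measure.restrict_mono hAz le_rfl)
  -- By duality it suffices to pair the difference with a test function and to move the translation
  -- onto it.
  refine lintegral_sq_le_of_test hA (hu2.sub hu1) (by positivity) fun φ hφ hs => ?_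
  have hsupp : ∀ s ∈ Icc (0 : ℝ) 1, tsupport (fun x => φ (x - s • z)) ⊆ Ω := by
    intro s hs' x hx
    rw [tsupport_translate] at hx
    simpa using hz _ (hs hx) s hs'
  have h0 : ∫ x in A, (u (x + z) - u x) * (φ x : ℂ)
      = (∫ x in Ω, u x * (φ (x - (1 : ℝ) • z) : ℂ)) - ∫ x in Ω, u x * (φ (x - (0 : ℝ) • z) : ℂ) := by
    simp_rw [sub_mul]
    rw [integral_sub (integrable_mul_test hu2 hφ.1.continuous hφ.2)
      (integrable_mul_test hu1 hφ.1.continuous hφ.2)]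
    congr 1
    · rw [setIntegral_eq_integral_of_forall_compl_eq_zero (s := A) fun x hx => by
        rw [image_eq_zero_of_notMem_tsupport fun h => hx (hs h)]; simp,
        setIntegral_eq_integral_of_forall_compl_eq_zero (s := Ω) fun x hx => by
        rw [image_eq_zero_of_notMem_tsupport (f := fun x => φ (x - (1 : ℝ) • z))
          fun h => hx (hsupp 1 (by simp) h)]; simp]
      rw [eq_comm, ← integral_add_right_eq_self _ z]
      simp
    · rw [setIntegral_eq_integral_of_forall_compl_eq_zero (s := A) fun x hx => by
        rw [image_eq_zero_of_notMem_tsupport fun h => hx (hs h)]; simp,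
        setIntegral_eq_integral_of_forall_compl_eq_zero (s := Ω) fun x hx => by
        rw [image_eq_zero_of_notMem_tsupport (f := fun x => φ (x - (0 : ℝ) • z))
          fun h => hx (hsupp 0 (by simp) h)]; simp]
      simp
  change ‖∫ x in A, (u (x + z) - u x) * (φ x : ℂ)‖ ≤ _
  rw [h0]
  -- Mean value inequality along the segment: its translates of the test function stay supported in
  -- `Ω`, so the derivative equals a pairing with the gradient.
  refine norm_image_sub_le_of_norm_deriv_le_segment_01' (fun s _ =>
    (hasDerivAt_integral_translate u hφ z s).hasDerivWithinAt) fun s hs' => ?_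
  have hφs := hφ.translate (s • z)
  have h1 := sum_green u G hφs z
  rw [Finset.sum_eq_zero fun i _ => by
    rw [hG _ hφs (hsupp s ⟨hs'.1, hs'.2.le⟩) i, mul_zero],
    integral_add (integrable_fderiv_apply u hφs z) (integrable_sum_mul G hφs z)] at h1
  simp_rw [fderiv_translate] at h1
  rw [← eq_neg_iff_add_eq_zero.2 ((add_comm _ _).trans h1)]
  refine (norm_integral_sum_mul_le G hφs z).trans (le_of_eq ?_)
  rw [integral_sub_right_eq_self (fun x => φ x ^ 2) (s • z)]

end Translation

/-- Near each point there is a cone of directions that lead from points of `Ω` into `Ω`. -/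
def LocalCone {n : ℕ} (Ω : Set (E n)) : Prop :=
  ∀ p, ∃ (e : E n) (r c : ℝ), 0 < r ∧ 0 < c ∧ ‖e‖ ≤ 1 ∧
    ∀ x ∈ Ω, x ∈ Metric.ball p r → ∀ t, 0 < t → t ≤ r → ∀ z : E n, ‖z + t • e‖ ≤ c * t → x + z ∈ Ω

theorem norm_horiz_le {d : ℕ} (x : E (d + 1)) : ‖horiz x‖ ≤ ‖x‖ := by
  rw [EuclideanSpace.norm_eq, EuclideanSpace.norm_eq, Fin.sum_univ_castSucc]
  refine Real.sqrt_le_sqrt ?_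
  simp only [horiz]
  exact le_add_of_nonneg_right (sq_nonneg _)

theorem abs_apply_le_norm {n : ℕ} (x : E n) (i : Fin n) : |x i| ≤ ‖x‖ := by
  have := PiLp.norm_apply_le x i
  rwa [Real.norm_eq_abs] at this

theorem horiz_add {d : ℕ} (x y : E (d + 1)) : horiz (x + y) = horiz x + horiz y := rfl

theorem horiz_smul {d : ℕ} (c : ℝ) (x : E (d + 1)) : horiz (c • x) = c • horiz x := rfl

/-- In graph coordinates `e` points upwards. A step `-t • e` plus an error of size `t / (K + 1)`
lowers the point by at least `K t / (K + 1)`, and over the same step the graph descends by at most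
this amount. At interior points `e = 0` works; away from the closure the condition is empty. -/
theorem HasLipschitzBoundary.localCone {d : ℕ} {Ω : Set (E (d + 1))} (hΩ : IsOpen Ω)
    (h : HasLipschitzBoundary Ω) : LocalCone Ω := by
  intro p
  by_cases hp : p ∈ Ω
  · obtain ⟨ρ, hρ, hb⟩ := Metric.isOpen_iff.1 hΩ p hp
    refine ⟨0, ρ / 2, 1, by positivity, one_pos, by simp, fun x _ hx t ht htr z hz => hb ?_⟩
    rw [smul_zero, add_zero, one_mul] at hz
    rw [Metric.mem_ball, dist_eq_norm] at hx ⊢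
    calc ‖x + z - p‖ = ‖(x - p) + z‖ := by congr 1; abel
      _ ≤ ‖x - p‖ + ‖z‖ := norm_add_le _ _
      _ < ρ := by linarith
  by_cases hp' : p ∈ closure Ω
  swap
  · obtain ⟨ρ, hρ, hb⟩ := Metric.isOpen_iff.1 isClosed_closure.isOpen_compl p hp'
    exact ⟨0, ρ, 1, hρ, one_pos, by simp, fun x hx hx' => absurd (subset_closure hx) (hb hx')⟩
  have hfr : p ∈ frontier Ω := by rw [hΩ.frontier_eq]; exact ⟨hp', hp⟩
  obtain ⟨R, f, K, ρ, hρ, hf, hR⟩ := h p hfr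
  set e : E (d + 1) := R.symm (EuclideanSpace.single (Fin.last d) 1) with he
  have hen : ‖e‖ = 1 := by rw [he, LinearIsometryEquiv.norm_map]; simp
  have hRe : R e = EuclideanSpace.single (Fin.last d) 1 := R.apply_symm_apply _
  refine ⟨e, ρ / 8, 1 / ((K : ℝ) + 1), by positivity, by positivity, hen.le,
    fun x hx hxp t ht htr z hz => ?_⟩
  set w := z + t • e with hw
  have hc1 : 1 / ((K : ℝ) + 1) * t ≤ t := by
    rw [div_mul_eq_mul_div, one_mul]
    exact div_le_self ht.le (by linarith [K.coe_nonneg])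
  have hzn : ‖z‖ ≤ 2 * t := by
    have : z = w - t • e := by rw [hw]; abel
    rw [this]
    refine (norm_sub_le _ _).trans ?_
    rw [norm_smul, hen, Real.norm_eq_abs, abs_of_pos ht]
    linarith
  have hxb : x ∈ Metric.ball p ρ := Metric.ball_subset_ball (by linarith) hxp
  have hxzb : x + z ∈ Metric.ball p ρ := by
    rw [Metric.mem_ball, dist_eq_norm] at hxp ⊢
    calc ‖x + z - p‖ = ‖(x - p) + z‖ := by congr 1; abel
      _ ≤ ‖x - p‖ + ‖z‖ := norm_add_le _ _
      _ < ρ := by linarith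
  have h1 := (hR x hxb).1 hx
  rw [hR _ hxzb]
  have hxz : R (x + z) = R x + R w + (-t) • R e := by
    rw [← map_smul, ← map_add, ← map_add]
    congr 1
    rw [hw]
    module
  have hhe : horiz (R e) = 0 := by
    ext i
    rw [hRe]
    simp [horiz, Fin.castSucc_ne_last]
  have hh : horiz (R (x + z)) = horiz (R x) + horiz (R w) := by
    rw [hxz, horiz_add, horiz_add, horiz_smul, hhe, smul_zero, add_zero]
  have hl : (R (x + z)) (Fin.last d) = (R x) (Fin.last d) + (R w) (Fin.last d) - t := by
    rw [hxz, hRe]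
    simp [sub_eq_add_neg]
  have hwn : ‖R w‖ ≤ 1 / ((K : ℝ) + 1) * t := by rw [LinearIsometryEquiv.norm_map]; exact hz
  have h2 := hf.dist_le_mul (horiz (R (x + z))) (horiz (R x))
  rw [hh, dist_eq_norm, dist_eq_norm, add_sub_cancel_left, Real.norm_eq_abs] at h2
  have h3 := (abs_le.1 h2).1
  have h4 : (K : ℝ) * ‖horiz (R w)‖ ≤ K * (1 / ((K : ℝ) + 1) * t) := by
    gcongr
    exact (norm_horiz_le _).trans hwn
  have h5 := (le_abs_self _).trans ((abs_apply_le_norm (R w) (Fin.last d)).trans hwn)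
  have h6 : K * (1 / ((K : ℝ) + 1) * t) + 1 / ((K : ℝ) + 1) * t = t := by
    field_simp
  rw [hl, hh]
  linarith

/-! ### Rellich's lemma -/

section Rellich

variable {n : ℕ}

/-- Integration over `D`, as a functional on `L²(Ω)`. -/
def integralOn {Ω : Set (E n)} (D : Set (E n)) (hD : MeasurableSet D)
    (hD' : (volume : Measure (E n)).restrict Ω D ≠ ⊤) : L2 Ω →L[ℂ] ℂ :=
  innerSL ℂ (indicatorConstLp 2 hD hD' (1 : ℂ))

theorem integralOn_apply {Ω : Set (E n)} {D : Set (E n)} (hD : MeasurableSet D)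
    (hD' : (volume : Measure (E n)).restrict Ω D ≠ ⊤) (hDΩ : D ⊆ Ω) (u : L2 Ω) :
    integralOn D hD hD' u = ∫ x in D, u x := by
  rw [integralOn, innerSL_apply_apply, L2.inner_indicatorConstLp_one, Measure.restrict_restrict hD,
    inter_eq_left.2 hDΩ]

/-- The mean oscillation over a set `D` of finite measure. -/
theorem enorm_sub_average_sq_le {D : Set (E n)} {b : ℝ} (hb : 0 < b)
    (hD : (volume : Measure (E n)) D = ENNReal.ofReal b) {u : E n → ℂ} (hum : Measurable u)
    (hu : IntegrableOn u D) (a : ℂ) :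
    ‖a - ((b⁻¹ : ℝ) : ℂ) * ∫ y in D, u y‖ₑ ^ 2
      ≤ ENNReal.ofReal b⁻¹ * ∫⁻ y in D, ‖u y - a‖ₑ ^ 2 := by
  have hDr : (volume : Measure (E n)).real D = b := by
    rw [Measure.real, hD, ENNReal.toReal_ofReal hb.le]
  have hfin : IsFiniteMeasure ((volume : Measure (E n)).restrict D) :=
    ⟨by rw [Measure.restrict_apply_univ, hD]; exact ENNReal.ofReal_lt_top⟩
  have h1 : a - ((b⁻¹ : ℝ) : ℂ) * ∫ y in D, u y = -(((b⁻¹ : ℝ) : ℂ) * ∫ y in D, (u y - a)) := by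
    rw [integral_sub hu (integrable_const a), setIntegral_const, hDr, mul_sub,
      Complex.real_smul, ← mul_assoc, ← Complex.ofReal_mul, inv_mul_cancel₀ hb.ne']
    simp
  rw [h1, enorm_neg, enorm_mul, mul_pow]
  have h2 : ‖((b⁻¹ : ℝ) : ℂ)‖ₑ = ENNReal.ofReal b⁻¹ := by
    rw [← ofReal_norm, Complex.norm_real, Real.norm_eq_abs, abs_of_pos (inv_pos.2 hb)]
  rw [h2]
  have h3 : ‖∫ y in D, (u y - a)‖ₑ ^ 2 ≤ ENNReal.ofReal b * ∫⁻ y in D, ‖u y - a‖ₑ ^ 2 := by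
    calc ‖∫ y in D, (u y - a)‖ₑ ^ 2 ≤ (∫⁻ y in D, ‖u y - a‖ₑ) ^ 2 := by
          gcongr
          exact enorm_integral_le_lintegral_enorm _
      _ ≤ _ := by
          have := sq_lintegral_le (μ := (volume : Measure (E n)).restrict D)
            (fun y => ‖u y - a‖ₑ) (hum.sub_const a).enorm.aemeasurable
          rwa [Measure.restrict_apply_univ, hD] at this
  calc ENNReal.ofReal b⁻¹ ^ 2 * ‖∫ y in D, (u y - a)‖ₑ ^ 2
      ≤ ENNReal.ofReal b⁻¹ ^ 2 * (ENNReal.ofReal b * ∫⁻ y in D, ‖u y - a‖ₑ ^ 2) := by gcongr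
    _ = ENNReal.ofReal b⁻¹ * ∫⁻ y in D, ‖u y - a‖ₑ ^ 2 := by
        rw [← mul_assoc]
        congr 1
        rw [← ENNReal.ofReal_pow (by positivity), ← ENNReal.ofReal_mul (by positivity)]
        congr 1
        field_simp

theorem two_mul_ofReal (a : ℝ) :
    (2 : ℝ≥0∞) * ENNReal.ofReal a = ENNReal.ofReal (2 * a) := by
  rw [ENNReal.ofReal_mul two_pos.le, ENNReal.ofReal_ofNat]

theorem natCast_mul_ofReal (N : ℕ) (a : ℝ) :
    (N : ℝ≥0∞) * ENNReal.ofReal a = ENNReal.ofReal (N * a) := by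
  rw [ENNReal.ofReal_mul N.cast_nonneg, ENNReal.ofReal_natCast]

theorem enorm_sq_le_two_mul_add (a c : ℂ) : ‖a‖ₑ ^ 2 ≤ 2 * ‖a - c‖ₑ ^ 2 + 2 * ‖c‖ₑ ^ 2 := by
  have h : ‖a‖ ^ 2 ≤ 2 * ‖a - c‖ ^ 2 + 2 * ‖c‖ ^ 2 := by
    have h1 : ‖a‖ ≤ ‖a - c‖ + ‖c‖ := by
      simpa using norm_add_le (a - c) c
    nlinarith [sq_nonneg (‖a - c‖ - ‖c‖), norm_nonneg a]
  have := ENNReal.ofReal_le_ofReal h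
  rw [ENNReal.ofReal_add (by positivity) (by positivity), ENNReal.ofReal_mul (by positivity),
    ENNReal.ofReal_mul (by positivity), ENNReal.ofReal_pow (by positivity),
    ENNReal.ofReal_pow (by positivity), ENNReal.ofReal_pow (by positivity)] at this
  simpa using this

/-- On a small cell, `u` is compared with its mean over a ball shifted into `Ω` along the cone. The
deviation is an average of squared translation differences with steps of order `t`, which the
gradient controls. The finitely many means form `P`. -/
theorem exists_finite_rank_approx_local {Ω : Set (E n)} (hΩ : IsOpen Ω) (hc : LocalCone Ω)
    (p : E n) : ∃ r > 0, ∀ ε > 0, ∃ (N : ℕ) (C : ℝ) (P : L2 Ω →L[ℂ] (Fin N → ℂ)), 0 ≤ C ∧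
      ∀ (u : L2 Ω) (G : L2Vec n Ω), IsWeakGradient u G →
      ∫⁻ x in Ω ∩ Metric.ball p r, ‖u x‖ₑ ^ 2 ≤ ENNReal.ofReal (ε * ‖G‖ ^ 2 + C * ‖P u‖ ^ 2) := by
  obtain ⟨e, r, c, hr, hc0, he, hcone⟩ := hc p
  refine ⟨r, hr, fun ε hε => ?_⟩
  -- The quantity bounded by `ε` is the factor of `‖G‖ ^ 2` that comes out of the final estimate.
  obtain ⟨t, ht0, htr, htε⟩ : ∃ t : ℝ, 0 < t ∧ t ≤ r ∧ 2 ^ n * 4 * ((c + 1) * t) ^ 2 ≤ ε := by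
    have h1 : Tendsto (fun t : ℝ => 2 ^ n * 4 * ((c + 1) * t) ^ 2) (𝓝[>] 0) (𝓝 0) := by
      have : Continuous fun t : ℝ => (2 : ℝ) ^ n * 4 * ((c + 1) * t) ^ 2 := by fun_prop
      simpa using (this.tendsto 0).mono_left nhdsWithin_le_nhds
    obtain ⟨t, ht⟩ := ((h1.eventually (gt_mem_nhds hε)).and
      (Ioc_mem_nhdsGT hr)).exists
    exact ⟨t, ht.2.1, ht.2.2, ht.1.le⟩
  -- For `x` in the ball about `a j` and `y` in the shifted ball, `y - x + t • e` has norm below `2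
  -- * δ = c * t`, as the cone condition requires.
  set δ : ℝ := c * t / 2 with hδ
  have hδ0 : 0 < δ := by positivity
  obtain ⟨T, -, hTf, hT⟩ := (isCompact_closedBall p r).finite_cover_balls hδ0
  obtain ⟨N, a, -, haT⟩ := hTf.fin_param
  set A : Set (E n) := Ω ∩ Metric.ball p r with hA
  have hAo : IsOpen A := hΩ.inter Metric.isOpen_ball
  have hcov : A ⊆ ⋃ j, Metric.ball (a j) δ := by
    intro x hx
    have h1 := hT (Metric.ball_subset_closedBall hx.2)
    rw [← haT, biUnion_range] at h1
    exact h1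
  set Q : Fin N → Set (E n) := fun j => A ∩ disjointed (fun i => Metric.ball (a i) δ) j with hQ
  have hQm : ∀ j, MeasurableSet (Q j) := fun j =>
    hAo.measurableSet.inter (disjointedRec (p := MeasurableSet)
      (fun _ _ ht => ht.diff Metric.isOpen_ball.measurableSet) Metric.isOpen_ball.measurableSet)
  have hQd : Pairwise (Function.onFun Disjoint Q) := fun i j hij =>
    ((disjoint_disjointed _ hij).mono inter_subset_right inter_subset_right)
  have hQA : ⋃ j, Q j = A := by
    rw [← inter_iUnion, iUnion_disjointed]
    exact inter_eq_left.2 hcov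
  have hQb : ∀ j, ∀ x ∈ Q j, x ∈ Metric.ball (a j) δ := fun j x hx =>
    disjointed_subset (fun i => Metric.ball (a i) δ) j hx.2
  set D : Fin N → Set (E n) := fun j => Metric.ball (a j - t • e) δ with hD
  set b : ℝ := (volume : Measure (E n)).real (Metric.ball (0 : E n) δ) with hb
  have hb0 : 0 < b := ENNReal.toReal_pos (Metric.measure_ball_pos _ _ hδ0).ne'
    measure_ball_lt_top.ne
  have hDb : ∀ x : E n, volume (Metric.ball x δ) = ENNReal.ofReal b := by
    intro x
    rw [Measure.addHaar_ball_center, hb, Measure.real, ENNReal.ofReal_toReal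
      measure_ball_lt_top.ne]
  have hDfin : ∀ j, (volume : Measure (E n)).restrict Ω (D j) ≠ ⊤ := fun j =>
    ((Measure.restrict_apply_le _ _).trans_lt measure_ball_lt_top).ne
  set P : L2 Ω →L[ℂ] (Fin N → ℂ) := ContinuousLinearMap.pi fun j =>
    integralOn (D j) Metric.isOpen_ball.measurableSet (hDfin j) with hP
  set V : ℝ := (volume : Measure (E n)).real (Metric.ball p r) with hV
  refine ⟨N, N * (2 * V * b⁻¹ ^ 2), P, by positivity, fun u G hG => ?_⟩
  have hum : Measurable u := (Lp.stronglyMeasurable u).measurable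
  have hseg : ∀ x ∈ A, ∀ z ∈ Metric.ball (-(t • e)) (2 * δ), ∀ s ∈ Icc (0 : ℝ) 1,
      x + s • z ∈ Ω := by
    intro x hx z hz s hs
    rcases hs.1.eq_or_lt with rfl | hs0
    · simpa using hx.1
    · refine hcone x hx.1 hx.2 (s * t) (by positivity) ?_ (s • z) ?_
      · exact (mul_le_of_le_one_left ht0.le hs.2).trans htr
      · rw [Metric.mem_ball, dist_eq_norm, sub_neg_eq_add] at hz
        rw [mul_smul, ← smul_add, norm_smul, Real.norm_eq_abs, abs_of_pos hs0]
        calc s * ‖z + t • e‖ ≤ s * (2 * δ) := by gcongr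
          _ = c * (s * t) := by rw [hδ]; ring
  have hDΩ : ∀ j, ∀ x ∈ Q j, D j ⊆ (fun y => y - x) ⁻¹' Metric.ball (-(t • e)) (2 * δ) := by
    intro j x hx y hy
    have h1 := hQb j x hx
    rw [Metric.mem_ball, dist_eq_norm] at h1
    rw [hD, Metric.mem_ball, dist_eq_norm] at hy
    rw [mem_preimage, Metric.mem_ball, dist_eq_norm]
    have : y - x - -(t • e) = (y - (a j - t • e)) - (x - a j) := by abel
    rw [this]
    linarith [norm_sub_le (y - (a j - t • e)) (x - a j)]
  have hlocal : ∀ j, ∫⁻ x in Q j, ‖u x‖ₑ ^ 2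
      ≤ 2 * ENNReal.ofReal b⁻¹ * (∫⁻ x in Q j, ∫⁻ z in Metric.ball (-(t • e)) (2 * δ),
          ‖u (x + z) - u x‖ₑ ^ 2) + ENNReal.ofReal (2 * V * b⁻¹ ^ 2 * ‖P u‖ ^ 2) := by
    intro j
    rcases (Q j).eq_empty_or_nonempty with hemp | ⟨x₀, hx₀⟩
    · simp [hemp]
    have hDjΩ : D j ⊆ Ω := by
      intro y hy
      have := hseg x₀ hx₀.1 (y - x₀) (hDΩ j x₀ hx₀ hy) 1 (by simp)
      simpa using this
    have hPj : P u j = ∫ y in D j, u y := integralOn_apply _ _ hDjΩ u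
    have huD : IntegrableOn u (D j) := by
      have hfin : IsFiniteMeasure ((volume : Measure (E n)).restrict (D j)) :=
        ⟨by rw [Measure.restrict_apply_univ]; exact measure_ball_lt_top⟩
      exact ((Lp.memLp u).mono_measure (Measure.restrict_mono hDjΩ le_rfl)).integrable
        (by norm_num)
    have hpt : ∀ x ∈ Q j, ‖u x‖ₑ ^ 2 ≤ 2 * ENNReal.ofReal b⁻¹ *
        (∫⁻ z in Metric.ball (-(t • e)) (2 * δ), ‖u (x + z) - u x‖ₑ ^ 2)
        + ENNReal.ofReal (2 * b⁻¹ ^ 2 * ‖P u‖ ^ 2) := by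
      intro x hx
      refine (enorm_sq_le_two_mul_add (u x) (((b⁻¹ : ℝ) : ℂ) * P u j)).trans ?_
      refine add_le_add ?_ ?_
      · rw [hPj, mul_assoc]
        gcongr
        refine (enorm_sub_average_sq_le hb0 (hDb _) hum huD (u x)).trans (mul_le_mul' le_rfl ?_)
        calc ∫⁻ y in D j, ‖u y - u x‖ₑ ^ 2
            ≤ ∫⁻ y in (fun y => y - x) ⁻¹' Metric.ball (-(t • e)) (2 * δ), ‖u y - u x‖ₑ ^ 2 :=
              lintegral_mono_set (hDΩ j x hx)
          _ = ∫⁻ z in Metric.ball (-(t • e)) (2 * δ), ‖u (x + z) - u x‖ₑ ^ 2 := by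
              have := (measurePreserving_sub_right (volume : Measure (E n)) x).setLIntegral_comp_preimage
                (f := fun z => ‖u (x + z) - u x‖ₑ ^ 2)
                (s := Metric.ball (-(t • e)) (2 * δ)) Metric.isOpen_ball.measurableSet
                (by fun_prop)
              rw [← this]
              simp
      · rw [enorm_mul, mul_pow]
        have h2 : ‖((b⁻¹ : ℝ) : ℂ)‖ₑ = ENNReal.ofReal b⁻¹ := by
          rw [← ofReal_norm, Complex.norm_real, Real.norm_eq_abs, abs_of_pos (inv_pos.2 hb0)]
        rw [h2, ← ofReal_norm, ← ENNReal.ofReal_pow (by positivity),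
          ← ENNReal.ofReal_pow (by positivity), ← ENNReal.ofReal_mul (by positivity)]
        rw [two_mul_ofReal, ← mul_assoc]
        refine ENNReal.ofReal_le_ofReal ?_
        gcongr
        exact norm_le_pi_norm (P u) j
    calc ∫⁻ x in Q j, ‖u x‖ₑ ^ 2 ≤ ∫⁻ x in Q j, (2 * ENNReal.ofReal b⁻¹ *
        (∫⁻ z in Metric.ball (-(t • e)) (2 * δ), ‖u (x + z) - u x‖ₑ ^ 2)
        + ENNReal.ofReal (2 * b⁻¹ ^ 2 * ‖P u‖ ^ 2)) := setLIntegral_mono' (hQm j) hpt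
      _ ≤ _ := by
        rw [lintegral_add_right _ measurable_const, lintegral_const_mul _ (by fun_prop),
          setLIntegral_const]
        gcongr
        have h4 : volume (Q j) ≤ ENNReal.ofReal V := by
          rw [hV, Measure.real, ENNReal.ofReal_toReal measure_ball_lt_top.ne]
          exact measure_mono fun x hx => hx.1.2
        calc ENNReal.ofReal (2 * b⁻¹ ^ 2 * ‖P u‖ ^ 2) * volume (Q j)
            ≤ ENNReal.ofReal (2 * b⁻¹ ^ 2 * ‖P u‖ ^ 2) * ENNReal.ofReal V := by gcongr
          _ = _ := by
            rw [← ENNReal.ofReal_mul (by positivity)]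
            congr 1
            ring
  -- The order of integration is exchanged and the translation estimate is applied for each fixed
  -- `z`; the ball of radius `2 * δ` has volume `2 ^ n * b`.
  have hmain : ∫⁻ x in A, ∫⁻ z in Metric.ball (-(t • e)) (2 * δ), ‖u (x + z) - u x‖ₑ ^ 2
      ≤ ENNReal.ofReal (2 * ((c + 1) * t * ‖G‖) ^ 2 * (2 ^ n * b)) := by
    rw [lintegral_lintegral_swap (by fun_prop)]
    calc ∫⁻ z in Metric.ball (-(t • e)) (2 * δ), ∫⁻ x in A, ‖u (x + z) - u x‖ₑ ^ 2
        ≤ ∫⁻ _ in Metric.ball (-(t • e)) (2 * δ),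
            ENNReal.ofReal (2 * ((c + 1) * t * ‖G‖) ^ 2) := by
          refine setLIntegral_mono' Metric.isOpen_ball.measurableSet fun z hz => ?_
          refine (lintegral_translate_sub_le hG hΩ hAo fun x hx => hseg x hx z hz).trans ?_
          refine ENNReal.ofReal_le_ofReal ?_
          have : ‖z‖ ≤ (c + 1) * t := by
            rw [Metric.mem_ball, dist_eq_norm, sub_neg_eq_add] at hz
            have h1 := norm_sub_le (z + t • e) (t • e)
            rw [add_sub_cancel_right, norm_smul, Real.norm_eq_abs, abs_of_pos ht0] at h1
            nlinarith
          gcongr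
      _ = _ := by
          rw [setLIntegral_const, Measure.addHaar_ball_mul_of_pos _ _ two_pos, hDb,
            finrank_euclideanSpace_fin, ← ENNReal.ofReal_mul (by positivity),
            ← ENNReal.ofReal_mul (by positivity)]
  rw [← hQA, lintegral_iUnion hQm hQd, tsum_fintype]
  calc ∑ j, ∫⁻ x in Q j, ‖u x‖ₑ ^ 2
      ≤ ∑ j, (2 * ENNReal.ofReal b⁻¹ * (∫⁻ x in Q j, ∫⁻ z in Metric.ball (-(t • e)) (2 * δ),
          ‖u (x + z) - u x‖ₑ ^ 2) + ENNReal.ofReal (2 * V * b⁻¹ ^ 2 * ‖P u‖ ^ 2)) :=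
        Finset.sum_le_sum fun j _ => hlocal j
    _ = 2 * ENNReal.ofReal b⁻¹ * (∫⁻ x in A, ∫⁻ z in Metric.ball (-(t • e)) (2 * δ),
          ‖u (x + z) - u x‖ₑ ^ 2) + N * ENNReal.ofReal (2 * V * b⁻¹ ^ 2 * ‖P u‖ ^ 2) := by
        rw [Finset.sum_add_distrib, ← Finset.mul_sum, ← tsum_fintype (L := .unconditional _),
          ← lintegral_iUnion hQm hQd, hQA]
        simp
    _ ≤ 2 * ENNReal.ofReal b⁻¹ * ENNReal.ofReal (2 * ((c + 1) * t * ‖G‖) ^ 2 * (2 ^ n * b))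
          + N * ENNReal.ofReal (2 * V * b⁻¹ ^ 2 * ‖P u‖ ^ 2) := by gcongr
    _ ≤ _ := by
        rw [two_mul_ofReal, natCast_mul_ofReal, ← ENNReal.ofReal_mul (by positivity),
          ← ENNReal.ofReal_add (by positivity) (by positivity)]
        refine ENNReal.ofReal_le_ofReal ?_
        refine add_le_add ?_ (le_of_eq (by ring))
        calc 2 * b⁻¹ * (2 * ((c + 1) * t * ‖G‖) ^ 2 * (2 ^ n * b))
            = 2 ^ n * 4 * ((c + 1) * t) ^ 2 * ‖G‖ ^ 2 * (b⁻¹ * b) := by ring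
          _ = 2 ^ n * 4 * ((c + 1) * t) ^ 2 * ‖G‖ ^ 2 := by
            rw [inv_mul_cancel₀ hb0.ne', mul_one]
          _ ≤ ε * ‖G‖ ^ 2 := by gcongr

/-- The Rellich lemma: the embedding of `H¹(Ω)` into `L²(Ω ∩ K)` is approximated by operators of
finite rank. -/
theorem exists_finite_rank_approx {Ω : Set (E n)} (hΩ : IsOpen Ω) (hc : LocalCone Ω)
    {K : Set (E n)} (hK : MeasurableSet K) (hKb : Bornology.IsBounded K) {ε : ℝ} (hε : 0 < ε) :
    ∃ (N : ℕ) (P : L2 Ω →L[ℂ] (Fin N → ℂ)),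
      ∀ (u : L2 Ω) (G : L2Vec n Ω), IsWeakGradient u G → ‖cut K hK u‖ ≤ ε * ‖G‖ + ‖P u‖ := by
  choose r hr H using exists_finite_rank_approx_local hΩ hc
  obtain ⟨T, -, hcov⟩ := hKb.isCompact_closure.elim_nhds_subcover (fun p => Metric.ball p (r p))
    (fun p _ => Metric.ball_mem_nhds p (hr p))
  have hT0 : (0 : ℝ) < (T.card : ℝ) + 1 := by positivity
  choose N C P hC hP using fun p => H p (ε ^ 2 / ((T.card : ℝ) + 1)) (by positivity)
  set Ctot : ℝ := ∑ p ∈ T, C p with hCtot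
  have hCtot0 : 0 ≤ Ctot := Finset.sum_nonneg fun p _ => hC p
  let ι := Σ p : T, Fin (N p)
  let e : ι ≃ Fin (Fintype.card ι) := Fintype.equivFin ι
  -- All local functionals are stacked. In the maximum norm the factor `√Ctot` is what dominates the
  -- sum of the `C p * ‖P p u‖ ^ 2`.
  set Q : L2 Ω →L[ℂ] (Fin (Fintype.card ι) → ℂ) := ContinuousLinearMap.pi fun k =>
    (Real.sqrt Ctot : ℂ) • ((ContinuousLinearMap.proj (e.symm k).2).comp (P (e.symm k).1)) with hQ
  refine ⟨_, Q, fun u G hG => ?_⟩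
  have hPQ : ∀ p ∈ T, Ctot * ‖P p u‖ ^ 2 ≤ ‖Q u‖ ^ 2 := by
    intro p hp
    have h1 : Real.sqrt Ctot * ‖P p u‖ ≤ ‖Q u‖ := by
      have h2 : ‖(Real.sqrt Ctot : ℂ) • P p u‖ ≤ ‖Q u‖ := by
        refine (pi_norm_le_iff_of_nonneg (norm_nonneg _)).2 fun i => ?_
        have h3 := norm_le_pi_norm (Q u) (e ⟨⟨p, hp⟩, i⟩)
        have h4 : Q u (e ⟨⟨p, hp⟩, i⟩) = (Real.sqrt Ctot : ℂ) • P p u i :=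
          congrArg (fun k : ι => (Real.sqrt Ctot : ℂ) • P k.1 u k.2)
            (e.symm_apply_apply ⟨⟨p, hp⟩, i⟩)
        rwa [h4] at h3
      rwa [norm_smul, Complex.norm_real, Real.norm_eq_abs, abs_of_nonneg (Real.sqrt_nonneg _)] at h2
    calc Ctot * ‖P p u‖ ^ 2 = (Real.sqrt Ctot * ‖P p u‖) ^ 2 := by
          rw [mul_pow, Real.sq_sqrt hCtot0]
      _ ≤ ‖Q u‖ ^ 2 := by gcongr
  have hsum : ∑ p ∈ T, C p * ‖P p u‖ ^ 2 ≤ ‖Q u‖ ^ 2 := by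
    rcases hCtot0.eq_or_lt with h0 | hpos
    · have : ∀ p ∈ T, C p = 0 := (Finset.sum_eq_zero_iff_of_nonneg fun p _ => hC p).1 h0.symm
      rw [Finset.sum_eq_zero fun p hp => by rw [this p hp, zero_mul]]
      positivity
    · calc ∑ p ∈ T, C p * ‖P p u‖ ^ 2 ≤ ∑ p ∈ T, C p * (‖Q u‖ ^ 2 / Ctot) := by
            refine Finset.sum_le_sum fun p hp => mul_le_mul_of_nonneg_left ?_ (hC p)
            rw [le_div_iff₀ hpos, mul_comm]
            exact hPQ p hp
        _ = ‖Q u‖ ^ 2 := by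
            rw [← Finset.sum_mul, ← hCtot]
            field_simp
  refine le_of_ofReal_sq_le (by positivity) ?_
  rw [norm_sq_cut, Measure.restrict_restrict hK]
  have hsub : K ∩ Ω ⊆ ⋃ p ∈ T, Ω ∩ Metric.ball p (r p) := by
    intro x hx
    have := hcov (subset_closure hx.1)
    simp only [mem_iUnion] at this ⊢
    obtain ⟨p, hp, hxp⟩ := this
    exact ⟨p, hp, hx.2, hxp⟩
  calc ∫⁻ x in K ∩ Ω, ‖u x‖ₑ ^ 2 ≤ ∫⁻ x in ⋃ p ∈ T, Ω ∩ Metric.ball p (r p), ‖u x‖ₑ ^ 2 :=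
        lintegral_mono_set hsub
    _ ≤ ∑ p ∈ T, ∫⁻ x in Ω ∩ Metric.ball p (r p), ‖u x‖ₑ ^ 2 := by
        have hU : (⋃ p ∈ T, Ω ∩ Metric.ball p (r p)) = ⋃ p : T, Ω ∩ Metric.ball p.1 (r p) := by
          ext x
          simp
        rw [hU]
        refine (lintegral_iUnion_le _ _).trans (le_of_eq ?_)
        rw [tsum_fintype]
        exact Finset.sum_coe_sort T fun p => ∫⁻ x in Ω ∩ Metric.ball p (r p), ‖u x‖ₑ ^ 2
    _ ≤ ∑ p ∈ T, ENNReal.ofReal (ε ^ 2 / ((T.card : ℝ) + 1) * ‖G‖ ^ 2 + C p * ‖P p u‖ ^ 2) :=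
        Finset.sum_le_sum fun p _ => hP p u G hG
    _ = ENNReal.ofReal (∑ p ∈ T, (ε ^ 2 / ((T.card : ℝ) + 1) * ‖G‖ ^ 2 + C p * ‖P p u‖ ^ 2)) :=
        (ENNReal.ofReal_sum_of_nonneg fun p _ =>
          add_nonneg (by positivity) (mul_nonneg (hC p) (sq_nonneg _))).symm
    _ ≤ _ := by
        refine ENNReal.ofReal_le_ofReal ?_
        rw [Finset.sum_add_distrib, Finset.sum_const, nsmul_eq_mul]
        have h1 : (T.card : ℝ) * (ε ^ 2 / ((T.card : ℝ) + 1) * ‖G‖ ^ 2) ≤ ε ^ 2 * ‖G‖ ^ 2 := by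
          rw [← mul_assoc]
          gcongr
          rw [mul_div_assoc', div_le_iff₀ hT0]
          nlinarith [sq_nonneg ε]
        have h2 : 0 ≤ ε * ‖G‖ * ‖Q u‖ := by positivity
        nlinarith

end Rellich

/-! ### Coordinates -/

section Coordinates

variable {n : ℕ}

/-- Insertion of a coordinate. -/
def insE (k : Fin (n + 1)) : ℝ × E n ≃ᵐ E (n + 1) :=
  ((MeasurableEquiv.prodCongr (MeasurableEquiv.refl ℝ)
      (MeasurableEquiv.toLp 2 (Fin n → ℝ)).symm).trans
    (MeasurableEquiv.piFinSuccAbove (fun _ => ℝ) k).symm).trans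
    (MeasurableEquiv.toLp 2 (Fin (n + 1) → ℝ))

theorem insE_apply (k : Fin (n + 1)) (p : ℝ × E n) :
    insE k p = WithLp.toLp 2 (k.insertNth p.1 p.2.ofLp) := rfl

@[simp] theorem insE_same (k : Fin (n + 1)) (p : ℝ × E n) : insE k p k = p.1 := by
  simp [insE_apply]

@[simp] theorem insE_succAbove (k : Fin (n + 1)) (p : ℝ × E n) (j : Fin n) :
    insE k p (k.succAbove j) = p.2 j := by
  simp [insE_apply]

theorem measurePreserving_insE (k : Fin (n + 1)) :
    MeasurePreserving (insE (n := n) k) (volume.prod volume) volume := by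
  refine (PiLp.volume_preserving_toLp (Fin (n + 1))).comp ?_
  refine ((volume_preserving_piFinSuccAbove (fun _ : Fin (n + 1) => ℝ) k).symm _).comp ?_
  exact (MeasurePreserving.id volume).prod (PiLp.volume_preserving_ofLp (Fin n))

theorem horiz_insE_last (p : ℝ × E n) : horiz (insE (Fin.last n) p) = p.2 := by
  ext j
  have := insE_succAbove (Fin.last n) p j
  rwa [Fin.succAbove_last] at this

end Coordinates

/-! ### Cutoff functions -/

section Cutoff

variable {n : ℕ}

/-- A smooth function of the coordinate `x_k` that vanishes for `m σ x_k ≤ 1`. -/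
def coordCutoff (k : Fin n) (σ : ℝ) (m : ℕ) (x : E n) : ℝ := Real.smoothTransition (m * (σ * x k) - 1)

theorem contDiff_coordCutoff (k : Fin n) (σ : ℝ) (m : ℕ) : ContDiff ℝ ∞ (coordCutoff k σ m) := by
  unfold coordCutoff
  refine Real.smoothTransition.contDiff.comp ?_
  fun_prop

theorem coordCutoff_eq_zero {k : Fin n} {σ : ℝ} {m : ℕ} {x : E n} (h : m * (σ * x k) ≤ 1) :
    coordCutoff k σ m x = 0 :=
  Real.smoothTransition.zero_of_nonpos (by linarith)

theorem tsupport_coordCutoff_mul (k : Fin n) (σ : ℝ) (m : ℕ) (φ : E n → ℝ) :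
    tsupport (fun x => coordCutoff k σ m x * φ x) ⊆ tsupport φ ∩ {x | 1 ≤ m * (σ * x k)} := by
  refine subset_inter (closure_mono fun x hx => right_ne_zero_of_mul hx) ?_
  refine closure_minimal (fun x hx => ?_) (isClosed_le continuous_const (by fun_prop))
  by_contra h
  exact left_ne_zero_of_mul hx (coordCutoff_eq_zero (not_le.1 h).le)

theorem tendsto_coordCutoff {k : Fin n} {σ : ℝ} {x : E n} (h : 0 < σ * x k) :
    Tendsto (fun m => coordCutoff k σ m x) atTop (𝓝 1) := by
  refine tendsto_const_nhds.congr' ?_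
  filter_upwards [(tendsto_natCast_atTop_atTop (R := ℝ)).eventually_ge_atTop (2 / (σ * x k))]
    with m hm
  rw [div_le_iff₀ h] at hm
  exact (Real.smoothTransition.one_of_one_le (by linarith)).symm

theorem partialDeriv_mul {φ ψ : E n → ℝ} (hφ : Differentiable ℝ φ) (hψ : Differentiable ℝ ψ)
    (i : Fin n) (x : E n) :
    partialDeriv (fun x => φ x * ψ x) i x = φ x * partialDeriv ψ i x + partialDeriv φ i x * ψ x := by
  unfold partialDeriv
  rw [fderiv_fun_mul (hφ x) (hψ x)]
  simp [mul_comm]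

theorem partialDeriv_coordCutoff {k i : Fin n} (h : i ≠ k) (σ : ℝ) (m : ℕ) (x : E n) :
    partialDeriv (coordCutoff k σ m) i x = 0 := by
  unfold partialDeriv
  have h1 : HasLineDerivAt ℝ (coordCutoff k σ m) 0 x (EuclideanSpace.single i 1) := by
    have : (fun t : ℝ => coordCutoff k σ m (x + t • EuclideanSpace.single i 1))
        = fun _ => coordCutoff k σ m x := by
      ext t
      simp [coordCutoff, h.symm]
    unfold HasLineDerivAt
    rw [this]
    exact hasDerivAt_const _ _
  rw [← ((contDiff_coordCutoff k σ m).differentiable (by simp) x).lineDeriv_eq_fderiv]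
  exact h1.lineDeriv

theorem tendsto_integral_coordCutoff {X : Type*} [MeasurableSpace X] {μ : Measure X} {f : X → ℂ}
    (hf : Integrable f μ) {k : Fin n} {σ : ℝ} {π : X → E n} (hπ : Measurable π)
    (h : ∀ᵐ x ∂μ, 0 < σ * π x k) :
    Tendsto (fun m => ∫ x, (coordCutoff k σ m (π x) : ℂ) * f x ∂μ) atTop (𝓝 (∫ x, f x ∂μ)) := by
  refine tendsto_integral_of_dominated_convergence (fun x => ‖f x‖) (fun m => ?_) hf.norm
    (fun m => Eventually.of_forall fun x => ?_) ?_
  · refine AEStronglyMeasurable.mul ?_ hf.1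
    exact (Complex.measurable_ofReal.comp
      ((contDiff_coordCutoff k σ m).continuous.measurable.comp hπ)).aestronglyMeasurable
  · have h0 : 0 ≤ coordCutoff k σ m (π x) := Real.smoothTransition.nonneg _
    rw [norm_mul, Complex.norm_real, Real.norm_eq_abs, abs_of_nonneg h0]
    exact mul_le_of_le_one_left (norm_nonneg _) (Real.smoothTransition.le_one _)
  · filter_upwards [h] with x hx
    have := ((Complex.continuous_ofReal.tendsto 1).comp (tendsto_coordCutoff hx)).mul_const (f x)
    simpa using this

/-- A cutoff in `x_k` is not differentiated in a direction `i ≠ k`, so dominated convergence removes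
it from Green's expression. -/
theorem tendsto_green_coordCutoff {Ω : Set (E n)} (hΩ : MeasurableSet Ω) {k i : Fin n} (hik : i ≠ k)
    {σ : ℝ} (hσ : ∀ x ∈ Ω, 0 < σ * x k) (u : L2 Ω) (G : L2Vec n Ω) {φ : E n → ℝ} (hφ : IsTest φ) :
    Tendsto (fun m => green u G (fun x => coordCutoff k σ m x * φ x) i) atTop
      (𝓝 (green u G φ i)) := by
  have h := tendsto_integral_coordCutoff (green_integrable u G hφ i) (π := id) measurable_id
    (k := k) (σ := σ) ((ae_restrict_iff' hΩ).2 (Eventually.of_forall hσ))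
  refine h.congr fun m => ?_
  unfold green
  refine integral_congr_ae (Eventually.of_forall fun x => ?_)
  simp only [id]
  rw [partialDeriv_mul ((contDiff_coordCutoff k σ m).differentiable (by simp))
    (hφ.1.differentiable (by simp)), partialDeriv_coordCutoff hik]
  push_cast
  ring

/-- A test function whose support does not meet the boundary of `Ω` can be cut off outside `Ω`. -/
theorem IsTest.indicator {Ω : Set (E n)} (hΩ : IsOpen Ω) {φ : E n → ℝ} (hφ : IsTest φ)
    (hs : tsupport φ ∩ closure Ω ⊆ Ω) :
    IsTest (Ω.indicator φ) ∧ tsupport (Ω.indicator φ) ⊆ Ω := by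
  have h1 : tsupport (Ω.indicator φ) ⊆ tsupport φ ∩ closure Ω := by
    refine closure_minimal (fun x hx => ?_) ((isClosed_tsupport φ).inter isClosed_closure)
    have hxΩ : x ∈ Ω := by
      by_contra h
      exact hx (indicator_of_notMem h φ)
    refine ⟨subset_tsupport φ ?_, subset_closure hxΩ⟩
    intro h0
    exact hx (by rw [indicator_of_mem hxΩ, h0])
  refine ⟨⟨contDiff_iff_contDiffAt.2 fun x => ?_, ?_⟩, h1.trans hs⟩
  · by_cases hx : x ∈ Ω
    · refine hφ.1.contDiffAt.congr_of_eventuallyEq ?_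
      filter_upwards [hΩ.mem_nhds hx] with y hy
      exact indicator_of_mem hy φ
    · have hx' : x ∉ tsupport (Ω.indicator φ) := fun h => hx (hs (h1 h))
      have : Ω.indicator φ =ᶠ[𝓝 x] fun _ => 0 := notMem_tsupport_iff_eventuallyEq.1 hx'
      exact contDiffAt_const.congr_of_eventuallyEq this
  · exact hφ.2.of_isClosed_subset (isClosed_tsupport _) (h1.trans inter_subset_left)

theorem green_congr {Ω : Set (E n)} (hΩ : IsOpen Ω) (u : L2 Ω) (G : L2Vec n Ω) {φ ψ : E n → ℝ}
    (h : ∀ x ∈ Ω, φ x = ψ x) (i : Fin n) : green u G φ i = green u G ψ i := by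
  unfold green
  refine setIntegral_congr_fun hΩ.measurableSet fun x hx => ?_
  have h1 : partialDeriv φ i x = partialDeriv ψ i x := by
    unfold partialDeriv
    rw [Filter.EventuallyEq.fderiv_eq (f₁ := φ) (f := ψ) (by
      filter_upwards [hΩ.mem_nhds hx] with y hy using h y hy)]
  simp only [h1, h x hx]

theorem IsWeakGradient.green_eq_zero {Ω : Set (E n)} (hΩ : IsOpen Ω) {u : L2 Ω} {G : L2Vec n Ω}
    (hG : IsWeakGradient u G) {φ : E n → ℝ} (hφ : IsTest φ) (hs : tsupport φ ∩ closure Ω ⊆ Ω)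
    (i : Fin n) : green u G φ i = 0 := by
  obtain ⟨h1, h2⟩ := hφ.indicator hΩ hs
  rw [← hG _ h1 h2 i]
  exact green_congr hΩ u G (fun x hx => (indicator_of_mem hx φ).symm) i

end Cutoff

/-! ### The flat part of the boundary -/

section Surface

variable {d : ℕ}

@[simp] theorem toSurface_last (y : E d) : toSurface y (Fin.last d) = 0 := by simp [toSurface]

@[simp] theorem toSurface_castSucc (y : E d) (i : Fin d) : toSurface y i.castSucc = y i := by
  simp [toSurface]

@[simp] theorem horiz_toSurface (y : E d) : horiz (toSurface y) = y := by
  ext i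
  simp [horiz]

theorem continuous_horiz : Continuous (horiz : E (d + 1) → E d) := by
  unfold horiz
  fun_prop

theorem contDiff_horiz : ContDiff ℝ ∞ (horiz : E (d + 1) → E d) := by
  rw [contDiff_euclidean]
  intro i
  simp only [horiz]
  fun_prop

theorem continuous_toSurface : Continuous (toSurface : E d → E (d + 1)) := by
  refine (PiLp.continuous_toLp 2 _).comp (continuous_pi fun j => ?_)
  refine Fin.lastCases ?_ (fun i => ?_) j
  · simpa using continuous_const
  · simp only [Fin.snoc_castSucc]
    fun_prop

theorem eq_toSurface_iff {x : E (d + 1)} {y : E d} :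
    x = toSurface y ↔ x (Fin.last d) = 0 ∧ horiz x = y := by
  constructor
  · rintro rfl
    simp
  · rintro ⟨h1, rfl⟩
    ext i
    refine Fin.lastCases ?_ (fun i => ?_) i
    · simp [h1]
    · simp [horiz]

theorem last_nonpos_of_mem_closure {Ω : Set (E (d + 1))} (hlow : ∀ x ∈ Ω, x (Fin.last d) < 0)
    {x : E (d + 1)} (hx : x ∈ closure Ω) : x (Fin.last d) ≤ 0 :=
  closure_minimal (fun y hy => (hlow y hy).le)
    (isClosed_le (f := fun y : E (d + 1) => y (Fin.last d)) (by fun_prop) continuous_const) hx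

/-- The directions `i` are tangential to the surface, so no boundary term arises: a cutoff in the
last coordinate detaches the test function from the surface and disappears in the limit. -/
theorem IsWeakGradient.green_eq_zero_of_ne_last {Ω : Set (E (d + 1))} (hΩ : IsOpen Ω)
    (hlow : ∀ x ∈ Ω, x (Fin.last d) < 0) {S : Set (E d)} {u : L2 Ω} {G : L2Vec (d + 1) Ω}
    (hG : IsWeakGradient u G) {φ : E (d + 1) → ℝ} (hφ : IsTest φ)
    (hs : tsupport φ ∩ closure Ω ⊆ Ω ∪ toSurface '' S) {i : Fin (d + 1)} (hi : i ≠ Fin.last d) :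
    green u G φ i = 0 := by
  have h := tendsto_green_coordCutoff hΩ.measurableSet hi (σ := -1)
    (fun x hx => by linarith [hlow x hx]) u G hφ
  refine tendsto_nhds_unique h (tendsto_const_nhds.congr fun m => ?_)
  symm
  refine hG.green_eq_zero hΩ (hφ.mul_left (contDiff_coordCutoff _ _ _)) ?_ i
  rintro x ⟨hx, hxΩ⟩
  have h1 := tsupport_coordCutoff_mul _ _ _ _ hx
  rcases hs ⟨h1.1, hxΩ⟩ with h2 | ⟨y, -, rfl⟩
  · exact h2
  · have h3 := h1.2
    simp only [mem_ofPred_eq, toSurface_last, mul_zero] at h3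
    linarith

/-- A direction that leads from the surface into `Ω`. -/
theorem LocalCone.exists_surface_direction {Ω : Set (E (d + 1))} (hc : LocalCone Ω)
    (hlow : ∀ x ∈ Ω, x (Fin.last d) < 0) (p : E (d + 1)) :
    ∃ (r τ : ℝ) (e : E (d + 1)), 0 < r ∧ 0 < τ ∧ e (Fin.last d) = 1 ∧
      ∀ y : E d, toSurface y ∈ closure Ω → toSurface y ∈ Metric.ball p r →
        ∀ t, 0 < t → t ≤ τ → toSurface y - t • e ∈ Ω := by
  obtain ⟨e, r, c, hr, hc0, he, hcone⟩ := hc p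
  by_cases hex : ∃ y : E d, toSurface y ∈ closure Ω ∧ toSurface y ∈ Metric.ball p r
  swap
  · exact ⟨r, 1, EuclideanSpace.single (Fin.last d) 1, hr, one_pos, by simp,
      fun y h1 h2 => absurd ⟨y, h1, h2⟩ hex⟩
  -- The strict inequality leaves room to replace the boundary point by a nearby point of `Ω`.
  have key : ∀ y : E d, toSurface y ∈ closure Ω → toSurface y ∈ Metric.ball p r →
      ∀ t, 0 < t → t ≤ r → ∀ z : E (d + 1), ‖z + t • e‖ < c * t → toSurface y + z ∈ Ω := by
    intro y h1 h2 t ht htr z hz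
    have hε : 0 < c * t - ‖z + t • e‖ := by linarith
    obtain ⟨x, ⟨hxb, hxd⟩, hxΩ⟩ := mem_closure_iff_nhds.1 h1
      (Metric.ball p r ∩ Metric.ball (toSurface y) (c * t - ‖z + t • e‖))
      (inter_mem (Metric.isOpen_ball.mem_nhds h2) (Metric.ball_mem_nhds _ hε))
    have := hcone x hxΩ hxb t ht htr (toSurface y + z - x) ?_
    · simpa using this
    · rw [Metric.mem_ball, dist_comm, dist_eq_norm] at hxd
      calc ‖toSurface y + z - x + t • e‖ = ‖(toSurface y - x) + (z + t • e)‖ := by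
            congr 1; abel
        _ ≤ ‖toSurface y - x‖ + ‖z + t • e‖ := norm_add_le _ _
        _ ≤ c * t := by linarith
  -- The point `-r e`, raised by `c r / 2`, still belongs to the cone and thus lies below the
  -- surface. So `e` has positive height and can be scaled to height one.
  have hel : 0 < e (Fin.last d) := by
    obtain ⟨y, h1, h2⟩ := hex
    have h3 := hlow _ (key y h1 h2 r hr le_rfl
      (-(r • e) + (c * r / 2) • EuclideanSpace.single (Fin.last d) 1) (by
        rw [neg_add_cancel_comm, norm_smul, Real.norm_eq_abs, abs_of_pos (by positivity)]
        simp only [PiLp.norm_single, norm_one, mul_one]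
        linarith [mul_pos hc0 hr]))
    simp only [PiLp.add_apply, toSurface_last, PiLp.neg_apply, PiLp.smul_apply, smul_eq_mul,
      PiLp.single_apply, if_true, mul_one, zero_add] at h3
    have h4 : 0 < c * r / 2 := by positivity
    nlinarith
  refine ⟨r, r * e (Fin.last d), (e (Fin.last d))⁻¹ • e, hr, by positivity, by
    simp [hel.ne'], fun y h1 h2 t ht htr => ?_⟩
  have := key y h1 h2 (t * (e (Fin.last d))⁻¹) (by positivity)
    (by rwa [mul_inv_le_iff₀ hel]) (-((t * (e (Fin.last d))⁻¹) • e))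
    (by rw [neg_add_cancel, norm_zero]; positivity)
  rwa [mul_smul, ← sub_eq_add_neg] at this

/-- The part of the half space below the surface belongs to `Ω`. -/
theorem LocalCone.exists_half_ball {Ω : Set (E (d + 1))} (hc : LocalCone Ω)
    (hlow : ∀ x ∈ Ω, x (Fin.last d) < 0) {S : Set (E d)} (hSo : IsOpen S)
    (hS : ∀ y ∈ S, toSurface y ∈ closure Ω) {y₀ : E d} (hy₀ : y₀ ∈ S) :
    ∃ ρ > 0, ∀ x ∈ Metric.ball (toSurface y₀) ρ, horiz x ∈ S ∧ (x (Fin.last d) < 0 → x ∈ Ω) := by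
  obtain ⟨r, τ, e, hr, hτ, he, h⟩ := hc.exists_surface_direction hlow (toSurface y₀)
  have hcont : Continuous fun x : E (d + 1) => horiz (x + (-x (Fin.last d)) • e) :=
    continuous_horiz.comp (by fun_prop)
  -- A point close to `y₀` and below the surface is reached along `-e` from its oblique projection,
  -- which still belongs to the open set `S`.
  have h1 : ∀ᶠ x in 𝓝 (toSurface y₀), horiz (x + (-x (Fin.last d)) • e) ∈ S := by
    refine hcont.continuousAt.eventually_mem (hSo.mem_nhds ?_)
    simpa using hy₀
  have h2 : ∀ᶠ x in 𝓝 (toSurface y₀),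
      toSurface (horiz (x + (-x (Fin.last d)) • e)) ∈ Metric.ball (toSurface y₀) r := by
    refine (continuous_toSurface.comp hcont).continuousAt.eventually_mem ?_
    refine Metric.isOpen_ball.mem_nhds ?_
    simpa using hr
  have h3 : ∀ᶠ x : E (d + 1) in 𝓝 (toSurface y₀), -x (Fin.last d) < τ := by
    have : Continuous fun x : E (d + 1) => -x (Fin.last d) := by fun_prop
    refine this.continuousAt.eventually_lt continuousAt_const ?_
    simpa using hτ
  have h4 : ∀ᶠ x in 𝓝 (toSurface y₀), horiz x ∈ S := by
    refine continuous_horiz.continuousAt.eventually_mem (hSo.mem_nhds ?_)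
    simpa using hy₀
  obtain ⟨ρ, hρ, hb⟩ := Metric.eventually_nhds_iff_ball.1 (h1.and (h2.and (h3.and h4)))
  refine ⟨ρ, hρ, fun x hx => ⟨(hb x hx).2.2.2, fun hneg => ?_⟩⟩
  obtain ⟨k1, k2, k3, -⟩ := hb x hx
  have k4 := h _ (hS _ k1) k2 (-x (Fin.last d)) (by linarith) k3.le
  have k5 : x + (-x (Fin.last d)) • e = toSurface (horiz (x + (-x (Fin.last d)) • e)) := by
    rw [eq_toSurface_iff]
    simp [he]
  rw [← k5, add_sub_cancel_right] at k4
  exact k4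

end Surface

/-! ### The trace inequality -/

section TraceInequality

variable {d : ℕ}

/-- The function `h(y) k(s)` in the oblique coordinates `x = (y, 0) + s e`. -/
def obliqueProd (e : E (d + 1)) (h : E d → ℝ) (k : ℝ → ℝ) (x : E (d + 1)) : ℝ :=
  h (horiz x - x (Fin.last d) • horiz e) * k (x (Fin.last d))

theorem obliqueProd_support {e : E (d + 1)} (he : e (Fin.last d) = 1) {h : E d → ℝ} {k : ℝ → ℝ}
    {x : E (d + 1)} (hx : x ∈ tsupport (obliqueProd e h k)) (hh : HasCompactSupport h)
    (hk : HasCompactSupport k) :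
    ∃ y ∈ tsupport h, ∃ s ∈ tsupport k, x = toSurface y + s • e := by
  have hcomp : IsCompact ((fun p : E d × ℝ => toSurface p.1 + p.2 • e) '' (tsupport h ×ˢ tsupport k)) := by
    refine (hh.isCompact.prod hk.isCompact).image ?_
    exact (continuous_toSurface.comp continuous_fst).add (continuous_snd.smul continuous_const)
  have hsub : tsupport (obliqueProd e h k) ⊆
      (fun p : E d × ℝ => toSurface p.1 + p.2 • e) '' (tsupport h ×ˢ tsupport k) := by
    refine closure_minimal (fun x hx => ?_) hcomp.isClosed
    refine ⟨(horiz x - x (Fin.last d) • horiz e, x (Fin.last d)),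
      ⟨subset_tsupport _ (left_ne_zero_of_mul hx), subset_tsupport _ (right_ne_zero_of_mul hx)⟩, ?_⟩
    ext i
    refine Fin.lastCases ?_ (fun i => ?_) i
    · simp [he]
    · simp [horiz]
  obtain ⟨⟨y, s⟩, ⟨h1, h2⟩, h3⟩ := hsub hx
  exact ⟨y, h1, s, h2, h3.symm⟩

theorem isTest_obliqueProd {e : E (d + 1)} (he : e (Fin.last d) = 1) {h : E d → ℝ} {k : ℝ → ℝ}
    (hh : IsTest h) (hk : ContDiff ℝ ∞ k) (hk' : HasCompactSupport k) :
    IsTest (obliqueProd e h k) := by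
  constructor
  · unfold obliqueProd
    refine (hh.1.comp ?_).mul (hk.comp (by fun_prop))
    exact contDiff_horiz.sub ((by fun_prop : ContDiff ℝ ∞ fun x : E (d + 1) => x (Fin.last d)).smul
      contDiff_const)
  · have hcomp : IsCompact ((fun p : E d × ℝ => toSurface p.1 + p.2 • e) ''
        (tsupport h ×ˢ tsupport k)) := by
      refine (hh.2.isCompact.prod hk'.isCompact).image ?_
      exact (continuous_toSurface.comp continuous_fst).add (continuous_snd.smul continuous_const)
    refine hcomp.of_isClosed_subset (isClosed_tsupport _) fun x hx => ?_
    obtain ⟨y, hy, s, hs, rfl⟩ := obliqueProd_support he hx hh.2 hk'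
    exact ⟨(y, s), ⟨hy, hs⟩, rfl⟩

theorem fderiv_obliqueProd {e : E (d + 1)} (he : e (Fin.last d) = 1) {h : E d → ℝ} {k : ℝ → ℝ}
    (hh : IsTest h) (hk : ContDiff ℝ ∞ k) (hk' : HasCompactSupport k) (x : E (d + 1)) :
    fderiv ℝ (obliqueProd e h k) x e = obliqueProd e h (deriv k) x := by
  have hd : Differentiable ℝ (obliqueProd e h k) :=
    (isTest_obliqueProd he hh hk hk').1.differentiable (by simp)
  rw [← (hd x).lineDeriv_eq_fderiv]
  refine HasLineDerivAt.lineDeriv ?_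
  unfold HasLineDerivAt
  have e1 : (fun t : ℝ => obliqueProd e h k (x + t • e))
      = fun t => h (horiz x - x (Fin.last d) • horiz e) * k (x (Fin.last d) + t) := by
    ext t
    simp only [obliqueProd, horiz_add, horiz_smul, PiLp.add_apply, PiLp.smul_apply, smul_eq_mul, he,
      mul_one, add_smul, add_sub_add_right_eq_sub]
  rw [e1]
  unfold obliqueProd
  refine HasDerivAt.const_mul _ ?_
  have h2 : HasDerivAt k (deriv k (x (Fin.last d) + 0)) (x (Fin.last d) + 0) :=
    (hk.differentiable (by simp) _).hasDerivAt
  rw [add_zero] at h2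
  have h3 := HasDerivAt.comp_const_add (x (Fin.last d)) 0 (by rwa [add_zero] : HasDerivAt k (deriv k (x (Fin.last d))) (x (Fin.last d) + 0))
  exact h3

theorem integrable_sq_of_hasCompactSupport {X : Type*} [TopologicalSpace X] [MeasurableSpace X]
    [OpensMeasurableSpace X] {μ : Measure X} [IsFiniteMeasureOnCompacts μ] {f : X → ℝ}
    (hf : Continuous f) (hc : HasCompactSupport f) : Integrable (fun x => f x ^ 2) μ := by
  simp only [sq]
  exact (hf.mul hf).integrable_of_hasCompactSupport hc.mul_left

/-- The values lie between zero and one, so the integral is at most the length of the support. This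
profile localises to a thin layer below the surface. -/
theorem exists_bump_integral_sq_le {t : ℝ} (ht0 : 0 < t) :
    ∃ η : ℝ → ℝ, ContDiff ℝ ∞ η ∧ HasCompactSupport η ∧ tsupport η = Metric.closedBall 0 t ∧
      η 0 = 1 ∧ ∫ s, η s ^ 2 ≤ 2 * t := by
  let η : ContDiffBump (0 : ℝ) := ⟨t / 2, t, by positivity, by linarith⟩
  have hη : ContDiff ℝ ∞ η := η.contDiff
  have hηc : HasCompactSupport η := η.hasCompactSupport
  have hηs : tsupport η = Metric.closedBall 0 t := η.tsupport_eq
  have hη0 : η 0 = 1 := η.one_of_mem_closedBall (Metric.mem_closedBall_self (by positivity))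
  refine ⟨η, hη, hηc, hηs, hη0, ?_⟩
  have h1 : ∫ s, η s ^ 2 ≤ ∫ s, (Metric.closedBall (0 : ℝ) t).indicator (fun _ => (1 : ℝ)) s := by
    refine integral_mono ?_ ?_ fun s => ?_
    · exact integrable_sq_of_hasCompactSupport hη.continuous hηc
    · rw [integrable_indicator_iff Metric.isClosed_closedBall.measurableSet]
      exact integrableOn_const (isCompact_closedBall (0 : ℝ) t).measure_lt_top.ne
    · by_cases hs : s ∈ Metric.closedBall (0 : ℝ) t
      · rw [indicator_of_mem hs]
        exact pow_le_one₀ η.nonneg η.le_one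
      · rw [indicator_of_notMem hs, image_eq_zero_of_notMem_tsupport (f := η) (by rwa [hηs]),
          zero_pow two_ne_zero]
  refine h1.trans (le_of_eq ?_)
  rw [integral_indicator Metric.isClosed_closedBall.measurableSet, setIntegral_const]
  simp [Measure.real, Real.volume_closedBall, ht0.le]

theorem integral_obliqueProd_sq {e : E (d + 1)} (he : e (Fin.last d) = 1) {h : E d → ℝ} {k : ℝ → ℝ}
    (hh : IsTest h) (hk : ContDiff ℝ ∞ k) (hk' : HasCompactSupport k) :
    ∫ x, obliqueProd e h k x ^ 2 = (∫ y, h y ^ 2) * ∫ s, k s ^ 2 := by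
  have hmp := measurePreserving_insE (n := d) (Fin.last d)
  have hi : Integrable (fun x => obliqueProd e h k x ^ 2) volume := by
    have ht := isTest_obliqueProd he hh hk hk'
    exact integrable_sq_of_hasCompactSupport ht.1.continuous ht.2
  rw [← hmp.integral_comp (insE _).measurableEmbedding,
    integral_prod (fun z => obliqueProd e h k (insE (Fin.last d) z) ^ 2) ((hmp.integrable_comp_emb (insE _).measurableEmbedding).2 hi)]
  simp only [obliqueProd, horiz_insE_last, insE_same, mul_pow]
  have : ∀ s : ℝ, ∫ y : E d, h (y - s • horiz e) ^ 2 * k s ^ 2 = (∫ y, h y ^ 2) * k s ^ 2 := by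
    intro s
    rw [integral_mul_const, integral_sub_right_eq_self (fun y => h y ^ 2)]
  simp_rw [this]
  rw [integral_const_mul]

theorem norm_integral_mul_test_le {n : ℕ} {Ω : Set (E n)} (u : L2 Ω) {φ : E n → ℝ} (hφ : IsTest φ)
    {N : Set (E n)} (hN : MeasurableSet N) (hs : tsupport φ ⊆ N) :
    ‖∫ x in Ω, u x * (φ x : ℂ)‖ ≤ ‖cut N hN u‖ * Real.sqrt (∫ x, φ x ^ 2) := by
  have hm := hφ.memLp ((volume : Measure (E n)).restrict Ω)
  have h2 : ‖hm.toLp φ‖ ≤ Real.sqrt (∫ x, φ x ^ 2) := by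
    have h3 := norm_toLp_test_eq hφ (subset_univ (tsupport φ))
    rw [← h3]
    refine le_of_ofReal_sq_le (norm_nonneg _) ?_
    rw [norm_sq_toLp_two, norm_sq_toLp_two, Measure.restrict_univ]
    exact setLIntegral_le_lintegral _ _
  calc ‖∫ x in Ω, u x * (φ x : ℂ)‖ ≤ ∫ x in Ω, ‖u x * (φ x : ℂ)‖ := norm_integral_le_integral_norm _
    _ = ∫ x in Ω, ‖cut N hN u x‖ * ‖φ x‖ := by
        refine integral_congr_ae ?_
        filter_upwards [cut_coeFn N hN u] with x hx
        rw [norm_mul, Complex.norm_real, hx]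
        by_cases h : x ∈ N
        · rw [indicator_of_mem h]
        · rw [image_eq_zero_of_notMem_tsupport fun h' => h (hs h')]
          simp
    _ ≤ ‖cut N hN u‖ * ‖hm.toLp φ‖ := integral_norm_mul_norm_le _ hm
    _ ≤ _ := by gcongr

/-- Green's formula in the direction `e` for the test function `h(y) η(s)`, with `η` supported in
`|s| ≤ t`, expresses the pairing of the trace with `h` by `u` and the gradient. The gradient term
carries the factor `√(2t)`, which is small for a thin layer; the price is the norm of `η'` at `u`.
-/
theorem exists_trace_bound_local {Ω : Set (E (d + 1))} (hΩ : IsOpen Ω) (hc : LocalCone Ω)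
    (hlow : ∀ x ∈ Ω, x (Fin.last d) < 0) {S : Set (E d)} (hSo : IsOpen S)
    (hS : ∀ y ∈ S, toSurface y ∈ closure Ω) (p : E (d + 1)) :
    ∃ r > 0, ∃ R : ℝ, ∀ ε > 0, ∃ C : ℝ, 0 ≤ C ∧ ∀ (u : L2 Ω) (G : L2Vec (d + 1) Ω) (g : L2 S),
      IsWeakGradient u G → IsSurfaceTrace u G g →
      ∫⁻ y in S ∩ toSurface ⁻¹' Metric.ball p r, ‖g y‖ₑ ^ 2
        ≤ ENNReal.ofReal ((ε * ‖G‖ + C * ‖cut (Metric.ball 0 R) Metric.isOpen_ball.measurableSet u‖) ^ 2) := by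
  obtain ⟨r, τ, e, hr, hτ, he, hdir⟩ := hc.exists_surface_direction hlow p
  -- The ball of radius `R` contains all oblique supports used below, uniformly in `t ≤ τ`.
  set R : ℝ := ‖p‖ + r + τ * ‖e‖ + 1 with hR
  refine ⟨r, hr, R, fun ε hε => ?_⟩
  obtain ⟨t, ht0, htτ, htε⟩ : ∃ t : ℝ, 0 < t ∧ t ≤ τ ∧ 4 * t * ‖e‖ ^ 2 ≤ ε ^ 2 := by
    have h1 : Tendsto (fun t : ℝ => 4 * t * ‖e‖ ^ 2) (𝓝[>] 0) (𝓝 0) := by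
      have : Continuous fun t : ℝ => 4 * t * ‖e‖ ^ 2 := by fun_prop
      simpa using (this.tendsto 0).mono_left nhdsWithin_le_nhds
    obtain ⟨t, ht⟩ := ((h1.eventually (gt_mem_nhds (pow_pos hε 2))).and
      (Ioc_mem_nhdsGT hτ)).exists
    exact ⟨t, ht.2.1, ht.2.2, ht.1.le⟩
  obtain ⟨η, hη, hηc, hηs, hη0, hη2⟩ := exists_bump_integral_sq_le ht0
  have hη' : ContDiff ℝ ∞ (deriv η) := (contDiff_infty_iff_deriv.1 hη).2
  have hηc' : HasCompactSupport (deriv η) := hηc.deriv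
  set D : ℝ := Real.sqrt (∫ s, deriv η s ^ 2) with hD
  refine ⟨Real.sqrt 2 * D, by positivity, fun u G g hG hg => ?_⟩
  set S' := S ∩ toSurface ⁻¹' Metric.ball p r with hS'
  have hS'o : IsOpen S' := hSo.inter (Metric.isOpen_ball.preimage continuous_toSurface)
  have hgm : MemLp g 2 ((volume : Measure (E d)).restrict S') :=
    (Lp.memLp g).mono_measure (Measure.restrict_mono inter_subset_left le_rfl)
  set a := ‖cut (Metric.ball 0 R) Metric.isOpen_ball.measurableSet u‖ with ha
  have hbound := lintegral_sq_le_of_test hS'o hgm (C := a * D + ‖e‖ * ‖G‖ * Real.sqrt (2 * t))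
    (by positivity) ?_
  · refine hbound.trans (ENNReal.ofReal_le_ofReal ?_)
    have h0 : ∀ q : ℝ, 2 * q ^ 2 = (Real.sqrt 2 * q) ^ 2 := fun q => by
      rw [mul_pow, Real.sq_sqrt two_pos.le]
    rw [h0, mul_add]
    refine pow_le_pow_left₀ (by positivity) ?_ 2
    have h1 : Real.sqrt 2 * (‖e‖ * ‖G‖ * Real.sqrt (2 * t)) ≤ ε * ‖G‖ := by
      have h2 : Real.sqrt 2 * Real.sqrt (2 * t) * ‖e‖ ≤ ε := by
        refine (abs_le_of_sq_le_sq' ?_ hε.le).2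
        rw [mul_pow, mul_pow, Real.sq_sqrt two_pos.le, Real.sq_sqrt (by positivity)]
        linarith
      calc Real.sqrt 2 * (‖e‖ * ‖G‖ * Real.sqrt (2 * t))
          = Real.sqrt 2 * Real.sqrt (2 * t) * ‖e‖ * ‖G‖ := by ring
        _ ≤ ε * ‖G‖ := by gcongr
    linarith
  · intro h hh hs
    set φ := obliqueProd e h η with hφdef
    have hφ : IsTest φ := isTest_obliqueProd he hh hη hηc
    have hψ : IsTest (obliqueProd e h (deriv η)) := isTest_obliqueProd he hh hη' hηc'
    have hφs : tsupport φ ∩ closure Ω ⊆ Ω ∪ toSurface '' S := by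
      rintro x ⟨hx, hxΩ⟩
      obtain ⟨y, hy, s, hs', rfl⟩ := obliqueProd_support he hx hh.2 hηc
      have hy' := hs hy
      have h0 := last_nonpos_of_mem_closure hlow hxΩ
      simp only [PiLp.add_apply, toSurface_last, PiLp.smul_apply, he, smul_eq_mul, mul_one,
        zero_add] at h0
      rcases h0.eq_or_lt with rfl | hneg
      · right
        exact ⟨y, hy'.1, by simp⟩
      · left
        rw [hηs, Metric.mem_closedBall, Real.dist_eq, sub_zero, abs_of_neg hneg] at hs'
        have := hdir y (hS y hy'.1) hy'.2 (-s) (by linarith) (by linarith)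
        simpa using this
    have hsum := sum_green u G hφ e
    -- Only the normal component has a boundary term, and `e` has height one.
    rw [Finset.sum_eq_single (Fin.last d) (fun i _ hi => by
        rw [hG.green_eq_zero_of_ne_last hΩ hlow hφ hφs hi, mul_zero]) (by simp), he,
      hg φ hφ hφs, integral_add (integrable_fderiv_apply u hφ e) (integrable_sum_mul G hφ e)] at hsum
    have e1 : ∫ y in S', g y * (h y : ℂ) = ∫ y in S, g y * (φ (toSurface y) : ℂ) := by
      have hz : ∀ y, y ∉ S' → g y * (h y : ℂ) = 0 := fun y hy => by
        rw [image_eq_zero_of_notMem_tsupport fun h' => hy (hs h')]; simp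
      rw [setIntegral_eq_integral_of_forall_compl_eq_zero hz,
        ← setIntegral_eq_integral_of_forall_compl_eq_zero (s := S) fun y hy =>
          hz y fun h' => hy h'.1]
      simp [hφdef, obliqueProd, hη0]
    rw [e1]
    have e2 : ∫ y in S, g y * (φ (toSurface y) : ℂ)
        = (∫ x in Ω, u x * (obliqueProd e h (deriv η) x : ℂ))
          + ∫ x in Ω, (∑ i, (e i : ℂ) * G x i) * (φ x : ℂ) := by
      simp_rw [hφdef, fderiv_obliqueProd he hh hη hηc, ← hφdef] at hsum
      rw [hsum]
      simp
    rw [e2]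
    refine (norm_add_le _ _).trans ?_
    rw [add_mul]
    refine add_le_add ?_ ?_
    · refine (norm_integral_mul_test_le u hψ Metric.isOpen_ball.measurableSet
        (N := Metric.ball 0 R) ?_).trans (le_of_eq ?_)
      · intro x hx
        obtain ⟨y, hy, s, hs', rfl⟩ := obliqueProd_support he hx hh.2 hηc'
        have hy' : toSurface y ∈ Metric.ball p r := (hs hy).2
        have hs2 : s ∈ tsupport η := closure_minimal support_deriv_subset (isClosed_tsupport _) hs'
        rw [hηs, Metric.mem_closedBall, Real.dist_eq, sub_zero] at hs2
        rw [mem_ball_zero_iff]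
        rw [Metric.mem_ball, dist_eq_norm] at hy'
        have k1 : ‖toSurface y‖ ≤ ‖p‖ + r := by
          have := norm_add_le (toSurface y - p) p
          rw [sub_add_cancel] at this
          linarith
        have k2 : ‖s • e‖ ≤ τ * ‖e‖ := by
          rw [norm_smul, Real.norm_eq_abs]
          gcongr
          linarith
        have := norm_add_le (toSurface y) (s • e)
        linarith
      · rw [integral_obliqueProd_sq he hh hη' hηc', Real.sqrt_mul (integral_nonneg fun _ => sq_nonneg _),
          ← ha, ← hD]
        ring
    · refine (norm_integral_sum_mul_le G hφ e).trans ?_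
      rw [hφdef, integral_obliqueProd_sq he hh hη hηc,
        Real.sqrt_mul (integral_nonneg fun _ => sq_nonneg _)]
      have k3 : Real.sqrt (∫ s, η s ^ 2) ≤ Real.sqrt (2 * t) := Real.sqrt_le_sqrt hη2
      calc ‖e‖ * ‖G‖ * (Real.sqrt (∫ y, h y ^ 2) * Real.sqrt (∫ s, η s ^ 2))
          ≤ ‖e‖ * ‖G‖ * (Real.sqrt (∫ y, h y ^ 2) * Real.sqrt (2 * t)) := by gcongr
        _ = _ := by ring

/-- The trace inequality. -/
theorem exists_trace_bound {Ω : Set (E (d + 1))} (hΩ : IsOpen Ω) (hc : LocalCone Ω)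
    (hlow : ∀ x ∈ Ω, x (Fin.last d) < 0) {S : Set (E d)} (hSo : IsOpen S)
    (hS : ∀ y ∈ S, toSurface y ∈ closure Ω) {K : Set (E d)} (hK : MeasurableSet K)
    (hKb : Bornology.IsBounded K) :
    ∃ R : ℝ, ∀ ε > 0, ∃ C : ℝ, 0 ≤ C ∧ ∀ (u : L2 Ω) (G : L2Vec (d + 1) Ω) (g : L2 S),
      IsWeakGradient u G → IsSurfaceTrace u G g →
      ‖cut K hK g‖ ≤ ε * ‖G‖ + C * ‖cut (Metric.ball 0 R) Metric.isOpen_ball.measurableSet u‖ := by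
  choose r hr R H using exists_trace_bound_local hΩ hc hlow hSo hS
  obtain ⟨T, -, hcov⟩ := hKb.isCompact_closure.elim_nhds_subcover
    (fun y => toSurface ⁻¹' Metric.ball (toSurface y) (r (toSurface y)))
    (fun y _ => (Metric.isOpen_ball.preimage continuous_toSurface).mem_nhds
      (Metric.mem_ball_self (hr _)))
  -- A single radius that dominates the local ones and does not depend on `ε`.
  refine ⟨∑ y ∈ T, |R (toSurface y)|, fun ε hε => ?_⟩
  choose C hC hb using fun p => H p (ε / ((T.card : ℝ) + 1)) (by positivity)
  refine ⟨∑ y ∈ T, C (toSurface y), Finset.sum_nonneg fun y _ => hC _, fun u G g hG hg => ?_⟩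
  set a := ‖cut (Metric.ball 0 (∑ y ∈ T, |R (toSurface y)|)) Metric.isOpen_ball.measurableSet u‖
    with ha
  set b : E d → ℝ := fun y => ε / ((T.card : ℝ) + 1) * ‖G‖ + C (toSurface y) * a with hb'
  have hb0 : ∀ y, 0 ≤ b y := fun y => add_nonneg (by positivity) (mul_nonneg (hC _) (norm_nonneg _))
  have hsum : ∑ y ∈ T, b y ≤ ε * ‖G‖ + (∑ y ∈ T, C (toSurface y)) * a := by
    rw [hb', Finset.sum_add_distrib, Finset.sum_const, nsmul_eq_mul, Finset.sum_mul]
    have : (T.card : ℝ) * (ε / ((T.card : ℝ) + 1) * ‖G‖) ≤ ε * ‖G‖ := by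
      rw [← mul_assoc]
      gcongr
      rw [mul_div_assoc', div_le_iff₀ (by positivity)]
      linarith
    linarith
  refine le_trans ?_ hsum
  refine le_of_ofReal_sq_le (Finset.sum_nonneg fun y _ => hb0 y) ?_
  rw [norm_sq_cut, Measure.restrict_restrict hK]
  have hsub : K ∩ S ⊆ ⋃ y : T, S ∩ toSurface ⁻¹' Metric.ball (toSurface y.1) (r (toSurface y.1)) := by
    intro x hx
    have := hcov (subset_closure hx.1)
    simp only [mem_iUnion] at this ⊢
    obtain ⟨y, hy, hxy⟩ := this
    exact ⟨⟨y, hy⟩, hx.2, hxy⟩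
  calc ∫⁻ x in K ∩ S, ‖g x‖ₑ ^ 2
      ≤ ∫⁻ x in ⋃ y : T, S ∩ toSurface ⁻¹' Metric.ball (toSurface y.1) (r (toSurface y.1)), ‖g x‖ₑ ^ 2 :=
        lintegral_mono_set hsub
    _ ≤ ∑ y ∈ T, ∫⁻ x in S ∩ toSurface ⁻¹' Metric.ball (toSurface y) (r (toSurface y)), ‖g x‖ₑ ^ 2 := by
        refine (lintegral_iUnion_le _ _).trans (le_of_eq ?_)
        rw [tsum_fintype]
        exact Finset.sum_coe_sort T fun y =>
          ∫⁻ x in S ∩ toSurface ⁻¹' Metric.ball (toSurface y) (r (toSurface y)), ‖g x‖ₑ ^ 2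
    _ ≤ ∑ y ∈ T, ENNReal.ofReal (b y ^ 2) := by
        refine Finset.sum_le_sum fun y hy => (hb _ u G g hG hg).trans (ENNReal.ofReal_le_ofReal ?_)
        refine pow_le_pow_left₀ (add_nonneg (by positivity) (mul_nonneg (hC _) (norm_nonneg _))) ?_ 2
        refine add_le_add le_rfl (mul_le_mul_of_nonneg_left ?_ (hC _))
        refine norm_cut_mono _ _ (Metric.ball_subset_ball ?_) u
        exact (le_abs_self _).trans (Finset.single_le_sum (f := fun y => |R (toSurface y)|)
          (fun _ _ => abs_nonneg _) hy)
    _ = ENNReal.ofReal (∑ y ∈ T, b y ^ 2) :=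
        (ENNReal.ofReal_sum_of_nonneg fun y _ => sq_nonneg _).symm
    _ ≤ ENNReal.ofReal ((∑ y ∈ T, b y) ^ 2) :=
        ENNReal.ofReal_le_ofReal (Finset.sum_sq_le_sq_sum_of_nonneg fun y _ => hb0 y)

end TraceInequality

/-! ### Functions with vanishing gradient -/

section ZeroGradient

variable {n : ℕ}

/-- The translation estimate with zero gradient shows, for each small `z`, that `u(x + z) = u(x)`
for almost all `x`. Fubini's theorem exchanges the quantifiers, and one good `x` determines `u`
almost everywhere. Steps up to `2 * r` connect any two points of the ball; hence the radius `3 * r`.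
-/
theorem IsWeakGradient.ae_eq_const_ball {Ω : Set (E n)} {u : L2 Ω} (hG : IsWeakGradient u 0)
    (hΩ : IsOpen Ω) {p : E n} {r : ℝ} (hr : 0 < r) (hp : Metric.ball p (3 * r) ⊆ Ω) :
    ∃ c : ℂ, ∀ᵐ x ∂(volume : Measure (E n)).restrict (Metric.ball p r), u x = c := by
  set v : E n → ℂ := (Lp.aestronglyMeasurable u).mk u with hv
  have hvm : StronglyMeasurable v := (Lp.aestronglyMeasurable u).stronglyMeasurable_mk
  have huv : u =ᵐ[(volume : Measure (E n)).restrict Ω] v := (Lp.aestronglyMeasurable u).ae_eq_mk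
  have huv' : ∀ᵐ x ∂(volume : Measure (E n)), x ∈ Ω → u x = v x :=
    (ae_restrict_iff' hΩ.measurableSet).1 huv
  have hin : ∀ x ∈ Metric.ball p r, ∀ z : E n, ‖z‖ < 2 * r → x + z ∈ Metric.ball p (3 * r) := by
    intro x hx z hz
    rw [Metric.mem_ball, dist_eq_norm] at *
    have := norm_add_le (x - p) z
    rw [show x + z - p = x - p + z by abel]
    linarith
  have h1 : ∀ z ∈ Metric.ball (0 : E n) (2 * r),
      ∀ᵐ x ∂(volume : Measure (E n)).restrict (Metric.ball p r), v (x + z) = v x := by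
    intro z hz
    rw [mem_ball_zero_iff] at hz
    have h2 := lintegral_translate_sub_le hG hΩ (Metric.isOpen_ball (x := p) (ε := r)) (z := z)
      fun x hx s hs => hp (hin x hx (s • z) (by
        rw [norm_smul, Real.norm_eq_abs, abs_of_nonneg hs.1]
        have := mul_le_mul_of_nonneg_right hs.2 (norm_nonneg z)
        linarith))
    have h3 : ∀ᵐ x ∂(volume : Measure (E n)).restrict (Metric.ball p r),
        u (x + z) = v (x + z) ∧ u x = v x := by
      rw [ae_restrict_iff' Metric.isOpen_ball.measurableSet]
      filter_upwards [huv', (measurePreserving_add_right (volume : Measure (E n)) z).quasiMeasurePreserving.ae huv']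
        with x h4 h5 hx
      refine ⟨h5 (hp (hin x hx z hz)), h4 (hp ?_)⟩
      simpa using hin x hx 0 (by simpa using hr)
    have h4 : ∫⁻ x in Metric.ball p r, ‖v (x + z) - v x‖ₑ ^ 2 = 0 := by
      rw [norm_zero, mul_zero, zero_pow two_ne_zero, mul_zero, ENNReal.ofReal_zero] at h2
      rw [← nonpos_iff_eq_zero]
      refine le_trans (le_of_eq (lintegral_congr_ae ?_)) h2
      filter_upwards [h3] with x hx
      rw [hx.1, hx.2]
    rw [lintegral_eq_zero_iff (by
      exact (((hvm.measurable.comp (measurable_add_const z)).sub hvm.measurable).enorm.pow_const 2))] at h4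
    filter_upwards [h4] with x hx
    simpa [sub_eq_zero] using hx
  have h2 : ∀ᵐ x ∂(volume : Measure (E n)).restrict (Metric.ball p r),
      ∀ᵐ z ∂(volume : Measure (E n)).restrict (Metric.ball 0 (2 * r)), v (x + z) = v x := by
    refine (Measure.ae_ae_comm ?_).1 ((ae_restrict_iff' Metric.isOpen_ball.measurableSet).2
      (Eventually.of_forall h1))
    exact measurableSet_eq_fun (hvm.measurable.comp (measurable_snd.add measurable_fst))
      (hvm.measurable.comp measurable_snd)
  have hne : (ae ((volume : Measure (E n)).restrict (Metric.ball p r))).NeBot := by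
    rw [ae_neBot, Ne, Measure.restrict_eq_zero]
    exact (Metric.measure_ball_pos _ _ hr).ne'
  obtain ⟨x, hx, hxp⟩ := (h2.and (ae_restrict_mem Metric.isOpen_ball.measurableSet)).exists
  refine ⟨v x, ?_⟩
  rw [ae_restrict_iff' Metric.isOpen_ball.measurableSet] at hx ⊢
  have hx' := (measurePreserving_sub_right (volume : Measure (E n)) x).quasiMeasurePreserving.ae hx
  filter_upwards [hx', huv'] with y hy1 hy2 hy
  rw [hy2 (hp (Metric.ball_subset_ball (by linarith) hy))]
  have := hy1 (by
    rw [mem_ball_zero_iff]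
    rw [Metric.mem_ball, dist_eq_norm] at hy hxp
    have := norm_sub_le (y - p) (x - p)
    rw [sub_sub_sub_cancel_right] at this
    linarith)
  simpa using this

/-- A function with vanishing gradient on a domain is constant. -/
theorem IsWeakGradient.ae_eq_const {Ω : Set (E n)} {u : L2 Ω} (hG : IsWeakGradient u 0)
    (hΩ : IsOpen Ω) (hconn : IsPreconnected Ω) :
    ∃ c : ℂ, ∀ᵐ x ∂(volume : Measure (E n)).restrict Ω, u x = c := by
  rcases Ω.eq_empty_or_nonempty with rfl | ⟨p₀, hp₀⟩
  · exact ⟨0, by simp⟩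
  have hloc : ∀ p ∈ Ω, ∃ r > 0, Metric.ball p r ⊆ Ω ∧
      ∃ c : ℂ, ∀ᵐ x ∂(volume : Measure (E n)).restrict (Metric.ball p r), u x = c := by
    intro p hp
    obtain ⟨r, hr, h⟩ := Metric.isOpen_iff.1 hΩ p hp
    refine ⟨r / 3, by positivity, (Metric.ball_subset_ball (by linarith)).trans h,
      hG.ae_eq_const_ball hΩ (by positivity) (by rwa [mul_div_cancel₀ _ three_ne_zero])⟩
  choose! r hr hsub c hc using hloc
  have hcl : ∀ p ∈ Ω, ∀ q ∈ Ω, q ∈ Metric.ball p (r p) → c q = c p := by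
    intro p hp q hq hqp
    have ho : IsOpen (Metric.ball p (r p) ∩ Metric.ball q (r q)) :=
      Metric.isOpen_ball.inter Metric.isOpen_ball
    have hne : (ae ((volume : Measure (E n)).restrict
        (Metric.ball p (r p) ∩ Metric.ball q (r q)))).NeBot := by
      rw [ae_neBot, Ne, Measure.restrict_eq_zero]
      exact (ho.measure_pos _ ⟨q, hqp, Metric.mem_ball_self (hr q hq)⟩).ne'
    obtain ⟨x, h1, h2⟩ := ((ae_restrict_of_ae_restrict_of_subset inter_subset_left (hc p hp)).and
      (ae_restrict_of_ae_restrict_of_subset inter_subset_right (hc q hq))).exists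
    rw [← h1, ← h2]
  have hconst : ∀ p ∈ Ω, c p = c p₀ := by
    intro p hp
    -- The local constants agree on overlapping balls, and connectedness propagates the equality.
    refine hconn.induction₂ (fun x y => c x = c y) (fun x hx => ?_) (fun _ _ _ _ _ _ h h' => h.trans h')
      (fun _ _ _ _ h => h.symm) hp hp₀
    filter_upwards [mem_nhdsWithin_of_mem_nhds (Metric.ball_mem_nhds x (hr x hx)),
      self_mem_nhdsWithin] with y hy hyΩ
    exact (hcl x hx y hyΩ hy).symm
  refine ⟨c p₀, ?_⟩
  rw [ae_restrict_iff' hΩ.measurableSet, ae_iff]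
  refine measure_null_of_locally_null _ fun p hp => ?_
  have hpΩ : p ∈ Ω := by
    by_contra h
    exact hp fun h' => absurd h' h
  have h1 := (ae_restrict_iff' Metric.isOpen_ball.measurableSet).1 (hc p hpΩ)
  refine ⟨Metric.ball p (r p) ∩ _, inter_mem (mem_nhdsWithin_of_mem_nhds
    (Metric.ball_mem_nhds p (hr p hpΩ))) self_mem_nhdsWithin, ?_⟩
  refine measure_mono_null ?_ (ae_iff.1 h1)
  rintro x ⟨hx1, hx2⟩ h
  exact hx2 fun _ => (h hx1).trans (hconst p hpΩ)

end ZeroGradient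

/-! ### Closedness of the Sobolev triples; uniqueness of gradient and trace -/

section Closed

variable {d : ℕ}

theorem continuous_integral_mul_test {n : ℕ} {Ω : Set (E n)} {ψ : E n → ℝ}
    (hψ : MemLp ψ 2 ((volume : Measure (E n)).restrict Ω)) :
    Continuous fun u : L2 Ω => ∫ x in Ω, u x * (ψ x : ℂ) := by
  have h : ∀ u : L2 Ω, ∫ x in Ω, u x * (ψ x : ℂ)
      = inner ℂ ((hψ.ofReal (K := ℂ)).toLp _) u := by
    intro u
    rw [L2.inner_def]
    refine integral_congr_ae ?_
    filter_upwards [(hψ.ofReal (K := ℂ)).coeFn_toLp] with x hx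
    rw [hx]
    simp [mul_comm]
  simp_rw [h]
  fun_prop

theorem IsTest.memLp_partialDeriv {n : ℕ} {φ : E n → ℝ} (h : IsTest φ) (i : Fin n)
    (μ : Measure (E n)) [IsFiniteMeasureOnCompacts μ] : MemLp (partialDeriv φ i) 2 μ :=
  (h.continuous_partialDeriv i).memLp_of_hasCompactSupport (h.hasCompactSupport_partialDeriv i)

theorem continuous_coord {n k : ℕ} {Ω : Set (E n)} (i : Fin k) :
    Continuous fun G : L2Vec k Ω => ((memLp_coord G i).toLp _ : L2 Ω) :=
  (((EuclideanSpace.proj i : EuclideanSpace ℂ (Fin k) →L[ℂ] ℂ).compLpL 2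
    ((volume : Measure (E n)).restrict Ω)).continuous).congr fun G => by
      refine Lp.ext ?_
      filter_upwards [(memLp_coord G i).coeFn_toLp, ContinuousLinearMap.coeFn_compLpL (p := 2)
        (EuclideanSpace.proj i : EuclideanSpace ℂ (Fin k) →L[ℂ] ℂ) G] with x h1 h2
      rw [h1, h2]
      rfl

theorem green_eq_add {n : ℕ} {Ω : Set (E n)} (u : L2 Ω) (G : L2Vec n Ω) {φ : E n → ℝ}
    (h : IsTest φ) (i : Fin n) :
    green u G φ i = (∫ x in Ω, u x * (partialDeriv φ i x : ℂ)) + ∫ x in Ω, G x i * (φ x : ℂ) :=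
  integral_add (integrable_mul_test (Lp.memLp u) (h.continuous_partialDeriv i)
    (h.hasCompactSupport_partialDeriv i)) (integrable_mul_test (memLp_coord G i) h.1.continuous h.2)

theorem continuous_green {n : ℕ} {Ω : Set (E n)} {φ : E n → ℝ} (h : IsTest φ) (i : Fin n) :
    Continuous fun w : L2 Ω × L2Vec n Ω => green w.1 w.2 φ i := by
  have e : ∀ w : L2 Ω × L2Vec n Ω, green w.1 w.2 φ i
      = (∫ x in Ω, w.1 x * (partialDeriv φ i x : ℂ))
        + ∫ x in Ω, ((memLp_coord w.2 i).toLp _ : L2 Ω) x * (φ x : ℂ) := by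
    intro w
    rw [green_eq_add _ _ h]
    congr 1
    refine integral_congr_ae ?_
    filter_upwards [(memLp_coord w.2 i).coeFn_toLp] with x hx
    rw [hx]
  simp_rw [e]
  exact ((continuous_integral_mul_test (h.memLp_partialDeriv i _)).comp continuous_fst).add
    ((continuous_integral_mul_test (h.memLp _)).comp ((continuous_coord i).comp continuous_snd))

theorem IsTest.memLp_surface {φ : E (d + 1) → ℝ} (h : IsTest φ) (μ : Measure (E d))
    [IsFiniteMeasureOnCompacts μ] : MemLp (fun y => φ (toSurface y)) 2 μ := by
  have hl : Function.LeftInverse (horiz : E (d + 1) → E d) toSurface := fun y =>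
    (eq_toSurface_iff.1 rfl).2
  exact (h.1.continuous.comp continuous_toSurface).memLp_of_hasCompactSupport
    (h.2.comp_isClosedEmbedding (hl.isClosedEmbedding continuous_horiz continuous_toSurface))

/-- For a fixed test function each defining identity is continuous in the `L²` norms, so the triples
form an intersection of closed sets. -/
theorem isClosed_sobolevTriples (Ω : Set (E (d + 1))) (S : Set (E d)) :
    IsClosed (sobolevTriples Ω S : Set (L2 Ω × L2Vec (d + 1) Ω × L2 S)) := by
  have e : (sobolevTriples Ω S : Set (L2 Ω × L2Vec (d + 1) Ω × L2 S))
      = (⋂ (φ : E (d + 1) → ℝ) (_ : IsTest φ) (_ : tsupport φ ⊆ Ω) (i : Fin (d + 1)),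
          {w | green w.1 w.2.1 φ i = 0}) ∩
        ⋂ (φ : E (d + 1) → ℝ) (_ : IsTest φ)
          (_ : tsupport φ ∩ closure Ω ⊆ Ω ∪ toSurface '' S),
          {w | green w.1 w.2.1 φ (Fin.last d)
            = ∫ y in S, w.2.2 y * (φ (toSurface y) : ℂ)} := by
    ext w
    simp only [mem_inter_iff, mem_iInter]
    rfl
  rw [e]
  have hw : Continuous fun w : L2 Ω × L2Vec (d + 1) Ω × L2 S => (w.1, w.2.1) := by fun_prop
  refine IsClosed.inter ?_ ?_
  · exact isClosed_iInter fun φ => isClosed_iInter fun hφ => isClosed_iInter fun _ =>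
      isClosed_iInter fun i => isClosed_eq ((continuous_green hφ i).comp hw) continuous_const
  · exact isClosed_iInter fun φ => isClosed_iInter fun hφ => isClosed_iInter fun _ =>
      isClosed_eq ((continuous_green hφ _).comp hw)
        ((continuous_integral_mul_test (hφ.memLp_surface _)).comp
          (continuous_snd.comp continuous_snd))

/-- A domain below the plane `{x_{d+1} = 0}` whose boundary is locally a graph and contains the
open piece `S` of that plane. -/
structure FlatTop (Ω : Set (E (d + 1))) (S : Set (E d)) : Prop where
  isOpen : IsOpen Ω
  cone : LocalCone Ω
  low : ∀ x ∈ Ω, x (Fin.last d) < 0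
  isOpen_top : IsOpen S
  top_mem : ∀ y ∈ S, toSurface y ∈ closure Ω

variable {Ω : Set (E (d + 1))} {S : Set (E d)}

namespace Sob

theorem isWeakGradient (w : Sob Ω S) : IsWeakGradient w.fn w.grad := w.2.1

theorem isSurfaceTrace (w : Sob Ω S) : IsSurfaceTrace w.fn w.grad w.trace := w.2.2

/-- The Sobolev function with the given value, gradient and trace. -/
def mk {u : L2 Ω} {G : L2Vec (d + 1) Ω} {g : L2 S} (h1 : IsWeakGradient u G)
    (h2 : IsSurfaceTrace u G g) : Sob Ω S := ⟨(u, G, g), h1, h2⟩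

@[simp] theorem fn_mk {u : L2 Ω} {G : L2Vec (d + 1) Ω} {g : L2 S} (h1 : IsWeakGradient u G)
    (h2 : IsSurfaceTrace u G g) : (mk h1 h2).fn = u := rfl

@[simp] theorem grad_mk {u : L2 Ω} {G : L2Vec (d + 1) Ω} {g : L2 S} (h1 : IsWeakGradient u G)
    (h2 : IsSurfaceTrace u G g) : (mk h1 h2).grad = G := rfl

@[simp] theorem trace_mk {u : L2 Ω} {G : L2Vec (d + 1) Ω} {g : L2 S} (h1 : IsWeakGradient u G)
    (h2 : IsSurfaceTrace u G g) : (mk h1 h2).trace = g := rfl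

theorem ext_all {v w : Sob Ω S} (h1 : v.fn = w.fn) (h2 : v.grad = w.grad)
    (h3 : v.trace = w.trace) : v = w := Subtype.ext (Prod.ext h1 (Prod.ext h2 h3))

theorem grad_eq_zero_of_fn (hΩ : IsOpen Ω) {w : Sob Ω S} (h : w.fn = 0) : w.grad = 0 := by
  have h1 : ∀ i, (fun x => w.grad x i) =ᵐ[(volume : Measure (E (d + 1))).restrict Ω] 0 := by
    intro i
    refine ae_eq_zero_of_integral_test hΩ (memLp_coord w.grad i) fun φ hφ hs => ?_
    have h2 := w.isWeakGradient φ hφ hs i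
    rw [green_eq_add _ _ hφ, h] at h2
    have h3 : ∫ x in Ω, (0 : L2 Ω) x * (partialDeriv φ i x : ℂ) = 0 := by
      refine integral_eq_zero_of_ae ?_
      filter_upwards [Lp.coeFn_zero ℂ 2 ((volume : Measure (E (d + 1))).restrict Ω)] with x hx
      rw [hx]
      simp
    rw [h3, zero_add] at h2
    simpa [mul_comm, Complex.real_smul] using h2
  refine Lp.ext ?_
  filter_upwards [ae_all_iff.2 h1, Lp.coeFn_zero (EuclideanSpace ℂ (Fin (d + 1))) 2
    ((volume : Measure (E (d + 1))).restrict Ω)] with x hx h0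
  rw [h0]
  ext i
  exact hx i

/-- The trace inequality, applied with zero function and zero gradient, annihilates the trace on
every ball. -/
theorem trace_eq_zero_of_fn (h : FlatTop Ω S) {w : Sob Ω S} (hw : w.fn = 0) : w.trace = 0 := by
  have hcut : ∀ k : ℕ, cut (Metric.ball 0 (k : ℝ)) Metric.isOpen_ball.measurableSet w.trace = 0 := by
    intro k
    obtain ⟨R, hR⟩ := exists_trace_bound h.isOpen h.cone h.low h.isOpen_top h.top_mem
      (Metric.isOpen_ball (x := (0 : E d)) (ε := k)).measurableSet Metric.isBounded_ball
    obtain ⟨C, -, hC⟩ := hR 1 one_pos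
    have := hC _ _ _ w.isWeakGradient w.isSurfaceTrace
    rw [grad_eq_zero_of_fn h.isOpen hw, hw, map_zero, norm_zero, norm_zero] at this
    simpa using this
  refine Lp.ext ?_
  have h1 : ∀ᵐ y ∂(volume : Measure (E d)).restrict S, ∀ k : ℕ,
      (Metric.ball 0 (k : ℝ)).indicator w.trace y = 0 := by
    refine ae_all_iff.2 fun k => ?_
    filter_upwards [cut_coeFn (Metric.ball 0 (k : ℝ)) Metric.isOpen_ball.measurableSet w.trace,
      Lp.coeFn_zero ℂ 2 ((volume : Measure (E d)).restrict S)] with y hy h0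
    rw [← hy, hcut k, h0, Pi.zero_apply]
  filter_upwards [h1, Lp.coeFn_zero ℂ 2 ((volume : Measure (E d)).restrict S)] with y hy h0
  rw [h0]
  obtain ⟨k, hk⟩ := exists_nat_gt ‖y‖
  have := hy k
  rwa [indicator_of_mem (by simpa using hk)] at this

/-- A triple is determined by its first component, so identities between Sobolev functions need to
be checked only there. -/
theorem ext_fn (h : FlatTop Ω S) {v w : Sob Ω S} (hvw : v.fn = w.fn) : v = w := by
  have h1 : (v - w).fn = 0 := by rw [map_sub, hvw, sub_self]
  have h2 := grad_eq_zero_of_fn h.isOpen h1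
  have h3 := trace_eq_zero_of_fn h h1
  rw [map_sub, sub_eq_zero] at h2 h3
  exact ext_all hvw h2 h3

end Sob

end Closed

/-! ### Test functions as Sobolev functions -/

section TestTriples

theorem insE_add_smul_single {n : ℕ} (k : Fin (n + 1)) (s t : ℝ) (z : E n) :
    insE k (s + t, z) = insE k (s, z) + t • EuclideanSpace.single k (1 : ℝ) := by
  ext i
  rcases Fin.eq_self_or_eq_succAbove k i with rfl | ⟨j, rfl⟩
  · simp
  · simp [insE_succAbove]

theorem hasDerivAt_insE {n : ℕ} {ψ : E (n + 1) → ℝ} (hψ : IsTest ψ) (k : Fin (n + 1)) (z : E n)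
    (s : ℝ) : HasDerivAt (fun s => ψ (insE k (s, z))) (partialDeriv ψ k (insE k (s, z))) s := by
  have hd : Differentiable ℝ ψ := hψ.1.differentiable (by simp)
  have h := (hd (insE k (s, z))).hasFDerivAt.hasLineDerivAt (EuclideanSpace.single k (1 : ℝ))
  unfold HasLineDerivAt at h
  simp_rw [← insE_add_smul_single] at h
  have h2 : HasDerivAt (fun t : ℝ => ψ (insE k (s + t, z))) (partialDeriv ψ k (insE k (s, z)))
    (s - s) := by rw [sub_self]; exact h
  have h3 := HasDerivAt.comp_sub_const s s h2
  simpa using h3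

theorem hasCompactSupport_insE {n : ℕ} {ψ : E (n + 1) → ℝ} (hψ : HasCompactSupport ψ)
    (k : Fin (n + 1)) (z : E n) : HasCompactSupport fun s => ψ (insE k (s, z)) := by
  obtain ⟨R, hR⟩ := hψ.isCompact.isBounded.exists_norm_le
  refine HasCompactSupport.intro (isCompact_closedBall (0 : ℝ) R) fun s hs => ?_
  refine image_eq_zero_of_notMem_tsupport fun h => hs ?_
  rw [mem_closedBall_zero_iff]
  have := abs_apply_le_norm (insE k (s, z)) k
  rw [insE_same] at this
  exact this.trans (hR _ h)

theorem contDiff_insE {n : ℕ} {ψ : E (n + 1) → ℝ} (hψ : IsTest ψ) (k : Fin (n + 1)) (z : E n) :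
    ContDiff ℝ 1 fun s => ψ (insE k (s, z)) := by
  have e : (fun s : ℝ => ψ (insE k (s, z)))
      = fun s => ψ (insE k (0, z) + s • EuclideanSpace.single k (1 : ℝ)) := by
    ext s
    rw [← insE_add_smul_single, zero_add]
  rw [e]
  refine (hψ.1.of_le (by simp)).comp ?_
  fun_prop

/-- Fubini's theorem and the fundamental theorem of calculus on each vertical half-line. -/
theorem setIntegral_partialDeriv_last {d : ℕ} {ψ : E (d + 1) → ℝ} (hψ : IsTest ψ) :
    ∫ x in {x : E (d + 1) | x (Fin.last d) < 0}, partialDeriv ψ (Fin.last d) x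
      = ∫ y, ψ (toSurface y) := by
  have hmp := measurePreserving_insE (n := d) (Fin.last d)
  have hm : MeasurableSet {x : E (d + 1) | x (Fin.last d) < 0} :=
    (isOpen_lt (by fun_prop) continuous_const).measurableSet
  have hi : Integrable (partialDeriv ψ (Fin.last d)) :=
    (hψ.continuous_partialDeriv _).integrable_of_hasCompactSupport
      (hψ.hasCompactSupport_partialDeriv _)
  rw [← integral_indicator hm, ← hmp.integral_comp (insE _).measurableEmbedding,
    integral_prod_symm (fun p => indicator _ _ (insE (Fin.last d) p))
      ((hmp.integrable_comp_emb (insE _).measurableEmbedding).2 (hi.indicator hm))]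
  refine integral_congr_ae (Eventually.of_forall fun y => ?_)
  have e : (fun s : ℝ => {x : E (d + 1) | x (Fin.last d) < 0}.indicator
        (partialDeriv ψ (Fin.last d)) (insE (Fin.last d) (s, y)))
      = (Iio (0 : ℝ)).indicator (deriv fun s => ψ (insE (Fin.last d) (s, y))) := by
    ext s
    by_cases h : s < 0
    · rw [indicator_of_mem (by simpa using h), indicator_of_mem (by exact h)]
      exact ((hasDerivAt_insE hψ _ y s).deriv).symm
    · rw [indicator_of_notMem (by simpa using h), indicator_of_notMem (by exact h)]
  simp only [e]
  rw [integral_indicator measurableSet_Iio, ← integral_Iic_eq_integral_Iio,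
    (hasCompactSupport_insE hψ.2 _ y).integral_Iic_deriv_eq (contDiff_insE hψ _ y)]
  congr 1
  rw [eq_toSurface_iff, insE_same, horiz_insE_last]
  exact ⟨rfl, rfl⟩

theorem setIntegral_partialDeriv_of_ne {n : ℕ} {ψ : E (n + 1) → ℝ} (hψ : IsTest ψ)
    {i : Fin (n + 1)} {A : Set (E (n + 1))} (hA : MeasurableSet A)
    (hAi : ∀ z : E n, ∀ s t : ℝ, insE i (s, z) ∈ A → insE i (t, z) ∈ A) :
    ∫ x in A, partialDeriv ψ i x = 0 := by
  have hmp := measurePreserving_insE (n := n) i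
  have hi : Integrable (partialDeriv ψ i) :=
    (hψ.continuous_partialDeriv _).integrable_of_hasCompactSupport
      (hψ.hasCompactSupport_partialDeriv _)
  rw [← integral_indicator hA, ← hmp.integral_comp (insE _).measurableEmbedding,
    integral_prod_symm (fun p => indicator _ _ (insE i p))
      ((hmp.integrable_comp_emb (insE _).measurableEmbedding).2 (hi.indicator hA))]
  refine integral_eq_zero_of_ae (Eventually.of_forall fun z => ?_)
  change ∫ s, A.indicator (partialDeriv ψ i) (insE i (s, z)) = 0
  by_cases h : insE i (0, z) ∈ A
  · have e : (fun s : ℝ => A.indicator (partialDeriv ψ i) (insE i (s, z)))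
        = deriv fun s => ψ (insE i (s, z)) := by
      ext s
      rw [(hasDerivAt_insE hψ _ z s).deriv, indicator_of_mem (hAi z 0 s h)]
    have hc := hasCompactSupport_insE hψ.2 i z
    have hd := contDiff_insE hψ i z
    rw [e]
    exact integral_eq_zero_of_hasDerivAt_of_integrable
      (fun s => (hd.differentiable one_ne_zero s).hasDerivAt)
      ((hd.continuous_deriv le_rfl).integrable_of_hasCompactSupport hc.deriv)
      (hd.continuous.integrable_of_hasCompactSupport hc)
  · refine integral_eq_zero_of_ae (Eventually.of_forall fun s => ?_)
    exact indicator_of_notMem (fun h' => h (hAi z s 0 h')) _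

variable {d : ℕ} {Ω : Set (E (d + 1))} {S : Set (E d)}

theorem IsTest.mul {n : ℕ} {φ ψ : E n → ℝ} (h : IsTest φ) (h' : IsTest ψ) :
    IsTest fun x => φ x * ψ x := h'.mul_left h.1

theorem support_partialDeriv_subset {n : ℕ} (ψ : E n → ℝ) (i : Fin n) :
    Function.support (partialDeriv ψ i) ⊆ tsupport ψ := by
  intro x hx
  by_contra h
  refine hx ?_
  rw [partialDeriv, fderiv_of_notMem_tsupport (𝕜 := ℝ) h]
  rfl

/-- Test functions that satisfy Green's formula are Sobolev functions. -/
theorem exists_sob_of_test (hS : ∀ y ∈ S, toSurface y ∉ Ω)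
    {ζ : E (d + 1) → ℝ} (hζ : IsTest ζ)
    (H : ∀ ψ : E (d + 1) → ℝ, IsTest ψ → tsupport ψ ⊆ tsupport ζ → ∀ i,
      ∫ x in Ω, partialDeriv ψ i x
        = if i = Fin.last d then ∫ y in S, ψ (toSurface y) else 0) :
    ∃ w : Sob Ω S, w.fn =ᵐ[(volume : Measure (E (d + 1))).restrict Ω] (fun x => (ζ x : ℂ)) ∧
      w.trace =ᵐ[(volume : Measure (E d)).restrict S] fun y => (ζ (toSurface y) : ℂ) := by
  set μ := (volume : Measure (E (d + 1))).restrict Ω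
  have hu : MemLp (fun x => (ζ x : ℂ)) 2 μ := (hζ.memLp μ).ofReal
  have hG : MemLp (fun x => (WithLp.toLp 2 fun i => (partialDeriv ζ i x : ℂ) :
      EuclideanSpace ℂ (Fin (d + 1)))) 2 μ := by
    refine Continuous.memLp_of_hasCompactSupport ?_ ?_
    · refine (PiLp.continuous_toLp 2 _).comp (continuous_pi fun i => ?_)
      exact Complex.continuous_ofReal.comp (hζ.continuous_partialDeriv i)
    · refine (hζ.2.fderiv ℝ).comp_left (g := fun L : E (d + 1) →L[ℝ] ℝ =>
        (WithLp.toLp 2 fun i => ((L (EuclideanSpace.single i 1) : ℝ) : ℂ) :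
          EuclideanSpace ℂ (Fin (d + 1)))) ?_
      ext i
      simp
  have hg : MemLp (fun y => (ζ (toSurface y) : ℂ)) 2 ((volume : Measure (E d)).restrict S) :=
    (hζ.memLp_surface _).ofReal
  have key : ∀ φ : E (d + 1) → ℝ, IsTest φ → ∀ i, green (hu.toLp _ : L2 Ω) (hG.toLp _ : L2Vec (d + 1) Ω) φ i
      = ((if i = Fin.last d then ∫ y in S, ζ (toSurface y) * φ (toSurface y) else 0 : ℝ) : ℂ) := by
    intro φ hφ i
    -- By the product rule, Green's formula for `ζ` tested with `φ` is Gauss' formula for the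
    -- product `ζ φ`.
    rw [← H _ (hζ.mul hφ) (closure_mono (Function.support_mul_subset_left _ _)), ← integral_complex_ofReal]
    refine integral_congr_ae ?_
    filter_upwards [hu.coeFn_toLp, hG.coeFn_toLp] with x h1 h2
    rw [h1, h2, partialDeriv_mul (hζ.1.differentiable (by simp)) (hφ.1.differentiable (by simp))]
    push_cast
    rfl
  refine ⟨Sob.mk (u := hu.toLp _) (G := hG.toLp _) (g := hg.toLp _) (fun φ hφ hs i => ?_) (fun φ hφ hs => ?_),
    hu.coeFn_toLp, hg.coeFn_toLp⟩
  · rw [key φ hφ, Complex.ofReal_eq_zero]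
    split_ifs
    · refine setIntegral_eq_zero_of_forall_eq_zero fun y hy => ?_
      rw [image_eq_zero_of_notMem_tsupport (f := φ) fun h => hS y hy (hs h), mul_zero]
    · rfl
  · rw [key φ hφ, if_pos rfl, ← integral_complex_ofReal]
    refine integral_congr_ae ?_
    filter_upwards [hg.coeFn_toLp] with y hy
    rw [hy]
    push_cast
    rfl

theorem FlatTop.toSurface_notMem (h : FlatTop Ω S) (y : E d) : toSurface y ∉ Ω := fun hy => by
  have := h.low _ hy
  simp at this

theorem FlatTop.exists_sob_of_test_interior (h : FlatTop Ω S) {ζ : E (d + 1) → ℝ}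
    (hζ : IsTest ζ) (hs : tsupport ζ ⊆ Ω) :
    ∃ w : Sob Ω S, w.fn =ᵐ[(volume : Measure (E (d + 1))).restrict Ω] (fun x => (ζ x : ℂ)) ∧
      w.trace = 0 := by
  obtain ⟨w, h1, h2⟩ := exists_sob_of_test (fun y _ => h.toSurface_notMem y) hζ (S := S) (Ω := Ω) fun ψ hψ hψs i => by
      have e1 : ∫ x in Ω, partialDeriv ψ i x = ∫ x in univ, partialDeriv ψ i x := by
        rw [Measure.restrict_univ]
        refine setIntegral_eq_integral_of_forall_compl_eq_zero fun x hx => ?_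
        exact image_eq_zero_of_notMem_tsupport fun hx' => hx (hs (hψs
          ((closure_minimal (support_partialDeriv_subset ψ i) (isClosed_tsupport ψ)) hx')))
      rw [e1, setIntegral_partialDeriv_of_ne hψ MeasurableSet.univ fun _ _ _ _ => trivial]
      split_ifs
      · refine (integral_eq_zero_of_ae (Eventually.of_forall fun y => ?_)).symm
        exact image_eq_zero_of_notMem_tsupport fun h' => h.toSurface_notMem y (hs (hψs h'))
      · rfl
  refine ⟨w, h1, Lp.ext ?_⟩
  filter_upwards [h2, Lp.coeFn_zero ℂ 2 ((volume : Measure (E d)).restrict S)] with y hy h0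
  rw [hy, h0, image_eq_zero_of_notMem_tsupport fun h' => h.toSurface_notMem y (hs h')]
  simp

/-- In a small ball about a surface point the domain coincides with the half-space, where Gauss'
formula is explicit. -/
theorem FlatTop.exists_sob_of_test_boundary (h : FlatTop Ω S) {y₀ : E d} (hy₀ : y₀ ∈ S) :
    ∃ ρ > 0, ∀ ζ : E (d + 1) → ℝ, IsTest ζ → tsupport ζ ⊆ Metric.ball (toSurface y₀) ρ →
    ∃ w : Sob Ω S, w.fn =ᵐ[(volume : Measure (E (d + 1))).restrict Ω] (fun x => (ζ x : ℂ)) ∧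
      w.trace =ᵐ[(volume : Measure (E d)).restrict S] fun y => (ζ (toSurface y) : ℂ) := by
  obtain ⟨ρ, hρ, hb⟩ := h.cone.exists_half_ball h.low h.isOpen_top h.top_mem hy₀
  refine ⟨ρ, hρ, fun ζ hζ hs => exists_sob_of_test (fun y _ => h.toSurface_notMem y) hζ fun ψ hψ hψs i => ?_⟩
  have e1 : ∫ x in Ω, partialDeriv ψ i x
      = ∫ x in {x : E (d + 1) | x (Fin.last d) < 0}, partialDeriv ψ i x := by
    have hz : ∀ x, x ∉ Metric.ball (toSurface y₀) ρ → partialDeriv ψ i x = 0 := fun x hx =>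
      image_eq_zero_of_notMem_tsupport fun hx' => hx (hs (hψs
        ((closure_minimal (support_partialDeriv_subset ψ i) (isClosed_tsupport ψ)) hx')))
    rw [← integral_indicator h.isOpen.measurableSet,
      ← integral_indicator (isOpen_lt (by fun_prop) continuous_const).measurableSet]
    congr 1
    ext x
    by_cases hx : x ∈ Metric.ball (toSurface y₀) ρ
    · by_cases h0 : x (Fin.last d) < 0
      · rw [indicator_of_mem ((hb x hx).2 h0), indicator_of_mem (by exact h0)]
      · rw [indicator_of_notMem (fun h' => h0 (h.low x h')), indicator_of_notMem (by exact h0)]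
    · simp [indicator, hz x hx]
  have e2 : ∫ y in S, ψ (toSurface y) = ∫ y, ψ (toSurface y) := by
    refine setIntegral_eq_integral_of_forall_compl_eq_zero fun y hy => ?_
    refine image_eq_zero_of_notMem_tsupport fun hx' => hy ?_
    have := (hb _ (hs (hψs hx'))).1
    rwa [horiz_toSurface] at this
  rw [e1, e2]
  split_ifs with hi
  · rw [hi, setIntegral_partialDeriv_last hψ]
  · refine setIntegral_partialDeriv_of_ne hψ (isOpen_lt (by fun_prop) continuous_const).measurableSet
      fun z s t hz => ?_
    obtain ⟨j, hj⟩ := Fin.exists_succAbove_eq (Ne.symm hi)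
    rw [mem_ofPred_eq, ← hj, insE_succAbove] at hz ⊢
    exact hz

end TestTriples

/-! ### Reflections and odd functions -/

section Mirror

/-- The reflection that changes the sign of the coordinate `k`. -/
def mirror {𝕜 : Type*} [RCLike 𝕜] {n : ℕ} (k : Fin n) :
    EuclideanSpace 𝕜 (Fin n) ≃ₗᵢ[𝕜] EuclideanSpace 𝕜 (Fin n) :=
  LinearIsometryEquiv.piLpCongrRight 2 fun i =>
    if i = k then LinearIsometryEquiv.neg 𝕜 else LinearIsometryEquiv.refl 𝕜 𝕜

variable {𝕜 : Type*} [RCLike 𝕜] {n : ℕ}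

@[simp] theorem mirror_same (k : Fin n) (x : EuclideanSpace 𝕜 (Fin n)) : mirror k x k = -x k := by
  simp [mirror]

theorem mirror_of_ne {k i : Fin n} (h : i ≠ k) (x : EuclideanSpace 𝕜 (Fin n)) :
    mirror k x i = x i := by
  simp [mirror, h]

@[simp] theorem mirror_mirror (k : Fin n) (x : EuclideanSpace 𝕜 (Fin n)) : mirror k (mirror k x) = x := by
  ext i
  by_cases h : i = k
  · subst h; simp
  · simp [mirror_of_ne h]

theorem mirror_apply (k i : Fin n) (x : EuclideanSpace 𝕜 (Fin n)) :
    mirror k x i = (if i = k then -1 else 1) * x i := by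
  by_cases h : i = k
  · subst h; simp
  · simp [mirror_of_ne h, h]

theorem mirror_single (k i : Fin n) :
    mirror (𝕜 := 𝕜) k (EuclideanSpace.single i 1)
      = (if i = k then (-1 : 𝕜) else 1) • EuclideanSpace.single i 1 := by
  ext j
  rw [mirror_apply]
  by_cases h : j = i
  · subst h
    split_ifs <;> simp
  · split_ifs <;> simp [h]

variable {d : ℕ}

theorem horiz_mirror (k : Fin d) (x : E (d + 1)) : horiz (mirror k.castSucc x) = mirror k (horiz x) := by
  ext i
  simp only [horiz, mirror_apply, Fin.castSucc_inj]

theorem toSurface_mirror (k : Fin d) (y : E d) : toSurface (mirror k y) = mirror k.castSucc (toSurface y) := by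
  symm
  rw [eq_toSurface_iff, horiz_mirror, horiz_toSurface, mirror_of_ne (Fin.castSucc_lt_last k).ne']
  exact ⟨toSurface_last y, rfl⟩

/-- `Ω` and `S` are symmetric in the coordinate `k`. -/
structure MirrorSymm (k : Fin d) (Ω : Set (E (d + 1))) (S : Set (E d)) : Prop where
  dom : ∀ x, mirror k.castSucc x ∈ Ω ↔ x ∈ Ω
  top : ∀ y, mirror k y ∈ S ↔ y ∈ S

theorem measurePreserving_mirror {k : Fin n} {Ω : Set (E n)} (h : ∀ x, mirror k x ∈ Ω ↔ x ∈ Ω) :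
    MeasurePreserving (mirror k : E n ≃ₗᵢ[ℝ] E n) ((volume : Measure (E n)).restrict Ω)
      ((volume : Measure (E n)).restrict Ω) := by
  have h1 := (mirror (𝕜 := ℝ) k).measurePreserving.restrict_preimage_emb
    (mirror (𝕜 := ℝ) k).toHomeomorph.measurableEmbedding Ω
  have h2 : (mirror k : E n ≃ₗᵢ[ℝ] E n) ⁻¹' Ω = Ω := ext h
  rwa [h2] at h1

theorem IsTest.comp_mirror {φ : E n → ℝ} (hφ : IsTest φ) (k : Fin n) :
    IsTest fun x => φ (mirror k x) :=
  ⟨hφ.1.comp (mirror (𝕜 := ℝ) k).contDiff, hφ.2.comp_homeomorph (mirror (𝕜 := ℝ) k).toHomeomorph⟩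

theorem tsupport_comp_mirror (φ : E n → ℝ) (k : Fin n) :
    tsupport (fun x => φ (mirror k x)) = (mirror k : E n ≃ₗᵢ[ℝ] E n) ⁻¹' tsupport φ :=
  tsupport_comp_eq_preimage φ (mirror (𝕜 := ℝ) k).toHomeomorph

theorem partialDeriv_comp_mirror {φ : E n → ℝ} (hφ : IsTest φ) (k i : Fin n) (x : E n) :
    partialDeriv (fun x => φ (mirror k x)) i x
      = (if i = k then -1 else 1) * partialDeriv φ i (mirror k x) := by
  have hd := (hφ.1.differentiable (by simp) (mirror k x)).hasFDerivAt.comp x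
    (mirror (𝕜 := ℝ) k).toContinuousLinearEquiv.hasFDerivAt
  have e : fderiv ℝ (fun x => φ (mirror k x)) x = _ := hd.fderiv
  rw [partialDeriv, e]
  change fderiv ℝ φ (mirror k x) (mirror k (EuclideanSpace.single i 1)) = _
  rw [mirror_single, map_smul]
  rfl

/-- Composition of `u` with the reflection. -/
def mirrorFn {F : Type*} [NormedAddCommGroup F] [NormedSpace ℂ F] {k : Fin n} {Ω : Set (E n)}
    (h : ∀ x, mirror k x ∈ Ω ↔ x ∈ Ω) :
    Lp F 2 ((volume : Measure (E n)).restrict Ω) →ₗᵢ[ℂ] Lp F 2 ((volume : Measure (E n)).restrict Ω) :=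
  Lp.compMeasurePreservingₗᵢ ℂ (mirror (𝕜 := ℝ) k) (measurePreserving_mirror h)

theorem coeFn_mirrorFn {F : Type*} [NormedAddCommGroup F] [NormedSpace ℂ F] {k : Fin n} {Ω : Set (E n)}
    (h : ∀ x, mirror k x ∈ Ω ↔ x ∈ Ω) (u : Lp F 2 ((volume : Measure (E n)).restrict Ω)) :
    mirrorFn h u =ᵐ[(volume : Measure (E n)).restrict Ω] fun x => u (mirror k x) :=
  Lp.coeFn_compMeasurePreserving u (measurePreserving_mirror h)

/-- Reflection of a vector field. -/
def mirrorVec {k : Fin n} {Ω : Set (E n)} (h : ∀ x, mirror k x ∈ Ω ↔ x ∈ Ω) :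
    L2Vec n Ω →L[ℂ] L2Vec n Ω :=
  ((mirror (𝕜 := ℂ) k).toContinuousLinearEquiv.toContinuousLinearMap.compLpL 2 _).comp
    (mirrorFn h).toContinuousLinearMap

theorem coeFn_mirrorVec {k : Fin n} {Ω : Set (E n)} (h : ∀ x, mirror k x ∈ Ω ↔ x ∈ Ω) (G : L2Vec n Ω) :
    mirrorVec h G =ᵐ[(volume : Measure (E n)).restrict Ω] fun x => mirror k (G (mirror k x)) := by
  filter_upwards [ContinuousLinearMap.coeFn_compLpL (p := 2)
    (mirror (𝕜 := ℂ) k).toContinuousLinearEquiv.toContinuousLinearMap (mirrorFn h G), coeFn_mirrorFn h G]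
    with x h1 h2
  rw [← h2]
  exact h1

theorem inner_mirrorVec {k : Fin n} {Ω : Set (E n)} (h : ∀ x, mirror k x ∈ Ω ↔ x ∈ Ω)
    (F G : L2Vec n Ω) : inner ℂ (mirrorVec h F) (mirrorVec h G) = inner ℂ F G := by
  rw [← (mirrorFn (F := EuclideanSpace ℂ (Fin n)) h).inner_map_map F G, L2.inner_def, L2.inner_def]
  refine integral_congr_ae ?_
  filter_upwards [coeFn_mirrorVec h F, coeFn_mirrorVec h G, coeFn_mirrorFn h F, coeFn_mirrorFn h G]
    with x h1 h2 h3 h4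
  rw [h1, h2, h3, h4, LinearIsometryEquiv.inner_map_map]

theorem green_mirror {k : Fin n} {Ω : Set (E n)} (h : ∀ x, mirror k x ∈ Ω ↔ x ∈ Ω) (u : L2 Ω)
    (G : L2Vec n Ω) {φ : E n → ℝ} (hφ : IsTest φ) (i : Fin n) :
    green (mirrorFn h u) (mirrorVec h G) φ i
      = (if i = k then -1 else 1) * green u G (fun x => φ (mirror k x)) i := by
  unfold green
  rw [← integral_const_mul, ← (measurePreserving_mirror h).integral_comp
    (mirror (𝕜 := ℝ) k).toHomeomorph.measurableEmbedding (fun x => _ * _)]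
  refine integral_congr_ae ?_
  filter_upwards [coeFn_mirrorFn h u, coeFn_mirrorVec h G] with x h1 h2
  rw [h1, h2, partialDeriv_comp_mirror hφ, mirror_mirror, mirror_apply]
  split_ifs <;> simp
  ring

variable {k : Fin d} {Ω : Set (E (d + 1))} {S : Set (E d)}

theorem closure_mirror {k : Fin n} {Ω : Set (E n)} (h : ∀ x, mirror k x ∈ Ω ↔ x ∈ Ω) (x : E n) :
    mirror k x ∈ closure Ω ↔ x ∈ closure Ω := by
  have h1 := (mirror (𝕜 := ℝ) k).toHomeomorph.preimage_closure Ω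
  have h2 : (mirror (𝕜 := ℝ) k).toHomeomorph ⁻¹' Ω = Ω := ext h
  rw [h2] at h1
  exact Set.ext_iff.1 h1 x

namespace Sob

/-- Reflection of a Sobolev function. -/
def mirror (h : MirrorSymm k Ω S) : Sob Ω S →ₗ[ℂ] Sob Ω S where
  toFun w := mk (u := mirrorFn h.dom w.fn) (G := mirrorVec h.dom w.grad) (g := mirrorFn h.top w.trace)
    (fun φ hφ hs i => by
      rw [green_mirror h.dom _ _ hφ, w.isWeakGradient _ (hφ.comp_mirror _), mul_zero]
      rw [tsupport_comp_mirror]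
      exact fun x hx => (h.dom x).1 (hs hx))
    (fun φ hφ hs => by
      rw [green_mirror h.dom _ _ hφ, if_neg (Fin.castSucc_lt_last k).ne', one_mul,
        w.isSurfaceTrace _ (hφ.comp_mirror _), ← (measurePreserving_mirror h.top).integral_comp
          (_root_.mirror (𝕜 := ℝ) k).toHomeomorph.measurableEmbedding]
      · refine integral_congr_ae ?_
        filter_upwards [coeFn_mirrorFn h.top w.trace] with y hy
        rw [hy, toSurface_mirror, mirror_mirror]
      · rw [tsupport_comp_mirror]
        rintro x ⟨hx, hx'⟩
        rcases hs ⟨hx, (closure_mirror h.dom x).2 hx'⟩ with h1 | ⟨y, hy, hyx⟩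
        · exact Or.inl ((h.dom x).1 h1)
        · refine Or.inr ⟨_root_.mirror k y, (h.top y).2 hy, ?_⟩
          rw [toSurface_mirror, hyx, mirror_mirror])
  map_add' v w := ext_all (map_add (mirrorFn h.dom) v.fn w.fn)
    (map_add (mirrorVec h.dom) v.grad w.grad) (map_add (mirrorFn h.top) v.trace w.trace)
  map_smul' c w := ext_all (map_smul (mirrorFn h.dom) c w.fn)
    (map_smul (mirrorVec h.dom) c w.grad) (map_smul (mirrorFn h.top) c w.trace)

variable (h : MirrorSymm k Ω S)

@[simp] theorem fn_mirror (w : Sob Ω S) : (mirror h w).fn = mirrorFn h.dom w.fn := rfl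

@[simp] theorem grad_mirror (w : Sob Ω S) : (mirror h w).grad = mirrorVec h.dom w.grad := rfl

@[simp] theorem trace_mirror (w : Sob Ω S) : (mirror h w).trace = mirrorFn h.top w.trace := rfl

theorem inner_mirror_mirror (v w : Sob Ω S) : inner ℂ (mirror h v) (mirror h w) = inner ℂ v w := by
  rw [inner_eq, inner_eq, grad_mirror, grad_mirror, trace_mirror, trace_mirror, inner_mirrorVec,
    LinearIsometry.inner_map_map]

@[simp] theorem mirror_mirror (hΩ : FlatTop Ω S) (w : Sob Ω S) : mirror h (mirror h w) = w := by
  refine ext_fn hΩ (Lp.ext ?_)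
  have h1 := (measurePreserving_mirror h.dom).quasiMeasurePreserving.ae (coeFn_mirrorFn h.dom w.fn)
  filter_upwards [coeFn_mirrorFn h.dom (mirror h w).fn, h1] with x h2 h3
  rw [fn_mirror, h2, fn_mirror, h3, _root_.mirror_mirror]

theorem inner_mirror_left (hΩ : FlatTop Ω S) (v w : Sob Ω S) :
    inner ℂ (mirror h v) w = inner ℂ v (mirror h w) := by
  rw [← inner_mirror_mirror h, mirror_mirror h hΩ]

/-- The Sobolev functions that are odd in the coordinate `k`. -/
def odd : Submodule ℂ (Sob Ω S) := LinearMap.ker (mirror h + LinearMap.id)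

theorem mem_odd {w : Sob Ω S} : w ∈ odd h ↔ mirror h w = -w := by
  rw [odd, LinearMap.mem_ker, LinearMap.add_apply, LinearMap.id_apply, ← eq_neg_iff_add_eq_zero]

/-- The odd part of a function. -/
def oddPart : Sob Ω S →ₗ[ℂ] Sob Ω S := (2⁻¹ : ℂ) • (LinearMap.id - mirror h)

theorem oddPart_apply (w : Sob Ω S) : oddPart h w = (2⁻¹ : ℂ) • (w - mirror h w) := rfl

theorem oddPart_mem (hΩ : FlatTop Ω S) (w : Sob Ω S) : oddPart h w ∈ odd h := by
  rw [mem_odd, oddPart_apply, map_smul, map_sub, mirror_mirror h hΩ, ← smul_neg, neg_sub]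

/-- The reflection is self-adjoint for the energy product. Together with the same fact for traces it
shows that an identity on the odd subspace holds when tested with all functions. -/
theorem inner_oddPart_left (hΩ : FlatTop Ω S) (w : Sob Ω S) {v : Sob Ω S} (hv : v ∈ odd h) :
    inner ℂ (oddPart h w) v = inner ℂ w v := by
  rw [oddPart_apply, inner_smul_left, inner_sub_left, inner_mirror_left h hΩ, (mem_odd h).1 hv,
    inner_neg_right]
  simp only [map_inv₀, Complex.conj_ofNat]
  ring

theorem mirrorFn_trace {w : Sob Ω S} (hw : w ∈ odd h) : mirrorFn h.top w.trace = -w.trace :=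
  congrArg trace ((mem_odd h).1 hw)

theorem mirrorFn_fn {w : Sob Ω S} (hw : w ∈ odd h) : mirrorFn h.dom w.fn = -w.fn :=
  congrArg fn ((mem_odd h).1 hw)

theorem mirrorVec_grad {w : Sob Ω S} (hw : w ∈ odd h) : mirrorVec h.dom w.grad = -w.grad :=
  congrArg grad ((mem_odd h).1 hw)

theorem trace_mirror_inner (v w : Sob Ω S) :
    inner ℂ (mirror h v).trace (mirror h w).trace = inner ℂ v.trace w.trace := by
  rw [trace_mirror, trace_mirror, LinearIsometry.inner_map_map]

theorem trace_oddPart_inner (hΩ : FlatTop Ω S) (w : Sob Ω S) {v : Sob Ω S} (hv : v ∈ odd h) :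
    inner ℂ (oddPart h w).trace v.trace = inner ℂ w.trace v.trace := by
  have h1 : inner ℂ (mirror h w).trace v.trace = - inner ℂ w.trace v.trace := by
    rw [← trace_mirror_inner h, mirror_mirror h hΩ, (mem_odd h).1 hv, map_neg, inner_neg_right]
  rw [oddPart_apply, map_smul, map_sub, inner_smul_left, inner_sub_left, h1]
  simp only [map_inv₀, Complex.conj_ofNat]
  ring

theorem mem_odd_iff_ae (hΩ : FlatTop Ω S) {w : Sob Ω S} :
    w ∈ odd h ↔ ∀ᵐ x ∂(volume : Measure (E (d + 1))).restrict Ω,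
      w.fn (_root_.mirror k.castSucc x) = -w.fn x := by
  constructor
  · intro hw
    filter_upwards [coeFn_mirrorFn h.dom w.fn, Lp.coeFn_neg w.fn] with x h1 h2
    rw [← h1, mirrorFn_fn h hw, h2, Pi.neg_apply]
  · intro hw
    rw [mem_odd]
    refine ext_fn hΩ (Lp.ext ?_)
    filter_upwards [coeFn_mirrorFn h.dom w.fn, Lp.coeFn_neg w.fn, hw] with x h1 h2 h3
    rw [fn_mirror, h1, h3, map_neg, h2, Pi.neg_apply]

theorem trace_ae_of_mem_odd {w : Sob Ω S} (hw : w ∈ odd h) :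
    ∀ᵐ y ∂(volume : Measure (E d)).restrict S, w.trace (_root_.mirror k y) = -w.trace y := by
  filter_upwards [coeFn_mirrorFn h.top w.trace, Lp.coeFn_neg w.trace] with x h1 h2
  rw [← h1, mirrorFn_trace h hw, h2, Pi.neg_apply]

theorem grad_ae_of_mem_odd {w : Sob Ω S} (hw : w ∈ odd h) :
    ∀ᵐ x ∂(volume : Measure (E (d + 1))).restrict Ω,
      _root_.mirror k.castSucc (w.grad (_root_.mirror k.castSucc x)) = -w.grad x := by
  filter_upwards [coeFn_mirrorVec h.dom w.grad, Lp.coeFn_neg w.grad] with x h1 h2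
  rw [← h1, mirrorVec_grad h hw, h2, Pi.neg_apply]

variable {h}

/-- A bound for the function by the energy norm makes a closed space of odd functions complete. -/
theorem completeSpace_of_bound (V : Submodule ℂ (Sob Ω S)) (hV : V = odd h) {C : ℝ}
    (hC : ∀ w ∈ V, ‖w.fn‖ ≤ C * ‖w‖) : CompleteSpace V := by
  refine Metric.complete_of_cauchySeq_tendsto fun w hw => ?_
  have hgr : ∀ v : Sob Ω S, ‖v.grad‖ ≤ ‖v‖ := fun v => by
    refine (abs_le_of_sq_le_sq' ?_ (norm_nonneg _)).2
    rw [norm_sq_eq]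
    exact le_add_of_nonneg_right (sq_nonneg _)
  have htr : ∀ v : Sob Ω S, ‖v.trace‖ ≤ ‖v‖ := fun v => by
    refine (abs_le_of_sq_le_sq' ?_ (norm_nonneg _)).2
    rw [norm_sq_eq]
    exact le_add_of_nonneg_left (sq_nonneg _)
  have key : ∀ {F : Type} [NormedAddCommGroup F] [NormedSpace ℂ F] [CompleteSpace F]
      (L : Sob Ω S →ₗ[ℂ] F) (c : ℝ), (∀ v ∈ V, ‖L v‖ ≤ c * ‖v‖) →
      ∃ f, Tendsto (fun n => L (w n).1) atTop (𝓝 f) := by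
    intro F _ _ _ L c hL
    have hLip : LipschitzWith c.toNNReal fun v : V => L v.1 :=
      LipschitzWith.of_dist_le_mul fun a b => by
        rw [dist_eq_norm, dist_eq_norm, ← map_sub]
        exact (hL _ (a - b).2).trans (mul_le_mul_of_nonneg_right (Real.le_coe_toNNReal c) (norm_nonneg _))
    exact cauchySeq_tendsto_of_complete (hLip.uniformContinuous.comp_cauchySeq hw)
  -- The energy norm does not contain the function itself. The bound supplies its `L²` limit, and
  -- closedness of the triples identifies the limit as a Sobolev function.
  obtain ⟨u, hu⟩ := key fn C hC
  obtain ⟨G, hG⟩ := key grad 1 fun v _ => (hgr v).trans (one_mul _).ge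
  obtain ⟨g, hg⟩ := key trace 1 fun v _ => (htr v).trans (one_mul _).ge
  have hmem : (u, G, g) ∈ sobolevTriples Ω S :=
    (isClosed_sobolevTriples Ω S).mem_of_tendsto (hu.prodMk_nhds (hG.prodMk_nhds hg))
      (Eventually.of_forall fun n => (w n).1.2)
  have hodd : (mk hmem.1 hmem.2 : Sob Ω S) ∈ odd h := by
    rw [mem_odd]
    have ho := fun n => (mem_odd h).1 (hV.le (w n).2)
    refine ext_all ?_ ?_ ?_
    · refine tendsto_nhds_unique (((mirrorFn h.dom).continuous.tendsto u).comp hu) ?_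
      exact hu.neg.congr fun n => (congrArg fn (ho n)).symm
    · refine tendsto_nhds_unique (((mirrorVec h.dom).continuous.tendsto G).comp hG) ?_
      exact hG.neg.congr fun n => (congrArg grad (ho n)).symm
    · refine tendsto_nhds_unique (((mirrorFn h.top).continuous.tendsto g).comp hg) ?_
      exact hg.neg.congr fun n => (congrArg trace (ho n)).symm
  refine ⟨⟨mk hmem.1 hmem.2, hV.ge hodd⟩, ?_⟩
  rw [tendsto_iff_norm_sub_tendsto_zero]
  have h1 : Tendsto (fun n => Real.sqrt (‖(w n).1.grad - G‖ ^ 2 + ‖(w n).1.trace - g‖ ^ 2)) atTop (𝓝 0) := by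
    have h2 := (tendsto_iff_norm_sub_tendsto_zero.1 hG)
    have h3 := (tendsto_iff_norm_sub_tendsto_zero.1 hg)
    simpa using ((h2.pow 2).add (h3.pow 2)).sqrt
  refine h1.congr fun n => ?_
  have h4 := norm_sq_eq ((w n).1 - mk hmem.1 hmem.2)
  rw [map_sub, map_sub] at h4
  have h5 : ‖(w n).1.grad - G‖ ^ 2 + ‖(w n).1.trace - g‖ ^ 2 = ‖(w n).1 - mk hmem.1 hmem.2‖ ^ 2 := h4.symm
  rw [h5, Real.sqrt_sq (norm_nonneg _)]
  rfl

theorem eq_zero_of_norm (hΩ : FlatTop Ω S) {C : ℝ} {w : Sob Ω S} (hC : ‖w.fn‖ ≤ C * ‖w‖)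
    (hw : ‖w‖ = 0) : w = 0 := by
  refine ext_fn hΩ ?_
  rw [map_zero, ← norm_le_zero_iff]
  simpa [hw] using hC

end Sob

end Mirror

/-! ### A negative eigenvalue of a form with compact perturbation -/

section Mode

variable {H Y Z : Type*} [SeminormedAddCommGroup H] [InnerProductSpace ℂ H] [NormedAddCommGroup Y]
  [InnerProductSpace ℂ Y] [NormedAddCommGroup Z] [InnerProductSpace ℂ Z]

/-- The lowest eigenvalue `m` of the pencil with `K = √c T` is negative, because the form is
negative at `x₀`; then `κ = √(-m)`. -/
theorem exists_mode_of_compact [CompleteSpace H] (T : H →L[ℂ] Y) (J : H →L[ℂ] Z)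
    (hT : CompactMap T) (hJ : CompactMap J) {c : ℝ} (hc : 0 < c)
    (hTJ : ∀ ε > 0, ∃ D : ℝ, ∀ w, ‖T w‖ ≤ ε * ‖w‖ + D * ‖J w‖) (x₀ : H)
    (hx₀ : ‖x₀‖ ^ 2 < c * ‖T x₀‖ ^ 2) :
    ∃ κ > 0, ∃ χ : H, J χ ≠ 0 ∧ ∀ ψ, inner ℂ ψ χ - (c : ℂ) * inner ℂ (T ψ) (T χ)
      = -((κ ^ 2 : ℝ) : ℂ) * inner ℂ (J ψ) (J χ) := by
  -- After squaring, the bound is doubled and multiplied by `c`; this choice leaves exactly half of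
  -- `‖w‖ ^ 2`.
  obtain ⟨D, hD⟩ := hTJ (Real.sqrt (4 * c))⁻¹ (by positivity)
  set e := (Real.sqrt (4 * c))⁻¹ with he
  have he2 : e ^ 2 * c = 1 / 4 := by
    rw [he, inv_pow, Real.sq_sqrt (by positivity)]
    field_simp
  let K : H →L[ℂ] Y := ((Real.sqrt c : ℝ) : ℂ) • T
  have hKn : ∀ w, ‖K w‖ ^ 2 = c * ‖T w‖ ^ 2 := fun w => by
    change ‖((Real.sqrt c : ℝ) : ℂ) • T w‖ ^ 2 = _
    rw [norm_smul, mul_pow, Complex.norm_real, Real.norm_eq_abs, sq_abs, Real.sq_sqrt hc.le]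
  have hKi : ∀ v w, inner ℂ (K v) (K w) = (c : ℂ) * inner ℂ (T v) (T w) := fun v w => by
    change inner ℂ (((Real.sqrt c : ℝ) : ℂ) • T v) (((Real.sqrt c : ℝ) : ℂ) • T w) = _
    rw [inner_smul_left, inner_smul_right, Complex.conj_ofReal, ← mul_assoc, ← Complex.ofReal_mul,
      Real.mul_self_sqrt hc.le]
  have hK : ∀ w, ‖K w‖ ^ 2 ≤ ‖w‖ ^ 2 / 2 + c * 2 * D ^ 2 * ‖J w‖ ^ 2 := fun w => by
    rw [hKn]
    have h3 : ‖T w‖ ^ 2 ≤ (e * ‖w‖ + D * ‖J w‖) ^ 2 := pow_le_pow_left₀ (norm_nonneg _) (hD w) 2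
    have h2 : ‖T w‖ ^ 2 ≤ 2 * (e * ‖w‖) ^ 2 + 2 * (D * ‖J w‖) ^ 2 := by
      linarith [sq_nonneg (e * ‖w‖ - D * ‖J w‖)]
    have h4 := mul_le_mul_of_nonneg_left h2 hc.le
    have h5 : c * (2 * (e * ‖w‖) ^ 2 + 2 * (D * ‖J w‖) ^ 2)
        = 2 * (e ^ 2 * c) * ‖w‖ ^ 2 + c * 2 * D ^ 2 * ‖J w‖ ^ 2 := by ring
    rw [h5, he2] at h4
    linarith
  have hJ0 : J x₀ ≠ 0 := fun h0 => by
    have := hK x₀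
    rw [hKn, h0, norm_zero] at this
    linarith [sq_nonneg ‖x₀‖]
  obtain ⟨m, χ, hχ1, hχ2, hχ3⟩ := exists_lowest_eigenvalue_pencil K J
    (hT.clm_comp (continuous_const_smul _)) hJ ⟨x₀, hJ0⟩ _ hK
  have hm : m < 0 := by
    have h1 := hχ2 x₀
    rw [pencilForm, hKn] at h1
    by_contra hcon
    push Not at hcon
    have := mul_nonneg hcon (sq_nonneg ‖J x₀‖)
    linarith
  refine ⟨Real.sqrt (-m), Real.sqrt_pos.2 (by linarith), χ, fun h0 => ?_, fun ψ => ?_⟩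
  · rw [h0, norm_zero] at hχ1
    exact zero_ne_one hχ1
  · rw [Real.sq_sqrt (by linarith), ← hKi, hχ3]
    push_cast
    ring

end Mode

/-! ### Poincaré's inequality, first Steklov eigenvalue and modes for odd functions -/

section OddSpaces

variable {d : ℕ} {Ω : Set (E (d + 1))} {S : Set (E d)} {k : Fin d}

namespace Sob

theorem norm_grad_le (w : Sob Ω S) : ‖w.grad‖ ≤ ‖w‖ := by
  refine (abs_le_of_sq_le_sq' ?_ (norm_nonneg _)).2
  rw [norm_sq_eq]
  exact le_add_of_nonneg_right (sq_nonneg _)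

theorem norm_trace_le (w : Sob Ω S) : ‖w.trace‖ ≤ ‖w‖ := by
  refine (abs_le_of_sq_le_sq' ?_ (norm_nonneg _)).2
  rw [norm_sq_eq]
  exact le_add_of_nonneg_left (sq_nonneg _)

theorem norm_le_add (w : Sob Ω S) : ‖w‖ ≤ ‖w.grad‖ + ‖w.trace‖ := by
  refine (abs_le_of_sq_le_sq' ?_ (by positivity)).2
  rw [norm_sq_eq, add_sq]
  nlinarith [mul_nonneg (norm_nonneg w.grad) (norm_nonneg w.trace)]

/-- The function is constant on the connected domain, and an odd constant is zero. -/
theorem fn_eq_zero_of_grad (hΩ : IsOpen Ω) (hconn : IsPreconnected Ω) (h : MirrorSymm k Ω S)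
    {w : Sob Ω S} (hw : mirrorFn h.dom w.fn = -w.fn) (hG : w.grad = 0) : w.fn = 0 := by
  obtain ⟨c, hc⟩ := IsWeakGradient.ae_eq_const (u := w.fn) (hG ▸ w.isWeakGradient) hΩ hconn
  have hc' := (measurePreserving_mirror h.dom).quasiMeasurePreserving.ae hc
  refine Lp.ext ?_
  filter_upwards [hc, hc', coeFn_mirrorFn h.dom w.fn, Lp.coeFn_neg w.fn,
    Lp.coeFn_zero ℂ 2 ((volume : Measure (E (d + 1))).restrict Ω)] with x h1 h2 h3 h4 h5
  rw [h5, Pi.zero_apply]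
  rw [hw, h4, Pi.neg_apply, h2, h1] at h3
  rw [h1]
  exact self_eq_neg.1 h3.symm

/-- Poincaré's inequality for odd functions, if it is known away from a bounded set. -/
theorem exists_poincare (hΩ : FlatTop Ω S) (hconn : IsPreconnected Ω) (h : MirrorSymm k Ω S)
    {K : Set (E (d + 1))} (hK : MeasurableSet K) (hKb : Bornology.IsBounded K) {C₀ : ℝ}
    (hC₀ : 0 ≤ C₀) (hcut : ∀ w ∈ odd h, ‖cut Kᶜ hK.compl w.fn‖ ≤ C₀ * ‖w‖) :
    ∃ C : ℝ, ∀ w ∈ odd h, ‖w.fn‖ ≤ C * ‖w‖ := by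
  let T := L2 Ω × L2Vec (d + 1) Ω × L2 S
  let M : T →L[ℂ] L2 Ω :=
    ((mirrorFn h.dom).toContinuousLinearMap + ContinuousLinearMap.id ℂ (L2 Ω)).comp
      (ContinuousLinearMap.fst ℂ _ _)
  -- The odd triples with the full graph norm are complete, being closed. The Peetre-Tartar lemma
  -- removes the function from this norm: `A` keeps gradient and trace, and `j` is the compact
  -- embedding over `K`.
  let Y : Submodule ℂ T := sobolevTriples Ω S ⊓ M.ker
  have hYc : IsClosed (Y : Set T) := (isClosed_sobolevTriples Ω S).inter M.isClosed_ker
  have : CompleteSpace Y := hYc.completeSpace_coe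
  have hodd : ∀ y : Y, mirrorFn h.dom y.1.1 = -y.1.1 := fun y =>
    eq_neg_of_add_eq_zero_left y.2.2
  let s : Y → Sob Ω S := fun y => ⟨y.1, y.2.1⟩
  have hs : ∀ y, s y ∈ odd h := fun y => by
    rw [mem_odd]
    exact ext_fn hΩ (hodd y)
  let A : Y →L[ℂ] L2Vec (d + 1) Ω × L2 S := (ContinuousLinearMap.snd ℂ _ _).comp Y.subtypeL
  let j : Y →L[ℂ] L2 Ω := (cut K hK).comp ((ContinuousLinearMap.fst ℂ _ _).comp Y.subtypeL)
  have hA : ∀ y, A y = 0 → y = 0 := by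
    intro y hy
    have h1 : y.1.2 = 0 := hy
    have h2 : (s y).fn = 0 := fn_eq_zero_of_grad hΩ.isOpen hconn h (hodd y) (congrArg Prod.fst h1)
    exact Subtype.ext (Prod.ext h2 h1)
  have hj : CompactMap j := by
    refine CompactMap.of_finite_rank_approx j.toLinearMap fun ε hε => ?_
    obtain ⟨N, P, hP⟩ := exists_finite_rank_approx hΩ.isOpen hΩ.cone hK hKb hε
    refine ⟨N, P.comp ((ContinuousLinearMap.fst ℂ _ _).comp Y.subtypeL), fun y => ?_⟩
    refine (hP _ _ y.2.1.1).trans ?_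
    have : ‖y.1.2.1‖ ≤ ‖y‖ := (norm_fst_le y.1.2).trans (norm_snd_le y.1)
    exact add_le_add (mul_le_mul_of_nonneg_left this hε.le) le_rfl
  -- Inside `K` the function is `j y`; outside `K` it is bounded by the energy through `hcut`.
  have hbound : ∀ y, ‖y‖ ≤ (1 + 2 * C₀) * (‖A y‖ + ‖j y‖) := by
    intro y
    have h1 : ‖s y‖ ≤ 2 * ‖A y‖ := by
      have h2 : ‖(s y).grad‖ ≤ ‖A y‖ := norm_fst_le y.1.2
      have h3 : ‖(s y).trace‖ ≤ ‖A y‖ := norm_snd_le y.1.2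
      linarith [norm_le_add (s y)]
    have h4 : ‖y.1.1‖ ≤ ‖j y‖ + C₀ * (2 * ‖A y‖) := by
      have h5 := norm_sq_cut_add_compl K hK y.1.1
      have h6 := (hcut _ (hs y)).trans (mul_le_mul_of_nonneg_left h1 hC₀)
      have h7 : ‖y.1.1‖ ≤ ‖cut K hK y.1.1‖ + ‖cut Kᶜ hK.compl y.1.1‖ := by
        refine (abs_le_of_sq_le_sq' ?_ (by positivity)).2
        rw [h5, add_sq]
        nlinarith [mul_nonneg (norm_nonneg (cut K hK y.1.1)) (norm_nonneg (cut Kᶜ hK.compl y.1.1))]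
      exact h7.trans (add_le_add le_rfl h6)
    have h8 : 0 ≤ C₀ * ‖j y‖ := mul_nonneg hC₀ (norm_nonneg _)
    have h9 : 0 ≤ C₀ * ‖A y‖ := mul_nonneg hC₀ (norm_nonneg _)
    refine max_le ?_ ?_
    · change ‖y.1.1‖ ≤ _
      linarith [norm_nonneg (A y)]
    · change ‖A y‖ ≤ _
      linarith [norm_nonneg (j y)]
  obtain ⟨C, hC⟩ := exists_bound_of_injective_of_compact A j hA hj _ hbound
  refine ⟨|C|, fun w hw => ?_⟩
  let y : Y := ⟨w.1, w.2, by
    change mirrorFn h.dom w.fn + w.fn = 0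
    rw [mirrorFn_fn h hw, neg_add_cancel]⟩
  have h1 : ‖w.fn‖ ≤ ‖y‖ := norm_fst_le y.1
  have h2 : ‖A y‖ ≤ ‖w‖ := max_le (norm_grad_le w) (norm_trace_le w)
  exact h1.trans ((hC y).trans ((mul_le_mul_of_nonneg_right (le_abs_self C) (norm_nonneg _)).trans
    (mul_le_mul_of_nonneg_left h2 (abs_nonneg C))))

/-- The trace as a continuous map on a space of Sobolev functions. -/
def traceL (V : Submodule ℂ (Sob Ω S)) : V →L[ℂ] L2 S :=
  LinearMap.mkContinuous (trace.comp V.subtype) 1 fun w => (norm_trace_le w.1).trans (one_mul _).ge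

@[simp] theorem traceL_apply (V : Submodule ℂ (Sob Ω S)) (w : V) : traceL V w = w.1.trace := rfl

/-- The embedding into `L²` as a continuous map. -/
def fnL {V : Submodule ℂ (Sob Ω S)} {C : ℝ} (hC : ∀ w ∈ V, ‖w.fn‖ ≤ C * ‖w‖) : V →L[ℂ] L2 Ω :=
  LinearMap.mkContinuous (fn.comp V.subtype) C fun w => hC _ w.2

@[simp] theorem fnL_apply {V : Submodule ℂ (Sob Ω S)} {C : ℝ} (hC : ∀ w ∈ V, ‖w.fn‖ ≤ C * ‖w‖)
    (w : V) : fnL hC w = w.1.fn := rfl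

theorem compactMap_cut_fn (hΩ : FlatTop Ω S) {V : Submodule ℂ (Sob Ω S)} {C : ℝ}
    (hC : ∀ w ∈ V, ‖w.fn‖ ≤ C * ‖w‖) {K : Set (E (d + 1))} (hK : MeasurableSet K)
    (hKb : Bornology.IsBounded K) : CompactMap ((cut K hK).comp (fnL hC)) := by
  refine CompactMap.of_finite_rank_approx ((cut K hK).comp (fnL hC)).toLinearMap fun ε hε => ?_
  obtain ⟨N, P, hP⟩ := exists_finite_rank_approx hΩ.isOpen hΩ.cone hK hKb hε
  refine ⟨N, P.comp (fnL hC), fun w => ?_⟩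
  refine (hP _ _ w.1.isWeakGradient).trans ?_
  exact add_le_add (mul_le_mul_of_nonneg_left (norm_grad_le w.1) hε.le) le_rfl

/-- The trace inequality bounds the trace by a small multiple of the energy and the function on a
bounded set, where the embedding is compact. -/
theorem compactMap_cut_trace (hΩ : FlatTop Ω S) {V : Submodule ℂ (Sob Ω S)} {C : ℝ}
    (hC : ∀ w ∈ V, ‖w.fn‖ ≤ C * ‖w‖) {K : Set (E d)} (hK : MeasurableSet K)
    (hKb : Bornology.IsBounded K) : CompactMap ((cut K hK).comp (traceL V)) := by
  obtain ⟨R, hR⟩ := exists_trace_bound hΩ.isOpen hΩ.cone hΩ.low hΩ.isOpen_top hΩ.top_mem hK hKb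
  have hj := compactMap_cut_fn hΩ hC (Metric.isOpen_ball (x := (0 : E (d + 1))) (ε := R)).measurableSet
    Metric.isBounded_ball
  refine CompactMap.of_le (j := ((cut _ _).comp (fnL hC)).toLinearMap) hj
    ((cut K hK).comp (traceL V)).toLinearMap fun ε hε => ?_
  obtain ⟨D, -, hD⟩ := hR ε hε
  refine ⟨D, fun w => (hD _ _ _ w.1.isWeakGradient w.1.isSurfaceTrace).trans ?_⟩
  exact add_le_add (mul_le_mul_of_nonneg_left (norm_grad_le w.1) hε.le) le_rfl

/-- The odd part of a bump about a surface point off the symmetry plane. Its radius is below the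
distance to that plane, so the mirrored bump vanishes at the centre. -/
theorem exists_odd_trace_ne_zero (hΩ : FlatTop Ω S) (h : MirrorSymm k Ω S) {y₀ : E d}
    (hy₀ : y₀ ∈ S) (hk : y₀ k ≠ 0) : ∃ w ∈ odd h, w.trace ≠ 0 := by
  obtain ⟨ρ, hρ, H⟩ := hΩ.exists_sob_of_test_boundary hy₀
  obtain ⟨r, hr, hrρ, hrk⟩ : ∃ r > 0, r < ρ ∧ r < |y₀ k| := by
    obtain ⟨r, h1, h2⟩ := exists_between (lt_min hρ (abs_pos.2 hk))
    exact ⟨r, h1, lt_min_iff.1 h2⟩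
  let ζ : ContDiffBump (toSurface y₀) := ⟨r / 2, r, by positivity, by linarith⟩
  have hζ : IsTest ζ := ⟨ζ.contDiff, ζ.hasCompactSupport⟩
  obtain ⟨w, -, hw⟩ := H ζ hζ (by
    rw [ζ.tsupport_eq]
    exact Metric.closedBall_subset_ball hrρ)
  refine ⟨oddPart h w, oddPart_mem h hΩ w, fun h0 => ?_⟩
  rw [oddPart_apply, map_smul, map_sub, smul_eq_zero_iff_right (by norm_num), sub_eq_zero] at h0
  have h1 : (fun y => (ζ (toSurface y) : ℂ)) =ᵐ[(volume : Measure (E d)).restrict S]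
      fun y => (ζ (toSurface (_root_.mirror k y)) : ℂ) := by
    have h2 := (measurePreserving_mirror h.top).quasiMeasurePreserving.ae hw
    filter_upwards [hw, h2, coeFn_mirrorFn h.top w.trace] with y h3 h4 h5
    rw [← h3, ← h4, ← h5]
    exact congrArg (fun f : L2 S => f y) h0
  have h6 : (ζ (toSurface y₀) : ℂ) = (ζ (toSurface (_root_.mirror k y₀)) : ℂ) := Measure.eqOn_open_of_ae_eq h1 hΩ.isOpen_top
    (Complex.continuous_ofReal.comp (hζ.1.continuous.comp continuous_toSurface)).continuousOn
    (Complex.continuous_ofReal.comp (hζ.1.continuous.comp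
      (continuous_toSurface.comp (_root_.mirror (𝕜 := ℝ) k).continuous))).continuousOn hy₀
  have h7 : ζ (toSurface y₀) = 1 := ζ.one_of_mem_closedBall (Metric.mem_closedBall_self (by positivity))
  have h8 : ζ (toSurface (_root_.mirror k y₀)) = 0 := by
    refine ζ.zero_of_le_dist ?_
    have h9 := abs_apply_le_norm (toSurface (_root_.mirror k y₀) - toSurface y₀) k.castSucc
    rw [PiLp.sub_apply, toSurface_castSucc, toSurface_castSucc, mirror_same, ← dist_eq_norm] at h9
    refine le_trans ?_ h9
    rw [show -y₀ k - y₀ k = -(2 * y₀ k) by ring, abs_neg, abs_mul, abs_two]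
    change r ≤ _
    linarith [abs_nonneg (y₀ k)]
  rw [h7, h8] at h6
  simp at h6

/-- In a bounded domain the embedding and the trace of odd functions are compact. -/
theorem exists_compact_of_isBounded (hΩ : FlatTop Ω S) (hconn : IsPreconnected Ω)
    (hb : Bornology.IsBounded Ω) (h : MirrorSymm k Ω S) :
    ∃ (C : ℝ) (hC : ∀ w ∈ odd h, ‖w.fn‖ ≤ C * ‖w‖), CompactMap (fnL hC) ∧
      CompactMap (traceL (odd h)) ∧
      ∀ ε > 0, ∃ D : ℝ, ∀ w ∈ odd h, ‖w.trace‖ ≤ ε * ‖w‖ + D * ‖w.fn‖ := by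
  have hcutfn : ∀ u : L2 Ω, cut Ω hΩ.isOpen.measurableSet u = u := fun u => by
    refine Lp.ext ?_
    filter_upwards [cut_coeFn Ω hΩ.isOpen.measurableSet u,
      ae_restrict_mem (μ := volume) hΩ.isOpen.measurableSet] with x h1 h2
    rw [h1, indicator_of_mem h2]
  have hcutc : ∀ u : L2 Ω, cut Ωᶜ hΩ.isOpen.measurableSet.compl u = 0 := fun u => by
    have h1 := norm_sq_cut_add_compl Ω hΩ.isOpen.measurableSet u
    rw [hcutfn, left_eq_add] at h1
    exact norm_eq_zero.1 (pow_eq_zero_iff two_ne_zero |>.1 h1)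
  have hbS : Bornology.IsBounded S := by
    obtain ⟨R, hR⟩ := hb.closure.exists_norm_le
    refine isBounded_iff_forall_norm_le.2 ⟨R, fun y hy => ?_⟩
    have := (norm_horiz_le (toSurface y)).trans (hR _ (hΩ.top_mem y hy))
    rwa [horiz_toSurface] at this
  have hcutS : ∀ g : L2 S, cut S hΩ.isOpen_top.measurableSet g = g := fun g => by
    refine Lp.ext ?_
    filter_upwards [cut_coeFn S hΩ.isOpen_top.measurableSet g,
      ae_restrict_mem (μ := volume) hΩ.isOpen_top.measurableSet] with x h1 h2
    rw [h1, indicator_of_mem h2]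
  -- With `K = Ω` nothing remains outside `K`.
  obtain ⟨C, hC⟩ := exists_poincare hΩ hconn h hΩ.isOpen.measurableSet hb le_rfl fun w _ => by
    rw [hcutc, norm_zero, zero_mul]
  have hJ : CompactMap (fnL hC) := by
    have := compactMap_cut_fn hΩ hC hΩ.isOpen.measurableSet hb
    refine (congrArg CompactMap (funext fun w => ?_)).mp this
    exact hcutfn _
  have hT : CompactMap (traceL (odd h)) := by
    have := compactMap_cut_trace hΩ hC hΩ.isOpen_top.measurableSet hbS
    refine (congrArg CompactMap (funext fun w => ?_)).mp this
    exact hcutS _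
  refine ⟨C, hC, hJ, hT, ?_⟩
  intro ε hε
  obtain ⟨R, hR⟩ := exists_trace_bound hΩ.isOpen hΩ.cone hΩ.low hΩ.isOpen_top hΩ.top_mem
    hΩ.isOpen_top.measurableSet hbS
  obtain ⟨D, hD, hb⟩ := hR ε hε
  refine ⟨D, fun w _ => ?_⟩
  have h1 := hb _ _ _ w.isWeakGradient w.isSurfaceTrace
  rw [hcutS] at h1
  exact h1.trans (add_le_add (mul_le_mul_of_nonneg_left (norm_grad_le w) hε.le)
    (mul_le_mul_of_nonneg_left (norm_cut_le _ _ _) hD))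

/-- The first eigenvalue of the Steklov problem for odd functions in a bounded domain. -/
theorem exists_steklov (hΩ : FlatTop Ω S) (hconn : IsPreconnected Ω)
    (hb : Bornology.IsBounded Ω) (h : MirrorSymm k Ω S) {y₀ : E d} (hy₀ : y₀ ∈ S)
    (hk : y₀ k ≠ 0) :
    ∃ lam : ℝ, 0 < lam ∧ (∀ ψ ∈ odd h, lam * ‖ψ.trace‖ ^ 2 ≤ ‖ψ.grad‖ ^ 2) ∧
      ∃ φ ∈ odd h, φ.fn ≠ 0 ∧ ‖φ.trace‖ = 1 ∧ ‖φ.grad‖ ^ 2 = lam ∧ ∀ ψ ∈ odd h,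
        inner ℂ ψ.grad φ.grad = (lam : ℂ) * inner ℂ ψ.trace φ.trace := by
  obtain ⟨C, hC, hJ, hT, htb⟩ := exists_compact_of_isBounded hΩ hconn hb h
  have hcomp : CompleteSpace (odd h) := completeSpace_of_bound (odd h) rfl hC
  obtain ⟨w₀, hw₀, hw₀t⟩ := exists_odd_trace_ne_zero hΩ h hy₀ hk
  -- With `K = 0` the quotient of squared energy norm and squared trace norm is minimised. The
  -- energy contains the trace, so the Steklov eigenvalue is `m - 1`.
  obtain ⟨m, φ, hφ1, hφ2, hφ3⟩ := exists_lowest_eigenvalue_pencil (H := odd h) (Y := L2 S)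
    (0 : odd h →L[ℂ] L2 S) (traceL (odd h)) (fun x D _ => ⟨0, id, strictMono_id, tendsto_const_nhds⟩) hT
    ⟨⟨w₀, hw₀⟩, hw₀t⟩ 0 (fun x => by simp; positivity)
  have hnorm : ∀ w : odd h, ‖w‖ ^ 2 = ‖w.1.grad‖ ^ 2 + ‖w.1.trace‖ ^ 2 := fun w => norm_sq_eq w.1
  have hφtr : ‖φ.1.trace‖ = 1 := hφ1
  have hφfn : φ.1.fn ≠ 0 := fun h0 => by
    rw [trace_eq_zero_of_fn hΩ h0, norm_zero] at hφtr
    exact zero_ne_one hφtr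
  have hEL : ∀ ψ ∈ odd h, inner ℂ ψ.grad φ.1.grad = ((m - 1 : ℝ) : ℂ) * inner ℂ ψ.trace φ.1.trace := by
    intro ψ hψ
    have h1 := hφ3 ⟨ψ, hψ⟩
    have h2 : inner ℂ (⟨ψ, hψ⟩ : odd h) φ = inner ℂ ψ.grad φ.1.grad + inner ℂ ψ.trace φ.1.trace :=
      inner_eq ψ φ.1
    rw [h2] at h1
    simp only [zero_apply, inner_zero_left, sub_zero, traceL_apply] at h1
    push_cast
    linear_combination h1
  have hlow : ∀ ψ ∈ odd h, (m - 1) * ‖ψ.trace‖ ^ 2 ≤ ‖ψ.grad‖ ^ 2 := by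
    intro ψ hψ
    have h1 := hφ2 ⟨ψ, hψ⟩
    rw [pencilForm, hnorm] at h1
    simp only [zero_apply, norm_zero, traceL_apply] at h1
    linarith
  have hval : ‖φ.1.grad‖ ^ 2 = m - 1 := by
    have h1 := congrArg Complex.re (hEL _ φ.2)
    have h2 : (inner ℂ φ.1.grad φ.1.grad).re = ‖φ.1.grad‖ ^ 2 := inner_self_eq_norm_sq (𝕜 := ℂ) _
    have h3 : (inner ℂ φ.1.trace φ.1.trace).re = ‖φ.1.trace‖ ^ 2 := inner_self_eq_norm_sq (𝕜 := ℂ) _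
    rw [Complex.re_ofReal_mul, h2, h3, hφtr] at h1
    linarith
  have hpos : 0 < m - 1 := by
    rw [← hval]
    refine pow_pos (norm_pos_iff.2 fun h0 => hφfn ?_) 2
    exact fn_eq_zero_of_grad hΩ.isOpen hconn h (mirrorFn_fn h φ.2) h0
  exact ⟨m - 1, hpos, hlow, φ.1, φ.2, hφfn, hφtr, hval, hEL⟩

/-- The mode of an odd wave at the spectral parameter `lam'` above the cut-off value. -/
theorem exists_mode (hΩ : FlatTop Ω S) (hconn : IsPreconnected Ω)
    (hb : Bornology.IsBounded Ω) (h : MirrorSymm k Ω S) {lam lam' : ℝ} (hlam0 : 0 < lam)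
    (hlam : lam < lam') {φ : Sob Ω S} (hφ : φ ∈ odd h) (hφtr : ‖φ.trace‖ = 1)
    (hval : ‖φ.grad‖ ^ 2 = lam) :
    ∃ κ > 0, ∃ χ ∈ odd h, χ.fn ≠ 0 ∧ ∀ ψ ∈ odd h,
      inner ℂ ψ.grad χ.grad - (lam' : ℂ) * inner ℂ ψ.trace χ.trace
        = -((κ ^ 2 : ℝ) : ℂ) * inner ℂ ψ.fn χ.fn := by
  obtain ⟨C, hC, hJ, hT, htb⟩ := exists_compact_of_isBounded hΩ hconn hb h
  have hcomp : CompleteSpace (odd h) := completeSpace_of_bound (odd h) rfl hC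
  have hnorm : ∀ w : odd h, ‖w‖ ^ 2 = ‖w.1.grad‖ ^ 2 + ‖w.1.trace‖ ^ 2 := fun w => norm_sq_eq w.1
  obtain ⟨κ, hκ, χ, hχ, H⟩ := exists_mode_of_compact (H := odd h) (traceL (odd h)) (fnL hC) hT hJ
    -- The extra one compensates the trace in the energy norm. The Steklov eigenfunction `φ` has
    -- energy `1 + lam` and serves as the vector where the form is negative.
    (c := 1 + lam') (by linarith) (fun ε hε => (htb ε hε).imp fun D hD w => hD w.1 w.2) (⟨φ, hφ⟩ : odd h)
    (by rw [hnorm, traceL_apply, hφtr, hval]; linarith)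
  refine ⟨κ, hκ, χ.1, χ.2, hχ, fun ψ hψ => ?_⟩
  have h1 := H ⟨ψ, hψ⟩
  have h2 : inner ℂ (⟨ψ, hψ⟩ : odd h) χ = inner ℂ ψ.grad χ.1.grad + inner ℂ ψ.trace χ.1.trace :=
    inner_eq ψ χ.1
  rw [h2, traceL_apply, traceL_apply, fnL_apply, fnL_apply] at h1
  push_cast at h1 ⊢
  linear_combination h1

end Sob

end OddSpaces

/-! ### Integration over symmetric sets and their halves -/

section Halves

variable {n : ℕ} {k : Fin n} {A A' : Set (E n)}

theorem volume_coord_eq_zero (k : Fin n) : (volume : Measure (E n)) {x | x k = 0} = 0 := by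
  have h1 : ({x | x k = 0} : Set (E n))
      = ((EuclideanSpace.proj k : E n →L[ℝ] ℝ).ker : Set (E n)) := rfl
  rw [h1]
  refine Measure.addHaar_submodule _ _ fun h => ?_
  have h2 : EuclideanSpace.single k (1 : ℝ) ∈ (EuclideanSpace.proj k : E n →L[ℝ] ℝ).ker := by
    rw [h]; trivial
  have h3 : (EuclideanSpace.single k (1 : ℝ) : E n) k = 0 := h2
  simp at h3

/-- The symmetry plane is a null set, so up to null sets the set is the disjoint union of its half
and the mirror image. -/
theorem restrict_eq_add_map_mirror (hA' : MeasurableSet A')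
    (h : ∀ x, mirror k x ∈ A ↔ x ∈ A) (hh : ∀ x, x ∈ A' ↔ x ∈ A ∧ 0 < x k) :
    (volume : Measure (E n)).restrict A = volume.restrict A' + (volume.restrict A').map (mirror k) := by
  let B : Set (E n) := (mirror (𝕜 := ℝ) k) ⁻¹' A'
  have hB : MeasurableSet B := (mirror (𝕜 := ℝ) k).continuous.measurable hA'
  have hBm : ∀ x, x ∈ B ↔ x ∈ A ∧ x k < 0 := fun x => by
    change mirror k x ∈ A' ↔ _
    rw [hh, h, mirror_same, neg_pos]
  have h1 : (volume.restrict A').map (mirror k) = volume.restrict B := by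
    have h2 := ((mirror (𝕜 := ℝ) k).measurePreserving.restrict_preimage_emb
      (mirror (𝕜 := ℝ) k).toHomeomorph.measurableEmbedding B).map_eq
    have h3 : (mirror (𝕜 := ℝ) k) ⁻¹' B = A' := by
      ext x
      change mirror k (mirror k x) ∈ A' ↔ _
      rw [mirror_mirror]
    rwa [h3] at h2
  rw [h1, ← Measure.restrict_union _ hB]
  · refine Measure.restrict_congr_set ?_
    have h4 : ∀ᵐ x ∂(volume : Measure (E n)), x k ≠ 0 := by
      rw [ae_iff]
      simpa using volume_coord_eq_zero k
    filter_upwards [h4] with x hx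
    refine propext ?_
    change x ∈ A ↔ x ∈ A' ∨ x ∈ B
    rw [hh, hBm]
    constructor
    · intro hxA
      rcases lt_or_gt_of_ne hx with h5 | h5
      · exact Or.inr ⟨hxA, h5⟩
      · exact Or.inl ⟨hxA, h5⟩
    · rintro (h5 | h5)
      · exact h5.1
      · exact h5.1
  · rw [Set.disjoint_left]
    intro x h5 h6
    exact lt_asymm ((hh x).1 h5).2 ((hBm x).1 h6).2

theorem ae_restrict_iff_mirror (hA' : MeasurableSet A')
    (h : ∀ x, mirror k x ∈ A ↔ x ∈ A) (hh : ∀ x, x ∈ A' ↔ x ∈ A ∧ 0 < x k) {p : E n → Prop} :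
    (∀ᵐ x ∂(volume : Measure (E n)).restrict A, p x) ↔
      ∀ᵐ x ∂(volume : Measure (E n)).restrict A', p x ∧ p (mirror k x) := by
  have he := (mirror (𝕜 := ℝ) k).toHomeomorph.measurableEmbedding
  rw [restrict_eq_add_map_mirror hA' h hh, ae_add_measure_iff, eventually_and]
  exact and_congr Iff.rfl he.ae_map_iff

theorem setIntegral_mirror {F : Type*} [NormedAddCommGroup F] [NormedSpace ℝ F]
    (hA' : MeasurableSet A')
    (h : ∀ x, mirror k x ∈ A ↔ x ∈ A) (hh : ∀ x, x ∈ A' ↔ x ∈ A ∧ 0 < x k) {f : E n → F}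
    (hf : IntegrableOn f A) : ∫ x in A, f x = ∫ x in A', (f x + f (mirror k x)) := by
  have he := (mirror (𝕜 := ℝ) k).toHomeomorph.measurableEmbedding
  rw [IntegrableOn, restrict_eq_add_map_mirror hA' h hh, integrable_add_measure] at hf
  rw [restrict_eq_add_map_mirror hA' h hh, integral_add_measure hf.1 hf.2, integral_add hf.1]
  · congr 1
    exact he.integral_map f
  · exact he.integrable_map_iff.1 hf.2

/-- The odd extension of a function, combined with the map `T` of the values. -/
def oddExt {F : Type*} [Neg F] (k : Fin n) (T : F → F) (f : E n → F) (x : E n) : F :=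
  open Classical in if 0 < x k then f x else -T (f (mirror k x))

theorem oddExt_of_pos {F : Type*} [Neg F] (T : F → F) (f : E n → F) {x : E n} (hx : 0 < x k) :
    oddExt k T f x = f x := if_pos hx

theorem oddExt_mirror_of_pos {F : Type*} [Neg F] (T : F → F) (f : E n → F) {x : E n}
    (hx : 0 < x k) : oddExt k T f (mirror k x) = -T (f x) := by
  rw [oddExt, if_neg, mirror_mirror]
  rw [mirror_same]
  linarith

theorem memLp_oddExt {F : Type*} [NormedAddCommGroup F] [NormedSpace ℂ F] (hA' : MeasurableSet A')
    (h : ∀ x, mirror k x ∈ A ↔ x ∈ A) (hh : ∀ x, x ∈ A' ↔ x ∈ A ∧ 0 < x k) (T : F ≃ₗᵢ[ℂ] F)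
    {f : E n → F} (hf : MemLp f 2 (volume.restrict A')) :
    MemLp (oddExt k T f) 2 (volume.restrict A) := by
  have he := (mirror (𝕜 := ℝ) k).toHomeomorph.measurableEmbedding
  have hpos : ∀ᵐ x ∂(volume : Measure (E n)).restrict A', 0 < x k := by
    filter_upwards [ae_restrict_mem hA'] with x hx using ((hh x).1 hx).2
  have h1 : MemLp (oddExt k T f) 2 (volume.restrict A') :=
    hf.ae_eq (hpos.mono fun x hx => (oddExt_of_pos T f hx).symm)
  have h2 : MemLp (oddExt k T f) 2 ((volume.restrict A').map (mirror k)) := by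
    refine (he.memLp_map_measure_iff).2 ?_
    refine MemLp.ae_eq (hpos.mono fun x hx => (oddExt_mirror_of_pos T f hx).symm) ?_
    exact (T.toContinuousLinearEquiv.toContinuousLinearMap.comp_memLp' hf).neg
  rw [restrict_eq_add_map_mirror hA' h hh]
  rw [memLp_two_iff_lintegral (h1.1.add_measure h2.1), lintegral_add_measure, ENNReal.add_lt_top]
  exact ⟨(memLp_two_iff_lintegral h1.1).1 h1, (memLp_two_iff_lintegral h2.1).1 h2⟩

end Halves

/-! ### Half domains and cutoffs at the symmetry plane -/

section HalfDomains

variable {d : ℕ} {Ω Ω' P : Set (E (d + 1))} {S S' : Set (E d)} {k : Fin d}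

/-- `Ω'` and `S'` are the halves of `Ω` and `S` on the positive side of the plane `{x_k = 0}`, and
`P` is the intersection of `Ω` with this plane. -/
structure IsHalf (k : Fin d) (Ω Ω' P : Set (E (d + 1))) (S S' : Set (E d)) : Prop where
  dom : ∀ x, x ∈ Ω' ↔ x ∈ Ω ∧ 0 < x k.castSucc
  top : ∀ y, y ∈ S' ↔ y ∈ S ∧ 0 < y k
  mid : ∀ x, x ∈ P ↔ x ∈ Ω ∧ x k.castSucc = 0

namespace IsHalf

theorem isOpen (H : IsHalf k Ω Ω' P S S') (hΩ : IsOpen Ω) : IsOpen Ω' := by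
  have : Ω' = Ω ∩ {x | 0 < x k.castSucc} := ext H.dom
  rw [this]
  exact hΩ.inter (isOpen_lt continuous_const (by fun_prop))

theorem measurableSet_top (H : IsHalf k Ω Ω' P S S') (hS : IsOpen S) : MeasurableSet S' := by
  have : S' = S ∩ {x | 0 < x k} := ext H.top
  rw [this]
  exact (hS.inter (isOpen_lt continuous_const (by fun_prop))).measurableSet

theorem nonneg_of_mem_closure (H : IsHalf k Ω Ω' P S S') {x : E (d + 1)} (hx : x ∈ closure Ω') :
    0 ≤ x k.castSucc := by
  have hc : IsClosed {x : E (d + 1) | 0 ≤ x k.castSucc} := isClosed_le continuous_const (by fun_prop)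
  exact closure_minimal (fun y hy => ((H.dom y).1 hy).2.le) hc hx

theorem mem_closure_of_pos (H : IsHalf k Ω Ω' P S S') {x : E (d + 1)} (hx : x ∈ closure Ω)
    (h0 : 0 < x k.castSucc) : x ∈ closure Ω' := by
  have : Ω' = {x | 0 < x k.castSucc} ∩ Ω := ext fun x => by rw [H.dom, and_comm]; rfl
  rw [this]
  exact (isOpen_lt continuous_const (by fun_prop)).inter_closure ⟨h0, hx⟩

theorem closure_subset (H : IsHalf k Ω Ω' P S S') : closure Ω' ⊆ closure Ω :=
  closure_mono fun x hx => ((H.dom x).1 hx).1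

end IsHalf

/-- The restriction of an `L²` function to a subset. -/
def restrictLp {n : ℕ} {F : Type*} [NormedAddCommGroup F] {A B : Set (E n)} (h : B ⊆ A)
    (f : Lp F 2 ((volume : Measure (E n)).restrict A)) : Lp F 2 ((volume : Measure (E n)).restrict B) :=
  ((Lp.memLp f).mono_measure (Measure.restrict_mono h le_rfl)).toLp f

theorem coeFn_restrictLp {n : ℕ} {F : Type*} [NormedAddCommGroup F] {A B : Set (E n)} (h : B ⊆ A)
    (f : Lp F 2 ((volume : Measure (E n)).restrict A)) :
    restrictLp h f =ᵐ[(volume : Measure (E n)).restrict B] f := MemLp.coeFn_toLp _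

theorem green_restrictLp {n : ℕ} {A B : Set (E n)} (hA : MeasurableSet A) (h : B ⊆ A) (u : L2 A)
    (G : L2Vec n A) {φ : E n → ℝ} (hs : tsupport φ ∩ A ⊆ B) (i : Fin n) :
    green (restrictLp h u) (restrictLp h G) φ i = green u G φ i := by
  have h1 : green (restrictLp h u) (restrictLp h G) φ i
      = ∫ x in B, (u x * (partialDeriv φ i x : ℂ) + G x i * (φ x : ℂ)) := by
    refine integral_congr_ae ?_
    filter_upwards [coeFn_restrictLp h u, coeFn_restrictLp h G] with x h1 h2
    rw [h1, h2]
  rw [h1]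
  refine (setIntegral_eq_of_subset_of_forall_sdiff_eq_zero hA h fun x hx => ?_).symm
  have h2 : x ∉ tsupport φ := fun h' => hx.2 (hs ⟨h', hx.1⟩)
  rw [image_eq_zero_of_notMem_tsupport h2,
    show partialDeriv φ i x = 0 from by_contra fun h' => h2 (support_partialDeriv_subset φ i h')]
  simp

theorem coordCutoff_eq_one {n : ℕ} {k : Fin n} {m : ℕ} {x : E n} (h : 2 ≤ m * x k) :
    coordCutoff k 1 m x = 1 := by
  refine Real.smoothTransition.one_of_one_le ?_
  rw [one_mul]
  linarith

/-- A test function that vanishes near the plane `{x_k = 0}` in `closure Ω'` can be cut off on the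
other side of this plane. -/
theorem exists_test_away {φ : E (d + 1) → ℝ} (hφ : IsTest φ)
    (hs : tsupport φ ∩ closure Ω' ⊆ {x | 0 < x k.castSucc}) :
    ∃ ψ : E (d + 1) → ℝ, IsTest ψ ∧ tsupport ψ ⊆ tsupport φ ∩ {x | 0 < x k.castSucc} ∧
      ∀ x ∈ closure Ω', ψ x = φ x := by
  have hc : IsCompact (tsupport φ ∩ closure Ω') := hφ.2.isCompact.inter_right isClosed_closure
  -- On the compact set in question `x_k` is bounded away from zero, so a fixed cutoff equals one
  -- there.
  obtain ⟨δ, hδ, hδ'⟩ : ∃ δ > 0, ∀ x ∈ tsupport φ ∩ closure Ω', δ ≤ x k.castSucc := by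
    rcases (tsupport φ ∩ closure Ω').eq_empty_or_nonempty with h0 | hne
    · exact ⟨1, one_pos, by simp [h0]⟩
    · obtain ⟨x₀, hx₀, hmin⟩ := hc.exists_isMinOn hne
        (f := fun x : E (d + 1) => x k.castSucc) (by fun_prop)
      exact ⟨x₀ k.castSucc, hs hx₀, fun x hx => hmin hx⟩
  obtain ⟨m, hm⟩ := exists_nat_gt (2 / δ)
  have hm0 : (0 : ℝ) < m := (by positivity : (0 : ℝ) < 2 / δ).trans hm
  refine ⟨fun x => coordCutoff k.castSucc 1 m x * φ x, hφ.mul_left (contDiff_coordCutoff _ _ _),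
    fun x hx => ?_, fun x hx => ?_⟩
  · obtain ⟨h1, h2⟩ := tsupport_coordCutoff_mul k.castSucc 1 m φ hx
    refine ⟨h1, ?_⟩
    rw [mem_ofPred_eq, one_mul] at h2
    rw [mem_ofPred_eq]
    by_contra hcon
    push Not at hcon
    have := mul_nonpos_of_nonneg_of_nonpos hm0.le hcon
    linarith
  · by_cases h1 : x ∈ tsupport φ
    · change coordCutoff k.castSucc 1 m x * φ x = φ x
      rw [coordCutoff_eq_one, one_mul]
      have h2 := hδ' x ⟨h1, hx⟩
      rw [div_lt_iff₀ hδ] at hm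
      have := mul_le_mul_of_nonneg_left h2 hm0.le
      linarith
    · change coordCutoff k.castSucc 1 m x * φ x = φ x
      rw [image_eq_zero_of_notMem_tsupport h1, mul_zero]

theorem partialDeriv_coordCutoff_self {n : ℕ} (k : Fin n) (m : ℕ) (x : E n) :
    partialDeriv (coordCutoff k 1 m) k x = m * deriv Real.smoothTransition (m * x k - 1) := by
  have hd : Differentiable ℝ Real.smoothTransition := Real.smoothTransition.contDiff.differentiable
    (n := 1) one_ne_zero
  have h1 : HasLineDerivAt ℝ (coordCutoff k 1 m) (m * deriv Real.smoothTransition (m * x k - 1)) x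
      (EuclideanSpace.single k 1) := by
    unfold HasLineDerivAt
    have e : (fun t : ℝ => coordCutoff k 1 m (x + t • EuclideanSpace.single k 1))
        = fun t => Real.smoothTransition (m * (x k + t) - 1) := by
      ext t
      simp [coordCutoff]
    rw [e]
    have h2 : HasDerivAt (fun t : ℝ => m * (x k + t) - 1) (m : ℝ) 0 := by
      simpa using (((hasDerivAt_id (0 : ℝ)).const_add (x k)).const_mul (m : ℝ)).sub_const 1
    have h3 : HasDerivAt Real.smoothTransition (deriv Real.smoothTransition (m * x k - 1))
        (m * (x k + 0) - 1) := by
      rw [add_zero]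
      exact (hd _).hasDerivAt
    have h4 := HasDerivAt.comp (0 : ℝ) h3 h2
    rw [mul_comm]
    exact h4
  unfold partialDeriv
  rw [← ((contDiff_coordCutoff k 1 m).differentiable (by simp) x).lineDeriv_eq_fderiv]
  exact h1.lineDeriv

theorem deriv_smoothTransition_eq_zero {t : ℝ} (ht : t ∉ Icc (0 : ℝ) 1) :
    deriv Real.smoothTransition t = 0 := by
  rw [mem_Icc, not_and_or, not_le, not_le] at ht
  rcases ht with ht | ht
  · have : Real.smoothTransition =ᶠ[𝓝 t] fun _ => 0 := by
      filter_upwards [gt_mem_nhds ht] with s hs using Real.smoothTransition.zero_of_nonpos hs.le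
    rw [this.deriv_eq, deriv_const]
  · have : Real.smoothTransition =ᶠ[𝓝 t] fun _ => 1 := by
      filter_upwards [lt_mem_nhds ht] with s hs using Real.smoothTransition.one_of_one_le hs.le
    rw [this.deriv_eq, deriv_const]

/-- The derivative is of size `m`, but lives only where `1 ≤ m x_k ≤ 2`; there the factor `|x_k|`
compensates `m`. -/
theorem exists_bound_partialDeriv_coordCutoff {n : ℕ} (k : Fin n) :
    ∃ M : ℝ, 0 ≤ M ∧ ∀ (m : ℕ) (x : E n), |partialDeriv (coordCutoff k 1 m) k x| * |x k| ≤ M := by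
  obtain ⟨M, hM⟩ := (isCompact_Icc (a := (0 : ℝ)) (b := 1)).exists_bound_of_continuousOn
    ((Real.smoothTransition.contDiff (n := 1)).continuous_deriv le_rfl).continuousOn
  have hM0 : 0 ≤ M := (norm_nonneg _).trans (hM 0 (by simp))
  refine ⟨2 * M, by positivity, fun m x => ?_⟩
  rw [partialDeriv_coordCutoff_self]
  by_cases h : (m * x k - 1 : ℝ) ∈ Icc (0 : ℝ) 1
  · have h1 := hM _ h
    rw [Real.norm_eq_abs] at h1
    have h2 : |(m : ℝ) * x k| ≤ 2 := by
      rw [abs_le]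
      constructor <;> linarith [h.1, h.2]
    rw [abs_mul, mul_right_comm, ← abs_mul]
    exact mul_le_mul h2 h1 (abs_nonneg _) zero_le_two
  · rw [deriv_smoothTransition_eq_zero h]
    simpa using hM0

/-- In the normal direction the cutoff is differentiated. The extra term stays bounded since `φ`
vanishes linearly at the plane, and it tends to zero at each point of `A`. -/
theorem tendsto_green_coordCutoff_self {n : ℕ} {A : Set (E n)} (hA : MeasurableSet A) {k : Fin n}
    (hσ : ∀ x ∈ A, 0 < x k) (u : L2 A) (G : L2Vec n A) {φ : E n → ℝ} (hφ : IsTest φ) {L : ℝ}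
    (hL : ∀ x, |φ x| ≤ L * |x k|) :
    Tendsto (fun m => green u G (fun x => coordCutoff k 1 m x * φ x) k) atTop (𝓝 (green u G φ k)) := by
  have h := tendsto_integral_coordCutoff (green_integrable u G hφ k) (π := id) measurable_id
    (k := k) (σ := 1) ((ae_restrict_iff' hA).2 (Eventually.of_forall fun x hx => by
      rw [one_mul]; exact hσ x hx))
  obtain ⟨M, hM0, hM⟩ := exists_bound_partialDeriv_coordCutoff k
  have hcd : ∀ m, Continuous (partialDeriv (coordCutoff k 1 m) k) := fun m => by
    have := (contDiff_coordCutoff k 1 m).continuous_fderiv (by simp)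
    unfold partialDeriv
    fun_prop
  have hK : IsCompact (tsupport φ) := hφ.2
  have hui : Integrable ((tsupport φ).indicator fun x => ‖u x‖ * (M * L)) ((volume : Measure (E n)).restrict A) := by
    rw [integrable_indicator_iff hK.measurableSet]
    have : IsFiniteMeasure (((volume : Measure (E n)).restrict A).restrict (tsupport φ)) :=
      ⟨by
        rw [Measure.restrict_apply_univ]
        exact hK.measure_lt_top⟩
    exact (((Lp.memLp u).restrict (tsupport φ)).integrable (by norm_num)).norm.mul_const _
  have h2 : Tendsto (fun m => ∫ x in A, u x * ((partialDeriv (coordCutoff k 1 m) k x * φ x : ℝ) : ℂ))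
      atTop (𝓝 (∫ _ in A, (0 : ℂ))) := by
    refine tendsto_integral_of_dominated_convergence _ (fun m => ?_) hui
      (fun m => Eventually.of_forall fun x => ?_) ?_
    · refine (Lp.aestronglyMeasurable u).mul ?_
      exact (Complex.continuous_ofReal.comp ((hcd m).mul hφ.1.continuous)).aestronglyMeasurable
    · rw [norm_mul, Complex.norm_real, Real.norm_eq_abs, abs_mul]
      by_cases hx : x ∈ tsupport φ
      · rw [indicator_of_mem hx]
        refine mul_le_mul_of_nonneg_left ?_ (norm_nonneg _)
        have hL0 : 0 ≤ L * |x k| := (abs_nonneg _).trans (hL x)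
        by_cases hxk : x k = 0
        · have : φ x = 0 := by simpa [hxk] using hL x
          have hL' : 0 ≤ L := by
            by_contra hcon
            push Not at hcon
            have h3 := (abs_nonneg _).trans (hL (EuclideanSpace.single k 1))
            simp at h3
            linarith
          rw [this, abs_zero, mul_zero]
          exact mul_nonneg hM0 hL'
        · have hL' : 0 ≤ L := nonneg_of_mul_nonneg_left hL0 (abs_pos.2 hxk)
          calc |partialDeriv (coordCutoff k 1 m) k x| * |φ x|
              ≤ |partialDeriv (coordCutoff k 1 m) k x| * (L * |x k|) := by gcongr; exact hL x
            _ = |partialDeriv (coordCutoff k 1 m) k x| * |x k| * L := by ring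
            _ ≤ M * L := by gcongr; exact hM m x
      · rw [indicator_of_notMem hx, image_eq_zero_of_notMem_tsupport hx]
        simp
    · rw [ae_restrict_iff' hA]
      refine Eventually.of_forall fun x hx => tendsto_const_nhds.congr' ?_
      filter_upwards [(tendsto_natCast_atTop_atTop (R := ℝ)).eventually_gt_atTop (2 / x k)] with m hm
      rw [div_lt_iff₀ (hσ x hx)] at hm
      rw [partialDeriv_coordCutoff_self, deriv_smoothTransition_eq_zero]
      · simp
      · rw [mem_Icc, not_and_or]
        right
        linarith
  rw [integral_zero] at h2
  have h3 := h.add h2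
  rw [add_zero] at h3
  refine h3.congr fun m => ?_
  have hφm : IsTest fun x => partialDeriv (coordCutoff k 1 m) k x * φ x := by
    refine hφ.mul_left ?_
    have h5 : ContDiff ℝ ∞ (fderiv ℝ (coordCutoff k 1 m)) :=
      (contDiff_coordCutoff k 1 m).fderiv_right (by simp)
    unfold partialDeriv
    fun_prop
  unfold green
  rw [← integral_add]
  · refine integral_congr_ae (Eventually.of_forall fun x => ?_)
    simp only [id]
    rw [partialDeriv_mul ((contDiff_coordCutoff k 1 m).differentiable (by simp))
      (hφ.1.differentiable (by simp))]
    push_cast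
    ring
  · have h4 := (green_integrable u G hφ k).norm
    refine (green_integrable u G hφ k).bdd_mul (c := 1) ?_ ?_
    · exact (Complex.continuous_ofReal.comp (contDiff_coordCutoff k 1 m).continuous).aestronglyMeasurable
    · refine Eventually.of_forall fun x => ?_
      have h0 : 0 ≤ coordCutoff k 1 m x := Real.smoothTransition.nonneg _
      rw [id, Complex.norm_real, Real.norm_eq_abs, abs_of_nonneg h0]
      exact Real.smoothTransition.le_one _
  · exact integrable_mul_test (Lp.memLp u) hφm.1.continuous hφm.2

theorem exists_test_eq_one {n : ℕ} {C U : Set (E n)} (hC : IsCompact C) (hU : IsOpen U) (h : C ⊆ U) :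
    ∃ χ : E n → ℝ, IsTest χ ∧ tsupport χ ⊆ U ∧ ∀ x ∈ C, χ x = 1 := by
  obtain ⟨δ, hδ, hδU⟩ := hC.exists_cthickening_subset_open hU h
  obtain ⟨f, hf, -, hs, h1⟩ := exists_contMDiff_support_eq_eq_one_iff (n := (⊤ : ℕ∞))
    (modelWithCornersSelf ℝ (E n)) Metric.isOpen_thickening hC.isClosed
    (Metric.self_subset_thickening hδ C)
  have ht : tsupport f ⊆ Metric.cthickening δ C := by
    rw [tsupport, hs]
    exact Metric.closure_thickening_subset_cthickening δ C
  exact ⟨f, ⟨hf.contDiff, hC.cthickening.of_isClosed_subset (isClosed_tsupport f) ht⟩,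
    ht.trans hδU, fun x hx => (h1 x).1 hx⟩

/-- A point and its mirror image are `2 |x_k|` apart while the values differ by `2 |φ x|`, so the
Lipschitz constant works. -/
theorem abs_le_of_odd_test {n : ℕ} {φ : E n → ℝ} (hφ : IsTest φ) {k : Fin n}
    (ho : ∀ x, φ (mirror k x) = -φ x) : ∃ L : ℝ, ∀ x, |φ x| ≤ L * |x k| := by
  obtain ⟨L, hL⟩ := hφ.1.lipschitzWith_of_hasCompactSupport hφ.2 (by simp)
  refine ⟨L, fun x => ?_⟩
  have h1 := hL.dist_le_mul x (mirror k x)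
  have h2 : x - mirror k x = EuclideanSpace.single k (2 * x k) := by
    ext i
    by_cases h : i = k
    · subst h
      simp
      ring
    · simp [mirror_of_ne h, h]
  rw [dist_eq_norm, dist_eq_norm, ho, h2, PiLp.norm_single, sub_neg_eq_add, ← two_mul, norm_mul,
    norm_mul, Real.norm_eq_abs, Real.norm_eq_abs, Real.norm_eq_abs, abs_two] at h1
  linarith

end HalfDomains

/-! ### Restriction of odd functions to the half domain -/

section RestrictExtend

variable {d : ℕ} {Ω Ω' P : Set (E (d + 1))} {S S' : Set (E d)} {k : Fin d}

theorem green_add_test {n : ℕ} {A : Set (E n)} (u : L2 A) (G : L2Vec n A) {φ ψ : E n → ℝ}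
    (hφ : IsTest φ) (hψ : IsTest ψ) (i : Fin n) :
    green u G (φ + ψ) i = green u G φ i + green u G ψ i := by
  unfold green
  rw [← integral_add (green_integrable u G hφ i) (green_integrable u G hψ i)]
  refine integral_congr_ae (Eventually.of_forall fun x => ?_)
  have : partialDeriv (φ + ψ) i x = partialDeriv φ i x + partialDeriv ψ i x := by
    unfold partialDeriv
    rw [fderiv_add (hφ.1.differentiable (by simp) x) (hψ.1.differentiable (by simp) x)]
    rfl
  simp only [this, Pi.add_apply]
  push_cast
  ring

theorem green_smul_test {n : ℕ} {A : Set (E n)} (u : L2 A) (G : L2Vec n A) (c : ℝ) {φ : E n → ℝ}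
    (hφ : IsTest φ) (i : Fin n) :
    green u G (c • φ) i = (c : ℂ) * green u G φ i := by
  unfold green
  rw [← integral_const_mul]
  refine integral_congr_ae (Eventually.of_forall fun x => ?_)
  have : partialDeriv (c • φ) i x = c * partialDeriv φ i x := by
    unfold partialDeriv
    rw [fderiv_const_smul (hφ.1.differentiable (by simp) x)]
    rfl
  simp only [this, Pi.smul_apply, smul_eq_mul]
  push_cast
  ring

theorem IsTest.smul {n : ℕ} (c : ℝ) {φ : E n → ℝ} (hφ : IsTest φ) : IsTest (c • φ) :=
  ⟨hφ.1.const_smul c, hφ.2.smul_left (f := fun _ => c)⟩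

/-- `green` on a half domain for the restriction of odd data. -/
theorem green_half_odd {n : ℕ} {k : Fin n} {A A' : Set (E n)} (hA' : MeasurableSet A')
    (h : ∀ x, mirror k x ∈ A ↔ x ∈ A) (hh : ∀ x, x ∈ A' ↔ x ∈ A ∧ 0 < x k) (hs : A' ⊆ A)
    {u : L2 A} {G : L2Vec n A}
    (hu : ∀ᵐ x ∂(volume : Measure (E n)).restrict A, u (mirror k x) = -u x)
    (hG : ∀ᵐ x ∂(volume : Measure (E n)).restrict A, mirror k (G (mirror k x)) = -G x)
    {φ : E n → ℝ} (hφ : IsTest φ) (he : ∀ x, φ (mirror k x) = φ x) :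
    green u G φ k = 2 * green (restrictLp hs u) (restrictLp hs G) φ k := by
  unfold green
  rw [setIntegral_mirror hA' h hh (green_integrable u G hφ k), ← integral_const_mul]
  refine integral_congr_ae ?_
  filter_upwards [coeFn_restrictLp hs u, coeFn_restrictLp hs G,
    ae_restrict_of_ae_restrict_of_subset hs hu, ae_restrict_of_ae_restrict_of_subset hs hG]
    with x h1 h2 h3 h4
  have h5 : partialDeriv φ k (mirror k x) = -partialDeriv φ k x := by
    have := partialDeriv_comp_mirror hφ k k x
    simp only [he] at this
    rw [this]
    simp
  have h6 : G (mirror k x) k = G x k := by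
    have := congrArg (fun v : EuclideanSpace ℂ (Fin n) => v k) h4
    simpa using this
  rw [h1, h2, h3, h5, h6, he]
  push_cast
  ring

namespace Sob

/-- The restriction of an odd function to the half domain. -/
theorem exists_restrict (hΩ : FlatTop Ω S) (h : MirrorSymm k Ω S) (H : IsHalf k Ω Ω' P S S')
    {φ : Sob Ω S} (hφ : φ ∈ odd h) :
    ∃ w : Sob Ω' S', VanishesOn w.fn w.grad P ∧
      w.fn =ᵐ[(volume : Measure (E (d + 1))).restrict Ω'] φ.fn ∧
      w.grad =ᵐ[(volume : Measure (E (d + 1))).restrict Ω'] φ.grad ∧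
      w.trace =ᵐ[(volume : Measure (E d)).restrict S'] φ.trace := by
  have hs : Ω' ⊆ Ω := fun x hx => ((H.dom x).1 hx).1
  have hsS : S' ⊆ S := fun x hx => ((H.top x).1 hx).1
  have hO : IsOpen Ω' := H.isOpen hΩ.isOpen
  have hvan : VanishesOn (restrictLp hs φ.fn) (restrictLp hs φ.grad) P := by
    intro η hη hηs i
    by_cases hi : i = k.castSucc
    · subst hi
      -- Normal direction: the cutoff `χ` makes the test function compactly supported in `Ω` without
      -- changing it on the half, so that it can be split into an even and an odd part.
      obtain ⟨χ, hχ, hχs, hχ1⟩ := exists_test_eq_one (hη.2.isCompact.inter_right isClosed_closure)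
        hΩ.isOpen (C := tsupport η ∩ closure Ω') fun x hx => by
          rcases hηs hx with h1 | h1
          · exact hs h1
          · exact ((H.mid x).1 h1).1
      set ψ : E (d + 1) → ℝ := fun x => χ x * η x with hψ
      have hψt : IsTest ψ := hχ.mul hη
      have hψs : tsupport ψ ⊆ Ω := (closure_mono (Function.support_mul_subset_left χ η)).trans hχs
      have e1 : green (restrictLp hs φ.fn) (restrictLp hs φ.grad) η k.castSucc
          = green (restrictLp hs φ.fn) (restrictLp hs φ.grad) ψ k.castSucc := by
        refine green_congr hO _ _ (fun x hx => ?_) _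
        by_cases hx' : x ∈ tsupport η
        · rw [hψ]
          change _ = χ x * η x
          rw [hχ1 x ⟨hx', subset_closure hx⟩, one_mul]
        · change _ = χ x * η x
          rw [image_eq_zero_of_notMem_tsupport hx', mul_zero]
      set ψm : E (d + 1) → ℝ := fun x => ψ (_root_.mirror k.castSucc x) with hψm
      have hψmt : IsTest ψm := hψt.comp_mirror _
      have hψms : tsupport ψm ⊆ Ω := by
        rw [hψm, tsupport_comp_mirror]
        exact fun x hx => (h.dom x).1 (hψs hx)
      have hmm : ∀ x, ψm (_root_.mirror k.castSucc x) = ψ x := fun x => by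
        simp only [hψm, _root_.mirror_mirror]
      have e2 : ψ = (2⁻¹ : ℝ) • (ψ + ψm) + (2⁻¹ : ℝ) • (ψ - ψm) := by
        ext x
        simp only [Pi.add_apply, Pi.smul_apply, Pi.sub_apply, smul_eq_mul]
        ring
      -- For an even test function, Green's expression over `Ω` is zero and is twice the one over
      -- the half.
      have hev : green (restrictLp hs φ.fn) (restrictLp hs φ.grad) (ψ + ψm) k.castSucc = 0 := by
        have h1 := green_half_odd hO.measurableSet h.dom H.dom hs ((mem_odd_iff_ae h hΩ).1 hφ)
          (grad_ae_of_mem_odd h hφ) (hψt.add hψmt) fun x => by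
            simp only [Pi.add_apply, hmm]
            exact add_comm _ _
        have h2 := φ.isWeakGradient (ψ + ψm) (hψt.add hψmt)
          (tsupport_add_subset_union.trans (union_subset hψs hψms)) k.castSucc
        rw [h2] at h1
        simpa using h1.symm
      -- An odd test function vanishes linearly at the plane and can be cut off there.
      have hodd : green (restrictLp hs φ.fn) (restrictLp hs φ.grad) (ψ - ψm) k.castSucc = 0 := by
        obtain ⟨L, hL⟩ := abs_le_of_odd_test (hψt.sub hψmt) (k := k.castSucc) fun x => by
          simp only [Pi.sub_apply, hmm]
          exact (neg_sub _ _).symm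
        have h1 := tendsto_green_coordCutoff_self hO.measurableSet (fun x hx => ((H.dom x).1 hx).2)
          (restrictLp hs φ.fn) (restrictLp hs φ.grad) (hψt.sub hψmt) hL
        refine tendsto_nhds_unique h1 (tendsto_const_nhds.congr fun m => ?_)
        have hsub : tsupport (fun x => coordCutoff k.castSucc 1 m x * (ψ - ψm) x) ⊆
            Ω ∩ {x | 1 ≤ m * (1 * x k.castSucc)} := by
          refine (tsupport_coordCutoff_mul _ _ _ _).trans (inter_subset_inter_left _ ?_)
          rw [sub_eq_add_neg]
          refine tsupport_add_subset_union.trans (union_subset hψs ?_)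
          rw [tsupport, Function.support_neg]
          exact hψms
        have hpos : ∀ x, x ∈ tsupport (fun x => coordCutoff k.castSucc 1 m x * (ψ - ψm) x) → x ∈ Ω' := by
          intro x hx
          refine (H.dom x).2 ⟨(hsub hx).1, ?_⟩
          have h3 := (hsub hx).2
          rw [mem_ofPred_eq, one_mul] at h3
          by_contra hcon
          push Not at hcon
          have := mul_nonpos_of_nonneg_of_nonpos (Nat.cast_nonneg m) hcon
          linarith
        rw [green_restrictLp hΩ.isOpen.measurableSet hs _ _ fun x hx => hpos x hx.1]
        exact (φ.isWeakGradient _ ((hψt.sub hψmt).mul_left (contDiff_coordCutoff _ _ _))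
          (fun x hx => (hsub hx).1) _).symm
      rw [e1, e2, green_add_test _ _ ((hψt.add hψmt).smul _) ((hψt.sub hψmt).smul _),
        green_smul_test _ _ _ (hψt.add hψmt), green_smul_test _ _ _ (hψt.sub hψmt), hev, hodd]
      simp
    -- Tangential directions do not notice a cutoff in `x_k`.
    · have h1 := tendsto_green_coordCutoff hO.measurableSet hi (σ := 1) (fun x hx => by
        rw [one_mul]; exact ((H.dom x).1 hx).2) (restrictLp hs φ.fn) (restrictLp hs φ.grad) hη
      refine tendsto_nhds_unique h1 (tendsto_const_nhds.congr fun m => ?_)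
      set θ : E (d + 1) → ℝ := fun x => coordCutoff k.castSucc 1 m x * η x with hθ
      have hθt : IsTest θ := hη.mul_left (contDiff_coordCutoff _ _ _)
      have hpos : ∀ x ∈ tsupport θ, x ∈ tsupport η ∧ 0 < x k.castSucc := by
        intro x hx
        obtain ⟨h2, h3⟩ := tsupport_coordCutoff_mul _ _ _ _ hx
        refine ⟨h2, ?_⟩
        rw [mem_ofPred_eq, one_mul] at h3
        by_contra hcon
        push Not at hcon
        have := mul_nonpos_of_nonneg_of_nonpos (Nat.cast_nonneg m) hcon
        linarith
      have hin : tsupport θ ∩ closure Ω ⊆ Ω' := by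
        rintro x ⟨hx, hx'⟩
        rcases hηs ⟨(hpos x hx).1, H.mem_closure_of_pos hx' (hpos x hx).2⟩ with h2 | h2
        · exact h2
        · exact absurd ((H.mid x).1 h2).2 (hpos x hx).2.ne'
      rw [green_restrictLp hΩ.isOpen.measurableSet hs _ _
        fun x hx => hin ⟨hx.1, subset_closure hx.2⟩]
      exact (φ.isWeakGradient.green_eq_zero hΩ.isOpen hθt (hin.trans hs) i).symm
  refine ⟨mk (u := restrictLp hs φ.fn) (G := restrictLp hs φ.grad) (g := restrictLp hsS φ.trace)
    (fun η hη hηs i => hvan η hη (inter_subset_left.trans (hηs.trans subset_union_left)) i)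
    (fun η hη hηs => ?_), hvan, coeFn_restrictLp hs _, coeFn_restrictLp hs _, coeFn_restrictLp hsS _⟩
  -- Tests for the trace stay away from the symmetry plane, so after truncation they are admissible
  -- on the whole domain.
  obtain ⟨ψ, hψ, hψs, hψη⟩ := exists_test_away (k := k) hη (Ω' := Ω') fun x hx => by
    rcases hηs hx with h1 | ⟨y, hy, rfl⟩
    · exact ((H.dom x).1 h1).2
    · rw [mem_ofPred_eq, toSurface_castSucc]
      exact ((H.top y).1 hy).2
  have hin : tsupport ψ ∩ closure Ω ⊆ Ω' ∪ toSurface '' S' := fun x hx =>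
    hηs ⟨(hψs hx.1).1, H.mem_closure_of_pos hx.2 (hψs hx.1).2⟩
  have hnot : ∀ x ∈ Ω, x ∉ toSurface '' S' := by
    rintro _ hx ⟨y, -, rfl⟩
    exact hΩ.toSurface_notMem y hx
  have hcl : ∀ y ∈ S', toSurface y ∈ closure Ω' := fun y hy =>
    H.mem_closure_of_pos (hΩ.top_mem y (hsS hy)) (by
      rw [toSurface_castSucc]
      exact ((H.top y).1 hy).2)
  rw [green_congr hO _ _ fun x hx => (hψη x (subset_closure hx)).symm,
    green_restrictLp hΩ.isOpen.measurableSet hs _ _ fun x hx =>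
      (hin ⟨hx.1, subset_closure hx.2⟩).resolve_right (hnot x hx.2),
    φ.isSurfaceTrace ψ hψ (hin.trans (union_subset_union hs (image_mono hsS)))]
  have e1 : ∫ y in S, φ.trace y * (ψ (toSurface y) : ℂ) = ∫ y in S', φ.trace y * (ψ (toSurface y) : ℂ) := by
    refine setIntegral_eq_of_subset_of_forall_sdiff_eq_zero hΩ.isOpen_top.measurableSet hsS
      fun y hy => ?_
    rw [image_eq_zero_of_notMem_tsupport (f := ψ) (x := toSurface y) fun h' => hy.2 ?_]
    · simp
    · have := (hψs h').2
      rw [mem_ofPred_eq, toSurface_castSucc] at this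
      exact (H.top y).2 ⟨hy.1, this⟩
  rw [e1]
  refine integral_congr_ae ?_
  filter_upwards [coeFn_restrictLp hsS φ.trace,
    ae_restrict_mem (μ := volume) (H.measurableSet_top hΩ.isOpen_top)] with y hy hyS
  rw [hy, hψη _ (hcl y hyS)]

end Sob

end RestrictExtend

/-! ### Odd extension from the half domain -/

section RestrictExtend

variable {d : ℕ} {Ω Ω' P : Set (E (d + 1))} {S S' : Set (E d)} {k : Fin d}

/-- `green` for the odd extension of data on a half domain. -/
theorem green_oddExt {n : ℕ} {k : Fin n} {A A' : Set (E n)} (hA' : MeasurableSet A')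
    (h : ∀ x, mirror k x ∈ A ↔ x ∈ A) (hh : ∀ x, x ∈ A' ↔ x ∈ A ∧ 0 < x k)
    {u : L2 A} {G : L2Vec n A} {w : L2 A'} {F : L2Vec n A'}
    (hu : u =ᵐ[(volume : Measure (E n)).restrict A] oddExt k id w)
    (hG : G =ᵐ[(volume : Measure (E n)).restrict A] oddExt k (mirror k) F)
    {φ : E n → ℝ} (hφ : IsTest φ) (i : Fin n) :
    green u G φ i = green w F φ i
      - (if i = k then -1 else 1) * green w F (fun x => φ (mirror k x)) i := by
  unfold green
  rw [setIntegral_mirror hA' h hh (green_integrable u G hφ i), ← integral_const_mul,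
    ← integral_sub (green_integrable w F hφ i)
      ((green_integrable w F (hφ.comp_mirror k) i).const_mul _)]
  refine integral_congr_ae ?_
  filter_upwards [(ae_restrict_iff_mirror hA' h hh).1 hu, (ae_restrict_iff_mirror hA' h hh).1 hG,
    ae_restrict_mem hA'] with x h1 h2 hx
  have hx0 := ((hh x).1 hx).2
  have h5 : partialDeriv φ i (mirror k x)
      = (if i = k then -1 else 1) * partialDeriv (fun x => φ (mirror k x)) i x := by
    rw [partialDeriv_comp_mirror hφ]
    split_ifs <;> simp
  rw [h1.1, h1.2, h2.1, h2.2, oddExt_of_pos _ _ hx0, oddExt_of_pos _ _ hx0,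
    oddExt_mirror_of_pos _ _ hx0, oddExt_mirror_of_pos _ _ hx0, h5, PiLp.neg_apply, mirror_apply]
  split_ifs <;> simp <;> ring

namespace Sob

/-- The odd extension of a function that vanishes on the middle plane. -/
theorem exists_extend (hΩ : FlatTop Ω S) (h : MirrorSymm k Ω S) (H : IsHalf k Ω Ω' P S S')
    {w : Sob Ω' S'} (hw : VanishesOn w.fn w.grad P) :
    ∃ φ ∈ odd h, w.fn =ᵐ[(volume : Measure (E (d + 1))).restrict Ω'] φ.fn ∧
      w.grad =ᵐ[(volume : Measure (E (d + 1))).restrict Ω'] φ.grad ∧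
      w.trace =ᵐ[(volume : Measure (E d)).restrict S'] φ.trace := by
  have hO : IsOpen Ω' := H.isOpen hΩ.isOpen
  have hS'm : MeasurableSet S' := H.measurableSet_top hΩ.isOpen_top
  have hu := memLp_oddExt hO.measurableSet h.dom H.dom (LinearIsometryEquiv.refl ℂ ℂ) (Lp.memLp w.fn)
  have hG := memLp_oddExt hO.measurableSet h.dom H.dom (_root_.mirror k.castSucc) (Lp.memLp w.grad)
  have hg := memLp_oddExt hS'm h.top H.top (LinearIsometryEquiv.refl ℂ ℂ) (Lp.memLp w.trace)
  have hgr : ∀ φ : E (d + 1) → ℝ, IsTest φ → ∀ i,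
      green (hu.toLp _ : L2 Ω) (hG.toLp _ : L2Vec (d + 1) Ω) φ i = green w.fn w.grad φ i
        - (if i = k.castSucc then -1 else 1)
          * green w.fn w.grad (fun x => φ (_root_.mirror k.castSucc x)) i := fun φ hφ i =>
    green_oddExt hO.measurableSet h.dom H.dom hu.coeFn_toLp hG.coeFn_toLp hφ i
  have hcl : ∀ x ∈ closure Ω', x ∈ Ω → x ∈ Ω' ∪ P := by
    intro x hx hxΩ
    rcases (H.nonneg_of_mem_closure hx).eq_or_lt with h0 | h0
    · exact Or.inr ((H.mid x).2 ⟨hxΩ, h0.symm⟩)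
    · exact Or.inl ((H.dom x).2 ⟨hxΩ, h0⟩)
  -- Green's expression of the extension splits into two expressions over the half, for the test
  -- function and its mirror image. Both are zero because `w` vanishes on the middle plane.
  have hwg : IsWeakGradient (hu.toLp _ : L2 Ω) (hG.toLp _ : L2Vec (d + 1) Ω) := by
    intro φ hφ hφs i
    rw [hgr φ hφ, hw φ hφ (fun x hx => hcl x hx.2 (hφs hx.1)), hw _ (hφ.comp_mirror _), mul_zero,
      sub_zero]
    rw [tsupport_comp_mirror]
    exact fun x hx => hcl x hx.2 ((h.dom x).1 (hφs hx.1))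
  have hlast : Fin.last d ≠ k.castSucc := (Fin.castSucc_lt_last k).ne'
  have half : ∀ ψ : E (d + 1) → ℝ, IsTest ψ → tsupport ψ ∩ closure Ω ⊆ Ω ∪ toSurface '' S →
      green w.fn w.grad ψ (Fin.last d) = ∫ y in S', w.trace y * (ψ (toSurface y) : ℂ) := by
    intro ψ hψ hψs
    have h1 := tendsto_green_coordCutoff hO.measurableSet hlast (σ := 1) (fun x hx => by
      rw [one_mul]; exact ((H.dom x).1 hx).2) w.fn w.grad hψ
    have h2 := tendsto_integral_coordCutoff (hψ.integrable_surface w.trace) (k := k.castSucc) (σ := 1)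
      continuous_toSurface.measurable ((ae_restrict_iff' hS'm).2 (Eventually.of_forall fun y hy => by
        rw [one_mul, toSurface_castSucc]; exact ((H.top y).1 hy).2))
    refine tendsto_nhds_unique h1 (h2.congr fun m => ?_)
    rw [w.isSurfaceTrace _ (hψ.mul_left (contDiff_coordCutoff _ _ _))]
    · refine integral_congr_ae (Eventually.of_forall fun y => ?_)
      simp only []
      push_cast
      ring
    · rintro x ⟨hx, hx'⟩
      obtain ⟨h3, h4⟩ := tsupport_coordCutoff_mul _ _ _ _ hx
      have h0 : 0 < x k.castSucc := by
        rw [mem_ofPred_eq, one_mul] at h4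
        by_contra hcon
        push Not at hcon
        have := mul_nonpos_of_nonneg_of_nonpos (Nat.cast_nonneg m) hcon
        linarith
      rcases hψs ⟨h3, H.closure_subset hx'⟩ with h5 | ⟨y, hy, rfl⟩
      · exact Or.inl ((H.dom x).2 ⟨h5, h0⟩)
      · rw [toSurface_castSucc] at h0
        exact Or.inr ⟨y, (H.top y).2 ⟨hy, h0⟩, rfl⟩
  have htr : IsSurfaceTrace (hu.toLp _ : L2 Ω) (hG.toLp _ : L2Vec (d + 1) Ω) (hg.toLp _ : L2 S) := by
    intro φ hφ hφs
    rw [hgr φ hφ, if_neg hlast, one_mul, half φ hφ hφs, half _ (hφ.comp_mirror _),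
      setIntegral_mirror hS'm h.top H.top (hφ.integrable_surface (hg.toLp _ : L2 S)),
      ← integral_sub (hφ.integrable_surface w.trace) ((hφ.comp_mirror k.castSucc).integrable_surface w.trace)]
    · refine integral_congr_ae ?_
      filter_upwards [(ae_restrict_iff_mirror hS'm h.top H.top).1 hg.coeFn_toLp, ae_restrict_mem hS'm]
        with y h1 hy
      have hy0 := ((H.top y).1 hy).2
      rw [h1.1, h1.2, oddExt_of_pos _ _ hy0, oddExt_mirror_of_pos _ _ hy0, toSurface_mirror]
      simp only [LinearIsometryEquiv.coe_refl, id]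
      ring
    · rw [tsupport_comp_mirror]
      rintro x ⟨hx, hx'⟩
      rcases hφs ⟨hx, (closure_mirror h.dom x).2 hx'⟩ with h1 | ⟨y, hy, hyx⟩
      · exact Or.inl ((h.dom x).1 h1)
      · refine Or.inr ⟨_root_.mirror k y, (h.top y).2 hy, ?_⟩
        rw [toSurface_mirror, hyx, _root_.mirror_mirror]
  refine ⟨mk hwg htr, ?_, ?_, ?_, ?_⟩
  · rw [mem_odd_iff_ae h hΩ, ae_restrict_iff_mirror hO.measurableSet h.dom H.dom]
    filter_upwards [(ae_restrict_iff_mirror hO.measurableSet h.dom H.dom).1 hu.coeFn_toLp,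
      ae_restrict_mem hO.measurableSet] with x h1 hx
    have hx0 := ((H.dom x).1 hx).2
    rw [fn_mk, _root_.mirror_mirror, h1.1, h1.2, oddExt_of_pos _ _ hx0, oddExt_mirror_of_pos _ _ hx0]
    simp
  · filter_upwards [(ae_restrict_iff_mirror hO.measurableSet h.dom H.dom).1 hu.coeFn_toLp,
      ae_restrict_mem hO.measurableSet] with x h1 hx
    rw [fn_mk, h1.1, oddExt_of_pos _ _ ((H.dom x).1 hx).2]
  · filter_upwards [(ae_restrict_iff_mirror hO.measurableSet h.dom H.dom).1 hG.coeFn_toLp,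
      ae_restrict_mem hO.measurableSet] with x h1 hx
    rw [grad_mk, h1.1, oddExt_of_pos _ _ ((H.dom x).1 hx).2]
  · filter_upwards [(ae_restrict_iff_mirror hS'm h.top H.top).1 hg.coeFn_toLp,
      ae_restrict_mem hS'm] with x h1 hx
    rw [trace_mk, h1.1, oddExt_of_pos _ _ ((H.top x).1 hx).2]

end Sob

/-- The inner product of two odd functions is twice the inner product over the half domain. -/
theorem inner_eq_two_mul_half {n : ℕ} {k : Fin n} {A A' : Set (E n)} {F : Type*}
    [NormedAddCommGroup F] [InnerProductSpace ℂ F] (hA' : MeasurableSet A')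
    (h : ∀ x, mirror k x ∈ A ↔ x ∈ A) (hh : ∀ x, x ∈ A' ↔ x ∈ A ∧ 0 < x k) (T : F ≃ₗᵢ[ℂ] F)
    {u v : Lp F 2 ((volume : Measure (E n)).restrict A)}
    {u' v' : Lp F 2 ((volume : Measure (E n)).restrict A')}
    (hu : ∀ᵐ x ∂(volume : Measure (E n)).restrict A, T (u (mirror k x)) = -u x)
    (hv : ∀ᵐ x ∂(volume : Measure (E n)).restrict A, T (v (mirror k x)) = -v x)
    (hu' : u' =ᵐ[(volume : Measure (E n)).restrict A'] u)
    (hv' : v' =ᵐ[(volume : Measure (E n)).restrict A'] v) :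
    inner ℂ u v = 2 * inner ℂ u' v' := by
  have hs : A' ⊆ A := fun x hx => ((hh x).1 hx).1
  rw [L2.inner_def, L2.inner_def, setIntegral_mirror hA' h hh
    (f := fun x => inner ℂ (u x) (v x)) (L2.integrable_inner u v),
    ← integral_const_mul]
  refine integral_congr_ae ?_
  filter_upwards [hu', hv', ae_restrict_of_ae_restrict_of_subset hs hu,
    ae_restrict_of_ae_restrict_of_subset hs hv] with x h1 h2 h3 h4
  have h5 : inner ℂ (u (mirror k x)) (v (mirror k x)) = inner ℂ (u x) (v x) := by
    rw [← T.inner_map_map, h3, h4, inner_neg_neg]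
  rw [h1, h2, h5]
  ring

namespace Sob

/-- Inner products of odd functions in terms of the half domain. -/
theorem inner_half (hΩ : FlatTop Ω S) (h : MirrorSymm k Ω S) (H : IsHalf k Ω Ω' P S S')
    {φ ψ : Sob Ω S} (hφ : φ ∈ odd h) (hψ : ψ ∈ odd h) {v w : Sob Ω' S'}
    (hv1 : v.fn =ᵐ[(volume : Measure (E (d + 1))).restrict Ω'] φ.fn)
    (hv2 : v.grad =ᵐ[(volume : Measure (E (d + 1))).restrict Ω'] φ.grad)
    (hv3 : v.trace =ᵐ[(volume : Measure (E d)).restrict S'] φ.trace)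
    (hw1 : w.fn =ᵐ[(volume : Measure (E (d + 1))).restrict Ω'] ψ.fn)
    (hw2 : w.grad =ᵐ[(volume : Measure (E (d + 1))).restrict Ω'] ψ.grad)
    (hw3 : w.trace =ᵐ[(volume : Measure (E d)).restrict S'] ψ.trace) :
    inner ℂ φ.fn ψ.fn = 2 * inner ℂ v.fn w.fn ∧ inner ℂ φ.grad ψ.grad = 2 * inner ℂ v.grad w.grad ∧
      inner ℂ φ.trace ψ.trace = 2 * inner ℂ v.trace w.trace := by
  have hO : MeasurableSet Ω' := (H.isOpen hΩ.isOpen).measurableSet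
  refine ⟨?_, ?_, ?_⟩
  · exact inner_eq_two_mul_half hO h.dom H.dom (LinearIsometryEquiv.refl ℂ ℂ)
      ((mem_odd_iff_ae h hΩ).1 hφ) ((mem_odd_iff_ae h hΩ).1 hψ) hv1 hw1
  · exact inner_eq_two_mul_half hO h.dom H.dom (_root_.mirror k.castSucc)
      (grad_ae_of_mem_odd h hφ) (grad_ae_of_mem_odd h hψ) hv2 hw2
  · exact inner_eq_two_mul_half (H.measurableSet_top hΩ.isOpen_top) h.top H.top
      (LinearIsometryEquiv.refl ℂ ℂ) (trace_ae_of_mem_odd h hφ) (trace_ae_of_mem_odd h hψ) hv3 hw3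

end Sob

end RestrictExtend

/-! ### Geometry of the canal and its cross-section -/

section Geometry

theorem continuous_insE {n : ℕ} (k : Fin (n + 1)) : Continuous (insE (n := n) k) := by
  refine (PiLp.continuous_toLp 2 (fun _ => ℝ)).comp (continuous_pi fun i => ?_)
  rcases Fin.eq_self_or_eq_succAbove k i with rfl | ⟨j, rfl⟩
  · exact continuous_fst.congr fun p => (insE_same i p).symm
  · have h : Continuous fun p : ℝ × E n => p.2 j := by fun_prop
    exact h.congr fun p => (insE_succAbove k p j).symm

/-- The upper side of the cross-section. -/
def sectionTop (l : ℝ) : Set (E 1) := {y | |y 0| < l}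

variable {l : ℝ} {Γ : Set (E 2)} {Θ : Set (E 3)}

theorem flatTop_section (hΓ_open : IsOpen Γ) (hΓ_lip : HasLipschitzBoundary Γ)
    (hΓ_low : ∀ x ∈ Γ, x 1 < 0)
    (hΓ_top : {x ∈ frontier Γ | x 1 = 0} = {x : E 2 | |x 0| ≤ l ∧ x 1 = 0}) :
    FlatTop Γ (sectionTop l) where
  isOpen := hΓ_open
  cone := hΓ_lip.localCone hΓ_open
  low := hΓ_low
  isOpen_top := isOpen_lt (by fun_prop) continuous_const
  top_mem y hy := by
    have h1 : toSurface y ∈ {x : E 2 | |x 0| ≤ l ∧ x 1 = 0} :=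
      ⟨(toSurface_castSucc y 0).symm ▸ (le_of_lt hy), toSurface_last y⟩
    rw [← hΓ_top] at h1
    exact frontier_subset_closure h1.1

/-- The point of `ℝ³` with the first coordinate `t` and the further coordinates `x`. -/
theorem insE_zero_mem_canal (p : ℝ × E 2) : insE 0 p ∈ canal Γ ↔ p.2 ∈ Γ := by
  have h1 : (!₂[insE 0 p 1, insE 0 p 2] : E 2) = p.2 := by
    have e1 : insE 0 p 1 = p.2 0 := insE_succAbove 0 p 0
    have e2 : insE 0 p 2 = p.2 1 := insE_succAbove 0 p 1
    ext i
    fin_cases i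
    · exact e1
    · exact e2
  change (!₂[insE 0 p 1, insE 0 p 2] : E 2) ∈ Γ ↔ _
  rw [h1]

theorem isOpen_canal (hΓ : IsOpen Γ) : IsOpen (canal Γ) := by
  refine hΓ.preimage ((PiLp.continuous_toLp 2 _).comp (continuous_pi fun i => ?_))
  fin_cases i <;> simp <;> fun_prop

theorem exists_section_radius (hΘ : Bornology.IsBounded Θ) :
    ∃ R > 0, ∀ p : ℝ × E 2, R < |p.1| → (insE 0 p ∈ waterDomain Γ Θ ↔ p.2 ∈ Γ) := by
  obtain ⟨R, hR⟩ := hΘ.closure.exists_norm_le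
  refine ⟨|R| + 1, by positivity, fun p hp => ?_⟩
  rw [waterDomain, Set.mem_sdiff, insE_zero_mem_canal, and_iff_left]
  intro h
  have h1 := abs_apply_le_norm (insE 0 p) 0
  rw [insE_same] at h1
  linarith [hR _ h, le_abs_self R]

theorem mirror_one_eq_reflect (x : E 3) : mirror (𝕜 := ℝ) 1 x = reflect x := by
  ext i
  rw [mirror_apply]
  fin_cases i <;> simp [reflect]

theorem mirrorSymm_water (hΩ_symm : ∀ x, x ∈ waterDomain Γ Θ ↔ reflect x ∈ waterDomain Γ Θ) :
    MirrorSymm (1 : Fin 2) (waterDomain Γ Θ) (waterSurface l) where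
  dom x := by
    have := hΩ_symm x
    rw [← mirror_one_eq_reflect] at this
    exact this.symm
  top y := by
    change |mirror 1 y 1| < l ↔ |y 1| < l
    rw [mirror_same, abs_neg]

theorem mirror_insE_zero (p : ℝ × E 2) :
    mirror (𝕜 := ℝ) 1 (insE 0 p) = insE 0 (p.1, mirror 0 p.2) := by
  ext i
  rw [mirror_apply]
  refine Fin.cases ?_ (fun j => ?_) i
  · rw [insE_same, insE_same]
    simp
  · have e1 := insE_succAbove 0 p j
    have e2 := insE_succAbove 0 (p.1, mirror (𝕜 := ℝ) 0 p.2) j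
    rw [Fin.zero_succAbove] at e1 e2
    rw [e1, e2, mirror_apply]
    fin_cases j <;> simp

/-- Only the water domain is assumed symmetric. Beyond the body its sections are the full
cross-section, which therefore inherits the symmetry. -/
theorem mirrorSymm_section (hΘ : Bornology.IsBounded Θ)
    (hΩ_symm : ∀ x, x ∈ waterDomain Γ Θ ↔ reflect x ∈ waterDomain Γ Θ) :
    MirrorSymm (0 : Fin 1) Γ (sectionTop l) where
  dom x := by
    obtain ⟨R, hR, h⟩ := exists_section_radius (Γ := Γ) hΘ
    have hR' : R < |R + 1| := by
      rw [abs_of_pos (by linarith)]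
      linarith
    have h1 := (mirrorSymm_water (l := l) hΩ_symm).dom (insE 0 (R + 1, x))
    have h2 : mirror (𝕜 := ℝ) (Fin.castSucc (1 : Fin 2)) (insE 0 (R + 1, x)) = _ := mirror_insE_zero (R + 1, x)
    rw [h2, h _ hR', h _ hR'] at h1
    exact h1
  top y := by
    change |mirror 0 y 0| < l ↔ |y 0| < l
    rw [mirror_same, abs_neg]

theorem isHalf_section : IsHalf (0 : Fin 1) Γ (halfSection Γ) (midLine Γ) (sectionTop l) (halfTop l) where
  dom _ := Iff.rfl
  mid _ := Iff.rfl
  top y := by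
    change 0 < y 0 ∧ y 0 < l ↔ |y 0| < l ∧ 0 < y 0
    constructor
    · rintro ⟨h1, h2⟩
      exact ⟨by rwa [abs_of_pos h1], h1⟩
    · rintro ⟨h1, h2⟩
      exact ⟨h2, by rwa [abs_of_pos h2] at h1⟩

theorem toSurface_eq_insE_zero (y : E 2) :
    toSurface y = insE 0 (y 0, toSurface (WithLp.toLp 2 fun _ : Fin 1 => y 1)) := by
  rw [eq_comm, eq_toSurface_iff]
  constructor
  · have := insE_succAbove 0 (y 0, toSurface (WithLp.toLp 2 fun _ : Fin 1 => y 1)) 1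
    refine this.trans ?_
    exact toSurface_last _
  · ext i
    fin_cases i
    · exact insE_same 0 _
    · exact (insE_succAbove 0 (y 0, toSurface (WithLp.toLp 2 fun _ : Fin 1 => y 1)) 0).trans
        (toSurface_castSucc _ 0)

theorem flatTop_water (hΓ : FlatTop Γ (sectionTop l))
    (hΘ_surf : ∀ y ∈ waterSurface l, toSurface y ∉ closure Θ)
    (hΩ_lip : HasLipschitzBoundary (waterDomain Γ Θ)) :
    FlatTop (waterDomain Γ Θ) (waterSurface l) := by
  have hO : IsOpen (waterDomain Γ Θ) := (isOpen_canal hΓ.isOpen).sdiff isClosed_closure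
  refine ⟨hO, hΩ_lip.localCone hO, fun x hx => hΓ.low _ hx.1,
    isOpen_lt (by fun_prop) continuous_const, fun y hy => ?_⟩
  have h1 : toSurface y ∈ closure (canal Γ) := by
    rw [toSurface_eq_insE_zero]
    have h2 := hΓ.top_mem (WithLp.toLp 2 fun _ : Fin 1 => y 1) hy
    have hc : Continuous fun x : E 2 => insE 0 (y 0, x) := (continuous_insE 0).comp (by fun_prop)
    exact map_mem_closure (f := fun x : E 2 => insE 0 (y 0, x)) hc h2 fun x hx => (insE_zero_mem_canal (y 0, x)).2 hx
  rw [waterDomain, Set.sdiff_eq, inter_comm]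
  exact isClosed_closure.isOpen_compl.inter_closure ⟨hΘ_surf y hy, h1⟩

/-- Oddness almost everywhere yields an everywhere odd representative by antisymmetrising any
representative. -/
theorem oddSubspace_eq_odd {Ω : Set (E 3)} {S : Set (E 2)} (hΩ : FlatTop Ω S)
    (h : MirrorSymm (1 : Fin 2) Ω S) : oddSubspace Ω S = Sob.odd h := by
  ext w
  rw [Sob.mem_odd_iff_ae h hΩ]
  have hcs : ∀ x : E 3, mirror (𝕜 := ℝ) (Fin.castSucc (1 : Fin 2)) x = reflect x := mirror_one_eq_reflect
  have hmem : ∀ x, reflect x ∈ Ω ↔ x ∈ Ω := fun x => by rw [← hcs]; exact h.dom x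
  have hrr : ∀ x, reflect (reflect x) = x := fun x => by rw [← hcs, ← hcs, mirror_mirror]
  constructor
  · rintro ⟨f, hf, hw⟩
    have hw' := (measurePreserving_mirror h.dom).quasiMeasurePreserving.ae hw
    filter_upwards [hw, hw'] with x h1 h2
    rw [h1, h2, hcs, hf]
  · intro hw
    refine ⟨fun x => (2⁻¹ : ℂ) * (w.fn x - w.fn (reflect x)), fun x => ?_, ?_⟩
    · simp only [hrr]
      ring
    · filter_upwards [hw] with x hx
      rw [hcs] at hx
      rw [hx]
      ring

/-- Restriction and odd extension carry eigenfunctions and test functions into each other, and the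
common factor two cancels in the equation. Testing any eigenfunction with itself and using the
minimality `hlow` shows that no eigenvalue is smaller. -/
theorem isLeast_steklov (hΓ : FlatTop Γ (sectionTop l)) (hconn : IsPreconnected Γ)
    (h : MirrorSymm (0 : Fin 1) Γ (sectionTop l)) {lam : ℝ}
    (hlow : ∀ ψ ∈ Sob.odd h, lam * ‖ψ.trace‖ ^ 2 ≤ ‖ψ.grad‖ ^ 2)
    {φ : Sob Γ (sectionTop l)} (hφ : φ ∈ Sob.odd h) (hφ0 : φ.fn ≠ 0)
    (hEL : ∀ ψ ∈ Sob.odd h, inner ℂ ψ.grad φ.grad = (lam : ℂ) * inner ℂ ψ.trace φ.trace) :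
    IsLeast {lam : ℝ | IsSteklovEigenvalue l Γ lam} lam := by
  constructor
  · obtain ⟨w, hw, hw1, hw2, hw3⟩ := Sob.exists_restrict hΓ h isHalf_section hφ
    refine ⟨w, fun h0 => ?_, hw, fun ψ hψ => ?_⟩
    · have h1 := (Sob.inner_half hΓ h isHalf_section hφ hφ hw1 hw2 hw3 hw1 hw2 hw3).1
      rw [h0, inner_zero_left, mul_zero] at h1
      exact hφ0 (inner_self_eq_zero.1 h1)
    · obtain ⟨χ, hχ, hχ1, hχ2, hχ3⟩ := Sob.exists_extend hΓ h isHalf_section hψ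
      have h1 := Sob.inner_half hΓ h isHalf_section hχ hφ hχ1 hχ2 hχ3 hw1 hw2 hw3
      have h2 := hEL χ hχ
      rw [h1.2.1, h1.2.2] at h2
      linear_combination (2⁻¹ : ℂ) * h2
  · rintro lam₀ ⟨w, hw0, hw, hEL₀⟩
    obtain ⟨χ, hχ, hχ1, hχ2, hχ3⟩ := Sob.exists_extend hΓ h isHalf_section hw
    have h1 := Sob.inner_half hΓ h isHalf_section hχ hχ hχ1 hχ2 hχ3 hχ1 hχ2 hχ3
    have h2 : ‖χ.grad‖ ^ 2 = lam₀ * ‖χ.trace‖ ^ 2 := by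
      have h3 : inner ℂ χ.grad χ.grad = (lam₀ : ℂ) * inner ℂ χ.trace χ.trace := by
        rw [h1.2.1, h1.2.2, hEL₀ w hw]
        ring
      have h4 := congrArg Complex.re h3
      have h5 : (inner ℂ χ.grad χ.grad).re = ‖χ.grad‖ ^ 2 := inner_self_eq_norm_sq (𝕜 := ℂ) _
      have h6 : (inner ℂ χ.trace χ.trace).re = ‖χ.trace‖ ^ 2 := inner_self_eq_norm_sq (𝕜 := ℂ) _
      rwa [Complex.re_ofReal_mul, h5, h6] at h4
    have h3 := hlow χ hχ
    rw [h2] at h3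
    -- A zero trace would force a zero gradient, hence by oddness the zero function.
    rcases (sq_nonneg ‖χ.trace‖).eq_or_lt with h4 | h4
    · exfalso
      rw [← h4, mul_zero] at h2
      have h5 := Sob.fn_eq_zero_of_grad hΓ.isOpen hconn h (Sob.mirrorFn_fn h hχ)
        (norm_eq_zero.1 (pow_eq_zero_iff two_ne_zero |>.1 h2))
      have h6 := h1.1
      rw [h5, inner_zero_left] at h6
      exact hw0 (inner_self_eq_zero.1 ((mul_eq_zero.1 h6.symm).resolve_left two_ne_zero))
    · exact le_of_mul_le_mul_right h3 h4

end Geometry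

/-! ### Functions of two variables: scalar products in one variable and Parseval's identity -/

section Slices

variable {Y T : Type*} [MeasurableSpace Y] [MeasurableSpace T] {ν : Measure Y} {μ : Measure T}
  [SigmaFinite ν] [SigmaFinite μ]

/-- The scalar product of `h` with a function of two variables, in the second variable. -/
def slice (h : Lp ℂ 2 μ) (f : Y × T → ℂ) (y : Y) : ℂ := ∫ t, (starRingEnd ℂ) (h t) * f (y, t) ∂μ

theorem ae_memLp_slice {f : Y × T → ℂ} (hf : MemLp f 2 (ν.prod μ)) :
    ∀ᵐ y ∂ν, MemLp (fun t => f (y, t)) 2 μ := by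
  have h1 := (memLp_two_iff_lintegral hf.1).1 hf
  rw [lintegral_prod _ (hf.1.enorm.pow_const 2)] at h1
  filter_upwards [ae_lt_top' (hf.1.enorm.pow_const 2).lintegral_prod_right' h1.ne, hf.1.prodMk_left]
    with y h2 h3
  exact (memLp_two_iff_lintegral h3).2 h2

theorem slice_eq_inner (h : Lp ℂ 2 μ) {f : Y × T → ℂ} {y : Y} (hf : MemLp (fun t => f (y, t)) 2 μ) :
    slice h f y = inner ℂ h (hf.toLp _) := by
  rw [L2.inner_def]
  refine integral_congr_ae ?_
  filter_upwards [hf.coeFn_toLp] with t ht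
  rw [ht, RCLike.inner_apply, mul_comm]

theorem aestronglyMeasurable_slice (h : Lp ℂ 2 μ) {f : Y × T → ℂ}
    (hf : AEStronglyMeasurable f (ν.prod μ)) : AEStronglyMeasurable (slice h f) ν := by
  have h1 : AEStronglyMeasurable (fun p : Y × T => (starRingEnd ℂ) (h p.2) * f p) (ν.prod μ) :=
    (Complex.continuous_conj.comp_aestronglyMeasurable (Lp.aestronglyMeasurable h).comp_snd).mul hf
  exact h1.integral_prod_right'

theorem memLp_slice (h : Lp ℂ 2 μ) {f : Y × T → ℂ} (hf : MemLp f 2 (ν.prod μ)) :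
    MemLp (slice h f) 2 ν := by
  rw [memLp_two_iff_lintegral (aestronglyMeasurable_slice h hf.1)]
  have h1 : ∫⁻ y, ‖slice h f y‖ₑ ^ 2 ∂ν ≤ ∫⁻ y, ENNReal.ofReal (‖h‖ ^ 2) * ∫⁻ t, ‖f (y, t)‖ₑ ^ 2 ∂μ ∂ν := by
    refine lintegral_mono_ae ?_
    filter_upwards [ae_memLp_slice hf] with y hy
    rw [slice_eq_inner h hy, ← norm_sq_toLp_two hy, ← ENNReal.ofReal_mul (sq_nonneg _),
      ← ofReal_norm, ← ENNReal.ofReal_pow (norm_nonneg _), ← mul_pow]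
    exact ENNReal.ofReal_le_ofReal (pow_le_pow_left₀ (norm_nonneg _) (norm_inner_le_norm _ _) 2)
  refine h1.trans_lt ?_
  rw [lintegral_const_mul'' _ (hf.1.enorm.pow_const 2).lintegral_prod_right',
    ← lintegral_prod _ (hf.1.enorm.pow_const 2)]
  exact ENNReal.mul_lt_top ENNReal.ofReal_lt_top ((memLp_two_iff_lintegral hf.1).1 hf)

theorem hasSum_sq_norm_inner {H ι : Type*} [NormedAddCommGroup H] [InnerProductSpace ℂ H]
    (b : HilbertBasis ι ℂ H) (x : H) : HasSum (fun i => ‖inner ℂ (b i) x‖ ^ 2) (‖x‖ ^ 2) := by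
  have h1 := (Complex.hasSum_iff _ _).1 (b.hasSum_inner_mul_inner x x)
  have h2 : (inner ℂ x x).re = ‖x‖ ^ 2 := inner_self_eq_norm_sq (𝕜 := ℂ) x
  rw [h2] at h1
  refine h1.1.congr_fun ?_
  intro i
  rw [← inner_conj_symm (b i) x, Complex.mul_conj, Complex.ofReal_re, Complex.normSq_eq_norm_sq,
    RCLike.norm_conj]

/-- Parseval's identity in the second variable. -/
theorem tsum_lintegral_slice {ι : Type*} [Countable ι] (b : HilbertBasis ι ℂ (Lp ℂ 2 μ))
    {f : Y × T → ℂ} (hf : MemLp f 2 (ν.prod μ)) :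
    ∑' i, ∫⁻ y, ‖slice (b i) f y‖ₑ ^ 2 ∂ν = ∫⁻ p, ‖f p‖ₑ ^ 2 ∂(ν.prod μ) := by
  rw [lintegral_prod _ (hf.1.enorm.pow_const 2),
    ← lintegral_tsum fun i => (aestronglyMeasurable_slice (b i) hf.1).enorm.pow_const 2]
  refine lintegral_congr_ae ?_
  filter_upwards [ae_memLp_slice hf] with y hy
  rw [← norm_sq_toLp_two hy]
  have h1 := hasSum_sq_norm_inner b (hy.toLp _)
  rw [← h1.tsum_eq, ENNReal.ofReal_tsum_of_nonneg (fun i => sq_nonneg _) h1.summable]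
  refine tsum_congr fun i => ?_
  rw [slice_eq_inner _ hy, ENNReal.ofReal_pow (norm_nonneg _), ofReal_norm]

theorem memLp_mul_prod {g : Y → ℂ} {h : T → ℂ} (hg : MemLp g 2 ν) (hh : MemLp h 2 μ) :
    MemLp (fun p : Y × T => g p.1 * h p.2) 2 (ν.prod μ) := by
  refine (memLp_two_iff_lintegral (f := fun p : Y × T => g p.1 * h p.2)
    (hg.1.comp_fst.mul hh.1.comp_snd)).2 ?_
  simp only [enorm_mul, mul_pow]
  rw [lintegral_prod_mul (hg.1.enorm.pow_const 2) (hh.1.enorm.pow_const 2)]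
  exact ENNReal.mul_lt_top ((memLp_two_iff_lintegral hg.1).1 hg) ((memLp_two_iff_lintegral hh.1).1 hh)

/-- Fubini's theorem for the pairing with a product. -/
theorem integral_mul_mul_prod {f : Y × T → ℂ} (hf : MemLp f 2 (ν.prod μ)) {g : Y → ℂ} {h : T → ℂ}
    (hg : MemLp g 2 ν) (hh : MemLp h 2 μ) :
    Integrable (fun p : Y × T => f p * (g p.1 * h p.2)) (ν.prod μ) ∧
      Integrable (fun t => h t * ∫ y, f (y, t) * g y ∂ν) μ ∧
      ∫ p, f p * (g p.1 * h p.2) ∂(ν.prod μ) = ∫ t, h t * ∫ y, f (y, t) * g y ∂ν ∂μ := by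
  have h1 : Integrable (fun p : Y × T => f p * (g p.1 * h p.2)) (ν.prod μ) :=
    hf.integrable_mul (memLp_mul_prod hg hh)
  have e : ∀ t, ∫ y, f (y, t) * (g y * h t) ∂ν = h t * ∫ y, f (y, t) * g y ∂ν := fun t => by
    rw [← integral_const_mul]
    exact integral_congr_ae (Eventually.of_forall fun y => by simp only []; ring)
  refine ⟨h1, ?_, ?_⟩
  · have := h1.integral_prod_right
    simpa only [e] using this
  · rw [integral_prod_symm _ h1]
    simp only [e]

theorem integral_slice_mul {f : Y × T → ℂ} (hf : MemLp f 2 (ν.prod μ)) {g : Y → ℂ}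
    (hg : MemLp g 2 ν) (h : Lp ℂ 2 μ) :
    ∫ y, slice h f y * g y ∂ν = ∫ t, (starRingEnd ℂ) (h t) * ∫ y, f (y, t) * g y ∂ν ∂μ := by
  have hh : MemLp (fun t => (starRingEnd ℂ) (h t)) 2 μ := (Lp.memLp h).star
  obtain ⟨h1, -, h2⟩ := integral_mul_mul_prod hf hg hh
  rw [← h2, integral_prod _ h1]
  refine integral_congr_ae (Eventually.of_forall fun y => ?_)
  simp only [slice]
  rw [← integral_mul_const]
  exact integral_congr_ae (Eventually.of_forall fun t => by simp only []; ring)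

theorem memLp_integral_mul {f : Y × T → ℂ} (hf : MemLp f 2 (ν.prod μ)) {g : Y → ℂ}
    (hg : MemLp g 2 ν) : MemLp (fun t => ∫ y, f (y, t) * g y ∂ν) 2 μ := by
  have h1 : MemLp (fun p : T × Y => f p.swap) 2 (μ.prod ν) :=
    hf.comp_measurePreserving Measure.measurePreserving_swap
  refine (memLp_slice (hg.star.toLp _) h1).ae_eq (Eventually.of_forall fun t => ?_)
  refine integral_congr_ae ?_
  filter_upwards [hg.star.coeFn_toLp] with y hy
  rw [hy]
  simp [mul_comm]

/-- Orthonormal vectors are `√2` apart, so the balls of radius one half about them are disjoint, and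
a separable space holds only countably many. Countability permits exchanging sum and integral. -/
theorem exists_countable_hilbertBasis (H : Type*) [NormedAddCommGroup H] [InnerProductSpace ℂ H]
    [CompleteSpace H] [SecondCountableTopology H] :
    ∃ (w : Set H) (_ : HilbertBasis w ℂ H), Countable w := by
  obtain ⟨w, b, hb⟩ := exists_hilbertBasis ℂ H
  refine ⟨w, b, ?_⟩
  have ho := b.orthonormal
  refine Set.countable_coe_iff.2 (Set.PairwiseDisjoint.countable_of_isOpen (s := fun x : H => Metric.ball x (1 / 2))
    (a := w) ?_ (fun _ _ => Metric.isOpen_ball) fun x _ => ⟨x, Metric.mem_ball_self (by norm_num)⟩)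
  intro x hx y hy hxy
  refine Metric.ball_disjoint_ball ?_
  have h1 : ‖x - y‖ ^ 2 = 2 := by
    have hx1 : ‖x‖ = 1 := by simpa [hb] using ho.1 ⟨x, hx⟩
    have hy1 : ‖y‖ = 1 := by simpa [hb] using ho.1 ⟨y, hy⟩
    have h2 : inner ℂ x y = 0 := by
      have := ho.2 (i := ⟨x, hx⟩) (j := ⟨y, hy⟩) fun h => hxy (congrArg Subtype.val h)
      simpa [hb] using this
    rw [norm_sub_sq (𝕜 := ℂ), hx1, hy1, h2]
    norm_num
  rw [dist_eq_norm]
  nlinarith [norm_nonneg (x - y)]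

end Slices

/-! ### The fundamental lemma on the line -/

section DuBoisReymond

theorem ae_eq_zero_of_integral_smooth {U : Set ℝ} (hU : IsOpen U) {f : ℝ → ℂ}
    (hf : MemLp f 2 ((volume : Measure ℝ).restrict U))
    (h : ∀ χ : ℝ → ℝ, ContDiff ℝ ∞ χ → HasCompactSupport χ → tsupport χ ⊆ U →
      ∫ t in U, (χ t : ℂ) * f t = 0) : f =ᵐ[(volume : Measure ℝ).restrict U] 0 := by
  have h1 := hU.ae_eq_zero_of_integral_contDiff_smul_eq_zero (μ := volume) (f := f)
    (locallyIntegrableOn_of_locallyIntegrable_restrict (hf.locallyIntegrable (by norm_num))) fun g hg hgc hgs => by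
      rw [← h g hg hgc hgs]
      have : ∀ x, x ∉ U → g x • f x = 0 := fun x hx => by
        rw [image_eq_zero_of_notMem_tsupport fun h' => hx (hgs h'), zero_smul]
      rw [← setIntegral_eq_integral_of_forall_compl_eq_zero this]
      simp [Complex.real_smul]
  rw [EventuallyEq, ae_restrict_iff' hU.measurableSet]
  exact h1

end DuBoisReymond

/-! ### Coordinates in the cylindrical ends -/

section Tube

variable {n d : ℕ} {R : ℝ}

/-- Outside the layer `|x₁| ≤ R`, the set `A` is the cylinder with cross-section `A'`. -/
def IsTube (A : Set (E (n + 1))) (A' : Set (E n)) (R : ℝ) : Prop :=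
  ∀ p : ℝ × E n, R < |p.1| → (insE 0 p ∈ A ↔ p.2 ∈ A')

/-- The two half-lines `|t| > R`. -/
def ends (R : ℝ) : Set ℝ := {t | R < |t|}

/-- The layers `|x₁| > R`. -/
def outer (n : ℕ) (R : ℝ) : Set (E (n + 1)) := {x | R < |x 0|}

theorem isOpen_ends (R : ℝ) : IsOpen (ends R) := isOpen_lt continuous_const continuous_abs

theorem isOpen_outer (n : ℕ) (R : ℝ) : IsOpen (outer n R) :=
  isOpen_lt continuous_const (by fun_prop)

/-- Points of `ℝ^{n+1}` by cross-sectional and longitudinal coordinates. -/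
def slab (n : ℕ) : E n × ℝ ≃ᵐ E (n + 1) := MeasurableEquiv.prodComm.trans (insE 0)

@[simp] theorem slab_zero (p : E n × ℝ) : slab n p 0 = p.2 := insE_same 0 _

@[simp] theorem slab_succ (p : E n × ℝ) (i : Fin n) : slab n p i.succ = p.1 i :=
  insE_succAbove 0 (p.2, p.1) i

/-- The coordinates after the first one. -/
def vtail (x : E (n + 1)) : E n := WithLp.toLp 2 fun i => x i.succ

@[simp] theorem vtail_slab (p : E n × ℝ) : vtail (slab n p) = p.1 := by
  ext i
  exact slab_succ p i

@[simp] theorem slab_vtail (x : E (n + 1)) : slab n (vtail x, x 0) = x := by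
  ext i
  refine Fin.cases ?_ (fun j => ?_) i
  · simp
  · rw [slab_succ]
    rfl

theorem contDiff_vtail : ContDiff ℝ ∞ (vtail : E (n + 1) → E n) := by
  unfold vtail
  fun_prop

theorem continuous_vtail : Continuous (vtail : E (n + 1) → E n) := contDiff_vtail.continuous

theorem toSurface_slab (p : E d × ℝ) :
    toSurface (slab d p) = slab (d + 1) (toSurface p.1, p.2) := by
  ext i
  refine Fin.lastCases ?_ (fun j => ?_) i
  · rw [toSurface_last]
    have := slab_succ (toSurface p.1, p.2) (Fin.last d)
    rw [Fin.succ_last] at this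
    rw [this]
    exact (toSurface_last _).symm
  · rw [toSurface_castSucc]
    refine Fin.cases ?_ (fun k => ?_) j
    · rw [slab_zero, Fin.castSucc_zero, slab_zero]
    · rw [slab_succ, ← Fin.succ_castSucc, slab_succ]
      exact (toSurface_castSucc _ _).symm

theorem measurePreserving_slab {A : Set (E (n + 1))} {A' : Set (E n)} (h : IsTube A A' R) :
    MeasurePreserving (slab n)
      (((volume : Measure (E n)).restrict A').prod ((volume : Measure ℝ).restrict (ends R)))
      (((volume : Measure (E (n + 1))).restrict A).restrict (outer n R)) := by
  have h1 : MeasurePreserving (slab n) ((volume : Measure (E n)).prod (volume : Measure ℝ)) volume :=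
    (measurePreserving_insE 0).comp Measure.measurePreserving_swap
  have h2 := h1.restrict_preimage_emb (slab n).measurableEmbedding (outer n R ∩ A)
  rw [Measure.restrict_restrict (isOpen_outer n R).measurableSet, Measure.prod_restrict]
  convert h2 using 3
  ext p
  have h3 := h (p.2, p.1)
  constructor
  · rintro ⟨h4, h5⟩
    refine ⟨?_, (h3 h5).2 h4⟩
    change R < |slab n p 0|
    rw [slab_zero]
    exact h5
  · rintro ⟨h4, h5⟩
    have h6 : R < |slab n p 0| := h4
    rw [slab_zero] at h6
    exact ⟨(h3 h6).1 h5, h6⟩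

theorem ae_slab {A : Set (E (n + 1))} {A' : Set (E n)} (h : IsTube A A' R) {P : E (n + 1) → Prop}
    (hP : ∀ᵐ x ∂(volume : Measure (E (n + 1))).restrict A, P x) :
    ∀ᵐ p ∂((volume : Measure (E n)).restrict A').prod ((volume : Measure ℝ).restrict (ends R)),
      P (slab n p) :=
  (measurePreserving_slab h).quasiMeasurePreserving.ae (ae_restrict_of_ae hP)

theorem memLp_slab {F : Type*} [NormedAddCommGroup F] {A : Set (E (n + 1))} {A' : Set (E n)}
    (h : IsTube A A' R) {f : E (n + 1) → F}
    (hf : MemLp f 2 ((volume : Measure (E (n + 1))).restrict A)) :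
    MemLp (fun p => f (slab n p)) 2
      (((volume : Measure (E n)).restrict A').prod ((volume : Measure ℝ).restrict (ends R))) :=
  (hf.restrict (outer n R)).comp_measurePreserving (measurePreserving_slab h)

theorem memLp_of_slab {A : Set (E (n + 1))} {A' : Set (E n)}
    (h : IsTube A A' R) {f : E (n + 1) → ℂ} (h0 : ∀ x, x ∉ outer n R → f x = 0)
    (hf : MemLp (fun p => f (slab n p)) 2
      (((volume : Measure (E n)).restrict A').prod ((volume : Measure ℝ).restrict (ends R)))) :
    MemLp f 2 ((volume : Measure (E (n + 1))).restrict A) := by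
  have e : (outer n R).indicator f = f := indicator_eq_self.2 fun x hx => by
    by_contra h'
    exact hx (h0 x h')
  rw [← e, memLp_indicator_iff_restrict (isOpen_outer n R).measurableSet,
    ← (measurePreserving_slab h).map_eq,
    (slab n).measurableEmbedding.memLp_map_measure_iff]
  exact hf

theorem integral_slab {A : Set (E (n + 1))} {A' : Set (E n)}
    (h : IsTube A A' R) {f : E (n + 1) → ℂ} (h0 : ∀ x, x ∉ outer n R → f x = 0) :
    ∫ x in A, f x = ∫ p, f (slab n p)
      ∂((volume : Measure (E n)).restrict A').prod ((volume : Measure ℝ).restrict (ends R)) := by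
  rw [(measurePreserving_slab h).integral_comp (slab n).measurableEmbedding,
    setIntegral_eq_integral_of_forall_compl_eq_zero h0]

theorem norm_sq_cut_outer {F : Type*} [NormedAddCommGroup F] [NormedSpace ℂ F]
    {A : Set (E (n + 1))} {A' : Set (E n)} (h : IsTube A A' R)
    (f : Lp F 2 ((volume : Measure (E (n + 1))).restrict A)) :
    ENNReal.ofReal (‖cut (outer n R) (isOpen_outer n R).measurableSet f‖ ^ 2)
      = ∫⁻ p, ‖f (slab n p)‖ₑ ^ 2
      ∂((volume : Measure (E n)).restrict A').prod ((volume : Measure ℝ).restrict (ends R)) := by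
  rw [norm_sq_cut, (measurePreserving_slab h).lintegral_comp_emb (slab n).measurableEmbedding
    fun x => ‖f x‖ₑ ^ 2]

end Tube

/-! ### Products of longitudinal and cross-sectional test functions -/

section Tensor

variable {n d : ℕ} {R : ℝ}

/-- `a(x₁) φ(x')`. -/
def tensor (a : ℝ → ℝ) (φ : E n → ℝ) (x : E (n + 1)) : ℝ := a (x 0) * φ (vtail x)

@[simp] theorem tensor_slab (a : ℝ → ℝ) (φ : E n → ℝ) (p : E n × ℝ) :
    tensor a φ (slab n p) = a p.2 * φ p.1 := by
  simp [tensor]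

theorem continuous_slab : Continuous (slab n) :=
  (continuous_insE 0).comp continuous_swap

theorem isTest_tensor {a : ℝ → ℝ} (ha : ContDiff ℝ ∞ a) (hac : HasCompactSupport a) {φ : E n → ℝ}
    (hφ : IsTest φ) : IsTest (tensor a φ) := by
  refine ⟨?_, ?_⟩
  · have h1 : ContDiff ℝ ∞ fun x : E (n + 1) => x 0 := by fun_prop
    exact (ha.comp h1).mul (hφ.1.comp contDiff_vtail)
  · refine HasCompactSupport.intro ((hφ.2.isCompact.prod hac.isCompact).image continuous_slab) ?_
    intro x hx
    by_contra h
    refine hx ⟨(vtail x, x 0), ⟨?_, ?_⟩, slab_vtail x⟩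
    · exact subset_tsupport _ (right_ne_zero_of_mul h)
    · exact subset_tsupport _ (left_ne_zero_of_mul h)

theorem tsupport_tensor {a : ℝ → ℝ} {φ : E n → ℝ} {x : E (n + 1)} (hx : x ∈ tsupport (tensor a φ)) :
    x 0 ∈ tsupport a ∧ vtail x ∈ tsupport φ := by
  have hc : IsClosed {x : E (n + 1) | x 0 ∈ tsupport a ∧ vtail x ∈ tsupport φ} :=
    ((isClosed_tsupport a).preimage (by fun_prop : Continuous fun x : E (n + 1) => x 0)).inter
      ((isClosed_tsupport φ).preimage continuous_vtail)
  have hs : Function.support (tensor a φ) ⊆ {x : E (n + 1) | x 0 ∈ tsupport a ∧ vtail x ∈ tsupport φ} :=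
    fun x hx => ⟨subset_tsupport _ (left_ne_zero_of_mul hx), subset_tsupport _ (right_ne_zero_of_mul hx)⟩
  exact closure_minimal hs hc hx

theorem slab_add_smul_single_succ (p : E n × ℝ) (i : Fin n) (s : ℝ) :
    slab n p + s • EuclideanSpace.single i.succ 1
      = slab n (p.1 + s • EuclideanSpace.single i 1, p.2) := by
  ext j
  refine Fin.cases ?_ (fun k => ?_) j
  · have h : (0 : Fin (n + 1)) ≠ i.succ := (Fin.succ_ne_zero i).symm
    simp [h]
  · simp [Fin.succ_inj]

/-- Restriction of a partial derivative to a cross-section. -/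
theorem partialDeriv_comp_slab {ψ : E (n + 1) → ℝ} (hψ : IsTest ψ) (t : ℝ) (i : Fin n) (y : E n) :
    partialDeriv (fun y => ψ (slab n (y, t))) i y = partialDeriv ψ i.succ (slab n (y, t)) := by
  have hd : Differentiable ℝ ψ := hψ.1.differentiable (by simp)
  have hs : Differentiable ℝ fun y : E n => ψ (slab n (y, t)) := by
    refine hd.comp ?_
    intro y
    rw [differentiableAt_piLp]
    intro j
    refine Fin.cases ?_ (fun k => ?_) j
    · simp
    · simp only [slab_succ]
      fun_prop
  have h1 := (hd (slab n (y, t))).hasFDerivAt.hasLineDerivAt (EuclideanSpace.single i.succ (1 : ℝ))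
  have h2 := (hs y).hasFDerivAt.hasLineDerivAt (EuclideanSpace.single i (1 : ℝ))
  unfold HasLineDerivAt at h1 h2
  simp only [slab_add_smul_single_succ] at h1
  exact h2.unique h1

theorem isTest_comp_slab {ψ : E (n + 1) → ℝ} (hψ : IsTest ψ) (t : ℝ) :
    IsTest fun y => ψ (slab n (y, t)) := by
  refine ⟨hψ.1.comp ?_, HasCompactSupport.intro (hψ.2.isCompact.image continuous_vtail) ?_⟩
  · rw [contDiff_piLp]
    intro j
    refine Fin.cases ?_ (fun k => ?_) j
    · simp only [slab_zero]
      fun_prop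
    · simp only [slab_succ]
      fun_prop
  · intro y hy
    by_contra h
    exact hy ⟨slab n (y, t), subset_tsupport _ h, vtail_slab _⟩

theorem partialDeriv_tensor_succ {a : ℝ → ℝ} (ha : ContDiff ℝ ∞ a) (hac : HasCompactSupport a)
    {φ : E n → ℝ} (hφ : IsTest φ) (i : Fin n) (p : E n × ℝ) :
    partialDeriv (tensor a φ) i.succ (slab n p) = a p.2 * partialDeriv φ i p.1 := by
  have h1 := partialDeriv_comp_slab (isTest_tensor ha hac hφ) p.2 i p.1
  rw [← h1]
  simp only [tensor_slab]
  unfold partialDeriv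
  rw [fderiv_const_mul (hφ.1.differentiable (by simp) _)]
  simp

theorem partialDeriv_tensor_zero {a : ℝ → ℝ} (ha : ContDiff ℝ ∞ a) (hac : HasCompactSupport a)
    {φ : E n → ℝ} (hφ : IsTest φ) (p : E n × ℝ) :
    partialDeriv (tensor a φ) 0 (slab n p) = deriv a p.2 * φ p.1 := by
  have h1 := hasDerivAt_insE (isTest_tensor ha hac hφ) 0 p.1 p.2
  have h2 : HasDerivAt (fun s => a s * φ p.1) (deriv a p.2 * φ p.1) p.2 :=
    ((ha.differentiable (by simp) p.2).hasDerivAt).mul_const _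
  refine h1.unique (h2.congr_of_eventuallyEq (Eventually.of_forall fun s => ?_))
  exact tensor_slab a φ (p.1, s)

theorem IsTube.vtail_mem_closure {A : Set (E (n + 1))} {A' : Set (E n)} (h : IsTube A A' R)
    {x : E (n + 1)} (hx : x ∈ closure A) (hR : R < |x 0|) : vtail x ∈ closure A' := by
  have h1 : x ∈ closure (A ∩ outer n R) := by
    rw [inter_comm]
    exact (isOpen_outer n R).inter_closure ⟨hR, hx⟩
  refine closure_mono ?_ (image_closure_subset_closure_image continuous_vtail ⟨x, h1, rfl⟩)
  rintro _ ⟨z, ⟨hz, hz'⟩, rfl⟩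
  refine (h (z 0, vtail z) hz').1 ?_
  rwa [← slab_vtail z] at hz

end Tensor

/-! ### Slices of Sobolev functions -/

section SliceSobolev

variable {n d : ℕ} {R : ℝ}

/-- Green's expression over the cross-section `Ω'` at the longitudinal coordinate `t`. -/
def tubeGreen {Ω : Set (E (n + 1))} (Ω' : Set (E n)) (u : L2 Ω) (G : L2Vec (n + 1) Ω) (φ : E n → ℝ)
    (i : Fin n) (t : ℝ) : ℂ :=
  (∫ y in Ω', u (slab n (y, t)) * (partialDeriv φ i y : ℂ))
    + ∫ y in Ω', G (slab n (y, t)) i.succ * (φ y : ℂ)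

variable {Ω : Set (E (n + 1))} {Ω' : Set (E n)} (u : L2 Ω)
  (G : L2Vec (n + 1) Ω)

theorem memLp_slab_coord (hΩ : IsTube Ω Ω' R) (i : Fin (n + 1)) : MemLp (fun p => G (slab n p) i) 2
    (((volume : Measure (E n)).restrict Ω').prod ((volume : Measure ℝ).restrict (ends R))) :=
  memLp_slab hΩ (memLp_coord G i)

theorem IsTest.memLp_two {φ : E n → ℝ} (hφ : IsTest φ) (μ : Measure (E n))
    [IsFiniteMeasureOnCompacts μ] : MemLp (fun y => (φ y : ℂ)) 2 μ :=
  (hφ.1.continuous.memLp_of_hasCompactSupport hφ.2).ofReal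

theorem memLp_tubeGreen (hΩ : IsTube Ω Ω' R) {φ : E n → ℝ} (hφ : IsTest φ) (i : Fin n) :
    MemLp (tubeGreen Ω' u G φ i) 2 ((volume : Measure ℝ).restrict (ends R)) :=
  (memLp_integral_mul (memLp_slab hΩ (Lp.memLp u)) (hφ.memLp_partialDeriv i _).ofReal).add
    (memLp_integral_mul (memLp_slab_coord G hΩ i.succ) (hφ.memLp_two _))

/-- By Fubini's theorem, slicing with `h` commutes with Green's expression over the cross-section.
-/
theorem green_slice (hΩ : IsTube Ω Ω' R) (h : Lp ℂ 2 ((volume : Measure ℝ).restrict (ends R))) {u' : L2 Ω'}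
    {G' : L2Vec n Ω'}
    (hu' : u' =ᵐ[(volume : Measure (E n)).restrict Ω'] slice h fun p => u (slab n p))
    (hG' : ∀ i, (fun y => G' y i) =ᵐ[(volume : Measure (E n)).restrict Ω']
      slice h fun p => G (slab n p) i.succ) {φ : E n → ℝ} (hφ : IsTest φ) (i : Fin n) :
    green u' G' φ i = ∫ t in ends R, (starRingEnd ℂ) (h t) * tubeGreen Ω' u G φ i t := by
  have h1 := memLp_slab hΩ (Lp.memLp u)
  have h2 := memLp_slab_coord G hΩ i.succ
  have hp : MemLp (fun y => (partialDeriv φ i y : ℂ)) 2 ((volume : Measure (E n)).restrict Ω') :=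
    (hφ.memLp_partialDeriv i _).ofReal
  have hq := hφ.memLp_two ((volume : Measure (E n)).restrict Ω')
  have hh : MemLp (fun t => (starRingEnd ℂ) (h t)) 2 ((volume : Measure ℝ).restrict (ends R)) :=
    (Lp.memLp h).star
  rw [green_eq_add _ _ hφ]
  have e1 : ∫ x in Ω', u' x * (partialDeriv φ i x : ℂ)
      = ∫ x in Ω', slice h (fun p => u (slab n p)) x * (partialDeriv φ i x : ℂ) := by
    refine integral_congr_ae ?_
    filter_upwards [hu'] with x hx
    rw [hx]
  have e2 : ∫ x in Ω', G' x i * (φ x : ℂ)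
      = ∫ x in Ω', slice h (fun p => G (slab n p) i.succ) x * (φ x : ℂ) := by
    refine integral_congr_ae ?_
    filter_upwards [hG' i] with x hx
    rw [hx]
  have e3 := integral_slice_mul h1 hp h
  have e4 := integral_slice_mul h2 hq h
  rw [e1, e2]
  refine (congrArg₂ (· + ·) e3 e4).trans ?_
  rw [← integral_add (integral_mul_mul_prod h1 hp hh).2.1 (integral_mul_mul_prod h2 hq hh).2.1]
  simp only [tubeGreen, mul_add]

theorem IsTube.tensor_eq_zero {a : ℝ → ℝ} (has : tsupport a ⊆ ends R) (φ : E n → ℝ) {x : E (n + 1)}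
    (hx : x ∉ outer n R) : tensor a φ x = 0 := by
  have : a (x 0) = 0 := image_eq_zero_of_notMem_tsupport fun h => hx (has h)
  rw [tensor, this, zero_mul]

theorem IsTube.partialDeriv_tensor_eq_zero {a : ℝ → ℝ} (has : tsupport a ⊆ ends R) (φ : E n → ℝ)
    (i : Fin (n + 1)) {x : E (n + 1)} (hx : x ∉ outer n R) : partialDeriv (tensor a φ) i x = 0 := by
  by_contra h
  exact hx (has (tsupport_tensor (support_partialDeriv_subset _ i h)).1)

theorem green_tensor (hΩ : IsTube Ω Ω' R) {a : ℝ → ℝ} (ha : ContDiff ℝ ∞ a) (hac : HasCompactSupport a)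
    (has : tsupport a ⊆ ends R) {φ : E n → ℝ} (hφ : IsTest φ) (i : Fin n) :
    green u G (tensor a φ) i.succ = ∫ t in ends R, (a t : ℂ) * tubeGreen Ω' u G φ i t := by
  have h1 := memLp_slab hΩ (Lp.memLp u)
  have h2 := memLp_slab_coord G hΩ i.succ
  have hp : MemLp (fun y => (partialDeriv φ i y : ℂ)) 2 ((volume : Measure (E n)).restrict Ω') :=
    (hφ.memLp_partialDeriv i _).ofReal
  have hq := hφ.memLp_two ((volume : Measure (E n)).restrict Ω')
  have hh : MemLp (fun t => (a t : ℂ)) 2 ((volume : Measure ℝ).restrict (ends R)) :=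
    (ha.continuous.memLp_of_hasCompactSupport hac).ofReal
  rw [green_eq_add _ _ (isTest_tensor ha hac hφ),
    integral_slab hΩ fun x hx => by rw [IsTube.partialDeriv_tensor_eq_zero has φ _ hx]; simp,
    integral_slab hΩ fun x hx => by rw [IsTube.tensor_eq_zero has φ hx]; simp]
  simp only [partialDeriv_tensor_succ ha hac hφ, tensor_slab]
  have e3 := (integral_mul_mul_prod h1 hp hh)
  have e4 := (integral_mul_mul_prod h2 hq hh)
  simp only [tubeGreen, mul_add]
  refine Eq.trans ?_ (integral_add e3.2.1 e4.2.1).symm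
  rw [← e3.2.2, ← e4.2.2]
  congr 1 <;> refine integral_congr_ae (Eventually.of_forall fun p => ?_) <;>
    simp only [Complex.ofReal_mul] <;> ring

end SliceSobolev

namespace Sob

variable {d : ℕ} {R : ℝ} {Ω : Set (E (d + 2))} {S : Set (E (d + 1))} {Ω' : Set (E (d + 1))}
  {S' : Set (E d)}

/-- Testing in the canal with products `a(x₁) φ(x')` and varying `a` gives the identity for almost
every `t`. The exceptional set depends on `φ`, which is harmless since afterwards the identity is
only integrated against `h`. -/
theorem tubeGreen_eq_zero (hΩ : IsTube Ω Ω' R) (w : Sob Ω S) {φ : E (d + 1) → ℝ} (hφ : IsTest φ)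
    (hs : tsupport φ ⊆ Ω') (i : Fin (d + 1)) :
    tubeGreen Ω' w.fn w.grad φ i =ᵐ[(volume : Measure ℝ).restrict (ends R)] 0 := by
  refine ae_eq_zero_of_integral_smooth (isOpen_ends R) (memLp_tubeGreen _ _ hΩ hφ i)
    fun a ha hac has => ?_
  rw [← green_tensor _ _ hΩ ha hac has hφ i]
  refine w.isWeakGradient _ (isTest_tensor ha hac hφ) (fun x hx => ?_) _
  have h1 := tsupport_tensor hx
  rw [← slab_vtail x]
  exact (hΩ (x 0, vtail x) (has h1.1)).2 (hs h1.2)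

theorem tubeGreen_eq_trace (hΩ : IsTube Ω Ω' R) (hS : IsTube S S' R) (w : Sob Ω S)
    {φ : E (d + 1) → ℝ} (hφ : IsTest φ)
    (hs : tsupport φ ∩ closure Ω' ⊆ Ω' ∪ toSurface '' S') :
    tubeGreen Ω' w.fn w.grad φ (Fin.last d) =ᵐ[(volume : Measure ℝ).restrict (ends R)]
      fun t => ∫ y in S', w.trace (slab d (y, t)) * (φ (toSurface y) : ℂ) := by
  have h1 := memLp_slab hS (Lp.memLp w.trace)
  have hq : MemLp (fun y => (φ (toSurface y) : ℂ)) 2 ((volume : Measure (E d)).restrict S') :=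
    (hφ.memLp_surface _).ofReal
  have hB := memLp_integral_mul h1 hq
  have hF := memLp_tubeGreen w.fn w.grad hΩ hφ (Fin.last d)
  have h0 := ae_eq_zero_of_integral_smooth (isOpen_ends R) (hF.sub hB) fun a ha hac has => by
    have hh : MemLp (fun t => (a t : ℂ)) 2 ((volume : Measure ℝ).restrict (ends R)) :=
      (ha.continuous.memLp_of_hasCompactSupport hac).ofReal
    have e1 := green_tensor w.fn w.grad hΩ ha hac has hφ (Fin.last d)
    have e2 := w.isSurfaceTrace _ (isTest_tensor ha hac hφ) (by
      rintro x ⟨hx, hxc⟩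
      have h2 := tsupport_tensor hx
      rw [← slab_vtail x]
      rcases hs ⟨h2.2, hΩ.vtail_mem_closure hxc (has h2.1)⟩ with h3 | ⟨y, hy, h3⟩
      · exact Or.inl ((hΩ (x 0, vtail x) (has h2.1)).2 h3)
      · refine Or.inr ⟨slab d (y, x 0), (hS (x 0, y) (has h2.1)).2 hy, ?_⟩
        rw [toSurface_slab, h3])
    rw [Fin.succ_last, e2] at e1
    rw [integral_slab hS fun y hy => by
      rw [show tensor a φ (toSurface y) = 0 from IsTube.tensor_eq_zero has φ fun h => hy (by
        have h5 : R < |toSurface y 0| := h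
        rw [show toSurface y 0 = y 0 from toSurface_castSucc y 0] at h5
        exact h5)]
      simp] at e1
    simp only [toSurface_slab, tensor_slab] at e1
    have e3 := integral_mul_mul_prod h1 hq hh
    simp only [Pi.sub_apply, mul_sub]
    refine (integral_sub (hh.integrable_mul hF) e3.2.1).trans ?_
    rw [show (∫ t in ends R, ((fun t => (a t : ℂ)) * tubeGreen Ω' w.fn w.grad φ (Fin.last d)) t) = _ from e1.symm, ← e3.2.2, sub_eq_zero]
    refine integral_congr_ae (Eventually.of_forall fun p => ?_)
    simp only [Complex.ofReal_mul]
    ring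
  filter_upwards [h0] with t ht
  exact sub_eq_zero.1 ht

/-- Integration of a Sobolev function in the longitudinal direction gives a Sobolev function on the
cross-section. -/
theorem exists_slice (hΩ : IsTube Ω Ω' R) (hS : IsTube S S' R) (w : Sob Ω S)
    (h : Lp ℂ 2 ((volume : Measure ℝ).restrict (ends R))) :
    ∃ ψ : Sob Ω' S',
      ψ.fn =ᵐ[(volume : Measure (E (d + 1))).restrict Ω'] slice h (fun p => w.fn (slab _ p)) ∧
      (∀ i, (fun y => ψ.grad y i) =ᵐ[(volume : Measure (E (d + 1))).restrict Ω']
        slice h (fun p => w.grad (slab _ p) i.succ)) ∧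
      ψ.trace =ᵐ[(volume : Measure (E d)).restrict S'] slice h (fun p => w.trace (slab _ p)) := by
  have m1 := memLp_slice h (memLp_slab hΩ (Lp.memLp w.fn))
  have m2 := fun i : Fin (d + 1) => memLp_slice h (memLp_slab_coord w.grad hΩ i.succ)
  have m3 := memLp_slice h (memLp_slab hS (Lp.memLp w.trace))
  have m4 : MemLp (fun y => (WithLp.toLp 2 fun i : Fin (d + 1) =>
      slice h (fun p => w.grad (slab _ p) i.succ) y : EuclideanSpace ℂ (Fin (d + 1)))) 2
      ((volume : Measure (E (d + 1))).restrict Ω') := MemLp.of_eval_piLp m2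
  have c2 : ∀ i, (fun y => m4.toLp _ y i) =ᵐ[(volume : Measure (E (d + 1))).restrict Ω']
      slice h (fun p => w.grad (slab _ p) i.succ) := fun i => by
    filter_upwards [m4.coeFn_toLp] with y hy
    rw [hy]
  refine ⟨mk (u := m1.toLp _) (G := m4.toLp _) (g := m3.toLp _) ?_ ?_, m1.coeFn_toLp, c2,
    m3.coeFn_toLp⟩
  · intro φ hφ hs i
    rw [green_slice w.fn w.grad hΩ h m1.coeFn_toLp c2 hφ i]
    refine integral_eq_zero_of_ae ?_
    filter_upwards [tubeGreen_eq_zero hΩ w hφ hs i] with t ht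
    rw [ht]
    simp
  · intro φ hφ hs
    rw [green_slice w.fn w.grad hΩ h m1.coeFn_toLp c2 hφ]
    have hq : MemLp (fun y => (φ (toSurface y) : ℂ)) 2 ((volume : Measure (E d)).restrict S') :=
      (hφ.memLp_surface _).ofReal
    have e := integral_slice_mul (memLp_slab hS (Lp.memLp w.trace)) hq h
    have e' : ∫ y in S', m3.toLp _ y * (φ (toSurface y) : ℂ)
        = ∫ y in S', slice h (fun p => w.trace (slab _ p)) y * (φ (toSurface y) : ℂ) := by
      refine integral_congr_ae ?_
      filter_upwards [m3.coeFn_toLp] with y hy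
      rw [hy]
    rw [e', e]
    refine integral_congr_ae ?_
    filter_upwards [tubeGreen_eq_trace hΩ hS w hφ hs] with t ht
    rw [ht]

theorem mirror_slab (k : Fin (d + 1)) (p : E (d + 1) × ℝ) :
    _root_.mirror (𝕜 := ℝ) k.succ (slab _ p) = slab _ (_root_.mirror k p.1, p.2) := by
  ext i
  rw [mirror_apply]
  refine Fin.cases ?_ (fun j => ?_) i
  · rw [if_neg (Fin.succ_ne_zero k).symm, slab_zero, slab_zero, one_mul]
  · rw [slab_succ, slab_succ, mirror_apply]
    simp only [Fin.succ_inj]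

/-- The slices of odd functions are odd. -/
theorem slice_mem_odd {k : Fin d} (hΩ : IsTube Ω Ω' R) (hf : FlatTop Ω S) (hf' : FlatTop Ω' S')
    (hm : MirrorSymm k.succ Ω S) (hm' : MirrorSymm k Ω' S') {w : Sob Ω S} (hw : w ∈ odd hm)
    (h : Lp ℂ 2 ((volume : Measure ℝ).restrict (ends R))) {ψ : Sob Ω' S'}
    (hψ : ψ.fn =ᵐ[(volume : Measure (E (d + 1))).restrict Ω'] slice h (fun p => w.fn (slab _ p))) :
    ψ ∈ odd hm' := by
  rw [mem_odd_iff_ae hm' hf']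
  rw [mem_odd_iff_ae hm hf] at hw
  have h1 := Measure.ae_ae_of_ae_prod (ae_slab hΩ hw)
  filter_upwards [hψ, (measurePreserving_mirror hm'.dom).quasiMeasurePreserving.ae hψ, h1]
    with y h2 h3 h4
  rw [h2, h3]
  unfold slice
  rw [← integral_neg]
  refine integral_congr_ae ?_
  filter_upwards [h4] with t ht
  rw [← Fin.succ_castSucc, mirror_slab] at ht
  rw [ht]
  ring

end Sob

theorem enorm_sq_euclidean {n : ℕ} (v : EuclideanSpace ℂ (Fin n)) : ‖v‖ₑ ^ 2 = ∑ i, ‖v i‖ₑ ^ 2 := by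
  have h : ∀ {F : Type} [NormedAddCommGroup F] (z : F), ‖z‖ₑ ^ 2 = ENNReal.ofReal (‖z‖ ^ 2) := fun z => by
    rw [ENNReal.ofReal_pow (norm_nonneg z), ofReal_norm]
  rw [h, EuclideanSpace.norm_sq_eq, ENNReal.ofReal_sum_of_nonneg fun i _ => sq_nonneg _]
  exact Finset.sum_congr rfl fun i _ => (h _).symm

namespace Sob

variable {d : ℕ} {R : ℝ} {Ω : Set (E (d + 2))} {S : Set (E (d + 1))} {Ω' : Set (E (d + 1))}
  {S' : Set (E d)} {k : Fin d}

/-- The restriction of an odd function to the cylindrical part of the domain, decomposed by an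
orthonormal basis in the longitudinal direction. -/
theorem exists_sliceFamily (hΩ : IsTube Ω Ω' R) (hS : IsTube S S' R) (hf : FlatTop Ω S)
    (hf' : FlatTop Ω' S') (hm : MirrorSymm k.succ Ω S) (hm' : MirrorSymm k Ω' S') {w : Sob Ω S}
    (hw : w ∈ odd hm) :
    ∃ (ι : Type) (ψ : ι → Sob Ω' S'), (∀ i, ψ i ∈ odd hm') ∧
      ∑' i, ENNReal.ofReal (‖(ψ i).fn‖ ^ 2)
        = ENNReal.ofReal (‖cut (outer _ R) (isOpen_outer _ R).measurableSet w.fn‖ ^ 2) ∧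
      ∑' i, ENNReal.ofReal (‖(ψ i).trace‖ ^ 2)
        = ENNReal.ofReal (‖cut (outer _ R) (isOpen_outer _ R).measurableSet w.trace‖ ^ 2) ∧
      ∑' i, ENNReal.ofReal (‖(ψ i).grad‖ ^ 2)
        ≤ ENNReal.ofReal (‖cut (outer _ R) (isOpen_outer _ R).measurableSet w.grad‖ ^ 2) := by
  -- The finite exponent makes `L²` of the ends separable, so the basis is countable.
  have : Fact ((2 : ℝ≥0∞) ≠ ⊤) := ⟨by simp⟩
  obtain ⟨ι, b, hι⟩ :=
    exists_countable_hilbertBasis (Lp ℂ 2 ((volume : Measure ℝ).restrict (ends R)))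
  choose ψ h1 h2 h3 using fun i : ι => exists_slice hΩ hS w (b i)
  refine ⟨ι, ψ, fun i => slice_mem_odd hΩ hf hf' hm hm' hw (b i) (h1 i), ?_, ?_, ?_⟩
  · rw [norm_sq_cut_outer hΩ, ← tsum_lintegral_slice b (memLp_slab hΩ (Lp.memLp w.fn))]
    refine tsum_congr fun i => ?_
    rw [norm_sq_Lp_two]
    refine lintegral_congr_ae ?_
    filter_upwards [h1 i] with y hy
    rw [hy]
  · rw [norm_sq_cut_outer hS, ← tsum_lintegral_slice b (memLp_slab hS (Lp.memLp w.trace))]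
    refine tsum_congr fun i => ?_
    rw [norm_sq_Lp_two]
    refine lintegral_congr_ae ?_
    filter_upwards [h3 i] with y hy
    rw [hy]
  · have e1 : ∀ i, ENNReal.ofReal (‖(ψ i).grad‖ ^ 2)
        = ∑ j : Fin (d + 1), ∫⁻ y in Ω', ‖slice (b i) (fun p => w.grad (slab _ p) j.succ) y‖ₑ ^ 2 := by
      intro i
      rw [norm_sq_Lp_two]
      simp_rw [enorm_sq_euclidean]
      rw [lintegral_finsetSum' _ fun j _ => ((memLp_coord (ψ i).grad j).1.enorm.pow_const 2)]
      refine Finset.sum_congr rfl fun j _ => lintegral_congr_ae ?_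
      filter_upwards [h2 i j] with y hy
      rw [hy]
    simp_rw [e1]
    rw [Summable.tsum_finsetSum fun j _ => ENNReal.summable]
    simp_rw [tsum_lintegral_slice b (memLp_slab_coord w.grad hΩ (Fin.succ _))]
    rw [norm_sq_cut_outer hΩ, ← lintegral_finsetSum' _ fun j _ =>
      ((memLp_slab_coord w.grad hΩ j.succ).1.enorm.pow_const 2)]
    -- The slices see only the cross-sectional part of the gradient; dropping the longitudinal
    -- component causes the inequality.
    refine lintegral_mono fun p => ?_
    rw [enorm_sq_euclidean, Fin.sum_univ_succ (f := fun i => ‖w.grad (slab (d + 1) p) i‖ₑ ^ 2)]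
    exact le_add_of_nonneg_left (bot_le : (0 : ℝ≥0∞) ≤ _)

/-- The Steklov estimate on the cross-section gives an estimate in the cylindrical part. -/
theorem mul_norm_sq_cut_trace_le (hΩ : IsTube Ω Ω' R) (hS : IsTube S S' R) (hf : FlatTop Ω S)
    (hf' : FlatTop Ω' S') (hm : MirrorSymm k.succ Ω S) (hm' : MirrorSymm k Ω' S') {lam : ℝ}
    (hlam0 : 0 ≤ lam) (hlam : ∀ ψ ∈ odd hm', lam * ‖ψ.trace‖ ^ 2 ≤ ‖ψ.grad‖ ^ 2) {w : Sob Ω S}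
    (hw : w ∈ odd hm) :
    lam * ‖cut (outer _ R) (isOpen_outer _ R).measurableSet w.trace‖ ^ 2
      ≤ ‖cut (outer _ R) (isOpen_outer _ R).measurableSet w.grad‖ ^ 2 := by
  obtain ⟨ι, ψ, h0, -, h2, h3⟩ := exists_sliceFamily hΩ hS hf hf' hm hm' hw
  rw [← ENNReal.ofReal_le_ofReal_iff (sq_nonneg _), ENNReal.ofReal_mul hlam0, ← h2,
    ← ENNReal.tsum_mul_left]
  refine le_trans (ENNReal.tsum_le_tsum fun i => ?_) h3
  rw [← ENNReal.ofReal_mul hlam0]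
  exact ENNReal.ofReal_le_ofReal (hlam _ (h0 i))

/-- Poincaré's inequality holds for each slice, and Parseval's identity sums the squares. -/
theorem norm_cut_outer_fn_le (hΩ : IsTube Ω Ω' R) (hS : IsTube S S' R) (hf : FlatTop Ω S)
    (hf' : FlatTop Ω' S') (hm : MirrorSymm k.succ Ω S) (hm' : MirrorSymm k Ω' S') {C : ℝ}
    (hC0 : 0 ≤ C) (hC : ∀ ψ ∈ odd hm', ‖ψ.fn‖ ≤ C * ‖ψ‖) {w : Sob Ω S} (hw : w ∈ odd hm) :
    ‖cut (outer _ R) (isOpen_outer _ R).measurableSet w.fn‖ ≤ C * ‖w‖ := by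
  obtain ⟨ι, ψ, h0, h1, h2, h3⟩ := exists_sliceFamily hΩ hS hf hf' hm hm' hw
  refine le_of_ofReal_sq_le (mul_nonneg hC0 (norm_nonneg _)) ?_
  rw [← h1, mul_pow, norm_sq_eq, ENNReal.ofReal_mul (sq_nonneg _),
    ENNReal.ofReal_add (sq_nonneg _) (sq_nonneg _)]
  have h4 : ∑' i, ENNReal.ofReal (‖(ψ i).fn‖ ^ 2) ≤ ∑' i, ENNReal.ofReal (C ^ 2)
      * (ENNReal.ofReal (‖(ψ i).grad‖ ^ 2) + ENNReal.ofReal (‖(ψ i).trace‖ ^ 2)) := by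
    refine ENNReal.tsum_le_tsum fun i => ?_
    rw [← ENNReal.ofReal_add (sq_nonneg _) (sq_nonneg _), ← norm_sq_eq,
      ← ENNReal.ofReal_mul (sq_nonneg _), ← mul_pow]
    exact ENNReal.ofReal_le_ofReal (pow_le_pow_left₀ (norm_nonneg _) (hC _ (h0 i)) 2)
  refine h4.trans ?_
  rw [ENNReal.tsum_mul_left, ENNReal.tsum_add, h2]
  gcongr
  · exact h3.trans (ENNReal.ofReal_le_ofReal (pow_le_pow_left₀ (norm_nonneg _) (norm_cut_le _ _ _) 2))
  · exact norm_cut_le _ _ _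

/-- Poincaré's inequality for odd functions in a domain with cylindrical ends. -/
theorem exists_poincare_of_isTube (hΩ : IsTube Ω Ω' R) (hS : IsTube S S' R) (hf : FlatTop Ω S)
    (hf' : FlatTop Ω' S') (hm : MirrorSymm k.succ Ω S) (hm' : MirrorSymm k Ω' S')
    (hconn : IsPreconnected Ω) (hconn' : IsPreconnected Ω') (hb' : Bornology.IsBounded Ω')
    (hb : ∀ x ∈ Ω, vtail x ∈ Ω') :
    ∃ C : ℝ, ∀ w ∈ odd hm, ‖w.fn‖ ≤ C * ‖w‖ := by
  obtain ⟨C, hC, -⟩ := exists_compact_of_isBounded hf' hconn' hb' hm'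
  have hC' : ∀ w ∈ odd hm', ‖w.fn‖ ≤ |C| * ‖w‖ := fun w hw =>
    (hC w hw).trans (mul_le_mul_of_nonneg_right (le_abs_self C) (norm_nonneg _))
  -- The middle part of the domain is bounded, so compactness works there; the ends are covered by
  -- the slices.
  have hK : MeasurableSet ((outer (d + 1) R)ᶜ ∩ Ω) :=
    (isOpen_outer _ R).measurableSet.compl.inter hf.isOpen.measurableSet
  refine exists_poincare hf hconn hm hK ?_ (abs_nonneg C) fun w hw => ?_
  · obtain ⟨r, hr⟩ := hb'.exists_norm_le
    refine isBounded_iff_forall_norm_le.2 ⟨|R| + r, fun x hx => ?_⟩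
    have h1 : |x 0| ≤ R := not_lt.1 hx.1
    have h2 := hr _ (hb x hx.2)
    have h3 : ‖x‖ ^ 2 = |x 0| ^ 2 + ‖vtail x‖ ^ 2 := by
      rw [EuclideanSpace.norm_sq_eq, EuclideanSpace.norm_sq_eq, Fin.sum_univ_succ]
      rfl
    have h4 := abs_nonneg (x 0)
    have h5 := norm_nonneg (vtail x)
    rw [abs_of_nonneg (h4.trans h1)]
    nlinarith [norm_nonneg x]
  · refine le_trans (le_of_eq ?_) (norm_cut_outer_fn_le hΩ hS hf hf' hm hm' (abs_nonneg C) hC' hw)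
    congr 1
    refine Lp.ext ?_
    filter_upwards [cut_coeFn _ hK.compl w.fn, cut_coeFn _ (isOpen_outer (d + 1) R).measurableSet w.fn,
      ae_restrict_mem hf.isOpen.measurableSet] with x h1 h2 h3
    rw [h1, h2]
    by_cases hx : x ∈ outer (d + 1) R
    · rw [indicator_of_mem hx, indicator_of_mem fun h => h.1 hx]
    · rw [indicator_of_notMem hx, indicator_of_notMem]
      exact fun h => h ⟨hx, h3⟩

end Sob

/-! ### Products of a longitudinal amplitude and a function on the cross-section -/

section ProdFunction

variable {n : ℕ} {R : ℝ} {A : Set (E (n + 1))} {A' : Set (E n)}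

/-- Smooth functions with compact support in the half-lines `|t| > R`. -/
structure IsEndTest (R : ℝ) (a : ℝ → ℝ) : Prop where
  smooth : ContDiff ℝ ∞ a
  compact : HasCompactSupport a
  supp : tsupport a ⊆ ends R

namespace IsEndTest

variable {a b : ℝ → ℝ}

theorem deriv (ha : IsEndTest R a) : IsEndTest R (deriv a) where
  smooth := (contDiff_infty_iff_deriv.1 ha.smooth).2
  compact := ha.compact.deriv
  supp := (tsupport_deriv_subset).trans ha.supp

theorem add_mul (ha : IsEndTest R a) (hb : IsEndTest R b) (c : ℝ) :
    IsEndTest R fun t => a t + c * b t where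
  smooth := ha.smooth.add (contDiff_const.mul hb.smooth)
  compact := ha.compact.add hb.compact.mul_left
  supp := (tsupport_add _ _).trans (union_subset ha.supp ((tsupport_mul_subset_right).trans hb.supp))

theorem memLp (ha : IsEndTest R a) :
    MemLp (fun t => (a t : ℂ)) 2 ((volume : Measure ℝ).restrict (ends R)) :=
  (ha.smooth.continuous.memLp_of_hasCompactSupport ha.compact).ofReal

/-- A test function as an element of `L²`. -/
def toL2 (ha : IsEndTest R a) : Lp ℂ 2 ((volume : Measure ℝ).restrict (ends R)) :=
  ha.memLp.toLp _

theorem coeFn_toL2 (ha : IsEndTest R a) :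
    ha.toL2 =ᵐ[(volume : Measure ℝ).restrict (ends R)] fun t => (a t : ℂ) := ha.memLp.coeFn_toLp

theorem eq_zero (ha : IsEndTest R a) {x : E (n + 1)} (hx : x ∉ outer n R) : a (x 0) = 0 :=
  image_eq_zero_of_notMem_tsupport fun h => hx (ha.supp h)

theorem norm_sq_toL2 (ha : IsEndTest R a) : ‖ha.toL2‖ ^ 2 = ∫ t, a t ^ 2 := by
  have h0 : ∀ t, t ∉ ends R → a t ^ 2 = 0 := fun t ht => by
    rw [image_eq_zero_of_notMem_tsupport fun h => ht (ha.supp h), zero_pow two_ne_zero]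
  have hi : Integrable (fun t => a t * a t) :=
    (ha.smooth.continuous.mul ha.smooth.continuous).integrable_of_hasCompactSupport ha.compact.mul_left
  simp only [← sq] at hi
  have h1 : ENNReal.ofReal (‖ha.toL2‖ ^ 2) = _ := norm_sq_toLp_two ha.memLp
  rw [← setIntegral_eq_integral_of_forall_compl_eq_zero h0]
  have h2 : ∫⁻ t in ends R, ‖(a t : ℂ)‖ₑ ^ 2 = ENNReal.ofReal (∫ t in ends R, a t ^ 2) := by
    rw [ofReal_integral_eq_lintegral_ofReal hi.integrableOn (Eventually.of_forall fun t => sq_nonneg _)]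
    refine lintegral_congr fun t => ?_
    rw [← ofReal_norm, ← ENNReal.ofReal_pow (norm_nonneg _), Complex.norm_real, Real.norm_eq_abs, sq_abs]
  rw [h2, ENNReal.ofReal_eq_ofReal_iff (sq_nonneg _) (integral_nonneg fun t => sq_nonneg _)] at h1
  exact h1

end IsEndTest

theorem ae_of_slab (h : IsTube A A' R) {P : E n → Prop}
    (hP : ∀ᵐ y ∂(volume : Measure (E n)).restrict A', P y) :
    ∀ᵐ x ∂(volume : Measure (E (n + 1))).restrict A, x ∈ outer n R → P (vtail x) := by
  rw [← ae_restrict_iff' (isOpen_outer n R).measurableSet, ← (measurePreserving_slab h).map_eq,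
    (slab n).measurableEmbedding.ae_map_iff]
  filter_upwards [Measure.quasiMeasurePreserving_fst.ae hP] with p hp
  rwa [vtail_slab]

variable {a : ℝ → ℝ}

theorem memLp_prodFn (h : IsTube A A' R) (ha : IsEndTest R a) {q : E n → ℂ}
    (hq : MemLp q 2 ((volume : Measure (E n)).restrict A')) :
    MemLp (fun x => (a (x 0) : ℂ) * q (vtail x)) 2 ((volume : Measure (E (n + 1))).restrict A) := by
  refine memLp_of_slab h (fun x hx => by rw [ha.eq_zero hx]; simp) ?_
  refine (memLp_mul_prod hq ha.memLp).ae_eq (Eventually.of_forall fun p => ?_)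
  simp [mul_comm]

/-- The product `a(x₁) q(x')`. -/
def prodFn (h : IsTube A A' R) (ha : IsEndTest R a) (q : L2 A') : L2 A :=
  (memLp_prodFn h ha (Lp.memLp q)).toLp _

theorem coeFn_prodFn (h : IsTube A A' R) (ha : IsEndTest R a) (q : L2 A') :
    prodFn h ha q =ᵐ[(volume : Measure (E (n + 1))).restrict A]
      fun x => (a (x 0) : ℂ) * q (vtail x) := MemLp.coeFn_toLp _

theorem norm_prodFn (h : IsTube A A' R) (ha : IsEndTest R a) (q : L2 A') :
    ‖prodFn h ha q‖ = ‖ha.toL2‖ * ‖q‖ := by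
  rw [← pow_left_inj₀ (norm_nonneg _) (by positivity) two_ne_zero, mul_pow,
    ← ENNReal.ofReal_eq_ofReal_iff (sq_nonneg _) (by positivity), ENNReal.ofReal_mul (sq_nonneg _),
    prodFn, norm_sq_toLp_two, norm_sq_Lp_two q, IsEndTest.toL2, norm_sq_toLp_two]
  have h1 : ∫⁻ x in A, ‖(a (x 0) : ℂ) * q (vtail x)‖ₑ ^ 2
      = ∫⁻ x in outer n R, ‖(a (x 0) : ℂ) * q (vtail x)‖ₑ ^ 2
        ∂(volume : Measure (E (n + 1))).restrict A := by
    symm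
    refine setLIntegral_eq_of_support_subset ?_
    intro x hx
    by_contra h'
    exact hx (by simp [ha.eq_zero h'])
  rw [h1, ← (measurePreserving_slab h).lintegral_comp_emb (slab n).measurableEmbedding
    fun x => ‖(a (x 0) : ℂ) * q (vtail x)‖ₑ ^ 2]
  simp only [slab_zero, vtail_slab, enorm_mul, mul_pow]
  rw [mul_comm, ← lintegral_prod_mul ((Lp.memLp q).1.enorm.pow_const 2) (ha.memLp.1.enorm.pow_const 2)]
  simp only [mul_comm]

/-- The pairing with a product is the pairing of the slice with the factor on the cross-section. -/
theorem integral_mul_prodFn (h : IsTube A A' R) (ha : IsEndTest R a) {f : E (n + 1) → ℂ}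
    (hf : MemLp f 2 ((volume : Measure (E (n + 1))).restrict A)) {q : E n → ℂ}
    (hq : MemLp q 2 ((volume : Measure (E n)).restrict A')) :
    ∫ x in A, (starRingEnd ℂ) (f x) * ((a (x 0) : ℂ) * q (vtail x))
      = ∫ y in A', (starRingEnd ℂ) (slice ha.toL2 (fun p => f (slab n p)) y) * q y := by
  have h1 : MemLp (fun p => (starRingEnd ℂ) (f (slab n p))) 2 (((volume : Measure (E n)).restrict A').prod
    ((volume : Measure ℝ).restrict (ends R))) := (memLp_slab h hf).star
  rw [integral_slab h fun x hx => by rw [ha.eq_zero hx]; simp]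
  simp only [slab_zero, vtail_slab]
  have h2 := (integral_mul_mul_prod h1 hq ha.memLp).1
  have h3 : (fun p : E n × ℝ => (starRingEnd ℂ) (f (slab n p)) * ((a p.2 : ℂ) * q p.1))
      = fun p => (starRingEnd ℂ) (f (slab n p)) * (q p.1 * (a p.2 : ℂ)) := by
    funext p
    ring
  rw [h3, integral_prod _ h2]
  refine integral_congr_ae (Eventually.of_forall fun y => ?_)
  simp only [slice]
  rw [← integral_conj, ← integral_mul_const]
  refine integral_congr_ae ?_
  filter_upwards [ha.coeFn_toL2] with t ht
  rw [ht]
  simp only [map_mul, Complex.conj_ofReal]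
  ring

theorem inner_prodFn (h : IsTube A A' R) (ha : IsEndTest R a) (f : L2 A) (q : L2 A') :
    inner ℂ f (prodFn h ha q)
      = ∫ y in A', (starRingEnd ℂ) (slice ha.toL2 (fun p => f (slab n p)) y) * q y := by
  rw [← integral_mul_prodFn h ha (Lp.memLp f) (Lp.memLp q), L2.inner_def]
  refine integral_congr_ae ?_
  filter_upwards [coeFn_prodFn h ha q] with x hx
  rw [hx, RCLike.inner_apply, mul_comm]

theorem prodFn_add_mul (h : IsTube A A' R) {b : ℝ → ℝ} (ha : IsEndTest R a) (hb : IsEndTest R b) (c : ℝ)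
    (q : L2 A') :
    prodFn h (ha.add_mul hb c) q = prodFn h ha q + (c : ℂ) • prodFn h hb q := by
  refine Lp.ext ?_
  filter_upwards [coeFn_prodFn h (ha.add_mul hb c) q, coeFn_prodFn h ha q, coeFn_prodFn h hb q,
    Lp.coeFn_add (prodFn h ha q) ((c : ℂ) • prodFn h hb q), Lp.coeFn_smul (c : ℂ) (prodFn h hb q)]
    with x h1 h2 h3 h4 h5
  rw [h1, h4, Pi.add_apply, h5, Pi.smul_apply, h2, h3, smul_eq_mul]
  push_cast
  ring

end ProdFunction

namespace Sob

variable {d : ℕ} {R : ℝ} {Ω : Set (E (d + 2))} {S : Set (E (d + 1))} {Ω' : Set (E (d + 1))}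
  {S' : Set (E d)} {k : Fin d} {a : ℝ → ℝ}

/-- Integration by parts in the longitudinal direction. -/
theorem slice_grad_zero (hΩ : IsTube Ω Ω' R) (ho : IsOpen Ω') (ha : IsEndTest R a) (w : Sob Ω S) :
    slice ha.toL2 (fun p => w.grad (slab _ p) 0) =ᵐ[(volume : Measure (E (d + 1))).restrict Ω']
      fun y => -slice ha.deriv.toL2 (fun p => w.fn (slab _ p)) y := by
  have m0 := memLp_slab hΩ (Lp.memLp w.fn)
  have m1 := memLp_slab_coord w.grad hΩ 0
  have h0 := ae_eq_zero_of_integral_test ho ((memLp_slice ha.toL2 m1).add (memLp_slice ha.deriv.toL2 m0))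
    fun θ hθ hs => by
      have hq : MemLp (fun y => (θ y : ℂ)) 2 ((volume : Measure (E (d + 1))).restrict Ω') := hθ.memLp_two _
      -- Both slices, paired with `θ`, come from Green's formula in the direction `x₁` for the test
      -- function `a(x₁) θ(x')`.
      have h1 := w.isWeakGradient _ (isTest_tensor ha.smooth ha.compact hθ) (fun x hx => by
        have h1 := tsupport_tensor hx
        rw [← slab_vtail x]
        exact (hΩ (x 0, vtail x) (ha.supp h1.1)).2 (hs h1.2)) 0
      rw [green_eq_add _ _ (isTest_tensor ha.smooth ha.compact hθ),
        integral_slab hΩ fun x hx => by rw [IsTube.partialDeriv_tensor_eq_zero ha.supp θ _ hx]; simp,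
        integral_slab hΩ fun x hx => by rw [IsTube.tensor_eq_zero ha.supp θ hx]; simp] at h1
      simp only [partialDeriv_tensor_zero ha.smooth ha.compact hθ, tensor_slab] at h1
      have e0 := (integral_mul_mul_prod m0 hq ha.deriv.memLp).2.2
      have e1 := (integral_mul_mul_prod m1 hq ha.memLp).2.2
      have f0 := integral_slice_mul m0 hq ha.deriv.toL2
      have f1 := integral_slice_mul m1 hq ha.toL2
      have g : ∀ {b : ℝ → ℝ} (hb : IsEndTest R b) (F : ℝ → ℂ),
          ∫ t in ends R, (starRingEnd ℂ) (hb.toL2 t) * F t = ∫ t in ends R, (b t : ℂ) * F t := by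
        intro b hb F
        refine integral_congr_ae ?_
        filter_upwards [hb.coeFn_toL2] with t ht
        rw [ht, Complex.conj_ofReal]
      rw [g, ← e0] at f0
      rw [g, ← e1] at f1
      have e : ∫ y in Ω', θ y • (slice ha.toL2 (fun p => w.grad (slab _ p) 0)
            + slice ha.deriv.toL2 (fun p => w.fn (slab _ p))) y
          = (∫ y in Ω', slice ha.toL2 (fun p => w.grad (slab _ p) 0) y * (θ y : ℂ))
            + ∫ y in Ω', slice ha.deriv.toL2 (fun p => w.fn (slab _ p)) y * (θ y : ℂ) := by
        refine Eq.trans ?_ (integral_add ((memLp_slice ha.toL2 m1).integrable_mul hq)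
          ((memLp_slice ha.deriv.toL2 m0).integrable_mul hq))
        refine integral_congr_ae (Eventually.of_forall fun y => ?_)
        simp only [Pi.add_apply, Complex.real_smul]
        ring
      rw [e, f0, f1, add_comm, ← h1]
      congr 1 <;> refine integral_congr_ae (Eventually.of_forall fun p => ?_) <;>
        simp only [Complex.ofReal_mul] <;> ring
  filter_upwards [h0] with y hy
  exact eq_neg_of_add_eq_zero_left hy

/-- The product of a test function of the longitudinal variable and a Sobolev function on the
cross-section. -/
theorem exists_prod (hΩ : IsTube Ω Ω' R) (hS : IsTube S S' R) (ha : IsEndTest R a) (φ : Sob Ω' S') :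
    ∃ Φ : Sob Ω S, Φ.fn = prodFn hΩ ha φ.fn ∧ Φ.trace = prodFn hS ha φ.trace ∧
      ∀ᵐ x ∂(volume : Measure (E (d + 2))).restrict Ω,
        Φ.grad x 0 = ((deriv a (x 0) : ℝ) : ℂ) * φ.fn (vtail x) ∧
        ∀ i : Fin (d + 1), Φ.grad x i.succ = (a (x 0) : ℂ) * φ.grad (vtail x) i := by
  have m4 : MemLp (fun x : E (d + 2) => (WithLp.toLp 2 (Fin.cons (α := fun _ => ℂ) (((deriv a (x 0) : ℝ) : ℂ) * φ.fn (vtail x))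
      fun i : Fin (d + 1) => (a (x 0) : ℂ) * φ.grad (vtail x) i) : EuclideanSpace ℂ (Fin (d + 2)))) 2
      ((volume : Measure (E (d + 2))).restrict Ω) := by
    refine MemLp.of_eval_piLp fun i => ?_
    refine Fin.cases ?_ (fun j => ?_) i
    · exact memLp_prodFn hΩ ha.deriv (Lp.memLp φ.fn)
    · exact memLp_prodFn hΩ ha (memLp_coord φ.grad j)
  have c4 : ∀ᵐ x ∂(volume : Measure (E (d + 2))).restrict Ω,
        m4.toLp _ x 0 = ((deriv a (x 0) : ℝ) : ℂ) * φ.fn (vtail x) ∧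
        ∀ i : Fin (d + 1), m4.toLp _ x i.succ = (a (x 0) : ℂ) * φ.grad (vtail x) i := by
    filter_upwards [m4.coeFn_toLp] with x hx
    rw [hx]
    exact ⟨rfl, fun i => rfl⟩
  -- On each longitudinal line the integrand is the derivative of `a ψ`, times a constant. As `a`
  -- has compact support in the ends, no condition on the support of `ψ` is needed.
  have key0 : ∀ ψ : E (d + 2) → ℝ, IsTest ψ → green (prodFn hΩ ha φ.fn) (m4.toLp _) ψ 0 = 0 := by
    intro ψ hψ
    have e1 : (fun x => prodFn hΩ ha φ.fn x * (partialDeriv ψ 0 x : ℂ) + m4.toLp _ x 0 * (ψ x : ℂ))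
        =ᵐ[(volume : Measure (E (d + 2))).restrict Ω] fun x => (a (x 0) : ℂ) * φ.fn (vtail x)
          * (partialDeriv ψ 0 x : ℂ) + ((deriv a (x 0) : ℝ) : ℂ) * φ.fn (vtail x) * (ψ x : ℂ) := by
      filter_upwards [coeFn_prodFn hΩ ha φ.fn, c4] with x h1 h2
      rw [h1, h2.1]
    have hi := (integrable_congr e1).1 (green_integrable (prodFn hΩ ha φ.fn) (m4.toLp _) hψ 0)
    have hi' := (hi.restrict (s := outer _ R))
    rw [← (measurePreserving_slab hΩ).integrable_comp_emb (slab _).measurableEmbedding] at hi'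
    unfold green
    rw [integral_congr_ae e1, integral_slab hΩ fun x hx => by
      rw [ha.eq_zero hx, ha.deriv.eq_zero hx]; simp]
    simp only [Function.comp_def] at hi'
    rw [integral_prod _ hi']
    refine integral_eq_zero_of_ae (Eventually.of_forall fun y => ?_)
    have hd : ∀ t, HasDerivAt (fun t => a t * ψ (slab _ (y, t)))
        (deriv a t * ψ (slab _ (y, t)) + a t * partialDeriv ψ 0 (slab _ (y, t))) t := fun t =>
      ((ha.smooth.differentiable (by simp) t).hasDerivAt).mul (hasDerivAt_insE hψ 0 y t)
    have hc1 : Continuous fun t => slab (d + 1) (y, t) := continuous_slab.comp (by fun_prop)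
    have hcψ : Continuous fun t => ψ (slab (d + 1) (y, t)) := hψ.1.continuous.comp hc1
    have hcψ' : Continuous fun t => partialDeriv ψ 0 (slab (d + 1) (y, t)) :=
      (hψ.continuous_partialDeriv 0).comp hc1
    have i1 : Integrable fun t => deriv a t * ψ (slab _ (y, t)) :=
      (ha.deriv.smooth.continuous.mul hcψ).integrable_of_hasCompactSupport ha.deriv.compact.mul_right
    have i2 : Integrable fun t => a t * partialDeriv ψ 0 (slab _ (y, t)) :=
      (ha.smooth.continuous.mul hcψ').integrable_of_hasCompactSupport ha.compact.mul_right
    have i3 : Integrable fun t => a t * ψ (slab _ (y, t)) :=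
      (ha.smooth.continuous.mul hcψ).integrable_of_hasCompactSupport ha.compact.mul_right
    have h0 := integral_eq_zero_of_hasDerivAt_of_integrable hd (i1.add i2) i3
    have h1 : ∫ t in ends R, (deriv a t * ψ (slab _ (y, t)) + a t * partialDeriv ψ 0 (slab _ (y, t)))
        = 0 := by
      rw [setIntegral_eq_integral_of_forall_compl_eq_zero]
      · exact h0
      · intro t ht
        rw [image_eq_zero_of_notMem_tsupport fun h => ht (ha.supp h),
          image_eq_zero_of_notMem_tsupport fun h => ht (ha.deriv.supp h)]
        simp
    have h2 : ∀ t, (a (slab (d + 1) (y, t) 0) : ℂ) * φ.fn (vtail (slab _ (y, t)))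
          * (partialDeriv ψ 0 (slab _ (y, t)) : ℂ)
          + ((deriv a (slab (d + 1) (y, t) 0) : ℝ) : ℂ) * φ.fn (vtail (slab _ (y, t))) * (ψ (slab _ (y, t)) : ℂ)
        = φ.fn y * ((deriv a t * ψ (slab _ (y, t)) + a t * partialDeriv ψ 0 (slab _ (y, t)) : ℝ) : ℂ) := by
      intro t
      simp only [slab_zero, vtail_slab]
      push_cast
      ring
    simp only [h2]
    rw [integral_const_mul, integral_complex_ofReal, h1]
    simp
  -- In the other directions Green's expression is the integral over `t` of those on the
  -- cross-sections, where the properties of `φ` apply.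
  have key : ∀ ψ : E (d + 2) → ℝ, IsTest ψ → ∀ i : Fin (d + 1),
      green (prodFn hΩ ha φ.fn) (m4.toLp _) ψ i.succ
        = ∫ t in ends R, (a t : ℂ) * green φ.fn φ.grad (fun y => ψ (slab _ (y, t))) i := by
    intro ψ hψ i
    have e1 : (fun x => prodFn hΩ ha φ.fn x * (partialDeriv ψ i.succ x : ℂ) + m4.toLp _ x i.succ * (ψ x : ℂ))
        =ᵐ[(volume : Measure (E (d + 2))).restrict Ω] fun x => (a (x 0) : ℂ) * φ.fn (vtail x)
          * (partialDeriv ψ i.succ x : ℂ) + (a (x 0) : ℂ) * φ.grad (vtail x) i * (ψ x : ℂ) := by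
      filter_upwards [coeFn_prodFn hΩ ha φ.fn, c4] with x h1 h2
      rw [h1, h2.2]
    have hi := (integrable_congr e1).1 (green_integrable (prodFn hΩ ha φ.fn) (m4.toLp _) hψ i.succ)
    have hi' := (hi.restrict (s := outer _ R))
    rw [← (measurePreserving_slab hΩ).integrable_comp_emb (slab _).measurableEmbedding] at hi'
    unfold green
    rw [integral_congr_ae e1, integral_slab hΩ fun x hx => by rw [ha.eq_zero hx]; simp]
    simp only [Function.comp_def] at hi'
    rw [integral_prod_symm _ hi']
    refine integral_congr_ae (Eventually.of_forall fun t => ?_)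
    simp only [slab_zero, vtail_slab]
    rw [← integral_const_mul]
    refine integral_congr_ae (Eventually.of_forall fun y => ?_)
    simp only [partialDeriv_comp_slab hψ]
    ring
  have hcs : ∀ t : ℝ, Continuous fun y : E (d + 1) => slab (d + 1) (y, t) := fun t =>
    continuous_slab.comp (by fun_prop)
  have hts : ∀ (ψ : E (d + 2) → ℝ) (t : ℝ), ∀ y ∈ tsupport (fun y => ψ (slab _ (y, t))),
      slab _ (y, t) ∈ tsupport ψ := fun ψ t y hy =>
    tsupport_comp_subset_preimage ψ (hcs t) hy
  refine ⟨mk (u := prodFn hΩ ha φ.fn) (G := m4.toLp _) (g := prodFn hS ha φ.trace) ?_ ?_, rfl, rfl, c4⟩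
  · intro ψ hψ hs i
    refine Fin.cases (key0 ψ hψ) (fun j => ?_) i
    rw [key ψ hψ]
    refine setIntegral_eq_zero_of_forall_eq_zero fun t ht => ?_
    rw [φ.isWeakGradient _ (isTest_comp_slab hψ t) (fun y hy =>
      (hΩ (t, y) ht).1 (hs (hts ψ t y hy))), mul_zero]
  · intro ψ hψ hs
    rw [← Fin.succ_last, key ψ hψ]
    have e1 : (fun y => prodFn hS ha φ.trace y * (ψ (toSurface y) : ℂ))
        =ᵐ[(volume : Measure (E (d + 1))).restrict S] fun y => (a (y 0) : ℂ) * φ.trace (vtail y)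
          * (ψ (toSurface y) : ℂ) := by
      filter_upwards [coeFn_prodFn hS ha φ.trace] with x h1
      rw [h1]
    have hi := (integrable_congr e1).1 (hψ.integrable_surface (prodFn hS ha φ.trace))
    have hi' := (hi.restrict (s := outer _ R))
    rw [← (measurePreserving_slab hS).integrable_comp_emb (slab _).measurableEmbedding] at hi'
    rw [integral_congr_ae e1, integral_slab hS fun x hx => by rw [ha.eq_zero hx]; simp]
    simp only [Function.comp_def] at hi'
    rw [integral_prod_symm _ hi']
    refine setIntegral_congr_fun (isOpen_ends R).measurableSet fun t ht => ?_
    simp only [slab_zero, vtail_slab, toSurface_slab]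
    rw [φ.isSurfaceTrace _ (isTest_comp_slab hψ t), ← integral_const_mul]
    · refine integral_congr_ae (Eventually.of_forall fun y => ?_)
      simp only []
      ring
    · rintro y ⟨hy, hyc⟩
      have h1 : slab _ (y, t) ∈ closure Ω := by
        refine closure_mono ?_ (image_closure_subset_closure_image (hcs t) ⟨y, hyc, rfl⟩)
        rintro _ ⟨z, hz, rfl⟩
        exact (hΩ (t, z) ht).2 hz
      rcases hs ⟨hts ψ t y hy, h1⟩ with h2 | ⟨s, hs2, h2⟩
      · exact Or.inl ((hΩ (t, y) ht).1 h2)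
      · rw [← slab_vtail s, toSurface_slab] at h2
        have h3 := congrArg Prod.fst ((slab (d + 1)).injective h2)
        have h4 := congrArg Prod.snd ((slab (d + 1)).injective h2)
        simp only at h3 h4
        refine Or.inr ⟨vtail s, (hS (t, vtail s) ht).1 ?_, h3⟩
        rw [← h4]
        exact (slab_vtail s).symm ▸ hs2

theorem prod_mem_odd (hΩ : IsTube Ω Ω' R) (hf : FlatTop Ω S) (hf' : FlatTop Ω' S')
    (hm : MirrorSymm k.succ Ω S) (hm' : MirrorSymm k Ω' S') (ha : IsEndTest R a) {φ : Sob Ω' S'}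
    (hφ : φ ∈ odd hm') {Φ : Sob Ω S} (hΦ : Φ.fn = prodFn hΩ ha φ.fn) : Φ ∈ odd hm := by
  rw [mem_odd_iff_ae hm hf, hΦ]
  rw [mem_odd_iff_ae hm' hf'] at hφ
  have h1 := coeFn_prodFn hΩ ha φ.fn
  filter_upwards [h1, (measurePreserving_mirror hm.dom).quasiMeasurePreserving.ae h1,
    ae_of_slab hΩ hφ] with x h2 h3 h4
  rw [h2, h3]
  have e : _root_.mirror (𝕜 := ℝ) (Fin.castSucc k.succ) x
      = slab _ (_root_.mirror (𝕜 := ℝ) k.castSucc (vtail x), x 0) := by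
    have h5 := mirror_slab k.castSucc (vtail x, x 0)
    rwa [slab_vtail] at h5
  rw [e, slab_zero, vtail_slab]
  by_cases hx : x ∈ outer _ R
  · rw [h4 hx]
    ring
  · rw [ha.eq_zero hx]
    simp

end Sob

theorem L2.inner_eq_sum_integral {n m : ℕ} {A : Set (E n)} (F G : L2Vec m A) :
    inner ℂ F G = ∑ i, ∫ x in A, (starRingEnd ℂ) (F x i) * G x i := by
  rw [MeasureTheory.L2.inner_def, ← integral_finsetSum]
  · refine integral_congr_ae (Eventually.of_forall fun x => ?_)
    simp only [PiLp.inner_apply, RCLike.inner_apply, mul_comm]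
  · intro i _
    exact ((memLp_coord F i).star).integrable_mul (memLp_coord G i)

namespace Sob

variable {d : ℕ} {R : ℝ} {Ω : Set (E (d + 2))} {S : Set (E (d + 1))} {Ω' : Set (E (d + 1))}
  {S' : Set (E d)} {k : Fin d} {a : ℝ → ℝ}

/-- The residual of the product of a longitudinal amplitude and a mode of the cross-section. -/
theorem inner_prod_mode (hΩ : IsTube Ω Ω' R) (hS : IsTube S S' R) (hf : FlatTop Ω S)
    (hf' : FlatTop Ω' S') (hm : MirrorSymm k.succ Ω S) (hm' : MirrorSymm k Ω' S')
    (ha : IsEndTest R a) {lam' κ : ℝ} {φ : Sob Ω' S'}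
    (hφ : ∀ ψ ∈ odd hm', inner ℂ ψ.grad φ.grad - (lam' : ℂ) * inner ℂ ψ.trace φ.trace
      = -((κ ^ 2 : ℝ) : ℂ) * inner ℂ ψ.fn φ.fn) {Φ : Sob Ω S}
    (h2 : Φ.trace = prodFn hS ha φ.trace)
    (h3 : ∀ᵐ x ∂(volume : Measure (E (d + 2))).restrict Ω,
        Φ.grad x 0 = ((deriv a (x 0) : ℝ) : ℂ) * φ.fn (vtail x) ∧
        ∀ i : Fin (d + 1), Φ.grad x i.succ = (a (x 0) : ℂ) * φ.grad (vtail x) i) {Ψ : Sob Ω S}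
    (hΨ : Ψ ∈ odd hm) :
    inner ℂ Ψ.grad Φ.grad - (lam' : ℂ) * inner ℂ Ψ.trace Φ.trace
      = -inner ℂ Ψ.fn (prodFn hΩ (ha.deriv.deriv.add_mul ha (κ ^ 2)) φ.fn) := by
  -- Pairing with the product amounts to pairing the slice of `Ψ` along `a` with the mode, and this
  -- slice is an admissible odd test function on the cross-section.
  obtain ⟨ψ, e1, e2, e3⟩ := exists_slice hΩ hS Ψ ha.toL2
  have hψ := hφ ψ (slice_mem_odd hΩ hf hf' hm hm' hΨ ha.toL2 e1)
  have f1 : inner ℂ Ψ.fn (prodFn hΩ ha φ.fn) = inner ℂ ψ.fn φ.fn := by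
    rw [inner_prodFn, MeasureTheory.L2.inner_def]
    refine integral_congr_ae ?_
    filter_upwards [e1] with y hy
    rw [hy, RCLike.inner_apply, mul_comm]
  have f2 : inner ℂ Ψ.trace Φ.trace = inner ℂ ψ.trace φ.trace := by
    rw [h2, inner_prodFn, MeasureTheory.L2.inner_def]
    refine integral_congr_ae ?_
    filter_upwards [e3] with y hy
    rw [hy, RCLike.inner_apply, mul_comm]
  -- The longitudinal component is integrated by parts once more, which produces the second
  -- derivative of the amplitude.
  have f3 : inner ℂ Ψ.grad Φ.grad
      = -inner ℂ Ψ.fn (prodFn hΩ ha.deriv.deriv φ.fn) + inner ℂ ψ.grad φ.grad := by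
    rw [L2.inner_eq_sum_integral, L2.inner_eq_sum_integral, Fin.sum_univ_succ]
    congr 1
    · have g1 : ∫ x in Ω, (starRingEnd ℂ) (Ψ.grad x 0) * Φ.grad x 0
          = ∫ x in Ω, (starRingEnd ℂ) (Ψ.grad x 0) * (((deriv a (x 0) : ℝ) : ℂ) * φ.fn (vtail x)) := by
        refine integral_congr_ae ?_
        filter_upwards [h3] with x hx
        rw [hx.1]
      rw [g1, integral_mul_prodFn hΩ ha.deriv (memLp_coord Ψ.grad 0) (Lp.memLp φ.fn), inner_prodFn,
        ← integral_neg]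
      refine integral_congr_ae ?_
      filter_upwards [slice_grad_zero hΩ hf'.isOpen ha.deriv Ψ] with y hy
      rw [hy, map_neg, neg_mul]
    · refine Finset.sum_congr rfl fun i _ => ?_
      have g1 : ∫ x in Ω, (starRingEnd ℂ) (Ψ.grad x i.succ) * Φ.grad x i.succ
          = ∫ x in Ω, (starRingEnd ℂ) (Ψ.grad x i.succ) * ((a (x 0) : ℂ) * φ.grad (vtail x) i) := by
        refine integral_congr_ae ?_
        filter_upwards [h3] with x hx
        rw [hx.2]
      rw [g1, integral_mul_prodFn hΩ ha (memLp_coord Ψ.grad i.succ) (memLp_coord φ.grad i)]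
      refine integral_congr_ae ?_
      filter_upwards [e2 i] with y hy
      rw [← hy]
  rw [prodFn_add_mul hΩ ha.deriv.deriv ha, inner_add_right, inner_smul_right, f1, f2, f3]
  push_cast at hψ ⊢
  linear_combination hψ

end Sob

/-! ### Slowly modulated waves -/

section Amplitude

theorem hasDerivAt_comp_div {η : ℝ → ℝ} (hη : ContDiff ℝ ∞ η) (N t : ℝ) :
    HasDerivAt (fun t => η (t / N)) (deriv η (t / N) / N) t := by
  have h1 := (hη.differentiable (by simp) (t / N)).hasDerivAt.comp t ((hasDerivAt_id t).div_const N)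
  rwa [mul_one_div] at h1

/-- Slowly varying waves. -/
theorem exists_wave {R κ ε : ℝ} (hκ : 0 < κ) (hε : 0 < ε) :
    ∃ (a : ℝ → ℝ) (ha : IsEndTest R a), 0 < ‖ha.toL2‖ ∧
      ‖(ha.deriv.deriv.add_mul ha (κ ^ 2)).toL2‖ ≤ ε * ‖ha.toL2‖ := by
  obtain ⟨η, hηs, hηc, hη, -, hη1⟩ : ∃ η : ℝ → ℝ, tsupport η ⊆ Ioo 1 2 ∧ HasCompactSupport η ∧
      ContDiff ℝ ∞ η ∧ range η ⊆ Icc 0 1 ∧ η (3 / 2) = 1 :=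
    exists_contDiff_tsupport_subset (isOpen_Ioo.mem_nhds ⟨by norm_num, by norm_num⟩)
  have hη' : ContDiff ℝ ∞ (deriv η) := (contDiff_infty_iff_deriv.1 hη).2
  have hη'' : ContDiff ℝ ∞ (deriv (deriv η)) := (contDiff_infty_iff_deriv.1 hη').2
  obtain ⟨M₁, hM₁⟩ := hηc.deriv.exists_bound_of_continuous hη'.continuous
  obtain ⟨M₂, hM₂⟩ := hηc.deriv.deriv.exists_bound_of_continuous hη''.continuous
  have hM₁0 : 0 ≤ M₁ := (norm_nonneg _).trans (hM₁ 0)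
  have hM₂0 : 0 ≤ M₂ := (norm_nonneg _).trans (hM₂ 0)
  -- Bounds the two terms left in `a'' + κ² a`: one with `η''` and one with `2 κ η'`.
  set M := M₂ + 2 * κ * M₁ with hM
  have hM0 : 0 ≤ M := by positivity
  set J := ∫ t, η t ^ 2 with hJ
  have hJ0 : 0 < J := by
    refine (hη.continuous.pow 2).integral_pos_of_hasCompactSupport_nonneg_nonzero (x := 3 / 2) ?_
      (fun t => sq_nonneg _) (by simp [hη1])
    exact hηc.comp_left (g := fun s : ℝ => s ^ 2) (by simp)
  -- `N` is the length scale of the envelope. The squared residual is at most `M ^ 2 / N`, while the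
  -- squared norm of the wave is at least `N * J / 2`.
  obtain ⟨N, hN1, hNR, hNε⟩ : ∃ N : ℝ, 1 ≤ N ∧ R < N ∧ M ^ 2 / N ≤ ε ^ 2 * (N * J / 2) := by
    refine ⟨max 1 (max (R + 1) (2 * M ^ 2 / (ε ^ 2 * J))), le_max_left _ _, ?_, ?_⟩
    · exact lt_of_lt_of_le (by linarith) ((le_max_left _ _).trans (le_max_right _ _))
    · set N := max 1 (max (R + 1) (2 * M ^ 2 / (ε ^ 2 * J)))
      have h1 : (1 : ℝ) ≤ N := le_max_left _ _
      have h2 : 2 * M ^ 2 / (ε ^ 2 * J) ≤ N := (le_max_right _ _).trans (le_max_right _ _)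
      rw [div_le_iff₀ (by positivity)] at h2
      rw [div_le_iff₀ (by positivity)]
      have h3 : N * (ε ^ 2 * J) ≤ N * N * (ε ^ 2 * J) := by
        refine mul_le_mul_of_nonneg_right ?_ (by positivity)
        nlinarith
      nlinarith
  have hN0 : 0 < N := by linarith
  -- A real wave with a free phase `θ`, supported in `[N, 2N]` beyond the body.
  set b : ℝ → ℝ → ℝ := fun θ t => η (t / N) * Real.cos (κ * t + θ) with hb
  have hout : ∀ t, t ∉ Icc N (2 * N) → t / N ∉ tsupport η := fun t ht h => by
    have h1 := hηs h
    rw [mem_Ioo, lt_div_iff₀ hN0, div_lt_iff₀ hN0] at h1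
    exact ht ⟨by linarith [h1.1], h1.2.le⟩
  have hbs : ∀ θ, tsupport (b θ) ⊆ Icc N (2 * N) := fun θ =>
    closure_minimal (fun t ht => by
      by_contra h
      exact ht (by simp only [hb]; rw [image_eq_zero_of_notMem_tsupport (hout t h), zero_mul])) isClosed_Icc
  have hend : Icc N (2 * N) ⊆ ends R := fun t ht => by
    change R < |t|
    rw [abs_of_pos (by linarith [ht.1])]
    linarith [ht.1]
  have hbt : ∀ θ, IsEndTest R (b θ) := fun θ =>
    { smooth := (hη.comp (by fun_prop)).mul (Real.contDiff_cos.comp (by fun_prop))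
      compact := isCompact_Icc.of_isClosed_subset (isClosed_tsupport _) (hbs θ)
      supp := (hbs θ).trans hend }
  have hd1 : ∀ θ, deriv (b θ) = fun t => deriv η (t / N) / N * Real.cos (κ * t + θ)
      - κ * (η (t / N) * Real.sin (κ * t + θ)) := fun θ => by
    funext t
    have h1 : HasDerivAt (fun t => κ * t + θ) κ t := by
      simpa using ((hasDerivAt_id t).const_mul κ).add_const θ
    have h2 := (hasDerivAt_comp_div hη N t).mul h1.cos
    refine h2.deriv.trans ?_
    ring
  -- The terms with `κ ^ 2` cancel; each remaining one contains a derivative of the envelope and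
  -- hence a factor `1 / N`.
  have hd2 : ∀ θ t, deriv (deriv (b θ)) t + κ ^ 2 * b θ t
      = deriv (deriv η) (t / N) / N / N * Real.cos (κ * t + θ)
        - 2 * κ * (deriv η (t / N) / N * Real.sin (κ * t + θ)) := fun θ t => by
    have h1 : HasDerivAt (fun t => κ * t + θ) κ t := by
      simpa using ((hasDerivAt_id t).const_mul κ).add_const θ
    have h2 := (((hasDerivAt_comp_div hη' N t).div_const N).mul h1.cos).sub
      (((hasDerivAt_comp_div hη N t).mul h1.sin).const_mul κ)
    rw [hd1]
    have h3 := h2.deriv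
    simp only [hb]
    refine (congrArg (· + _) h3).trans ?_
    ring
  have hres : ∀ θ, ‖((hbt θ).deriv.deriv.add_mul (hbt θ) (κ ^ 2)).toL2‖ ^ 2 ≤ M ^ 2 / N := by
    intro θ
    rw [IsEndTest.norm_sq_toL2]
    have h1 : ∀ t, (deriv (deriv (b θ)) t + κ ^ 2 * b θ t) ^ 2
        ≤ (Icc N (2 * N)).indicator (fun _ => (M / N) ^ 2) t := by
      intro t
      rw [hd2]
      by_cases ht : t ∈ Icc N (2 * N)
      · rw [indicator_of_mem ht, ← sq_abs]
        refine pow_le_pow_left₀ (abs_nonneg _) ?_ 2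
        refine (abs_sub _ _).trans ?_
        have hc := Real.abs_cos_le_one (κ * t + θ)
        have hs := Real.abs_sin_le_one (κ * t + θ)
        have h4 : |deriv (deriv η) (t / N) / N / N * Real.cos (κ * t + θ)| ≤ M₂ / N := by
          rw [abs_mul, abs_div, abs_div, abs_of_pos hN0]
          have h5 : |deriv (deriv η) (t / N)| / N ≤ M₂ := (div_le_self (abs_nonneg _) hN1).trans (hM₂ _)
          calc |deriv (deriv η) (t / N)| / N / N * |Real.cos (κ * t + θ)|
              ≤ M₂ / N * 1 := mul_le_mul (div_le_div_of_nonneg_right h5 hN0.le) hc (abs_nonneg _) (by positivity)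
            _ = M₂ / N := mul_one _
        have h5 : |2 * κ * (deriv η (t / N) / N * Real.sin (κ * t + θ))| ≤ 2 * κ * (M₁ / N) := by
          rw [abs_mul (2 * κ), abs_mul (_ / _), abs_div, abs_of_pos hN0,
            abs_of_pos (by positivity : 0 < 2 * κ)]
          refine mul_le_mul_of_nonneg_left ?_ (by positivity)
          calc |deriv η (t / N)| / N * |Real.sin (κ * t + θ)|
              ≤ M₁ / N * 1 := mul_le_mul (div_le_div_of_nonneg_right (hM₁ _) hN0.le) hs (abs_nonneg _) (by positivity)
            _ = M₁ / N := mul_one _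
        refine (add_le_add h4 h5).trans (le_of_eq ?_)
        rw [hM]
        ring
      · have h3 : ∀ {f : ℝ → ℝ}, tsupport f ⊆ tsupport η → f (t / N) = 0 := fun hf =>
          image_eq_zero_of_notMem_tsupport fun h => hout t ht (hf h)
        rw [indicator_of_notMem ht, h3 (tsupport_deriv_subset),
          h3 ((tsupport_deriv_subset).trans (tsupport_deriv_subset))]
        simp
    have h2 : Integrable ((Icc N (2 * N)).indicator fun _ => (M / N) ^ 2) :=
      (integrable_indicator_iff measurableSet_Icc).2 (by simp)
    refine (integral_mono_of_nonneg (Eventually.of_forall fun t => sq_nonneg _) h2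
      (Eventually.of_forall h1)).trans (le_of_eq ?_)
    rw [integral_indicator measurableSet_Icc, setIntegral_const, Real.volume_real_Icc_of_le (by linarith),
      smul_eq_mul]
    field_simp
    ring
  -- The oscillation could make a single norm small. By `cos² + sin² = 1` the two phases together
  -- carry the full norm of the envelope, so one of them carries at least half.
  have hsum : ‖(hbt 0).toL2‖ ^ 2 + ‖(hbt (-(Real.pi / 2))).toL2‖ ^ 2 = N * J := by
    rw [IsEndTest.norm_sq_toL2, IsEndTest.norm_sq_toL2]
    have hi : ∀ θ, Integrable fun t => b θ t ^ 2 := fun θ => by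
      have h : Integrable fun t => b θ t * b θ t :=
        ((hbt θ).smooth.continuous.mul (hbt θ).smooth.continuous).integrable_of_hasCompactSupport
          (hbt θ).compact.mul_left
      simpa only [← pow_two] using h
    rw [← integral_add (hi _) (hi _)]
    have h1 : ∀ t, b 0 t ^ 2 + b (-(Real.pi / 2)) t ^ 2 = (fun s => η s ^ 2) (t / N) := fun t => by
      simp only [hb, add_zero, ← sub_eq_add_neg, Real.cos_sub_pi_div_two, mul_pow]
      rw [← mul_add, Real.cos_sq_add_sin_sq, mul_one]
    simp only [h1]
    rw [Measure.integral_comp_div (fun s => η s ^ 2) N, abs_of_pos hN0, smul_eq_mul]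
  obtain ⟨θ, hθ⟩ : ∃ θ, N * J / 2 ≤ ‖(hbt θ).toL2‖ ^ 2 := by
    by_contra! h
    linarith [h 0, h (-(Real.pi / 2))]
  refine ⟨b θ, hbt θ, ?_, ?_⟩
  · have : 0 < ‖(hbt θ).toL2‖ ^ 2 := lt_of_lt_of_le (by positivity) hθ
    exact lt_of_le_of_ne (norm_nonneg _) fun h => by simp [← h] at this
  · refine le_of_sq_le_sq ?_ (by positivity)
    rw [mul_pow]
    exact (hres θ).trans (hNε.trans (mul_le_mul_of_nonneg_left hθ (sq_nonneg _)))

end Amplitude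

/-! ### The operator of the trace form and its kernel -/

namespace Sob

section General

variable {d : ℕ} {k : Fin d} {Ω : Set (E (d + 1))} {S : Set (E d)}

/-- An odd function that vanishes near the boundary. -/
theorem exists_odd_trace_eq_zero (hΩ : FlatTop Ω S) (h : MirrorSymm k Ω S) {y₀ : E d}
    (hy₀ : y₀ ∈ S) (hk : 0 < y₀ k) : ∃ w ∈ odd h, w.trace = 0 ∧ w.fn ≠ 0 := by
  obtain ⟨p, hpk, hp⟩ : ∃ p, 0 < p k.castSucc ∧ p ∈ Ω := by
    have ho : IsOpen {x : E (d + 1) | 0 < x k.castSucc} := isOpen_lt continuous_const (by fun_prop)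
    obtain ⟨p, hp⟩ := mem_closure_iff.1 (hΩ.top_mem y₀ hy₀) _ ho (by
      change 0 < toSurface y₀ k.castSucc
      rwa [toSurface_castSucc])
    exact ⟨p, hp⟩
  obtain ⟨ρ, hρ, hρΩ⟩ := Metric.isOpen_iff.1 hΩ.isOpen p hp
  obtain ⟨r, hr, hrρ, hrk⟩ : ∃ r > 0, r < ρ ∧ r < p k.castSucc := by
    obtain ⟨r, h1, h2⟩ := exists_between (lt_min hρ hpk)
    exact ⟨r, h1, lt_min_iff.1 h2⟩
  let ζ : ContDiffBump p := ⟨r / 2, r, by positivity, by linarith⟩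
  have hζ : IsTest ζ := ⟨ζ.contDiff, ζ.hasCompactSupport⟩
  obtain ⟨w, hw, hw0⟩ := hΩ.exists_sob_of_test_interior hζ (by
    rw [ζ.tsupport_eq]
    exact (Metric.closedBall_subset_ball hrρ).trans hρΩ)
  refine ⟨oddPart h w, oddPart_mem h hΩ w, ?_, fun h0 => ?_⟩
  · rw [oddPart_apply, map_smul, map_sub, trace_mirror, hw0, map_zero, sub_zero, smul_zero]
  rw [oddPart_apply, map_smul, map_sub, smul_eq_zero_iff_right (by norm_num), sub_eq_zero] at h0
  have h1 : (fun x => (ζ x : ℂ)) =ᵐ[(volume : Measure (E (d + 1))).restrict Ω]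
      fun x => (ζ (_root_.mirror k.castSucc x) : ℂ) := by
    have h2 := (measurePreserving_mirror h.dom).quasiMeasurePreserving.ae hw
    filter_upwards [hw, h2, coeFn_mirrorFn h.dom w.fn] with y h3 h4 h5
    rw [← h3, ← h4, ← h5]
    exact congrArg (fun f : L2 Ω => f y) h0
  have h6 : (ζ p : ℂ) = (ζ (_root_.mirror k.castSucc p) : ℂ) := Measure.eqOn_open_of_ae_eq h1 hΩ.isOpen
    (Complex.continuous_ofReal.comp hζ.1.continuous).continuousOn
    (Complex.continuous_ofReal.comp (hζ.1.continuous.comp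
      (_root_.mirror (𝕜 := ℝ) k.castSucc).continuous)).continuousOn hp
  have h7 : ζ p = 1 := ζ.one_of_mem_closedBall (Metric.mem_closedBall_self (by positivity))
  have h8 : ζ (_root_.mirror k.castSucc p) = 0 := by
    refine ζ.zero_of_le_dist ?_
    have h9 := abs_apply_le_norm (_root_.mirror k.castSucc p - p) k.castSucc
    rw [PiLp.sub_apply, mirror_same, ← dist_eq_norm] at h9
    refine le_trans ?_ h9
    rw [show -p k.castSucc - p k.castSucc = -(2 * p k.castSucc) by ring, abs_neg, abs_mul, abs_two,
      abs_of_pos hpk]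
    change r ≤ _
    linarith
  rw [h7, h8] at h6
  simp at h6

variable {V : Submodule ℂ (Sob Ω S)} {T : V →L[ℂ] V}

/-- The operator of the trace form on the odd functions is the restriction of the operator on all
functions. -/
theorem exists_trace_operator (hΩ : FlatTop Ω S) (h : MirrorSymm k Ω S) (hV : V = odd h)
    [CompleteSpace V] (hsep : ∀ x : V, ‖x‖ = 0 → x = 0) :
    ∃ T : V →L[ℂ] V, ∀ (Φ : V) (Ψ : Sob Ω S), inner ℂ Ψ (T Φ : Sob Ω S) = inner ℂ Ψ.trace Φ.1.trace := by
  obtain ⟨T, hT⟩ := exists_clm_of_sesqForm hsep (traceL V)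
  refine ⟨T, fun Φ Ψ => ?_⟩
  -- The Riesz representation gives the identity for odd test functions; a general one is replaced
  -- by its odd part.
  have h1 := hT Φ ⟨oddPart h Ψ, hV ▸ oddPart_mem h hΩ Ψ⟩
  have h2 : inner ℂ (oddPart h Ψ) (T Φ : Sob Ω S) = inner ℂ (oddPart h Ψ).trace Φ.1.trace := h1
  rwa [inner_oddPart_left h hΩ Ψ (hV ▸ (T Φ).2), trace_oddPart_inner h hΩ Ψ (hV ▸ Φ.2)] at h2

theorem trace_operator_symm (x y : V)
    (hT : ∀ (Φ : V) (Ψ : Sob Ω S), inner ℂ Ψ (T Φ : Sob Ω S) = inner ℂ Ψ.trace Φ.1.trace) :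
    inner ℂ (T x) y = inner ℂ x (T y) := by
  rw [← inner_conj_symm, Submodule.coe_inner, hT, inner_conj_symm, Submodule.coe_inner, hT]

/-- The kernel of the operator consists of the functions with vanishing trace. -/
theorem mem_eigenspace_zero_iff (hsep : ∀ x : V, ‖x‖ = 0 → x = 0)
    (hT : ∀ (Φ : V) (Ψ : Sob Ω S), inner ℂ Ψ (T Φ : Sob Ω S) = inner ℂ Ψ.trace Φ.1.trace) (Φ : V) :
    Φ ∈ Module.End.eigenspace (T : Module.End ℂ V) 0 ↔ Φ.1.trace = 0 := by
  rw [Module.End.mem_eigenspace_iff, zero_smul]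
  change T Φ = 0 ↔ _
  constructor
  · intro h
    have h1 := hT Φ Φ.1
    rw [h, ZeroMemClass.coe_zero, inner_zero_right] at h1
    exact inner_self_eq_zero.1 h1.symm
  · intro h
    refine hsep _ ?_
    have h1 := hT Φ (T Φ).1
    rw [h, inner_zero_right] at h1
    have h2 : (inner ℂ (T Φ).1 (T Φ).1).re = ‖(T Φ).1‖ ^ 2 := inner_self_eq_norm_sq (𝕜 := ℂ) (T Φ).1
    rw [h1, Complex.zero_re] at h2
    exact pow_eq_zero_iff two_ne_zero |>.1 h2.symm

end General

/-! ### The spectrum in a domain with cylindrical ends -/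

section Tube

variable {d : ℕ} {R : ℝ} {Ω : Set (E (d + 2))} {S : Set (E (d + 1))} {Ω' : Set (E (d + 1))}
  {S' : Set (E d)} {k : Fin d} {V : Submodule ℂ (Sob Ω S)} {T : V →L[ℂ] V}

/-- At each `ν` below the threshold, a slowly modulated wave times a mode of the cross-section
solves the equation up to a small residual. Poincaré's inequality converts the `L²` size of the
residual into the energy norm. -/
theorem mem_continuousSpectrum_of_isTube (hΩ : IsTube Ω Ω' R) (hS : IsTube S S' R) (hf : FlatTop Ω S)
    (hf' : FlatTop Ω' S') (hm : MirrorSymm k.succ Ω S) (hm' : MirrorSymm k Ω' S')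
    (hconn' : IsPreconnected Ω') (hb' : Bornology.IsBounded Ω') (hV : V = odd hm)
    [CompleteSpace V] (hsep : ∀ x : V, ‖x‖ = 0 → x = 0)
    (hT : ∀ (Φ : V) (Ψ : Sob Ω S), inner ℂ Ψ (T Φ : Sob Ω S) = inner ℂ Ψ.trace Φ.1.trace)
    {C : ℝ} (hC : ∀ w ∈ V, ‖w.fn‖ ≤ C * ‖w‖) {lam : ℝ} (hlam : 0 < lam) {φ : Sob Ω' S'}
    (hφ : φ ∈ odd hm') (hφtr : ‖φ.trace‖ = 1) (hφval : ‖φ.grad‖ ^ 2 = lam) {μ : ℝ} (hμ : 0 < μ)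
    (hμlam : μ ≤ (1 + lam)⁻¹) : (μ : ℂ) ∈ continuousSpectrum T := by
  subst hV
  refine not_isClosed_range_of_approximate_eigenvectors hsep
    (fun x y => trace_operator_symm x y hT) hμ fun ν hν hνμ ε hε => ?_
  -- The equation `T Φ = ν Φ` is the Steklov-type problem with the parameter `ν⁻¹ - 1`, which lies
  -- above the cut-off value.
  have hlam' : lam < ν⁻¹ - 1 := by
    have h1 : ν < (1 + lam)⁻¹ := hνμ.trans_le hμlam
    have h2 := (lt_inv_comm₀ hν (by positivity)).1 h1
    linarith
  obtain ⟨κ, hκ, χ, hχ, hχ0, hmode⟩ := exists_mode hf' hconn' hb' hm' hlam hlam' hφ hφtr hφval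
  have hχn : 0 < ‖χ.fn‖ := norm_pos_iff.2 hχ0
  obtain ⟨D, hD0, hCD⟩ : ∃ D > 0, ∀ w ∈ odd hm, ‖w.fn‖ ≤ D * ‖w‖ :=
    ⟨|C| + 1, by positivity, fun w hw =>
      (hC w hw).trans (mul_le_mul_of_nonneg_right ((le_abs_self C).trans (by linarith)) (norm_nonneg _))⟩
  -- The bound `D` enters twice, once for the residual and once for the norm of `Φ`; hence `D ^ 2`.
  obtain ⟨a, ha, ha0, hares⟩ := exists_wave (R := R) hκ (ε := ε / (ν * D ^ 2)) (by positivity)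
  obtain ⟨Φ, hΦ1, hΦ2, hΦ3⟩ := exists_prod hΩ hS ha χ
  have hΦ := prod_mem_odd hΩ hf hf' hm hm' ha hχ hΦ1
  have hΦn : ‖ha.toL2‖ * ‖χ.fn‖ ≤ D * ‖Φ‖ := by
    rw [← norm_prodFn hΩ ha, ← hΦ1]
    exact hCD Φ hΦ
  refine ⟨⟨Φ, hΦ⟩, ?_, ?_⟩
  · change 0 < ‖Φ‖
    have : 0 < D * ‖Φ‖ := lt_of_lt_of_le (by positivity) hΦn
    exact (pos_iff_pos_of_mul_pos this).1 hD0
  · change _ ≤ ε * ‖Φ‖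
    set Ψ : odd hm := T ⟨Φ, hΦ⟩ - (ν : ℂ) • ⟨Φ, hΦ⟩ with hΨ
    have h1 := inner_prod_mode hΩ hS hf hf' hm hm' ha hmode hΦ2 hΦ3 Ψ.2
    -- The residual `Ψ` is tested with itself, which gives its norm without any explicit formula for
    -- `T Φ`.
    have h2 : inner ℂ Ψ.1 Ψ.1 = (ν : ℂ) * inner ℂ Ψ.1.fn (prodFn hΩ (ha.deriv.deriv.add_mul ha (κ ^ 2)) χ.fn) := by
      have h3 : inner ℂ Ψ.1 Ψ.1 = inner ℂ Ψ.1 (T ⟨Φ, hΦ⟩ : Sob Ω S) - (ν : ℂ) * inner ℂ Ψ.1 Φ := by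
        conv_lhs => rw [hΨ]
        rw [← inner_smul_right, ← inner_sub_right]
        rfl
      rw [h3, hT, inner_eq]
      have h4 : (ν : ℂ) ≠ 0 := by exact_mod_cast hν.ne'
      have h5 := eq_neg_iff_add_eq_zero.1 h1
      push_cast at h5
      have h6 : (ν : ℂ) * (ν : ℂ)⁻¹ = 1 := mul_inv_cancel₀ h4
      linear_combination (-(ν : ℂ)) * h5 - (inner ℂ Ψ.1.trace Φ.trace) * h6
    have h3 : ‖Ψ‖ ^ 2 ≤ ν * (D * ‖Ψ‖ * (ε / (ν * D ^ 2) * ‖ha.toL2‖ * ‖χ.fn‖)) := by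
      have h4 : (inner ℂ Ψ.1 Ψ.1).re = ‖Ψ‖ ^ 2 := inner_self_eq_norm_sq (𝕜 := ℂ) Ψ.1
      rw [← h4]
      refine (Complex.re_le_norm _).trans ?_
      rw [h2, norm_mul, Complex.norm_real, Real.norm_of_nonneg hν.le]
      refine mul_le_mul_of_nonneg_left ?_ hν.le
      refine (norm_inner_le_norm _ _).trans ?_
      rw [norm_prodFn]
      exact mul_le_mul (hCD _ Ψ.2) (mul_le_mul_of_nonneg_right hares hχn.le)
        (mul_nonneg (norm_nonneg _) hχn.le) (mul_nonneg hD0.le (norm_nonneg _))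
    have h4 : ∀ p s t : ℝ, ν * (D * p * (ε / (ν * D ^ 2) * s * t)) = p * (ε / D * (s * t)) :=
      fun p s t => by field_simp
    have h5 : ε / D * (‖ha.toL2‖ * ‖χ.fn‖) ≤ ε * ‖Φ‖ := by
      refine (mul_le_mul_of_nonneg_left hΦn (div_pos hε hD0).le).trans (le_of_eq ?_)
      have : ∀ s : ℝ, ε / D * (D * s) = ε * s := fun s => by field_simp
      exact this _
    have h6 : ‖Ψ‖ * ‖Ψ‖ ≤ ‖Ψ‖ * (ε * ‖Φ‖) := by
      rw [← pow_two]
      exact (h3.trans_eq (h4 _ _ _)).trans (mul_le_mul_of_nonneg_left h5 (norm_nonneg _))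
    rcases (norm_nonneg Ψ).eq_or_lt with h7 | h7
    · rw [← h7]
      exact mul_nonneg hε.le (norm_nonneg _)
    · exact le_of_mul_le_mul_left h6 h7

/-- On the ends the Steklov estimate bounds the squared trace by `(1 + lam)⁻¹` times the energy. The
trace on the remaining bounded part of the surface is compact. -/
theorem mem_discreteSpectrum_of_isTube (hΩ : IsTube Ω Ω' R) (hS : IsTube S S' R) (hf : FlatTop Ω S)
    (hf' : FlatTop Ω' S') (hm : MirrorSymm k.succ Ω S) (hm' : MirrorSymm k Ω' S')
    (hbS : Bornology.IsBounded ((outer d R)ᶜ ∩ S)) (hV : V = odd hm)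
    [CompleteSpace V] (hsep : ∀ x : V, ‖x‖ = 0 → x = 0)
    (hT : ∀ (Φ : V) (Ψ : Sob Ω S), inner ℂ Ψ (T Φ : Sob Ω S) = inner ℂ Ψ.trace Φ.1.trace)
    {C : ℝ} (hC : ∀ w ∈ V, ‖w.fn‖ ≤ C * ‖w‖) {lam : ℝ} (hlam0 : 0 < lam)
    (hlam : ∀ ψ ∈ odd hm', lam * ‖ψ.trace‖ ^ 2 ≤ ‖ψ.grad‖ ^ 2) {μ : ℝ}
    (hμ : (1 + lam)⁻¹ < μ) (hspec : (μ : ℂ) ∈ spectrum ℂ T) : (μ : ℂ) ∈ discreteSpectrum T := by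
  subst hV
  have hO := (isOpen_outer d R).measurableSet
  have hK : MeasurableSet ((outer d R)ᶜ ∩ S) := hO.compl.inter hf.isOpen_top.measurableSet
  refine mem_discreteSpectrum_of_le_add_compact hsep (fun x y => trace_operator_symm x y hT) hμ
    ((cut _ hK).comp (traceL (odd hm))).toLinearMap (compactMap_cut_trace hf hC hK hbS)
    (fun x => ?_) hspec
  have h1 : (inner ℂ x (T x)).re = ‖x.1.trace‖ ^ 2 := by
    rw [Submodule.coe_inner, hT]
    exact inner_self_eq_norm_sq (𝕜 := ℂ) _
  have h2 : cut _ hK x.1.trace = cut _ hO.compl x.1.trace := by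
    refine Lp.ext ?_
    filter_upwards [cut_coeFn _ hK x.1.trace, cut_coeFn _ hO.compl x.1.trace,
      ae_restrict_mem hf.isOpen_top.measurableSet] with y h3 h4 h5
    rw [h3, h4]
    by_cases hy : y ∈ (outer d R)ᶜ
    · have hy' : y ∈ (outer d R)ᶜ ∩ S := ⟨hy, h5⟩
      rw [indicator_of_mem hy, indicator_of_mem hy']
    · rw [indicator_of_notMem hy, indicator_of_notMem fun h => hy h.1]
  change _ ≤ _ + ‖cut _ hK x.1.trace‖ ^ 2
  have h3 := mul_norm_sq_cut_trace_le hΩ hS hf hf' hm hm' hlam0.le hlam x.2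
  have h4 := norm_sq_cut_add_compl _ hO x.1.trace
  have h5 : ‖x‖ ^ 2 = ‖x.1.grad‖ ^ 2 + ‖x.1.trace‖ ^ 2 := norm_sq_eq x.1
  have h6 := pow_le_pow_left₀ (norm_nonneg _)
    (norm_cut_le _ (isOpen_outer (d + 1) R).measurableSet x.1.grad) 2
  -- The trace on the ends is added to both sides of the Steklov estimate, which turns `lam` into `1
  -- + lam`.
  have h7 : ‖cut _ hO x.1.trace‖ ^ 2 ≤ (1 + lam)⁻¹ * ‖x‖ ^ 2 := by
    rw [← div_eq_inv_mul, le_div_iff₀ (by positivity), h5]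
    nlinarith [sq_nonneg ‖cut _ hO.compl x.1.trace‖]
  rw [h1, h2, h4]
  linarith

/-- There are infinitely many independent odd functions with vanishing trace. -/
theorem not_finiteDimensional_of_isTube (hΩ : IsTube Ω Ω' R) (hS : IsTube S S' R) (hf : FlatTop Ω S)
    (hf' : FlatTop Ω' S') (hm : MirrorSymm k.succ Ω S) (hm' : MirrorSymm k Ω' S')
    {y₀ : E d} (hy₀ : y₀ ∈ S') (hk : 0 < y₀ k) (hV : V = odd hm) {N : Submodule ℂ V}
    (hN : ∀ w : V, w.1.trace = 0 → w ∈ N) : ¬ FiniteDimensional ℂ N := by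
  intro hfin
  obtain ⟨φ, hφ, hφ0, hφ1⟩ := exists_odd_trace_eq_zero hf' hm' hy₀ hk
  -- The amplitudes live in consecutive unit intervals beyond `|R|`. Disjoint supports make the
  -- products orthogonal in `L²`, hence independent.
  have hex : ∀ n : ℕ, ∃ (a : ℝ → ℝ) (_ : IsEndTest R a), tsupport a ⊆ Ioo (|R| + n) (|R| + (n + 1)) ∧
      ∃ t, a t ≠ 0 := fun n => by
    obtain ⟨η, h1, h2, h3, -, h4⟩ : ∃ η : ℝ → ℝ, tsupport η ⊆ Ioo (|R| + n) (|R| + (n + 1)) ∧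
        HasCompactSupport η ∧ ContDiff ℝ ∞ η ∧ range η ⊆ Icc 0 1 ∧ η (|R| + n + 1 / 2) = 1 :=
      exists_contDiff_tsupport_subset (isOpen_Ioo.mem_nhds ⟨by linarith, by linarith⟩)
    refine ⟨η, ⟨h3, h2, fun t ht => ?_⟩, h1, _, h4.trans_ne one_ne_zero⟩
    have h5 := (h1 ht).1
    have h6 : (0 : ℝ) ≤ n := Nat.cast_nonneg n
    change R < |t|
    rw [abs_of_pos (by linarith [abs_nonneg R])]
    linarith [le_abs_self R]
  choose a ha hsupp hne using hex
  choose Φ h1 h2 _ using fun n => exists_prod hΩ hS (ha n) φ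
  have hmem : ∀ n, Φ n ∈ V := fun n => hV ▸ prod_mem_odd hΩ hf hf' hm hm' (ha n) hφ (h1 n)
  have htr : ∀ n, (Φ n).trace = 0 := fun n => by
    rw [h2 n, hφ0, ← norm_eq_zero, norm_prodFn, norm_zero, mul_zero]
  let w : ℕ → N := fun n => ⟨⟨Φ n, hmem n⟩, hN _ (htr n)⟩
  have hli : LinearIndependent ℂ fun n => (Φ n).fn := by
    refine linearIndependent_of_ne_zero_of_inner_eq_zero (fun n h0 => ?_) fun i j hij => ?_
    · rw [h1 n, ← norm_eq_zero, norm_prodFn, mul_eq_zero, norm_eq_zero, norm_eq_zero] at h0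
      rcases h0 with h0 | h0
      · have h3 := (ha n).norm_sq_toL2
        rw [h0, norm_zero, zero_pow two_ne_zero] at h3
        have h4 : 0 < ∫ t, a n t ^ 2 := by
          obtain ⟨t, ht⟩ := hne n
          refine ((ha n).smooth.continuous.pow 2).integral_pos_of_hasCompactSupport_nonneg_nonzero (x := t) ?_
            (fun t => sq_nonneg _) (pow_ne_zero 2 ht)
          exact (ha n).compact.comp_left (g := fun s : ℝ => s ^ 2) (by simp)
        exact h4.ne h3
      · exact hφ1 h0
    · change inner ℂ (Φ i).fn (Φ j).fn = 0
      rw [h1 i, h1 j, MeasureTheory.L2.inner_def]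
      refine integral_eq_zero_of_ae ?_
      filter_upwards [coeFn_prodFn hΩ (ha i) φ.fn, coeFn_prodFn hΩ (ha j) φ.fn] with x h3 h4
      rw [h3, h4, RCLike.inner_apply]
      by_cases hi : x 0 ∈ tsupport (a i)
      · have hj : x 0 ∉ tsupport (a j) := fun hj => by
          have e1 := hsupp i hi
          have e2 := hsupp j hj
          have e3 : (i : ℝ) < j + 1 := by linarith [e1.1, e2.2]
          have e4 : (j : ℝ) < i + 1 := by linarith [e2.1, e1.2]
          have e5 : i < j + 1 := by exact_mod_cast e3
          have e6 : j < i + 1 := by exact_mod_cast e4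
          omega
        rw [image_eq_zero_of_notMem_tsupport hj]
        simp
      · rw [image_eq_zero_of_notMem_tsupport hi]
        simp
  have hli' : LinearIndependent ℂ w :=
    LinearIndependent.of_comp (((fn : Sob Ω S →ₗ[ℂ] L2 Ω).comp V.subtype).comp N.subtype) hli
  exact not_finite_iff_infinite.2 (inferInstance : Infinite ℕ) hli'.finite

end Tube

end Sob

/-! ### The ends of the canal and its surface -/

section Geometry

variable {l : ℝ} {Γ : Set (E 2)} {Θ : Set (E 3)}

theorem isTube_surface (l R : ℝ) : IsTube (waterSurface l) (sectionTop l) R := fun p _ => by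
  have h : insE 0 p 1 = p.2 0 := insE_succAbove 0 p 0
  change |insE 0 p 1| < l ↔ |p.2 0| < l
  rw [h]

theorem isBounded_surface (l R : ℝ) : Bornology.IsBounded ((outer 1 R)ᶜ ∩ waterSurface l) := by
  refine isBounded_iff_forall_norm_le.2 ⟨|R| + |l|, fun y hy => ?_⟩
  have h1 : |y 0| ≤ R := not_lt.1 hy.1
  have h2 : |y 1| < l := hy.2
  have h3 : ‖y‖ ^ 2 = |y 0| ^ 2 + |y 1| ^ 2 := by
    rw [EuclideanSpace.norm_sq_eq, Fin.sum_univ_two]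
    rfl
  have h4 := abs_nonneg (y 0)
  have h5 := abs_nonneg (y 1)
  rw [abs_of_nonneg (h4.trans h1), abs_of_pos (h5.trans_lt h2)]
  nlinarith [norm_nonneg y]

theorem vtail_mem_of_mem_water {x : E 3} (hx : x ∈ waterDomain Γ Θ) : vtail x ∈ Γ := by
  have h := hx.1
  rw [← slab_vtail x] at h
  exact (insE_zero_mem_canal (x 0, vtail x)).1 h

end Geometry

end

/-! ### Assembly of the result -/

theorem lemma3p2
    (l : ℝ) (hl : 0 < l)
    -- the cross-section
    (Γ : Set (E 2)) (hΓ_open : IsOpen Γ) (hΓ_conn : IsConnected Γ)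
    (hΓ_bdd : Bornology.IsBounded Γ) (hΓ_lip : HasLipschitzBoundary Γ)
    (hΓ_low : ∀ x ∈ Γ, x 1 < 0)
    (hΓ_top : {x ∈ frontier Γ | x 1 = 0} = {x : E 2 | |x 0| ≤ l ∧ x 1 = 0})
    -- the submerged body
    (Θ : Set (E 3)) (hΘ_sub : Θ ⊆ canal Γ) (hΘ_bdd : Bornology.IsBounded Θ)
    (hΘ_surf : ∀ y ∈ waterSurface l, toSurface y ∉ closure Θ)
    (hΩ_conn : IsConnected (waterDomain Γ Θ)) (hΩ_lip : HasLipschitzBoundary (waterDomain Γ Θ))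
    (hΩ_symm : ∀ x, x ∈ waterDomain Γ Θ ↔ reflect x ∈ waterDomain Γ Θ) :
    -- the space of odd functions is a Hilbert space
    (∀ Φ : OddSpace l Γ Θ, ‖Φ‖ = 0 → Φ = 0) ∧ CompleteSpace (OddSpace l Γ Θ) ∧
    -- the operator exists
    ∃ T : OddSpace l Γ Θ →L[ℂ] OddSpace l Γ Θ, IsOddOperator T ∧
    -- the first eigenvalue of the Steklov problem on the half cross-section exists
    ∃ lamΓ : ℝ, IsLeast {lam : ℝ | IsSteklovEigenvalue l Γ lam} lamΓ ∧ 0 < lamΓ ∧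
    -- the parts of the spectrum
    (∀ μ : ℝ, 0 < μ → μ ≤ (1 + lamΓ)⁻¹ → (μ : ℂ) ∈ continuousSpectrum T) ∧
    (∀ μ : ℝ, (1 + lamΓ)⁻¹ < μ → μ ≤ 1 → (μ : ℂ) ∈ spectrum ℂ T →
      (μ : ℂ) ∈ discreteSpectrum T) ∧
    -- the point zero
    Module.End.HasEigenvalue (T : Module.End ℂ (OddSpace l Γ Θ)) 0 ∧
    (∀ Φ : OddSpace l Γ Θ,
      Φ ∈ Module.End.eigenspace (T : Module.End ℂ (OddSpace l Γ Θ)) 0 ↔ Φ.1.trace = 0) ∧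
    ¬ FiniteDimensional ℂ (Module.End.eigenspace (T : Module.End ℂ (OddSpace l Γ Θ)) 0) := by
  have hfΓ := flatTop_section hΓ_open hΓ_lip hΓ_low hΓ_top
  have hf := flatTop_water hfΓ hΘ_surf hΩ_lip
  have hm : MirrorSymm (Fin.succ (0 : Fin 1)) (waterDomain Γ Θ) (waterSurface l) :=
    mirrorSymm_water hΩ_symm
  have hm' := mirrorSymm_section (l := l) hΘ_bdd hΩ_symm
  -- Beyond `|x₁| = R` the body is absent and the water domain is the full canal.
  obtain ⟨R, -, hR⟩ := exists_section_radius (Γ := Γ) hΘ_bdd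
  have hΩ : IsTube (waterDomain Γ Θ) Γ R := hR
  have hS := isTube_surface l R
  have hV : oddSubspace (waterDomain Γ Θ) (waterSurface l) = Sob.odd hm := oddSubspace_eq_odd hf hm
  obtain ⟨C, hC⟩ := Sob.exists_poincare_of_isTube hΩ hS hf hfΓ hm hm' hΩ_conn.isPreconnected
    hΓ_conn.isPreconnected hΓ_bdd fun x hx => vtail_mem_of_mem_water hx
  rw [← hV] at hC
  have hsep : ∀ Φ : OddSpace l Γ Θ, ‖Φ‖ = 0 → Φ = 0 := fun Φ hΦ =>
    Subtype.ext (Sob.eq_zero_of_norm hf (hC Φ.1 Φ.2) hΦ)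
  have hcomp : CompleteSpace (OddSpace l Γ Θ) := Sob.completeSpace_of_bound _ hV hC
  obtain ⟨T, hT⟩ := Sob.exists_trace_operator hf hm hV hsep
  -- A point of the upper side off the symmetry axis; near it there are odd functions with nonzero
  -- trace, and nonzero odd functions with zero trace.
  have hy₀ : (WithLp.toLp 2 fun _ => l / 2 : E 1) ∈ sectionTop l := by
    change |l / 2| < l
    rw [abs_of_pos (half_pos hl)]
    exact half_lt_self hl
  have hk : 0 < (WithLp.toLp 2 fun _ => l / 2 : E 1) 0 := half_pos hl
  obtain ⟨lam, hlam0, hlow, φ, hφ, hφ0, hφtr, hφval, hEL⟩ :=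
    Sob.exists_steklov hfΓ hΓ_conn.isPreconnected hΓ_bdd hm' hy₀ hk.ne'
  have hker := Sob.mem_eigenspace_zero_iff hsep hT
  have hinf := Sob.not_finiteDimensional_of_isTube hΩ hS hf hfΓ hm hm' hy₀ hk hV fun w hw =>
    (hker w).2 hw
  refine ⟨hsep, hcomp, T, hT, lam, isLeast_steklov hfΓ hΓ_conn.isPreconnected hm' hlow hφ hφ0 hEL,
    hlam0, fun μ hμ hμlam => ?_, fun μ hμ _ hspec => ?_, fun h => hinf ?_, hker, hinf⟩
  · exact Sob.mem_continuousSpectrum_of_isTube hΩ hS hf hfΓ hm hm' hΓ_conn.isPreconnected hΓ_bdd hV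
      hsep hT hC hlam0 hφ hφtr hφval hμ hμlam
  · exact Sob.mem_discreteSpectrum_of_isTube hΩ hS hf hfΓ hm hm' (isBounded_surface l R) hV hsep hT
      hC hlam0 hlow hμ hspec
  · change Module.End.eigenspace (T : Module.End ℂ (OddSpace l Γ Θ)) 0 = ⊥ at h
    rw [h]
    infer_instance
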